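/- **Weak–strong uniqueness for the compressible MHD system.** Let $d\in\{2,3\}$, $T>0$, $\mu>0$, $\frac{d-2}{d}\mu+\lambda\ge 0$, $a>0$, $\gamma>1$, and put $p(\varrho)=a\varrho^\gamma$, $H(\varrho)=\frac{a}{\gamma-1}\varrho^\gamma$, $\mathbb S(\nabla u)=\mu\big(\nabla u+\nabla^T u-\frac2d\,\mathrm{div}\,u\,\mathbb I\big)+\lambda\,\mathrm{div}\,u\,\mathbb I$. Let $\Omega$ be either the flat torus $(\mathbb R/\mathbb Z)^d$ (periodic case; all conditions on $\partial\Omega$ are then void) or a bounded open set in $\mathbb R^d$ with Lipschitz boundary and outward unit normal $n$ (no-slip case). If $d=2$, vectors $u,B,n$ are identified with $(u_1,u_2,0)$ etc., fields do not depend on $x_3$, and $E$, $j$ are of the form $(0,0,E_3)$, $(0,0,j_3)$; products $\times$ and $\mathrm{curl}$ are those of $\mathbb R^3$. *Classical solution.* $(\tilde\varrho,\tilde u,\tilde B,\tilde E)$ with $\tilde\varrho,\tilde u,\tilde B\in C^1([0,T]\times\overline\Omega)$, $\tilde\varrho>0$, $\tilde u|_{\partial\Omega}=0$, $\tilde B\cdot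 n|_{\partial\Omega}=0$, $\tilde E\in C([0,T]\times\overline\Omega)$, $\tilde E\times n|_{\partial\Omega}=0$, and $\tilde u(t,\cdot)\in C^2(\Omega)$, $\tilde E(t,\cdot)\in C^1(\Omega)$ for $t\in(0,T)$, is a classical solution with initial data $(\varrho_0,u_0,B_0)$ if $(\tilde\varrho,\tilde u,\tilde B)(0,\cdot)=(\varrho_0,u_0,B_0)$ and, pointwise in $(0,T)\times\Omega$, with $\tilde j=\tilde E+\tilde u\times\tilde B$, $$\partial_t\tilde\varrho+\mathrm{div}(\tilde\varrho\tilde u)=0,\quad \partial_t(\tilde\varrho\tilde u)+\mathrm{div}(\tilde\varrho\tilde u\otimes\tilde u)+\nabla p(\tilde\varrho)=\mathrm{div}\,\mathbb S(\nabla\tilde u)+\tilde j\times\tilde B,$$ $$\tilde j=\mathrm{curl}\,\tilde B,\quad \partial_t\tilde B+\mathrm{curl}\,\tilde E=0,\quad \mathrm{div}\,\tilde B=0 .$$ *Dissipative weak solution.* $(\varrho,u,B,E)$ is a dissipative weak solution with initial data $(\varrho_0,m_0,B_0)$ and defect measures $\mu_c\in L^\infty(0,T;\mathcal M(\overline\Omega;\mathbb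 R^{d\times d}_{sym}))$, $\mu_B\in L^2(0,T;\mathcal M(\overline\Omega;\mathbb R^d))$, $\mathfrak D\in L^\infty(0,T;\mathcal M^+(\overline\Omega))$, $\mathfrak C\in\mathcal M^+([0,T]\times\overline\Omega)$ if, with $j=E+u\times B$: 1. $\varrho\ge0$, $\varrho\in L^\infty(0,T;L^\gamma(\Omega))$, $\sqrt\varrho\,u,\,B\in L^\infty(0,T;L^2(\Omega))$, $\nabla u\in L^2(0,T;L^2(\Omega))$, $u(t)\in W^{1,2}(\Omega)$ (periodic case) resp. $u(t)\in W^{1,2}_0(\Omega)$ (no-slip case) for a.e. $t$, $j\in L^2(0,T;L^2(\Omega))$, $E\in L^2(0,T;L^{3/2}(\Omega))$; 2. for all $\varphi\in C^1([0,T]\times\overline\Omega)$ and a.e. $\tau\in(0,T)$: $\int_0^\tau\!\int_\Omega(\varrho\,\partial_t\varphi+\varrho u\cdot\nabla\varphi)\,dx\,dt=\int_\Omega\varrho(\tau)\varphi(\tau)\,dx-\int_\Omega\varrho_0\varphi(0)\,dx$; 3. for all $\varphi\in C^1_c([0,T]\times\Omega;\mathbb R^d)$ and a.e. $\tau$: $$\int_0^\tau\!\!\int_\Omega\big(\varrho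 u\cdot\partial_t\varphi+\varrho u\otimes u:\nabla\varphi+p(\varrho)\,\mathrm{div}\,\varphi-\mathbb S(\nabla u):\nabla\varphi+(j\times B)\cdot\varphi\big)dx\,dt+\int_0^\tau\!\!\int_{\overline\Omega}\nabla\varphi:d\mu_c(t)\,dt+\int_0^\tau\!\!\int_{\overline\Omega}\varphi\cdot d\mu_B(t)\,dt=\int_\Omega(\varrho u\cdot\varphi)(\tau)\,dx-\int_\Omega m_0\cdot\varphi(0)\,dx;$$ 4. for all $\varphi\in C^1([0,T]\times\overline\Omega;\mathbb R^d)$ with $\varphi\cdot n|_{\partial\Omega}=0$ and a.e. $\tau$: $\int_0^\tau\!\int_\Omega(B\cdot\partial_t\varphi-E\cdot\mathrm{curl}\,\varphi)\,dx\,dt=\int_\Omega B(\tau)\cdot\varphi(\tau)\,dx-\int_\Omega B_0\cdot\varphi(0)\,dx$; 5. for all $\varphi\in C^1_c([0,T]\times\Omega;\mathbb R^3)$ and a.e. $\tau$: $\int_0^\tau\!\int_\Omega j\cdot\varphi\,dx\,dt=\int_0^\tau\!\int_\Omega B\cdot\mathrm{curl}\,\varphi\,dx\,dt$; 6. $\mathrm{div}\,B(t)=0$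 in the sense of distributions for a.e. $t$; 7. for a.e. $\tau\in(0,T)$: $$\int_\Omega\Big[\tfrac12\varrho|u|^2+\tfrac12|B|^2+H(\varrho)\Big](\tau)\,dx+\int_0^\tau\!\!\int_\Omega\big(\mathbb S(\nabla u):\nabla u+|j|^2\big)dx\,dt+\mathfrak D(\tau)(\overline\Omega)+\mathfrak C([0,\tau]\times\overline\Omega)\le\int_\Omega\Big[\tfrac12\tfrac{|m_0|^2}{\varrho_0}+\tfrac12|B_0|^2+H(\varrho_0)\Big]dx;$$ 8. there is a constant $C$ such that for all $\varepsilon>0$ and all $\psi\in C([0,T])$, $\psi\ge0$: $$\int_0^T\psi\,|\mu_c(t)|(\overline\Omega)\,dt\le C\int_0^T\psi\,\mathfrak D(t)(\overline\Omega)\,dt,\qquad \int_0^T\psi\,|\mu_B(t)|(\overline\Omega)\,dt\le C\Big(\frac1\varepsilon\int_0^T\psi\,\mathfrak D(t)(\overline\Omega)\,dt+\varepsilon\int_{[0,T]\times\overline\Omega}\psi\,d\mathfrak C\Big).$$ **Theorem.** Let $(\tilde\varrho,\tilde u,\tilde B,\tilde E)$ be a classical solution with initial data $(\varrho_0,u_0,B_0)$,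 and let $(\varrho,u,B,E)$ be a dissipative weak solution with initial data $(\varrho_0,\varrho_0u_0,B_0)$ and defect measures $\mu_c,\mu_B,\mathfrak D,\mathfrak C$. Then $\varrho=\tilde\varrho$, $u=\tilde u$, $B=\tilde B$, $E=\tilde E$ a.e. in $(0,T)\times\Omega$; $\mu_c(t)=0$, $\mu_B(t)=0$, $\mathfrak D(t)=0$ for a.e. $t\in(0,T)$; and $\mathfrak C=0$ on $[0,T)\times\overline\Omega$. -/

import Mathlib

open Set Filter Topology MeasureTheory
open scoped ENNReal NNReal ContDiff

namespace MHD

noncomputable section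

/-! ### Vectors, tensors and differential operators -/

/-- Points of `ℝᵈ` and `d`-dimensional vectors. -/
abbrev Vec (d : ℕ) := EuclideanSpace ℝ (Fin d)

/-- `d × d` matrices with the Frobenius norm; the inner product of `Ten d` is `A : B`, and the
entry `A (i, j)` stands in row `i` and column `j`. -/
abbrev Ten (d : ℕ) := EuclideanSpace ℝ (Fin d × Fin d)

/-- The `j`-th standard basis vector. -/
def basisVec {d : ℕ} (j : Fin d) : Vec d := EuclideanSpace.single j 1

/-- The identity matrix. -/
def idT (d : ℕ) : Ten d := WithLp.toLp 2 fun p => if p.1 = p.2 then 1 else 0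

/-- The transpose of a matrix. -/
def transposeT {d : ℕ} (A : Ten d) : Ten d := WithLp.toLp 2 fun p => A (p.2, p.1)

/-- The trace of a matrix. -/
def traceT {d : ℕ} (A : Ten d) : ℝ := ∑ i, A (i, i)

/-- The tensor product `v ⊗ w`. -/
def tensorT {d : ℕ} (v w : Vec d) : Ten d := WithLp.toLp 2 fun p => v p.1 * w p.2

/-- The Jacobian matrix `(∇v)_{ij} = ∂_j v_i`. -/
def grad {d : ℕ} (v : Vec d → Vec d) (x : Vec d) : Ten d :=
  WithLp.toLp 2 fun p => fderiv ℝ v x (basisVec p.2) p.1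

/-- The divergence of a vector field. -/
def div {d : ℕ} (v : Vec d → Vec d) (x : Vec d) : ℝ := traceT (grad v x)

/-- The row-wise divergence `(div M)_i = ∑_j ∂_j M_{ij}` of a matrix field. -/
def divT {d : ℕ} (M : Vec d → Ten d) (x : Vec d) : Vec d :=
  WithLp.toLp 2 fun i => ∑ j, fderiv ℝ M x (basisVec j) (i, j)

/-- The inclusion of `ℝᵈ`, `d ≤ 3`, into `ℝ³`: missing coordinates are `0`. -/
def lift3 {d : ℕ} (v : Vec d) : Vec 3 :=
  WithLp.toLp 2 fun k => if h : (k : ℕ) < d then v ⟨k, h⟩ else 0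

/-- The cross product of `ℝ³`. -/
def cross (v w : Vec 3) : Vec 3 := WithLp.toLp 2 (crossProduct (⇑v) (⇑w))

/-- `∂_k F` for a field on `ℝᵈ`, `d ≤ 3`, that is understood as a field on `ℝ³` which does not
depend on the missing coordinates. -/
def partial3 {d : ℕ} (k : ℕ) (F : Vec d → Vec 3) (x : Vec d) : Vec 3 :=
  if h : k < d then fderiv ℝ F x (basisVec ⟨k, h⟩) else 0

/-- The curl of an `ℝ³`-valued field on `ℝᵈ`, `d ≤ 3`. -/
def curl {d : ℕ} (F : Vec d → Vec 3) (x : Vec d) : Vec 3 :=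
  !₂[partial3 1 F x 2 - partial3 2 F x 1,
     partial3 2 F x 0 - partial3 0 F x 2,
     partial3 0 F x 1 - partial3 1 F x 0]

/-- In the planar case `d = 2`, where `u` and `B` lie in the plane, the electric field and the
current density are orthogonal to the plane. No condition for `d = 3`. -/
def IsAxial (d : ℕ) (v : Vec 3) : Prop := d = 2 → v 0 = 0 ∧ v 1 = 0

/-- The current density `j = E + u × B`. -/
def current {d : ℕ} (E : Vec 3) (u B : Vec d) : Vec 3 := E + cross (lift3 u) (lift3 B)

/-! ### Constitutive laws -/

/-- Viscosity coefficients and constants of the pressure law. -/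
structure Params (d : ℕ) where
  mu : ℝ
  lam : ℝ
  a : ℝ
  γ : ℝ
  mu_pos : 0 < mu
  bulk_nonneg : 0 ≤ ((d : ℝ) - 2) / d * mu + lam
  a_pos : 0 < a
  one_lt_γ : 1 < γ

/-- The Newtonian stress
`S(A) = μ (A + Aᵀ - (2/d) tr(A) I) + λ tr(A) I`, where `A = ∇u`. -/
def Params.stress {d : ℕ} (P : Params d) (A : Ten d) : Ten d :=
  P.mu • (A + transposeT A - ((2 / (d : ℝ)) * traceT A) • idT d) + (P.lam * traceT A) • idT d

/-- The pressure `p(ρ) = a ρ^γ`. -/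
def Params.pressure {d : ℕ} (P : Params d) (ρ : ℝ) : ℝ := P.a * ρ ^ P.γ

/-- The pressure potential `H(ρ) = a / (γ - 1) ρ^γ`. -/
def Params.potential {d : ℕ} (P : Params d) (ρ : ℝ) : ℝ := P.a / (P.γ - 1) * ρ ^ P.γ

/-! ### The spatial domain -/

/-- `Ω` is a bounded open set which near each of its boundary points is, in suitable orthogonal
coordinates, the set below the graph of a Lipschitz function: `e` is the vertical direction, and
`g` does not depend on the vertical coordinate. -/
structure IsBoundedLipschitz {d : ℕ} (Ω : Set (Vec d)) : Prop where
  isOpen : IsOpen Ω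
  isBounded : Bornology.IsBounded Ω
  graph : ∀ x ∈ frontier Ω, ∃ (e : Vec d) (L : ℝ≥0) (g : Vec d → ℝ) (r : ℝ),
    ‖e‖ = 1 ∧ LipschitzWith L g ∧ (∀ y (s : ℝ), g (y + s • e) = g y) ∧ 0 < r ∧
      ∀ y ∈ Metric.ball x r, (y ∈ Ω ↔ inner ℝ y e < g y)

/-- `n` is the outward unit normal of `Ω` at the boundary point `x`: near `x`, up to cones of
arbitrarily small opening around the tangent plane, `Ω` is a half-space with outer normal `n`.
For a Lipschitz boundary such a normal exists at almost every boundary point. -/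
def IsOutwardNormal {d : ℕ} (Ω : Set (Vec d)) (x n : Vec d) : Prop :=
  x ∈ frontier Ω ∧ ‖n‖ = 1 ∧ ∀ ε > 0, ∃ δ > 0, ∀ y ∈ Metric.ball x δ,
    (inner ℝ (y - x) n < -(ε * ‖y - x‖) → y ∈ Ω) ∧
    (ε * ‖y - x‖ < inner ℝ (y - x) n → y ∉ Ω)

/-- The two geometries: the flat torus `(ℝ/ℤ)ᵈ` (periodic boundary conditions), or a bounded
Lipschitz set (no-slip boundary conditions). Fields on the torus are `ℤᵈ`-periodic fields on `ℝᵈ`,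
or fields on the unit cell. -/
inductive Geometry (d : ℕ)
  | torus : Geometry d
  | bounded (Ω : Set (Vec d)) (hΩ : IsBoundedLipschitz Ω) : Geometry d

/-- The half-open unit cube, a set of representatives of the torus. -/
def unitCell (d : ℕ) : Set (Vec d) := {x | ∀ i, x i ∈ Ico (0 : ℝ) 1}

/-- The open set on which the equations hold: `ℝᵈ` for the torus, else `Ω`. The torus has no
boundary, and correspondingly `frontier univ = ∅`. -/
def Geometry.region {d : ℕ} : Geometry d → Set (Vec d)
  | .torus => univ
  | .bounded Ω _ => Ω

/-- The set over which one integrates: the unit cell, or `Ω`. -/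
def Geometry.cell {d : ℕ} : Geometry d → Set (Vec d)
  | .torus => unitCell d
  | .bounded Ω _ => Ω

/-- The set that carries the defect measures: the torus (as the unit cell), or `closure Ω`. -/
def Geometry.closedCell {d : ℕ} : Geometry d → Set (Vec d)
  | .torus => unitCell d
  | .bounded Ω _ => closure Ω

/-- Periodicity in the case of the torus; no condition in the case of a bounded set. -/
def Geometry.Compatible {d : ℕ} {F : Type*} : Geometry d → (Vec d → F) → Prop
  | .torus, f => ∀ x i, f (x + basisVec i) = f x
  | .bounded _ _, _ => True

/-- Lebesgue measure on the cell. -/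
def Geometry.vol {d : ℕ} (G : Geometry d) : Measure (Vec d) := volume.restrict G.cell

/-- Lebesgue measure on `(0, T)`. -/
def timeMeasure (T : ℝ) : Measure ℝ := volume.restrict (Ioo 0 T)

/-! ### Function spaces -/

/-- `φ ∈ C¹([0,T] × closure Ω)`, where `φ t x` is the value at time `t` and position `x`: `φ` is
continuous on the closed cylinder, continuously differentiable in its interior, and its derivative
extends continuously to the closed cylinder; periodic in the case of the torus. -/
structure IsC1 {d : ℕ} {F : Type*} [NormedAddCommGroup F] [NormedSpace ℝ F]
    (G : Geometry d) (T : ℝ) (φ : ℝ → Vec d → F) : Prop where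
  compatible : ∀ t ∈ Icc 0 T, G.Compatible (φ t)
  continuousOn : ContinuousOn (fun z : ℝ × Vec d => φ z.1 z.2) (Icc 0 T ×ˢ closure G.region)
  contDiffOn : ContDiffOn ℝ 1 (fun z : ℝ × Vec d => φ z.1 z.2) (Ioo 0 T ×ˢ G.region)
  extends_deriv : ∃ D : ℝ × Vec d → (ℝ × Vec d →L[ℝ] F),
    ContinuousOn D (Icc 0 T ×ˢ closure G.region) ∧
      EqOn D (fderiv ℝ fun z : ℝ × Vec d => φ z.1 z.2) (Ioo 0 T ×ˢ G.region)

/-- `φ ∈ C_c¹([0,T] × Ω)`: `φ` is `C¹` and vanishes outside a closed set `K ⊆ Ω`. For bounded `Ω`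
the set `K` is compact; for the torus the condition is void. -/
def IsC1c {d : ℕ} {F : Type*} [NormedAddCommGroup F] [NormedSpace ℝ F]
    (G : Geometry d) (T : ℝ) (φ : ℝ → Vec d → F) : Prop :=
  IsC1 G T φ ∧ ∃ K, IsClosed K ∧ K ⊆ G.region ∧ ∀ t ∈ Icc 0 T, ∀ x ∉ K, φ t x = 0

/-- `φ ∈ C_c^∞(Ω)`, respectively `φ` smooth and periodic. -/
def IsSmoothC {d : ℕ} {F : Type*} [NormedAddCommGroup F] [NormedSpace ℝ F]
    (G : Geometry d) (φ : Vec d → F) : Prop :=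
  ContDiff ℝ ∞ φ ∧ G.Compatible φ ∧ ∃ K, IsClosed K ∧ K ⊆ G.region ∧ ∀ x ∉ K, φ x = 0

/-- `φ · n = 0` on `[0,T] × ∂Ω`. -/
def NormalZero {d : ℕ} (G : Geometry d) (T : ℝ) (φ : ℝ → Vec d → Vec d) : Prop :=
  ∀ t ∈ Icc 0 T, ∀ x n, IsOutwardNormal G.region x n → inner ℝ (φ t x) n = 0

/-- `f ∈ L^r(0,T; L^p(Ω))`. -/
def MemLrLp {d : ℕ} {F : Type*} [NormedAddCommGroup F] (G : Geometry d) (T : ℝ) (r p : ℝ≥0∞)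
    (f : ℝ → Vec d → F) : Prop :=
  AEStronglyMeasurable (fun z : ℝ × Vec d => f z.1 z.2) ((timeMeasure T).prod G.vol) ∧
    eLpNorm (fun t => eLpNorm (f t) p G.vol) r (timeMeasure T) < ⊤

/-- `v ∈ W_0^{1,2}(Ω)` (closure of `C_c^∞(Ω)`), respectively `v ∈ W^{1,2}` of the torus (closure of
the smooth periodic fields), and `A` is its weak gradient. -/
def IsW12WithGrad {d : ℕ} (G : Geometry d) (v : Vec d → Vec d) (A : Vec d → Ten d) : Prop :=
  AEStronglyMeasurable v G.vol ∧ AEStronglyMeasurable A G.vol ∧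
  ∃ φ : ℕ → Vec d → Vec d, (∀ n, IsSmoothC G (φ n)) ∧
    Tendsto (fun n => eLpNorm (φ n - v) 2 G.vol) atTop (𝓝 0) ∧
    Tendsto (fun n => eLpNorm (grad (φ n) - A) 2 G.vol) atTop (𝓝 0)

/-! ### Classical solutions -/

/-- `(ρ, u, B, E)` is a classical solution of the compressible MHD system on `[0,T]` with initial
data `(ρ, u, B)(0) = (ρ₀, u₀, B₀)`. -/
structure IsClassicalSolution {d : ℕ} (P : Params d) (G : Geometry d) (T : ℝ)
    (ρ₀ : Vec d → ℝ) (u₀ B₀ : Vec d → Vec d)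
    (ρ : ℝ → Vec d → ℝ) (u B : ℝ → Vec d → Vec d) (E : ℝ → Vec d → Vec 3) : Prop where
  density_C1 : IsC1 G T ρ
  velocity_C1 : IsC1 G T u
  magnetic_C1 : IsC1 G T B
  density_pos : ∀ t ∈ Icc 0 T, ∀ x ∈ closure G.region, 0 < ρ t x
  /- the further derivatives that occur in the equations exist and are continuous in space -/
  velocity_C2 : ∀ t ∈ Ioo 0 T, ContDiffOn ℝ 2 (u t) G.region
  electric_C1 : ∀ t ∈ Ioo 0 T, ContDiffOn ℝ 1 (E t) G.region
  electric_continuous :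
    ContinuousOn (fun z : ℝ × Vec d => E z.1 z.2) (Icc 0 T ×ˢ closure G.region)
  electric_compatible : ∀ t ∈ Icc 0 T, G.Compatible (E t)
  electric_axial : ∀ t ∈ Icc 0 T, ∀ x ∈ closure G.region, IsAxial d (E t x)
  /- boundary conditions -/
  noslip : ∀ t ∈ Icc 0 T, ∀ x ∈ frontier G.region, u t x = 0
  magnetic_normal : NormalZero G T B
  electric_tangential : ∀ t ∈ Icc 0 T, ∀ x n, IsOutwardNormal G.region x n →
    cross (E t x) (lift3 n) = 0
  /- initial conditions -/
  initial_density : ∀ x ∈ closure G.region, ρ 0 x = ρ₀ x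
  initial_velocity : ∀ x ∈ closure G.region, u 0 x = u₀ x
  initial_magnetic : ∀ x ∈ closure G.region, B 0 x = B₀ x
  /- the equations -/
  continuity : ∀ t ∈ Ioo 0 T, ∀ x ∈ G.region,
    deriv (fun s => ρ s x) t + div (fun y => ρ t y • u t y) x = 0
  momentum : ∀ t ∈ Ioo 0 T, ∀ x ∈ G.region,
    lift3 (deriv (fun s => ρ s x • u s x) t + divT (fun y => ρ t y • tensorT (u t y) (u t y)) x
        + gradient (fun y => P.pressure (ρ t y)) x)
      = lift3 (divT (fun y => P.stress (grad (u t) y)) x)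
        + cross (current (E t x) (u t x) (B t x)) (lift3 (B t x))
  ampere : ∀ t ∈ Ioo 0 T, ∀ x ∈ G.region,
    current (E t x) (u t x) (B t x) = curl (fun y => lift3 (B t y)) x
  maxwell : ∀ t ∈ Ioo 0 T, ∀ x ∈ G.region,
    lift3 (deriv (fun s => B s x) t) + curl (E t) x = 0
  solenoidal : ∀ t ∈ Ioo 0 T, ∀ x ∈ G.region, div (B t) x = 0

/-! ### Dissipative weak solutions -/

/-- `(ρ, u, B, E)` is a dissipative weak solution of the compressible MHD system on `(0,T)` with
initial data `(ρ, ρu, B)(0) = (ρ₀, m₀, B₀)`, weak velocity gradient `Du = ∇u`, and defect measures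
`μc` (with values in the symmetric matrices), `μB` (with values in the vectors), `𝔇`, `ℭ`. Here
the measures on `closure Ω` and on `[0,T] × closure Ω` are measures on the subtypes `closedCell`
and `Icc 0 T × closedCell`. -/
structure IsDissipativeWeakSolution {d : ℕ} (P : Params d) (G : Geometry d) (T : ℝ)
    (ρ₀ : Vec d → ℝ) (m₀ B₀ : Vec d → Vec d)
    (ρ : ℝ → Vec d → ℝ) (u B : ℝ → Vec d → Vec d) (E : ℝ → Vec d → Vec 3)
    (Du : ℝ → Vec d → Ten d)
    (μc : ℝ → VectorMeasure G.closedCell (Ten d)) (μB : ℝ → VectorMeasure G.closedCell (Vec d))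
    (𝔇 : ℝ → Measure G.closedCell) (ℭ : Measure (Icc (0 : ℝ) T × G.closedCell)) : Prop where
  /- regularity class -/
  density_nonneg : ∀ᵐ z ∂((timeMeasure T).prod G.vol), 0 ≤ ρ z.1 z.2
  density_mem : MemLrLp G T ⊤ (ENNReal.ofReal P.γ) ρ
  velocity_meas :
    AEStronglyMeasurable (fun z : ℝ × Vec d => u z.1 z.2) ((timeMeasure T).prod G.vol)
  kinetic_mem : MemLrLp G T ⊤ 2 (fun t x => √(ρ t x) • u t x)
  magnetic_mem : MemLrLp G T ⊤ 2 B
  /- `u(t)` has the weak gradient `Du(t)`, and zero trace in the no-slip case -/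
  velocity_grad : ∀ᵐ t ∂(timeMeasure T), IsW12WithGrad G (u t) (Du t)
  grad_mem : MemLrLp G T 2 2 Du
  current_mem : MemLrLp G T 2 2 (fun t x => current (E t x) (u t x) (B t x))
  electric_mem : MemLrLp G T 2 (3 / 2) E
  electric_axial : ∀ᵐ z ∂((timeMeasure T).prod G.vol), IsAxial d (E z.1 z.2)
  /- `μc ∈ L^∞(0,T; M(closure Ω; sym))`, `μB ∈ L²(0,T; M(closure Ω; ℝᵈ))`,
  `𝔇 ∈ L^∞(0,T; M⁺(closure Ω))`, `ℭ ∈ M⁺([0,T] × closure Ω)` -/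
  muc_meas : ∀ A, MeasurableSet A → AEStronglyMeasurable (fun t => μc t A) (timeMeasure T)
  muc_symm : ∀ᵐ t ∂(timeMeasure T), ∀ A, transposeT (μc t A) = μc t A
  muc_mem : eLpNorm (fun t => (μc t).variation univ) ⊤ (timeMeasure T) < ⊤
  muB_meas : ∀ A, MeasurableSet A → AEStronglyMeasurable (fun t => μB t A) (timeMeasure T)
  muB_mem : eLpNorm (fun t => (μB t).variation univ) 2 (timeMeasure T) < ⊤
  energyDefect_meas : ∀ A, MeasurableSet A → AEMeasurable (fun t => 𝔇 t A) (timeMeasure T)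
  energyDefect_mem : eLpNorm (fun t => 𝔇 t univ) ⊤ (timeMeasure T) < ⊤
  dissipationDefect_finite : IsFiniteMeasure ℭ
  /- continuity equation -/
  continuity : ∀ φ : ℝ → Vec d → ℝ, IsC1 G T φ → ∀ᵐ τ ∂(timeMeasure T),
    (∫ t in (0)..τ, ∫ x, (ρ t x * deriv (fun s => φ s x) t
        + inner ℝ (ρ t x • u t x) (gradient (φ t) x)) ∂G.vol)
      = (∫ x, ρ τ x * φ τ x ∂G.vol) - ∫ x, ρ₀ x * φ 0 x ∂G.vol
  /- momentum equation -/
  momentum : ∀ φ : ℝ → Vec d → Vec d, IsC1c G T φ → ∀ᵐ τ ∂(timeMeasure T),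
    (∫ t in (0)..τ, ∫ x, (inner ℝ (ρ t x • u t x) (deriv (fun s => φ s x) t)
        + inner ℝ (ρ t x • tensorT (u t x) (u t x)) (grad (φ t) x)
        + P.pressure (ρ t x) * div (φ t) x
        - inner ℝ (P.stress (Du t x)) (grad (φ t) x)
        + inner ℝ (cross (current (E t x) (u t x) (B t x)) (lift3 (B t x))) (lift3 (φ t x)))
          ∂G.vol)
      + (∫ t in (0)..τ, ∫ᵛ x, grad (φ t) x ∂[innerSL ℝ; μc t])
      + (∫ t in (0)..τ, ∫ᵛ x, φ t x ∂[innerSL ℝ; μB t])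
      = (∫ x, inner ℝ (ρ τ x • u τ x) (φ τ x) ∂G.vol) - ∫ x, inner ℝ (m₀ x) (φ 0 x) ∂G.vol
  /- Maxwell equation; the test functions with `φ · n = 0` encode `E × n = 0` on the boundary -/
  maxwell : ∀ φ : ℝ → Vec d → Vec d, IsC1 G T φ → NormalZero G T φ → ∀ᵐ τ ∂(timeMeasure T),
    (∫ t in (0)..τ, ∫ x, (inner ℝ (B t x) (deriv (fun s => φ s x) t)
        - inner ℝ (E t x) (curl (fun y => lift3 (φ t y)) x)) ∂G.vol)
      = (∫ x, inner ℝ (B τ x) (φ τ x) ∂G.vol) - ∫ x, inner ℝ (B₀ x) (φ 0 x) ∂G.vol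
  /- Ampère's law `j = curl B` in the sense of distributions: no boundary condition is imposed on the
  tangential part of `B` -/
  ampere : ∀ φ : ℝ → Vec d → Vec 3, IsC1c G T φ → ∀ᵐ τ ∂(timeMeasure T),
    (∫ t in (0)..τ, ∫ x, inner ℝ (current (E t x) (u t x) (B t x)) (φ t x) ∂G.vol)
      = ∫ t in (0)..τ, ∫ x, inner ℝ (lift3 (B t x)) (curl (φ t) x) ∂G.vol
  /- `div B(t) = 0` in the sense of distributions -/
  solenoidal : ∀ᵐ t ∂(timeMeasure T), ∀ ψ : Vec d → ℝ, IsSmoothC G ψ →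
    ∫ x, inner ℝ (B t x) (gradient ψ x) ∂G.vol = 0
  /- balance of total energy -/
  energy : ∀ᵐ τ ∂(timeMeasure T),
    (∫ x, (1 / 2 * ρ τ x * ‖u τ x‖ ^ 2 + 1 / 2 * ‖B τ x‖ ^ 2 + P.potential (ρ τ x)) ∂G.vol)
      + (∫ t in (0)..τ, ∫ x, (inner ℝ (P.stress (Du t x)) (Du t x)
          + ‖current (E t x) (u t x) (B t x)‖ ^ 2) ∂G.vol)
      + (𝔇 τ).real univ + ℭ.real {z | (z.1 : ℝ) ≤ τ}
      ≤ ∫ x, (1 / 2 * (‖m₀ x‖ ^ 2 / ρ₀ x) + 1 / 2 * ‖B₀ x‖ ^ 2 + P.potential (ρ₀ x)) ∂G.vol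
  /- compatibility conditions -/
  compat_muc : ∃ C : ℝ≥0, ∀ ψ : ℝ → ℝ, ContinuousOn ψ (Icc 0 T) → (∀ t ∈ Icc 0 T, 0 ≤ ψ t) →
    ∫⁻ t, ENNReal.ofReal (ψ t) * (μc t).variation univ ∂(timeMeasure T)
      ≤ C * ∫⁻ t, ENNReal.ofReal (ψ t) * 𝔇 t univ ∂(timeMeasure T)
  compat_muB : ∃ C : ℝ≥0, ∀ ε : ℝ≥0, 0 < ε → ∀ ψ : ℝ → ℝ, ContinuousOn ψ (Icc 0 T) →
    (∀ t ∈ Icc 0 T, 0 ≤ ψ t) →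
    ∫⁻ t, ENNReal.ofReal (ψ t) * (μB t).variation univ ∂(timeMeasure T)
      ≤ C * (((ε⁻¹ : ℝ≥0) : ℝ≥0∞) * ∫⁻ t, ENNReal.ofReal (ψ t) * 𝔇 t univ ∂(timeMeasure T)
        + (ε : ℝ≥0∞) * ∫⁻ z, ENNReal.ofReal (ψ z.1) ∂ℭ)

end

end MHD

open Set Filter Topology MeasureTheory
open scoped ENNReal NNReal ContDiff

namespace MHD

noncomputable section

/-! The proof is the relative energy method. For a weak solution `(ρ, u, B, E)` and a classical one
`(ρ', u', B', E')`, `relEnergy` is `½ρ|u-u'|² + ½|B-B'|² + H(ρ) - H'(ρ')(ρ-ρ') - H(ρ')`. Since `H`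
is strictly convex and `ρ' > 0`, it is non-negative and vanishes only where density, velocity and
magnetic field agree.

Expanding the squares splits it into the energy of the weak solution, terms linear in `ρu`, `ρ`,
`B`, and terms of the classical solution alone. The energy inequality, the momentum equation tested
with `u'`, the continuity equation tested with `½|u'|² - H'(ρ')` and the Maxwell equation tested
with `B'` therefore bound its growth (`relative_energy`). Inserting the classical equations and
integrating by parts, `relIntegrand_eq` and `integral_relIntegrand_eq` turn the right-hand side into
minus the viscous dissipation of `u-u'`, minus `|j-j'|²`, plus `relRemainder`. The remainder is
quadratic in the differences up to a term of size `|ρ-ρ'| |u-u'|`, and `relRemainder_le` bounds it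
by the relative energy, half of `|j-j'|²` and `δ|u-u'|²`. The last term is absorbed by Korn's
inequality together with a Poincaré inequality. On the torus the latter needs a weight; `min ρ N`
serves, as its mass stays bounded below by conservation of mass and the `L^γ` bound
(`truncated_mass`).

The concentration measures enter only through the momentum equation. The compatibility conditions
bound them by the time integral of `𝔇` and a small multiple of `ℭ`, and the latter is absorbed on
the left (`relative_energy_absorbed`). Gronwall applied to relative energy plus mass of `𝔇` makes
both vanish. What is left of the inequality then forces `ℭ = 0` before time `T` and `j = j'`, whence
`E = E'`.

Two test fields are not admissible as they stand. The momentum equation allows only compactly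
supported fields, while `u'` merely vanishes on the boundary; it is replaced by `η n ∘ u'`, where `η
n` kills small vectors. This converges with its derivatives because the derivative of a function
vanishes almost everywhere on its zero set. Ampère's law also allows only compactly supported
fields, but has to be tested with `E'`, of which only the tangential trace vanishes. Here the
Lipschitz boundary matters: extended by zero, a localization of `E'` keeps its curl without a
boundary contribution (`integral_curl_smul_eq_zero`), and pushing it below the graph and mollifying
yields admissible fields (`HasWeakCurl.integral_eq`). -/

/-! ### Linear algebra -/

/-- The product of a matrix and a vector. -/
def mulT {d : ℕ} (A : Ten d) (w : Vec d) : Vec d := WithLp.toLp 2 fun i => ∑ j, A (i, j) * w j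

/-- The matrix of a linear map. -/
def matL (d : ℕ) : (Vec d →L[ℝ] Vec d) →L[ℝ] Ten d :=
  LinearMap.toContinuousLinearMap
    { toFun := fun L => WithLp.toLp 2 fun p => L (basisVec p.2) p.1
      map_add' := fun L M => by ext p; simp
      map_smul' := fun c L => by ext p; simp }

/-- A partial derivative as a linear function of the derivative. -/
def partialL (d : ℕ) (k : ℕ) : (Vec d →L[ℝ] Vec 3) →L[ℝ] Vec 3 :=
  if h : k < d then ContinuousLinearMap.apply ℝ (Vec 3) (basisVec ⟨k, h⟩) else 0

/-- The curl as a linear function of the derivative. -/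
def curlL (d : ℕ) : (Vec d →L[ℝ] Vec 3) →L[ℝ] Vec 3 :=
  LinearMap.toContinuousLinearMap
    { toFun := fun L => !₂[partialL d 1 L 2 - partialL d 2 L 1,
        partialL d 2 L 0 - partialL d 0 L 2, partialL d 0 L 1 - partialL d 1 L 0]
      map_add' := fun L M => by
        ext p; fin_cases p <;> simp <;> ring
      map_smul' := fun c L => by
        ext p; fin_cases p <;> simp <;> ring }

/-- The trace as a continuous linear map. -/
def traceL (d : ℕ) : Ten d →L[ℝ] ℝ :=
  LinearMap.toContinuousLinearMap
    { toFun := traceT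
      map_add' := fun A B => by simp [traceT, Finset.sum_add_distrib]
      map_smul' := fun c A => by simp [traceT, Finset.mul_sum] }

/-- The transpose as a continuous linear map. -/
def transposeL (d : ℕ) : Ten d →L[ℝ] Ten d :=
  LinearMap.toContinuousLinearMap
    { toFun := transposeT
      map_add' := fun A B => by ext p; simp [transposeT]
      map_smul' := fun c A => by ext p; simp [transposeT] }

/-- The stress as a continuous linear map. -/
def Params.stressL {d : ℕ} (P : Params d) : Ten d →L[ℝ] Ten d :=
  P.mu • (ContinuousLinearMap.id ℝ _ + transposeL d
    - (2 / (d : ℝ)) • (traceL d).smulRight (idT d)) + P.lam • (traceL d).smulRight (idT d)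

/-- The inclusion `ℝᵈ → ℝ³` as a continuous linear map. -/
def liftL (d : ℕ) : Vec d →L[ℝ] Vec 3 :=
  LinearMap.toContinuousLinearMap
    { toFun := lift3
      map_add' := fun v w => by
        ext k; by_cases h : (k : ℕ) < d <;> simp [lift3, h]
      map_smul' := fun c v => by
        ext k; by_cases h : (k : ℕ) < d <;> simp [lift3, h] }

/-- The cross product as a continuous bilinear map. -/
def crossL : Vec 3 →L[ℝ] Vec 3 →L[ℝ] Vec 3 :=
  LinearMap.toContinuousLinearMap
    { toFun := fun v => LinearMap.toContinuousLinearMap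
        { toFun := fun w => cross v w
          map_add' := fun a b => by ext k; simp [cross]
          map_smul' := fun c a => by ext k; simp [cross] }
      map_add' := fun a b => by ext w k; simp [cross]
      map_smul' := fun c a => by ext w k; simp [cross] }

@[simp] lemma traceL_apply {d : ℕ} (A : Ten d) : traceL d A = traceT A := rfl
@[simp] lemma transposeL_apply {d : ℕ} (A : Ten d) : transposeL d A = transposeT A := rfl
@[simp] lemma liftL_apply {d : ℕ} (v : Vec d) : liftL d v = lift3 v := rfl
@[simp] lemma crossL_apply (v w : Vec 3) : crossL v w = cross v w := rfl

lemma stressL_apply {d : ℕ} (P : Params d) (A : Ten d) : P.stressL A = P.stress A := by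
  simp [Params.stressL, Params.stress, smul_smul]

lemma grad_eq {d : ℕ} (v : Vec d → Vec d) (x : Vec d) : grad v x = matL d (fderiv ℝ v x) := rfl

lemma div_eq {d : ℕ} (v : Vec d → Vec d) (x : Vec d) :
    div v x = traceT (matL d (fderiv ℝ v x)) := rfl

lemma partial3_eq {d : ℕ} (k : ℕ) (F : Vec d → Vec 3) (x : Vec d) :
    partial3 k F x = partialL d k (fderiv ℝ F x) := by
  unfold partial3 partialL; split_ifs <;> rfl

lemma curl_eq {d : ℕ} (F : Vec d → Vec 3) (x : Vec d) : curl F x = curlL d (fderiv ℝ F x) := by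
  simp only [curl, partial3_eq]; rfl

lemma vec_eq_sum {d : ℕ} (w : Vec d) : w = ∑ j, w j • basisVec j := by
  ext i; simp [basisVec, Finset.sum_apply, Pi.single_apply]

lemma mulT_matL {d : ℕ} (L : Vec d →L[ℝ] Vec d) (w : Vec d) : mulT (matL d L) w = L w := by
  conv_rhs => rw [vec_eq_sum w]
  ext i
  simp [mulT, matL, mul_comm]

lemma inner_lift3 {d : ℕ} (hd : d ≤ 3) (v w : Vec d) :
    inner ℝ (lift3 v) (lift3 w) = inner ℝ v w := by
  interval_cases d <;> simp [lift3, PiLp.inner_apply, Fin.sum_univ_succ] <;> rfl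

lemma norm_lift3 {d : ℕ} (hd : d ≤ 3) (v : Vec d) : ‖lift3 v‖ = ‖v‖ := by
  rw [← sq_eq_sq₀ (norm_nonneg _) (norm_nonneg _), ← real_inner_self_eq_norm_sq,
    ← real_inner_self_eq_norm_sq, inner_lift3 hd]

lemma norm_cross_le (v w : Vec 3) : ‖cross v w‖ ≤ ‖v‖ * ‖w‖ := by
  rw [← sq_le_sq₀ (norm_nonneg _) (by positivity), mul_pow, EuclideanSpace.real_norm_sq_eq,
    EuclideanSpace.real_norm_sq_eq, EuclideanSpace.real_norm_sq_eq]
  simp only [cross, Fin.sum_univ_three, crossProduct]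
  simp
  -- Lagrange's identity: the two sides differ by the square of the inner product.
  nlinarith [sq_nonneg (v 0 * w 0 + v 1 * w 1 + v 2 * w 2)]

lemma inner_tensorT {d : ℕ} (v w : Vec d) (A : Ten d) :
    inner ℝ (tensorT v w) A = inner ℝ v (mulT A w) := by
  simp only [PiLp.inner_apply, tensorT, mulT, RCLike.inner_apply, conj_trivial,
    Fintype.sum_prod_type, Finset.sum_mul]
  refine Finset.sum_congr rfl fun i _ => Finset.sum_congr rfl fun j _ => by ring

/-- The term with the transpose has no sign pointwise. It is kept apart because only its integral is
controlled, by `IsTest.integral_transpose`. -/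
lemma inner_stress_self {d : ℕ} (P : Params d) (A : Ten d) :
    inner ℝ (P.stress A) A = P.mu * ‖A‖ ^ 2 + P.mu * inner ℝ (transposeT A) A
      + (P.lam - 2 / d * P.mu) * traceT A ^ 2 := by
  have h2 : ∀ A : Ten d, inner ℝ (idT d) A = traceT A := fun A => by
    simp [PiLp.inner_apply, idT, traceT, Fintype.sum_prod_type]
  simp only [Params.stress, inner_add_left, inner_sub_left, real_inner_smul_left, h2,
    real_inner_self_eq_norm_sq]
  ring

lemma norm_mulT_le {d : ℕ} (A : Ten d) (w : Vec d) : ‖mulT A w‖ ≤ ‖A‖ * ‖w‖ := by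
  rw [← sq_le_sq₀ (norm_nonneg _) (by positivity), mul_pow, EuclideanSpace.real_norm_sq_eq,
    EuclideanSpace.real_norm_sq_eq, EuclideanSpace.real_norm_sq_eq]
  simp only [mulT, Fintype.sum_prod_type, Finset.sum_mul]
  exact Finset.sum_le_sum fun i _ => by
    simpa only [Finset.sum_mul] using Finset.sum_mul_sq_le_sq_mul_sq Finset.univ (fun j => A (i, j)) (fun j => w j)

/-- The electromagnetic part of the relative energy identity. -/
lemma lorentz_identity (e c u u' b b' : Vec 3) :
    let j := e + cross u b
    let e' := c - cross u' b'
    inner ℝ e c + inner ℝ (j - c) e' - ‖j‖ ^ 2 - inner ℝ (cross j b) u'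
        - inner ℝ (cross c b') (u - u')
      = -‖j - c‖ ^ 2 + inner ℝ (j - c) (cross u' (b - b')) - inner ℝ c (cross (u - u') (b - b')) := by
  intro j e'
  -- With `e` eliminated and `j` opaque, the claim is a polynomial identity in the coordinates.
  have hj : e = j - cross u b := by simp [j]
  rw [hj]
  clear_value j
  simp only [e', EuclideanSpace.real_norm_sq_eq, PiLp.inner_apply, cross, Fin.sum_univ_three,
    crossProduct]
  simp
  ring

/-! ### The domain of integration -/

lemma Geometry.isOpen_region {d : ℕ} (G : Geometry d) : IsOpen G.region := by
  cases G with
  | torus => exact isOpen_univ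
  | bounded Ω hΩ => exact hΩ.isOpen

/-- Seen as a fundamental domain of the lattice `ℤᵈ`, the cell inherits boundedness and
measurability, and integrals of periodic functions become translation invariant. -/
lemma unitCell_eq {d : ℕ} :
    unitCell d = ZSpan.fundamentalDomain (EuclideanSpace.basisFun (Fin d) ℝ).toBasis := by
  ext x; simp [unitCell, ZSpan.mem_fundamentalDomain]

lemma isBounded_unitCell (d : ℕ) : Bornology.IsBounded (unitCell d) := by
  rw [unitCell_eq]; exact ZSpan.fundamentalDomain_isBounded _

lemma Geometry.measurableSet_cell {d : ℕ} (G : Geometry d) : MeasurableSet G.cell := by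
  cases G with
  | torus =>
    change MeasurableSet (unitCell d)
    rw [unitCell_eq]; exact ZSpan.fundamentalDomain_measurableSet _
  | bounded Ω hΩ => exact hΩ.isOpen.measurableSet

lemma Geometry.isBounded_cell {d : ℕ} (G : Geometry d) : Bornology.IsBounded G.cell := by
  cases G with
  | torus => exact isBounded_unitCell d
  | bounded Ω hΩ => exact hΩ.isBounded

lemma Geometry.cell_subset_region {d : ℕ} (G : Geometry d) : G.cell ⊆ G.region := by
  cases G with
  | torus => exact subset_univ _
  | bounded Ω hΩ => exact subset_rfl

lemma Geometry.closedCell_subset {d : ℕ} (G : Geometry d) : G.closedCell ⊆ closure G.cell := by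
  cases G with
  | torus => exact subset_closure
  | bounded Ω hΩ => exact subset_rfl

lemma Geometry.closure_cell_subset {d : ℕ} (G : Geometry d) : closure G.cell ⊆ closure G.region :=
  closure_mono G.cell_subset_region

lemma Geometry.isCompact_closure_cell {d : ℕ} (G : Geometry d) : IsCompact (closure G.cell) :=
  G.isBounded_cell.isCompact_closure

instance {d : ℕ} (G : Geometry d) : IsFiniteMeasure G.vol :=
  isFiniteMeasure_restrict.2 (G.isBounded_cell.measure_lt_top).ne

instance (T : ℝ) : IsFiniteMeasure (timeMeasure T) :=
  isFiniteMeasure_restrict.2 (by simp)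

lemma Geometry.ae_mem_cell {d : ℕ} (G : Geometry d) : ∀ᵐ x ∂G.vol, x ∈ G.cell :=
  ae_restrict_mem G.measurableSet_cell

lemma Geometry.integral_congr {d : ℕ} {F : Type*} [NormedAddCommGroup F] [NormedSpace ℝ F]
    (G : Geometry d) {f g : Vec d → F} (h : ∀ x ∈ G.cell, f x = g x) :
    ∫ x, f x ∂G.vol = ∫ x, g x ∂G.vol :=
  setIntegral_congr_fun G.measurableSet_cell h

/-! ### Test functions and integration by parts -/

/-- Fields of class `Cⁿ`, periodic on the torus, vanishing off a closed subset of the region. -/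
structure IsTest {d : ℕ} {F : Type*} [NormedAddCommGroup F] [NormedSpace ℝ F]
    (n : ℕ) (G : Geometry d) (f : Vec d → F) : Prop where
  contDiff : ContDiff ℝ n f
  compatible : G.Compatible f
  support : ∃ K, IsClosed K ∧ K ⊆ G.region ∧ ∀ x ∉ K, f x = 0

lemma IsSmoothC.isTest {d : ℕ} {F : Type*} [NormedAddCommGroup F] [NormedSpace ℝ F]
    {G : Geometry d} {f : Vec d → F} (h : IsSmoothC G f) (n : ℕ) : IsTest n G f :=
  ⟨h.1.of_le (by exact_mod_cast le_top), h.2.1, h.2.2⟩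

lemma IsTest.of_le {d : ℕ} {F : Type*} [NormedAddCommGroup F] [NormedSpace ℝ F] {n m : ℕ}
    {G : Geometry d} {f : Vec d → F} (h : IsTest n G f) (hm : m ≤ n) : IsTest m G f :=
  ⟨h.1.of_le (by exact_mod_cast hm), h.2, h.3⟩

/-- A composition with a fixed function that vanishes at `0` stays a test function. -/
lemma IsTest.comp {d : ℕ} {F F' : Type*} [NormedAddCommGroup F] [NormedSpace ℝ F]
    [NormedAddCommGroup F'] [NormedSpace ℝ F'] {n : ℕ}
    {G : Geometry d} {f : Vec d → F} (h : IsTest n G f) {g : F → F'} (hg : ContDiff ℝ n g)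
    (hg0 : g 0 = 0) : IsTest n G (fun x => g (f x)) := by
  refine ⟨hg.comp h.1, ?_, ?_⟩
  · cases G with
    | torus => intro x i; simp only [h.compatible x i]
    | bounded Ω hΩ => trivial
  · obtain ⟨K, h1, h2, h3⟩ := h.support
    exact ⟨K, h1, h2, fun x hx => by simp [h3 x hx, hg0]⟩

/-- The product of a field that is regular in the region and a test field is a test function. -/
lemma IsTest.bilinear {d : ℕ} {F F' W : Type*} [NormedAddCommGroup F] [NormedSpace ℝ F]
    [NormedAddCommGroup F'] [NormedSpace ℝ F'] [NormedAddCommGroup W] [NormedSpace ℝ W] {n : ℕ}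
    {G : Geometry d} {f : Vec d → F} (h : IsTest n G f) {g : Vec d → F'}
    (hg : ContDiffOn ℝ n g G.region) (hc : G.Compatible g) (b : F' →L[ℝ] F →L[ℝ] W) :
    IsTest n G (fun x => b (g x) (f x)) := by
  obtain ⟨K, h1, h2, h3⟩ := h.support
  refine ⟨contDiff_iff_contDiffAt.2 fun x => ?_, ?_, K, h1, h2, fun x hx => by simp [h3 x hx]⟩
  -- Nothing is known about `g` outside the region, but there the product vanishes in a whole
  -- neighbourhood because `K` is closed.
  · by_cases hx : x ∈ K
    · exact b.isBoundedBilinearMap.contDiff.contDiffAt.comp x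
        ((hg.contDiffAt (G.isOpen_region.mem_nhds (h2 hx))).prodMk h.1.contDiffAt)
    · have : (fun x => b (g x) (f x)) =ᶠ[𝓝 x] fun _ => 0 := by
        filter_upwards [h1.isOpen_compl.mem_nhds hx] with y hy
        simp [h3 y hy]
      exact contDiffAt_const.congr_of_eventuallyEq this
  · cases G with
    | torus => intro x i; simp only [h.compatible x i, hc x i]
    | bounded Ω hΩ => trivial

/-- The support of a test function is compact, except on the torus. -/
lemma IsTest.hasCompactSupport {d : ℕ} {F : Type*} [NormedAddCommGroup F] [NormedSpace ℝ F]
    {n : ℕ} {Ω : Set (Vec d)} {hΩ : IsBoundedLipschitz Ω} {f : Vec d → F}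
    (h : IsTest n (.bounded Ω hΩ) f) : HasCompactSupport f := by
  obtain ⟨K, h1, h2, h3⟩ := h.support
  exact HasCompactSupport.intro (Metric.isCompact_of_isClosed_isBounded h1 (hΩ.isBounded.subset h2))
    h3

lemma periodic_of_basis {d : ℕ} {F : Type*} {f : Vec d → F}
    (hf : ∀ x i, f (x + basisVec i) = f x) (w : Vec d)
    (hw : w ∈ Submodule.span ℤ (Set.range (EuclideanSpace.basisFun (Fin d) ℝ).toBasis)) (x : Vec d) :
    f (w + x) = f x := by
  induction hw using Submodule.span_induction generalizing x with
  | mem w hw =>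
    obtain ⟨i, rfl⟩ := hw
    simpa [add_comm, basisVec] using hf x i
  | zero => simp
  | add a b _ _ ha hb => rw [add_assoc, ha, hb]
  | smul n a _ ha =>
    induction n using Int.induction_on generalizing x with
    | zero => simp
    | succ n hn => rw [add_smul, one_smul, add_assoc, hn, ha]
    | pred n hn =>
      rw [← ha, sub_smul, one_smul, ← add_assoc, add_sub_cancel, hn]

/-- A translate of the cell is again a fundamental domain of the lattice, and an invariant function
has the same integral over any two of them. -/
lemma setIntegral_unitCell_translate {d : ℕ} {F : Type*} [NormedAddCommGroup F] [NormedSpace ℝ F]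
    {f : Vec d → F} (hf : ∀ x i, f (x + basisVec i) = f x) (w : Vec d) :
    ∫ x in unitCell d, f (x + w) = ∫ x in unitCell d, f x := by
  rw [unitCell_eq]
  have h1 := ZSpan.isAddFundamentalDomain' (EuclideanSpace.basisFun (Fin d) ℝ).toBasis
    (volume : Measure (Vec d))
  have h2 := h1.vadd_of_comm w
  have : Countable (Submodule.span ℤ
      (Set.range (EuclideanSpace.basisFun (Fin d) ℝ).toBasis)).toAddSubgroup :=
    inferInstanceAs (Countable (Submodule.span ℤ _))
  rw [h1.setIntegral_eq h2 fun g x => periodic_of_basis hf g.1 g.2 x]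
  have : MeasurePreserving (fun x : Vec d => x + w) volume volume :=
    measurePreserving_add_right volume w
  rw [← this.setIntegral_image_emb (measurableEmbedding_addRight w)]
  congr 2
  ext x; simp only [Set.mem_vadd_set, Set.mem_image, vadd_eq_add, add_comm]

/-- The integral of a partial derivative of a test function vanishes. -/
lemma IsTest.integral_fderiv {d : ℕ} {G : Geometry d} {f : Vec d → ℝ} (h : IsTest 1 G f)
    (v : Vec d) : ∫ x, fderiv ℝ f x v ∂G.vol = 0 := by
  have hc1 : ContDiff ℝ 1 f := by exact_mod_cast h.1
  have hcont : Continuous (fun x => fderiv ℝ f x v) :=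
    (hc1.continuous_fderiv (by norm_num)).clm_apply continuous_const
  have hdiff : Differentiable ℝ f := hc1.differentiable (by norm_num)
  cases G with
  | bounded Ω hΩ =>
    have hs := h.hasCompactSupport
    obtain ⟨K, h1, h2, h3⟩ := h.support
    -- The derivative vanishes off `K ⊆ Ω`, so one may integrate over the whole space, where
    -- integration by parts against the constant `1` applies.
    have h0 : ∫ x, fderiv ℝ f x v ∂(Geometry.bounded Ω hΩ).vol = ∫ x, fderiv ℝ f x v := by
      refine setIntegral_eq_integral_of_forall_compl_eq_zero fun x hx => ?_
      have : f =ᶠ[𝓝 x] fun _ => 0 := by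
        filter_upwards [h1.isOpen_compl.mem_nhds (fun hk => hx (h2 hk))] with y hy using h3 y hy
      rw [this.fderiv_eq]; simp
    rw [h0]
    have hi : Integrable (fun x => fderiv ℝ f x v) := by
      refine hcont.integrable_of_hasCompactSupport ?_
      exact (hs.fderiv (𝕜 := ℝ)).comp_left (g := fun L : Vec d →L[ℝ] ℝ => L v) (by simp)
    have := integral_mul_fderiv_eq_neg_fderiv_mul_of_integrable (𝕜 := ℝ) (f := fun _ : Vec d => (1 : ℝ))
      (g := f) (v := v) (μ := volume) (by simp) (by simpa using hi)
      (by simpa using hc1.continuous.integrable_of_hasCompactSupport hs)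
      (fun x _ => by fun_prop) (fun x _ => hdiff x)
    simpa using this
  | torus =>
    change ∫ x in unitCell d, fderiv ℝ f x v = 0
    obtain ⟨R, hR⟩ := (isBounded_unitCell d).subset_closedBall 0
    obtain ⟨M, hM⟩ := (isCompact_closedBall (0 : Vec d) (R + ‖v‖)).exists_bound_of_continuousOn
      hcont.continuousOn
    have hmeas : MeasurableSet (unitCell d) := Geometry.measurableSet_cell .torus
    have : IsFiniteMeasure ((volume : Measure (Vec d)).restrict (unitCell d)) :=
      inferInstanceAs (IsFiniteMeasure (Geometry.torus (d := d)).vol)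
    -- By translation invariance `s ↦ ∫ f (x + s • v)` is constant; its derivative at `0`, taken
    -- under the integral, is the integral in question.
    have key := hasDerivAt_integral_of_dominated_loc_of_deriv_le (𝕜 := ℝ)
      (μ := (volume : Measure (Vec d)).restrict (unitCell d))
      (F := fun (s : ℝ) x => f (x + s • v)) (F' := fun s x => fderiv ℝ f (x + s • v) v)
      (x₀ := 0) (s := Metric.ball 0 1) (bound := fun _ => M) (Metric.ball_mem_nhds _ one_pos)
      (Eventually.of_forall fun s => by
        exact (hc1.continuous.comp (by fun_prop)).aestronglyMeasurable)
      (by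
        obtain ⟨M', hM'⟩ := (isCompact_closedBall (0 : Vec d) R).exists_bound_of_continuousOn
          hc1.continuous.continuousOn
        refine Integrable.of_bound (C := M')
          (by simpa using hc1.continuous.aestronglyMeasurable) ?_
        filter_upwards [ae_restrict_mem hmeas] with x hx
        simpa using hM' x (hR hx))
      (by simpa using hcont.aestronglyMeasurable)
      (by
        filter_upwards [ae_restrict_mem hmeas] with x hx s hs
        refine hM _ ?_
        have h1 : ‖x‖ ≤ R := by simpa using hR hx
        have h2 : |s| ≤ 1 := by simpa using (Metric.mem_ball.1 hs).le
        rw [mem_closedBall_zero_iff]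
        refine (norm_add_le _ _).trans (add_le_add h1 ?_)
        rw [norm_smul]
        exact mul_le_of_le_one_left (norm_nonneg _) h2)
      (integrable_const _)
      (Eventually.of_forall fun x s _ => by
        have h1 : HasDerivAt (fun s : ℝ => x + s • v) v s := by
          simpa using ((hasDerivAt_id s).smul_const v).const_add x
        exact (hdiff _).hasFDerivAt.comp_hasDerivAt s h1)
    have hconst : (fun s : ℝ => ∫ x in unitCell d, f (x + s • v))
        = fun _ => ∫ x in unitCell d, f x := by
      funext s
      exact setIntegral_unitCell_translate h.compatible _
    have h2 := key.2
    rw [hconst] at h2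
    simpa using (h2.unique (hasDerivAt_const _ _))

/-- Continuous fields are bounded on the cell. -/
lemma continuous_memLp {d : ℕ} {F : Type*} [NormedAddCommGroup F] (G : Geometry d)
    {f : Vec d → F} (hf : Continuous f) (p : ℝ≥0∞) : MemLp f p G.vol := by
  obtain ⟨M, hM⟩ := G.isCompact_closure_cell.exists_bound_of_continuousOn hf.continuousOn
  refine MemLp.of_bound hf.aestronglyMeasurable M ?_
  filter_upwards [G.ae_mem_cell] with x hx using hM x (subset_closure hx)

lemma continuous_integrable {d : ℕ} {F : Type*} [NormedAddCommGroup F] (G : Geometry d)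
    {f : Vec d → F} (hf : Continuous f) : Integrable f G.vol :=
  memLp_one_iff_integrable.1 (continuous_memLp G hf 1)

lemma Geometry.Compatible.fderiv_compatible {d : ℕ} {F : Type*} [NormedAddCommGroup F] [NormedSpace ℝ F]
    {G : Geometry d} {f : Vec d → F} (h : G.Compatible f) : G.Compatible (fderiv ℝ f) := by
  cases G with
  | torus =>
    intro x i
    have : (fun y => f (y + basisVec i)) = f := funext fun y => h y i
    rw [← fderiv_comp_add_right, this]
  | bounded Ω hΩ => trivial

lemma Geometry.Compatible.comp {d : ℕ} {F F' : Type*} {G : Geometry d} {f : Vec d → F}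
    (h : G.Compatible f) (g : F → F') : G.Compatible (fun x => g (f x)) := by
  cases G with
  | torus => intro x i; simp only [h x i]
  | bounded Ω hΩ => trivial

lemma Geometry.Compatible.comp₂ {d : ℕ} {F F' F'' : Type*} {G : Geometry d} {f : Vec d → F}
    {f' : Vec d → F'} (h : G.Compatible f) (h' : G.Compatible f') (g : F → F' → F'') :
    G.Compatible (fun x => g (f x) (f' x)) := by
  cases G with
  | torus => intro x i; simp only [h x i, h' x i]
  | bounded Ω hΩ => trivial

lemma IsTest.fderiv_test {d : ℕ} {F : Type*} [NormedAddCommGroup F] [NormedSpace ℝ F] {n : ℕ}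
    {G : Geometry d} {f : Vec d → F} (h : IsTest (n + 1) G f) : IsTest n G (fderiv ℝ f) := by
  obtain ⟨K, h1, h2, h3⟩ := h.support
  refine ⟨h.1.fderiv_right (by exact_mod_cast le_rfl), h.compatible.fderiv_compatible, K, h1, h2,
    fun x hx => ?_⟩
  have : f =ᶠ[𝓝 x] fun _ => 0 := by
    filter_upwards [h1.isOpen_compl.mem_nhds hx] with y hy using h3 y hy
  rw [this.fderiv_eq]; simp

lemma IsTest.clm {d : ℕ} {F F' : Type*} [NormedAddCommGroup F] [NormedSpace ℝ F]
    [NormedAddCommGroup F'] [NormedSpace ℝ F'] {n : ℕ}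
    {G : Geometry d} {f : Vec d → F} (h : IsTest n G f) (L : F →L[ℝ] F') :
    IsTest n G (fun x => L (f x)) := h.comp L.contDiff L.map_zero

/-- Korn's identity for test fields: `∫ A : Aᵀ = ∫ (tr A)²` for `A = ∇φ`. -/
lemma IsTest.integral_transpose {d : ℕ} {G : Geometry d} {φ : Vec d → Vec d} (h : IsTest 2 G φ) :
    ∫ x, (inner ℝ (transposeT (grad φ x)) (grad φ x) - traceT (grad φ x) ^ 2) ∂G.vol = 0 := by
  have hc : ContDiff ℝ 2 φ := by exact_mod_cast h.1
  have hd1 : Differentiable ℝ φ := hc.differentiable (by norm_num)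
  have hd2 : Differentiable ℝ (fderiv ℝ φ) :=
    (hc.fderiv_right (m := 1) (by norm_num)).differentiable (by norm_num)
  have hT : ∀ i k l, IsTest 1 G (fun x => φ x i * fderiv ℝ φ x (basisVec k) l) := by
    intro i k l
    have h1 : IsTest 1 G (fun x => fderiv ℝ φ x (basisVec k) l) :=
      h.fderiv_test.clm ((EuclideanSpace.proj l).comp (ContinuousLinearMap.apply ℝ (Vec d) (basisVec k)))
    have h2 : IsTest 1 G (fun x => φ x i) := (h.of_le one_le_two).clm (EuclideanSpace.proj i)
    exact h1.bilinear h2.1.contDiffOn h2.compatible (ContinuousLinearMap.mul ℝ ℝ)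
  have hder : ∀ i k l m x, fderiv ℝ (fun x => φ x i * fderiv ℝ φ x (basisVec k) l) x (basisVec m)
      = fderiv ℝ φ x (basisVec m) i * fderiv ℝ φ x (basisVec k) l
        + φ x i * fderiv ℝ (fderiv ℝ φ) x (basisVec m) (basisVec k) l := by
    intro i k l m x
    have e1 : HasFDerivAt (fun x => φ x i) ((EuclideanSpace.proj i).comp (fderiv ℝ φ x)) x :=
      (EuclideanSpace.proj (𝕜 := ℝ) i).hasFDerivAt.comp x (hd1 x).hasFDerivAt
    have e2 : HasFDerivAt (fun x => fderiv ℝ φ x (basisVec k) l)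
        (((EuclideanSpace.proj l).comp (ContinuousLinearMap.apply ℝ (Vec d) (basisVec k))).comp
          (fderiv ℝ (fderiv ℝ φ) x)) x :=
      ((EuclideanSpace.proj (𝕜 := ℝ) l).comp
        (ContinuousLinearMap.apply ℝ (Vec d) (basisVec k))).hasFDerivAt.comp x (hd2 x).hasFDerivAt
    rw [(e1.fun_mul e2).fderiv]
    simp; ring
  -- The integrand is a null Lagrangian, `∑ ∂ⱼ(φᵢ ∂ᵢφⱼ) - ∂ᵢ(φᵢ ∂ⱼφⱼ)`: the second derivatives
  -- cancel by symmetry, which is why two continuous derivatives are required.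
  have key : ∀ x, inner ℝ (transposeT (grad φ x)) (grad φ x) - traceT (grad φ x) ^ 2
      = ∑ i, ∑ j, (fderiv ℝ (fun x => φ x i * fderiv ℝ φ x (basisVec i) j) x (basisVec j)
        - fderiv ℝ (fun x => φ x i * fderiv ℝ φ x (basisVec j) j) x (basisVec i)) := by
    intro x
    have hs : IsSymmSndFDerivAt ℝ φ x := hc.contDiffAt.isSymmSndFDerivAt (by simp)
    simp only [hder, traceT, sq, Finset.sum_mul_sum, PiLp.inner_apply, Fintype.sum_prod_type,
      transposeT, grad, RCLike.inner_apply, conj_trivial, ← Finset.sum_sub_distrib]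
    refine Finset.sum_congr rfl fun i _ => Finset.sum_congr rfl fun j _ => ?_
    rw [hs.eq (basisVec j) (basisVec i)]
    ring
  have hint : ∀ i k l m, Integrable
      (fun x => fderiv ℝ (fun x => φ x i * fderiv ℝ φ x (basisVec k) l) x (basisVec m)) G.vol :=
    fun i k l m => continuous_integrable G
      (((hT i k l).1.continuous_fderiv (by norm_num)).clm_apply continuous_const)
  have hint' : ∀ i j, Integrable
      (fun x => fderiv ℝ (fun x => φ x i * fderiv ℝ φ x (basisVec i) j) x (basisVec j)
        - fderiv ℝ (fun x => φ x i * fderiv ℝ φ x (basisVec j) j) x (basisVec i)) G.vol :=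
    fun i j => (hint i i j j).sub (hint i j j i)
  simp only [key]
  rw [integral_finsetSum _ fun i _ => integrable_finsetSum _ fun j _ => hint' i j]
  refine Finset.sum_eq_zero fun i _ => ?_
  rw [integral_finsetSum _ fun j _ => hint' i j]
  refine Finset.sum_eq_zero fun j _ => ?_
  rw [integral_sub (hint i i j j) (hint i j j i), (hT _ _ _).integral_fderiv,
    (hT _ _ _).integral_fderiv, sub_zero]

lemma IsTest.continuous_grad {d : ℕ} {G : Geometry d} {φ : Vec d → Vec d} (h : IsTest 1 G φ) :
    Continuous (grad φ) :=
  (matL d).continuous.comp (h.1.continuous_fderiv (by norm_num))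

lemma continuous_transposeT {d : ℕ} : Continuous (transposeT (d := d)) := (transposeL d).continuous

lemma continuous_traceT {d : ℕ} : Continuous (traceT (d := d)) := (traceL d).continuous

/-- Korn's inequality for test fields. -/
lemma IsTest.korn {d : ℕ} (hd : 0 < d) (P : Params d) {G : Geometry d} {φ : Vec d → Vec d}
    (h : IsTest 2 G φ) : P.mu * ∫ x, inner ℝ (grad φ x) (grad φ x) ∂G.vol
      ≤ ∫ x, inner ℝ (P.stress (grad φ x)) (grad φ x) ∂G.vol := by
  have hg := (h.of_le one_le_two).continuous_grad
  have i1 : Integrable (fun x => P.mu * inner ℝ (grad φ x) (grad φ x)) G.vol :=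
    continuous_integrable G (continuous_const.mul (hg.inner hg))
  have i2 : Integrable (fun x => inner ℝ (transposeT (grad φ x)) (grad φ x)
      - traceT (grad φ x) ^ 2) G.vol :=
    continuous_integrable G (((continuous_transposeT.comp hg).inner hg).sub
      ((continuous_traceT.comp hg).pow 2))
  have i3 : Integrable (fun x => traceT (grad φ x) ^ 2) G.vol :=
    continuous_integrable G ((continuous_traceT.comp hg).pow 2)
  -- Subtracting `μ (tr A)²` from the transpose term gives it integral zero; the trace is left with
  -- the bulk coefficient, which is non-negative by assumption.
  have e : ∀ x, inner ℝ (P.stress (grad φ x)) (grad φ x)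
      = P.mu * inner ℝ (grad φ x) (grad φ x) + P.mu * (inner ℝ (transposeT (grad φ x)) (grad φ x)
      - traceT (grad φ x) ^ 2) + (((d : ℝ) - 2) / d * P.mu + P.lam) * traceT (grad φ x) ^ 2 := by
    intro x
    rw [inner_stress_self, real_inner_self_eq_norm_sq]
    have : (d : ℝ) ≠ 0 := by positivity
    field_simp; ring
  simp only [e]
  have i4 : Integrable (fun x => P.mu * inner ℝ (grad φ x) (grad φ x)
      + P.mu * (inner ℝ (transposeT (grad φ x)) (grad φ x) - traceT (grad φ x) ^ 2)) G.vol :=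
    i1.add (i2.const_mul _)
  rw [integral_add i4 (i3.const_mul _), integral_add i1 (i2.const_mul _),
    integral_const_mul, integral_const_mul, integral_const_mul, h.integral_transpose]
  have := mul_nonneg P.bulk_nonneg (integral_nonneg (μ := G.vol)
    (f := fun x => traceT (grad φ x) ^ 2) fun x => sq_nonneg _)
  linarith

/-! ### Poincaré inequalities for test fields. -/

lemma norm_basisVec {d : ℕ} (j : Fin d) : ‖basisVec j‖ = 1 := by simp [basisVec]

lemma norm_apply_le_matL {d : ℕ} (L : Vec d →L[ℝ] Vec d) (w : Vec d) : ‖L w‖ ≤ ‖matL d L‖ * ‖w‖ := by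
  rw [← mulT_matL]; exact norm_mulT_le _ _

/-- The Poincaré inequality on bounded sets. -/
lemma IsTest.poincare_bounded {d : ℕ} (hd : 0 < d) (Ω : Set (Vec d)) (hΩ : IsBoundedLipschitz Ω) :
    ∃ C : ℝ, 0 ≤ C ∧ ∀ φ : Vec d → Vec d, IsTest 1 (.bounded Ω hΩ) φ →
      ∫ x, ‖φ x‖ ^ 2 ∂(Geometry.bounded Ω hΩ).vol
        ≤ C * ∫ x, ‖grad φ x‖ ^ 2 ∂(Geometry.bounded Ω hΩ).vol := by
  set G := Geometry.bounded Ω hΩ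
  obtain ⟨R, hR⟩ := hΩ.isBounded.subset_closedBall 0
  let i : Fin d := ⟨0, hd⟩
  -- From `∫ ∂ᵢ(xᵢ ‖φ‖²) = 0` follows `∫ ‖φ‖² = -2 ∫ xᵢ φ · ∂ᵢφ`. As `|xᵢ| ≤ R`, Young's inequality
  -- bounds the right side by `½ ∫ ‖φ‖² + 2R² ∫ ‖∇φ‖²`; absorbing the first term yields `4R²`.
  refine ⟨4 * R ^ 2, by positivity, fun φ h => ?_⟩
  have hc : ContDiff ℝ 1 φ := by exact_mod_cast h.1
  have hφ := hc.continuous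
  have hd1 : Differentiable ℝ φ := hc.differentiable (by norm_num)
  have hD : Continuous fun x => fderiv ℝ φ x (basisVec i) :=
    (hc.continuous_fderiv (by norm_num)).clm_apply continuous_const
  have hproj : Continuous fun x : Vec d => x i := (EuclideanSpace.proj (𝕜 := ℝ) i).continuous
  have hT : IsTest 1 G (fun x => x i * ‖φ x‖ ^ 2) := by
    have := h.comp (g := fun v => ‖v‖ ^ 2) (contDiff_norm_sq ℝ) (by simp)
    exact this.bilinear (g := fun x : Vec d => x i)
      (EuclideanSpace.proj (𝕜 := ℝ) i).contDiff.contDiffOn trivial (ContinuousLinearMap.mul ℝ ℝ)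
  have hder : ∀ x, fderiv ℝ (fun x => x i * ‖φ x‖ ^ 2) x (basisVec i)
      = ‖φ x‖ ^ 2 + 2 * x i * inner ℝ (φ x) (fderiv ℝ φ x (basisVec i)) := by
    intro x
    have e1 : HasFDerivAt (fun x : Vec d => x i) (EuclideanSpace.proj i : Vec d →L[ℝ] ℝ) x :=
      (EuclideanSpace.proj i : Vec d →L[ℝ] ℝ).hasFDerivAt
    have e2 := (hd1 x).hasFDerivAt.norm_sq
    rw [(e1.fun_mul e2).fderiv]
    simp [basisVec]; ring
  have h0 := hT.integral_fderiv (basisVec i)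
  simp only [hder] at h0
  have i1 : Integrable (fun x => ‖φ x‖ ^ 2) G.vol := continuous_integrable G (hφ.norm.pow 2)
  have i2 : Integrable (fun x => 2 * x i * inner ℝ (φ x) (fderiv ℝ φ x (basisVec i))) G.vol :=
    continuous_integrable G ((continuous_const.mul hproj).mul (hφ.inner hD))
  have i3 : Integrable (fun x => ‖grad φ x‖ ^ 2) G.vol :=
    continuous_integrable G (h.continuous_grad.norm.pow 2)
  rw [integral_add i1 i2] at h0
  have h1 : -∫ x, 2 * x i * inner ℝ (φ x) (fderiv ℝ φ x (basisVec i)) ∂G.vol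
      ≤ ∫ x, (1 / 2 * ‖φ x‖ ^ 2 + 2 * R ^ 2 * ‖grad φ x‖ ^ 2) ∂G.vol := by
    rw [← integral_neg]
    refine integral_mono_ae i2.neg ((i1.const_mul _).add (i3.const_mul _)) ?_
    filter_upwards [G.ae_mem_cell] with x hx
    have hx1 : ‖x‖ ≤ R := by simpa using hR hx
    have hx2 : |x i| ≤ R := (PiLp.norm_apply_le x i).trans hx1
    have hx3 := abs_real_inner_le_norm (φ x) (fderiv ℝ φ x (basisVec i))
    have hx4 : ‖fderiv ℝ φ x (basisVec i)‖ ≤ ‖grad φ x‖ := by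
      simpa [norm_basisVec, grad_eq] using norm_apply_le_matL (fderiv ℝ φ x) (basisVec i)
    have hx5 : |x i * inner ℝ (φ x) (fderiv ℝ φ x (basisVec i))| ≤ R * (‖φ x‖ * ‖grad φ x‖) := by
      rw [abs_mul]
      exact mul_le_mul hx2 (hx3.trans (by gcongr)) (abs_nonneg _) ((norm_nonneg x).trans hx1)
    have := (abs_le.1 hx5).1
    nlinarith [sq_nonneg (‖φ x‖ - 2 * (R * ‖grad φ x‖))]
  rw [integral_add (i1.const_mul _) (i3.const_mul _), integral_const_mul, integral_const_mul] at h1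
  linarith

/-- Continuous functions are integrable for finite measures that live on compact sets. -/
lemma integrable_prod_of_continuous {α β F : Type*} [TopologicalSpace α] [TopologicalSpace β]
    [MeasurableSpace α] [MeasurableSpace β] [OpensMeasurableSpace (α × β)] [NormedAddCommGroup F]
    [SecondCountableTopologyEither (α × β) F] [TopologicalSpace.PseudoMetrizableSpace (α × β)]
    {μ : Measure α} {ν : Measure β} [IsFiniteMeasure μ] [IsFiniteMeasure ν] {K : Set α} {L : Set β}
    (hK : IsCompact K) (hL : IsCompact L) (hμ : ∀ᵐ x ∂μ, x ∈ K) (hν : ∀ᵐ y ∂ν, y ∈ L)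
    {f : α × β → F} (hf : Continuous f) : Integrable f (μ.prod ν) := by
  obtain ⟨M, hM⟩ := (hK.prod hL).exists_bound_of_continuousOn hf.continuousOn
  refine Integrable.of_bound hf.aestronglyMeasurable M ?_
  filter_upwards [Measure.quasiMeasurePreserving_fst.ae hμ,
    Measure.quasiMeasurePreserving_snd.ae hν] with z h1 h2 using hM z ⟨h1, h2⟩

lemma Geometry.ae_mem_closure_cell {d : ℕ} (G : Geometry d) : ∀ᵐ x ∂G.vol, x ∈ closure G.cell := by
  filter_upwards [G.ae_mem_cell] with x hx using subset_closure hx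

/-- Mean square oscillation on the torus. -/
lemma IsTest.oscillation_torus (d : ℕ) :
    ∃ C : ℝ, 0 ≤ C ∧ ∀ φ : Vec d → Vec d, IsTest 1 .torus φ →
      ∫ y, ∫ x, ‖φ x - φ y‖ ^ 2 ∂(Geometry.torus (d := d)).vol ∂(Geometry.torus (d := d)).vol
        ≤ C * ∫ x, ‖grad φ x‖ ^ 2 ∂(Geometry.torus (d := d)).vol := by
  set G := Geometry.torus (d := d)
  obtain ⟨R, hR⟩ := G.isBounded_cell.subset_closedBall 0
  refine ⟨G.vol.real univ * R ^ 2, by positivity, fun φ h => ?_⟩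
  have hc : ContDiff ℝ 1 φ := by exact_mod_cast h.1
  have hφ := hc.continuous
  have hD := hc.continuous_fderiv (by norm_num)
  have hg := h.continuous_grad
  have hd1 : Differentiable ℝ φ := hc.differentiable (by norm_num)
  -- By periodicity the shift `w = x - y` may range over the cell. For fixed `w`, the difference `φ
  -- (y + w) - φ y` is an integral of the gradient along a segment of length at most `R`, and the
  -- integral over `y` does not see where on the segment the gradient is evaluated.
  have h1 : ∀ y, ∫ x, ‖φ x - φ y‖ ^ 2 ∂G.vol = ∫ w, ‖φ (y + w) - φ y‖ ^ 2 ∂G.vol := by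
    intro y
    have := setIntegral_unitCell_translate (f := fun x => ‖φ x - φ y‖ ^ 2)
      (fun x i => by simp only [h.compatible x i]) y
    simp only [add_comm _ y] at this
    exact this.symm
  simp only [h1]
  rw [integral_integral_swap (integrable_prod_of_continuous G.isCompact_closure_cell
    G.isCompact_closure_cell G.ae_mem_closure_cell G.ae_mem_closure_cell
    (f := fun z : Vec d × Vec d => ‖φ (z.1 + z.2) - φ z.1‖ ^ 2) (by fun_prop))]
  have h2 : ∀ w ∈ G.cell, ∫ y, ‖φ (y + w) - φ y‖ ^ 2 ∂G.vol
      ≤ R ^ 2 * ∫ x, ‖grad φ x‖ ^ 2 ∂G.vol := by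
    intro w hw
    have hwR : ‖w‖ ≤ R := by simpa using hR hw
    have cont2 : Continuous fun z : Vec d × ℝ => R ^ 2 * ‖grad φ (z.1 + z.2 • w)‖ ^ 2 := by
      exact continuous_const.mul ((hg.comp (by fun_prop)).norm.pow 2)
    have hI : IsFiniteMeasure (volume.restrict (Ioc (0 : ℝ) 1)) := isFiniteMeasure_restrict.2 (by simp)
    have hprod : Integrable (fun z : Vec d × ℝ => R ^ 2 * ‖grad φ (z.1 + z.2 • w)‖ ^ 2)
        (G.vol.prod (volume.restrict (Ioc (0 : ℝ) 1))) :=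
      integrable_prod_of_continuous G.isCompact_closure_cell isCompact_Icc
        G.ae_mem_closure_cell (L := Icc 0 1)
        (by filter_upwards [ae_restrict_mem measurableSet_Ioc] with s hs using ⟨hs.1.le, hs.2⟩) cont2
    have pt : ∀ y, ‖φ (y + w) - φ y‖ ^ 2
        ≤ ∫ s in Ioc (0 : ℝ) 1, R ^ 2 * ‖grad φ (y + s • w)‖ ^ 2 := by
      intro y
      have c1 : Continuous fun s : ℝ => fderiv ℝ φ (y + s • w) w :=
        (hD.comp (by fun_prop)).clm_apply continuous_const
      have c2 : Continuous fun s : ℝ => R * ‖grad φ (y + s • w)‖ :=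
        continuous_const.mul (hg.comp (by fun_prop)).norm
      have ftc : ∫ s in (0 : ℝ)..1, fderiv ℝ φ (y + s • w) w = φ (y + w) - φ y := by
        have := intervalIntegral.integral_eq_sub_of_hasDerivAt (a := 0) (b := 1)
          (f := fun s : ℝ => φ (y + s • w)) (f' := fun s : ℝ => fderiv ℝ φ (y + s • w) w)
          (fun s _ => by
            have e1 : HasDerivAt (fun s : ℝ => y + s • w) w s := by
              simpa using ((hasDerivAt_id s).smul_const w).const_add y
            exact (hd1 _).hasFDerivAt.comp_hasDerivAt s e1)
          (c1.intervalIntegrable _ _)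
        simpa using this
      have b1 : ‖φ (y + w) - φ y‖ ≤ ∫ s in Ioc (0 : ℝ) 1, R * ‖grad φ (y + s • w)‖ := by
        rw [← ftc, ← intervalIntegral.integral_of_le zero_le_one]
        refine intervalIntegral.norm_integral_le_of_norm_le zero_le_one ?_ (c2.intervalIntegrable _ _)
        refine Eventually.of_forall fun s _ => (norm_apply_le_matL _ _).trans ?_
        rw [mul_comm]
        exact mul_le_mul_of_nonneg_right hwR (norm_nonneg _)
      have ic2 : Integrable (fun s : ℝ => R * ‖grad φ (y + s • w)‖) (volume.restrict (Ioc (0 : ℝ) 1)) :=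
        (c2.integrableOn_Icc (a := 0) (b := 1)).mono_set Ioc_subset_Icc_self
      have ic3 : Integrable (fun s : ℝ => (R * ‖grad φ (y + s • w)‖) ^ 2)
          (volume.restrict (Ioc (0 : ℝ) 1)) :=
        ((c2.pow 2).integrableOn_Icc (a := 0) (b := 1)).mono_set Ioc_subset_Icc_self
      -- Jensen's inequality on the unit interval, in the form `∫ (f - a)² ≥ 0`; the choice of `a`
      -- as the mean of `f` follows below.
      have b2 : ∀ a : ℝ, 2 * a * (∫ s in Ioc (0 : ℝ) 1, R * ‖grad φ (y + s • w)‖) - a ^ 2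
          ≤ ∫ s in Ioc (0 : ℝ) 1, (R * ‖grad φ (y + s • w)‖) ^ 2 := by
        intro a
        have : ∫ s in Ioc (0 : ℝ) 1, (2 * a * (R * ‖grad φ (y + s • w)‖) - a ^ 2)
            ≤ ∫ s in Ioc (0 : ℝ) 1, (R * ‖grad φ (y + s • w)‖) ^ 2 :=
          integral_mono ((ic2.const_mul _).sub (integrable_const _)) ic3 fun s => by
            simp only
            nlinarith [sq_nonneg (R * ‖grad φ (y + s • w)‖ - a)]
        rw [integral_sub (ic2.const_mul _) (integrable_const _), integral_const_mul] at this
        simpa using this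
      have b3 := b2 (∫ s in Ioc (0 : ℝ) 1, R * ‖grad φ (y + s • w)‖)
      simp only [mul_pow] at b3
      nlinarith [norm_nonneg (φ (y + w) - φ y)]
    calc ∫ y, ‖φ (y + w) - φ y‖ ^ 2 ∂G.vol
        ≤ ∫ y, (∫ s in Ioc (0 : ℝ) 1, R ^ 2 * ‖grad φ (y + s • w)‖ ^ 2) ∂G.vol :=
          integral_mono (continuous_integrable G (by fun_prop)) hprod.integral_prod_left pt
      _ = ∫ s in Ioc (0 : ℝ) 1, ∫ y, R ^ 2 * ‖grad φ (y + s • w)‖ ^ 2 ∂G.vol :=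
          integral_integral_swap hprod
      _ = ∫ s in Ioc (0 : ℝ) 1, R ^ 2 * ∫ x, ‖grad φ x‖ ^ 2 ∂G.vol := by
          congr 1; funext s
          rw [integral_const_mul]
          congr 1
          refine setIntegral_unitCell_translate (f := fun x => ‖grad φ x‖ ^ 2) (fun x i => ?_) _
          simp only [grad_eq]
          rw [h.compatible.fderiv_compatible x i]
      _ = _ := by simp
  calc ∫ w, ∫ y, ‖φ (y + w) - φ y‖ ^ 2 ∂G.vol ∂G.vol
      ≤ ∫ w, R ^ 2 * ∫ x, ‖grad φ x‖ ^ 2 ∂G.vol ∂G.vol := by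
        refine integral_mono_ae (Integrable.integral_prod_right (integrable_prod_of_continuous
          G.isCompact_closure_cell G.isCompact_closure_cell G.ae_mem_closure_cell
          G.ae_mem_closure_cell (f := fun z : Vec d × Vec d => ‖φ (z.1 + z.2) - φ z.1‖ ^ 2)
          (by fun_prop))) (integrable_const _) ?_
        filter_upwards [G.ae_mem_cell] with w hw using h2 w hw
    _ = _ := by simp; ring

/-- The Poincaré inequality on the torus, with a weight. -/
lemma IsTest.poincare_torus (d : ℕ) {N m : ℝ} (hm : 0 < m) (hN : 0 ≤ N) :
    ∃ C : ℝ, 0 ≤ C ∧ ∀ φ : Vec d → Vec d, IsTest 1 .torus φ → ∀ w : Vec d → ℝ,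
      AEStronglyMeasurable w (Geometry.torus (d := d)).vol →
      (∀ᵐ x ∂(Geometry.torus (d := d)).vol, 0 ≤ w x ∧ w x ≤ N) →
      m ≤ ∫ x, w x ∂(Geometry.torus (d := d)).vol →
      ∫ x, ‖φ x‖ ^ 2 ∂(Geometry.torus (d := d)).vol
        ≤ C * (∫ x, ‖grad φ x‖ ^ 2 ∂(Geometry.torus (d := d)).vol
          + ∫ x, w x * ‖φ x‖ ^ 2 ∂(Geometry.torus (d := d)).vol) := by
  obtain ⟨C, hC, hosc⟩ := IsTest.oscillation_torus d
  set G := Geometry.torus (d := d)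
  set V := G.vol.real univ
  -- Constants have zero gradient, so the weight has to detect them. Integrate `‖φ x‖² ≤ 2‖φ x - φ
  -- y‖² + 2‖φ y‖²` in `x`, multiply by `w y` and integrate in `y`: the left side is at least `m ∫
  -- ‖φ‖²`, the right side at most `2N` times the oscillation plus `2V ∫ w ‖φ‖²`.
  refine ⟨(2 * N * C + 2 * V) / m, by positivity, fun φ h w hw hwN hwm => ?_⟩
  have hc : ContDiff ℝ 1 φ := by exact_mod_cast h.1
  have hφ := hc.continuous
  have i1 : Integrable (fun x => ‖φ x‖ ^ 2) G.vol := continuous_integrable G (hφ.norm.pow 2)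
  have iw : Integrable w G.vol := Integrable.of_bound hw N (by
    filter_upwards [hwN] with x hx
    rw [Real.norm_of_nonneg hx.1]; exact hx.2)
  have bw : ∀ f : Vec d → ℝ, Continuous f → Integrable (fun y => w y * f y) G.vol := by
    intro f hf
    refine (continuous_integrable G hf).bdd_mul hw (c := N) ?_
    filter_upwards [hwN] with x hx
    rw [Real.norm_of_nonneg hx.1]; exact hx.2
  have cosc : Continuous fun z : Vec d × Vec d => ‖φ z.2 - φ z.1‖ ^ 2 := by fun_prop
  have iosc : Integrable (fun z : Vec d × Vec d => ‖φ z.2 - φ z.1‖ ^ 2) (G.vol.prod G.vol) :=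
    integrable_prod_of_continuous G.isCompact_closure_cell G.isCompact_closure_cell
      G.ae_mem_closure_cell G.ae_mem_closure_cell cosc
  have ptw : ∀ y, ∫ x, ‖φ x‖ ^ 2 ∂G.vol
      ≤ 2 * (∫ x, ‖φ x - φ y‖ ^ 2 ∂G.vol) + 2 * V * ‖φ y‖ ^ 2 := by
    intro y
    have i2 : Integrable (fun x => ‖φ x - φ y‖ ^ 2) G.vol := continuous_integrable G (by fun_prop)
    have : ∫ x, ‖φ x‖ ^ 2 ∂G.vol ≤ ∫ x, (2 * ‖φ x - φ y‖ ^ 2 + 2 * ‖φ y‖ ^ 2) ∂G.vol :=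
      integral_mono i1 ((i2.const_mul _).add (integrable_const _)) fun x => by
        have := norm_add_le (φ x - φ y) (φ y)
        rw [sub_add_cancel] at this
        simp only
        nlinarith [norm_nonneg (φ x), norm_nonneg (φ y), norm_nonneg (φ x - φ y),
          sq_nonneg (‖φ x - φ y‖ - ‖φ y‖)]
    rw [integral_add (i2.const_mul _) (integrable_const _), integral_const_mul, integral_const] at this
    simp only [smul_eq_mul] at this
    linarith
  have s1 : m * ∫ x, ‖φ x‖ ^ 2 ∂G.vol ≤ ∫ y, w y * (∫ x, ‖φ x‖ ^ 2 ∂G.vol) ∂G.vol := by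
    rw [integral_mul_const]
    exact mul_le_mul_of_nonneg_right hwm (integral_nonneg fun x => by positivity)
  have io : Integrable (fun y => ∫ x, ‖φ x - φ y‖ ^ 2 ∂G.vol) G.vol := iosc.integral_prod_left
  have iwo : Integrable (fun y => w y * (2 * V * ‖φ y‖ ^ 2)) G.vol := bw _ (by fun_prop)
  have s2 : ∫ y, w y * (∫ x, ‖φ x‖ ^ 2 ∂G.vol) ∂G.vol
      ≤ ∫ y, (2 * N * (∫ x, ‖φ x - φ y‖ ^ 2 ∂G.vol) + w y * (2 * V * ‖φ y‖ ^ 2)) ∂G.vol := by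
    refine integral_mono_ae (iw.mul_const _) ((io.const_mul _).add iwo) ?_
    filter_upwards [hwN] with y hy
    have h1 := mul_le_mul_of_nonneg_left (ptw y) hy.1
    have h2 : 0 ≤ ∫ x, ‖φ x - φ y‖ ^ 2 ∂G.vol := integral_nonneg fun x => by positivity
    nlinarith [mul_le_mul_of_nonneg_right hy.2 h2]
  rw [integral_add (io.const_mul _) iwo, integral_const_mul] at s2
  have s3 : ∫ y, w y * (2 * V * ‖φ y‖ ^ 2) ∂G.vol = 2 * V * ∫ y, w y * ‖φ y‖ ^ 2 ∂G.vol := by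
    rw [← integral_const_mul]; congr 1; funext y; ring
  have s4 := hosc φ h
  have s5 : 0 ≤ ∫ x, ‖grad φ x‖ ^ 2 ∂G.vol := integral_nonneg fun x => by positivity
  have s6 : 0 ≤ ∫ y, w y * ‖φ y‖ ^ 2 ∂G.vol := integral_nonneg_of_ae (by
    filter_upwards [hwN] with y hy
    have := hy.1
    simp only [Pi.zero_apply]; positivity)
  have hV : 0 ≤ V := measureReal_nonneg
  rw [div_mul_eq_mul_div, le_div_iff₀ hm]
  have := mul_le_mul_of_nonneg_left s4 (show 0 ≤ 2 * N by positivity)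
  nlinarith [mul_nonneg (mul_nonneg hN hC) s6, mul_nonneg hV s5]

/-! ### Truncation near the zero set -/

/-- The subspace topology of such a set is discrete, and it is separable as a subspace of the line.
-/
lemma countable_of_isolated {Z : Set ℝ} (h : ∀ s ∈ Z, ∀ᶠ s' in 𝓝[≠] s, s' ∉ Z) : Z.Countable := by
  have : DiscreteTopology Z := by
    rw [discreteTopology_subtype_iff]
    intro s hs
    rw [← Filter.empty_mem_iff_bot, Filter.mem_inf_principal]
    filter_upwards [h s hs] with s' hs' hz using absurd hz hs'
  exact Set.countable_coe_iff.1 (TopologicalSpace.separableSpace_iff_countable.1 inferInstance)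

/-- At almost every zero of a differentiable function, its derivative vanishes. -/
lemma ae_fderiv_eq_zero_of_eq_zero {E F : Type*} [NormedAddCommGroup E] [NormedSpace ℝ E]
    [FiniteDimensional ℝ E] [MeasurableSpace E] [BorelSpace E] [NormedAddCommGroup F]
    [NormedSpace ℝ F] [FiniteDimensional ℝ F] (μ : Measure E) [μ.IsAddHaarMeasure] {U : Set E}
    (hU : IsOpen U) {f : E → F} (hf : DifferentiableOn ℝ f U) :
    ∀ᵐ z ∂μ, z ∈ U → f z = 0 → fderiv ℝ f z = 0 := by
  have : CompleteSpace F := FiniteDimensional.complete ℝ F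
  have key : ∀ w : E, ∀ᵐ z ∂μ, z ∈ {z | z ∈ U → f z = 0 → fderiv ℝ f z w = 0} := by
    intro w
    borelize F
    have hm : MeasurableSet {z | z ∈ U → f z = 0 → fderiv ℝ f z w = 0} := by
      have h1 : MeasurableSet {z | z ∈ U ∧ f z = 0} := by
        obtain ⟨V, hV, hVe⟩ := (continuousOn_iff_isClosed.1 hf.continuousOn) {0} isClosed_singleton
        have : {z | z ∈ U ∧ f z = 0} = V ∩ U := by
          rw [← hVe]; ext z; simp [and_comm]
        rw [this]; exact hV.measurableSet.inter hU.measurableSet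
      have h2 : MeasurableSet {z | fderiv ℝ f z w = 0} :=
        measurable_fderiv_apply_const ℝ f w (measurableSet_singleton 0)
      have : {z | z ∈ U → f z = 0 → fderiv ℝ f z w = 0} = {z | z ∈ U ∧ f z = 0}ᶜ
          ∪ {z | fderiv ℝ f z w = 0} := by
        ext z; simp only [mem_ofPred_eq, mem_union, mem_compl_iff]; tauto
      rw [this]; exact h1.compl.union h2
    -- By Fubini it is enough to look at each line parallel to `w`. There a zero with non-zero
    -- derivative is isolated among such points, so these form a countable set.
    refine ae_mem_of_ae_add_linearMap_mem ((LinearMap.toSpanSingleton ℝ E w)) volume μ hm fun y => ?_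
    have hc : Set.Countable {s : ℝ | ¬ (y + s • w ∈ U → f (y + s • w) = 0
        → fderiv ℝ f (y + s • w) w = 0)} := by
      refine countable_of_isolated fun s hs => ?_
      simp only [mem_ofPred_eq, Classical.not_imp] at hs
      obtain ⟨h1, h2, h3⟩ := hs
      have hd : HasDerivAt (fun s : ℝ => f (y + s • w)) (fderiv ℝ f (y + s • w) w) s := by
        have e1 : HasDerivAt (fun s : ℝ => y + s • w) w s := by
          simpa using ((hasDerivAt_id s).smul_const w).const_add y
        exact ((hf.differentiableAt (hU.mem_nhds h1)).hasFDerivAt).comp_hasDerivAt s e1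
      filter_upwards [hd.eventually_ne (c := 0) h3] with s' hs'
      simp [hs']
    simpa [ae_iff] using hc.measure_zero volume
  have b := Module.finBasis ℝ E
  have hall : ∀ᵐ z ∂μ, ∀ i, z ∈ U → f z = 0 → fderiv ℝ f z (b i) = 0 :=
    ae_all_iff.2 fun i => key (b i)
  filter_upwards [hall] with z hz h1 h2
  apply ContinuousLinearMap.coe_injective
  exact b.ext fun i => by simpa using hz i h1 h2

/-- A sequence of smooth maps that vanish near `0`, with uniformly bounded derivatives, and which
are eventually the identity near each other point. -/
lemma exists_truncation (F : Type*) [NormedAddCommGroup F] [InnerProductSpace ℝ F]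
    [FiniteDimensional ℝ F] : ∃ (η : ℕ → F → F) (M : ℝ), 0 ≤ M ∧ (∀ n (m : ℕ), ContDiff ℝ m (η n)) ∧
      (∀ (n : ℕ) v, ‖v‖ ≤ 1 / ((n : ℝ) + 1) → η n v = 0) ∧ (∀ n v, ‖η n v‖ ≤ ‖v‖) ∧
      (∀ n v, ‖fderiv ℝ (η n) v‖ ≤ M) ∧ (∀ v ≠ 0, ∀ᶠ n in atTop, η n =ᶠ[𝓝 v] id) := by
  -- `θ` is `0` on the unit ball and the identity outside the ball of radius `2`, so its derivative
  -- is bounded.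
  let θ : F → F := fun v => Real.smoothTransition (‖v‖ ^ 2 - 1) • v
  have hθ : ∀ m : ℕ, ContDiff ℝ m θ := fun m =>
    (Real.smoothTransition.contDiff.comp ((contDiff_norm_sq ℝ).sub contDiff_const)).smul contDiff_id
  have hθ0 : ∀ v, ‖v‖ ≤ 1 → θ v = 0 := fun v hv => by
    have : ‖v‖ ^ 2 - 1 ≤ 0 := by nlinarith [norm_nonneg v]
    simp [θ, Real.smoothTransition.zero_of_nonpos this]
  have hθ1 : ∀ v, 2 ≤ ‖v‖ → θ v = v := fun v hv => by
    have : 1 ≤ ‖v‖ ^ 2 - 1 := by nlinarith [norm_nonneg v]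
    simp [θ, Real.smoothTransition.one_of_one_le this]
  have hθle : ∀ v, ‖θ v‖ ≤ ‖v‖ := fun v => by
    simp only [θ, norm_smul, Real.norm_of_nonneg (Real.smoothTransition.nonneg _)]
    exact mul_le_of_le_one_left (norm_nonneg _) (Real.smoothTransition.le_one _)
  have hθid : ∀ v : F, 2 < ‖v‖ → θ =ᶠ[𝓝 v] id := fun v hv => by
    filter_upwards [continuous_norm.continuousAt.eventually (lt_mem_nhds hv)] with w hw
      using hθ1 w hw.le
  have hd : Differentiable ℝ θ := (hθ 1).differentiable (by norm_num)
  obtain ⟨M, hM⟩ := (isCompact_closedBall (0 : F) 2).exists_bound_of_continuousOn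
    ((hθ 1).continuous_fderiv (by norm_num)).continuousOn
  have hM' : ∀ v, ‖fderiv ℝ θ v‖ ≤ max M 1 := fun v => by
    by_cases hv : ‖v‖ ≤ 2
    · exact (hM v (by simpa using hv)).trans (le_max_left _ _)
    · rw [(hθid v (not_le.1 hv)).fderiv_eq]
      rw [fderiv_id]
      exact ContinuousLinearMap.norm_id_le.trans (le_max_right _ _)
  have hn : ∀ n : ℕ, (0 : ℝ) < n + 1 := fun n => by positivity
  -- Rescaling shrinks the region of modification to radius `2 / (n + 1)` and leaves the bound of
  -- the derivative unchanged.
  refine ⟨fun n v => ((n : ℝ) + 1)⁻¹ • θ (((n : ℝ) + 1) • v), max M 1, by positivity, ?_, ?_, ?_, ?_, ?_⟩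
  · intro n m
    exact ((hθ m).comp (contDiff_const_smul _)).const_smul _
  · intro n v hv
    have : ‖((n : ℝ) + 1) • v‖ ≤ 1 := by
      rw [norm_smul, Real.norm_of_nonneg (hn n).le]
      calc ((n : ℝ) + 1) * ‖v‖ ≤ ((n : ℝ) + 1) * (1 / (n + 1)) := by gcongr
        _ = 1 := by field_simp
    simp [hθ0 _ this]
  · intro n v
    simp only [norm_smul, norm_inv, Real.norm_of_nonneg (hn n).le]
    calc ((n : ℝ) + 1)⁻¹ * ‖θ (((n : ℝ) + 1) • v)‖ ≤ ((n : ℝ) + 1)⁻¹ * ‖((n : ℝ) + 1) • v‖ := by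
          gcongr; exact hθle _
      _ = ‖v‖ := by
          rw [norm_smul, Real.norm_of_nonneg (hn n).le]
          field_simp
  · intro n v
    have e1 : HasFDerivAt (fun v : F => ((n : ℝ) + 1) • v)
        (((n : ℝ) + 1) • ContinuousLinearMap.id ℝ F) v := (hasFDerivAt_id v).const_smul _
    have e2 := ((hd (((n : ℝ) + 1) • v)).hasFDerivAt.comp v e1).const_smul ((n : ℝ) + 1)⁻¹
    have e3 : ((n : ℝ) + 1)⁻¹ • (fderiv ℝ θ (((n : ℝ) + 1) • v)).comp
        (((n : ℝ) + 1) • ContinuousLinearMap.id ℝ F) = fderiv ℝ θ (((n : ℝ) + 1) • v) := by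
      ext w
      simp [smul_smul, inv_mul_cancel₀ (hn n).ne']
    have e4 := e2.fderiv
    rw [e3] at e4
    have e5 : fderiv ℝ (fun v => ((n : ℝ) + 1)⁻¹ • θ (((n : ℝ) + 1) • v)) v
      = fderiv ℝ θ (((n : ℝ) + 1) • v) := e4
    rw [e5]
    exact hM' _
  · intro v hv
    have hlim : Tendsto (fun n : ℕ => ((n : ℝ) + 1) * ‖v‖) atTop atTop :=
      (tendsto_natCast_atTop_atTop.atTop_add tendsto_const_nhds).atTop_mul_const (norm_pos_iff.2 hv)
    filter_upwards [hlim.eventually (eventually_gt_atTop 2)] with n hn2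
    have hc : Tendsto (fun w : F => ((n : ℝ) + 1) • w) (𝓝 v) (𝓝 (((n : ℝ) + 1) • v)) :=
      (continuous_const_smul _).continuousAt
    have := hc.eventually (hθid (((n : ℝ) + 1) • v) (by
      rwa [norm_smul, Real.norm_of_nonneg (hn n).le]))
    filter_upwards [this] with w hw
    rw [hw]
    simp [smul_smul, inv_mul_cancel₀ (hn n).ne']

/-! ### Closure of the test fields in `W^{1,2}` -/

/-- Bounded pointwise convergence implies convergence in `L²`. -/
lemma tendsto_eLpNorm_two_of_bounded {α F : Type*} [MeasurableSpace α] [NormedAddCommGroup F]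
    {μ : Measure α} [IsFiniteMeasure μ] {f : ℕ → α → F} {g : α → F} {M : ℝ}
    (hf : ∀ n, AEStronglyMeasurable (f n) μ) (hM : ∀ n, ∀ᵐ x ∂μ, ‖f n x‖ ≤ M)
    (hg : MemLp g 2 μ) (h : ∀ᵐ x ∂μ, Tendsto (fun n => f n x) atTop (𝓝 (g x))) :
    Tendsto (fun n => eLpNorm (f n - g) 2 μ) atTop (𝓝 0) := by
  refine tendsto_Lp_finite_of_tendsto_ae (by norm_num) (by norm_num) hf hg ?_ h
  -- At any truncation level above `M` nothing is left of the functions, so the family is trivially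
  -- uniformly integrable.
  refine unifIntegrable_of (by norm_num) (by norm_num) hf fun ε hε => ⟨‖M‖₊ + 1, fun n => ?_⟩
  have : {x | ‖M‖₊ + 1 ≤ ‖f n x‖₊}.indicator (f n) =ᵐ[μ] 0 := by
    filter_upwards [hM n] with x hx
    refine indicator_of_notMem (fun hx' => ?_) _
    have h1 : ‖M‖ + 1 ≤ ‖f n x‖ := by exact_mod_cast hx'
    have h2 : M ≤ ‖M‖ := Real.le_norm_self M
    linarith
  rw [eLpNorm_congr_ae this]
  simp

lemma integrable_inner_of_memLp {α F : Type*} [MeasurableSpace α] [NormedAddCommGroup F]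
    [InnerProductSpace ℝ F] {μ : Measure α} {f g : α → F} (hf : MemLp f 2 μ) (hg : MemLp g 2 μ) :
    Integrable (fun x => inner ℝ (f x) (g x)) μ := by
  refine (L2.integrable_inner (𝕜 := ℝ) (hf.toLp f) (hg.toLp g)).congr ?_
  filter_upwards [hf.coeFn_toLp, hg.coeFn_toLp] with x h1 h2
  rw [h1, h2]

/-- `L²` convergence passes to the limit in integrals of inner products. -/
lemma tendsto_integral_inner {α F : Type*} [MeasurableSpace α] [NormedAddCommGroup F]
    [InnerProductSpace ℝ F] {μ : Measure α} {f g : ℕ → α → F} {f' g' : α → F}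
    (hf : ∀ n, MemLp (f n) 2 μ) (hf' : MemLp f' 2 μ) (hg : ∀ n, MemLp (g n) 2 μ)
    (hg' : MemLp g' 2 μ) (h1 : Tendsto (fun n => eLpNorm (f n - f') 2 μ) atTop (𝓝 0))
    (h2 : Tendsto (fun n => eLpNorm (g n - g') 2 μ) atTop (𝓝 0)) :
    Tendsto (fun n => ∫ x, inner ℝ (f n x) (g n x) ∂μ) atTop (𝓝 (∫ x, inner ℝ (f' x) (g' x) ∂μ)) := by
  have e : ∀ {p q : α → F} (hp : MemLp p 2 μ) (hq : MemLp q 2 μ),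
      ∫ x, inner ℝ (p x) (q x) ∂μ = inner ℝ (hp.toLp p) (hq.toLp q) := by
    intro p q hp hq
    rw [L2.inner_def]
    refine integral_congr_ae ?_
    filter_upwards [hp.coeFn_toLp, hq.coeFn_toLp] with x h1 h2
    rw [h1, h2]
  simp only [e (hf _) (hg _), e hf' hg']
  exact ((Lp.tendsto_Lp_iff_tendsto_eLpNorm'' f hf f' hf').2 h1).inner
    ((Lp.tendsto_Lp_iff_tendsto_eLpNorm'' g hg g' hg').2 h2)

lemma MemLp.of_tendsto_eLpNorm {α F : Type*} [MeasurableSpace α] [NormedAddCommGroup F]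
    {μ : Measure α} {f : ℕ → α → F} {g : α → F} {p : ℝ≥0∞} (hf : ∀ n, MemLp (f n) p μ)
    (hg : AEStronglyMeasurable g μ) (h : Tendsto (fun n => eLpNorm (f n - g) p μ) atTop (𝓝 0)) :
    MemLp g p μ := by
  obtain ⟨n, hn⟩ := (h.eventually (gt_mem_nhds zero_lt_one)).exists
  have : MemLp (f n - g) p μ := ⟨(hf n).1.sub hg, hn.trans ENNReal.one_lt_top⟩
  simpa using (hf n).sub this

lemma tendsto_eLpNorm_comp {α F F' : Type*} [MeasurableSpace α] [NormedAddCommGroup F]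
    [NormedSpace ℝ F] [NormedAddCommGroup F'] [NormedSpace ℝ F']
    {μ : Measure α} {f : ℕ → α → F} {g : α → F} {p : ℝ≥0∞} (L : F →L[ℝ] F')
    (h : Tendsto (fun n => eLpNorm (f n - g) p μ) atTop (𝓝 0)) :
    Tendsto (fun n => eLpNorm ((fun x => L (f n x)) - fun x => L (g x)) p μ) atTop (𝓝 0) := by
  have h1 : ∀ n, eLpNorm ((fun x => L (f n x)) - fun x => L (g x)) p μ
      ≤ ENNReal.ofReal ‖L‖ * eLpNorm (f n - g) p μ := fun n =>
    eLpNorm_le_mul_eLpNorm_of_ae_le_mul (Eventually.of_forall fun x => by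
      simp only [Pi.sub_apply, ← map_sub]; exact L.le_opNorm _) p
  refine tendsto_of_tendsto_of_tendsto_of_le_of_le tendsto_const_nhds ?_ (fun _ => zero_le) h1
  have := ENNReal.Tendsto.const_mul h (Or.inr (ENNReal.ofReal_ne_top (r := ‖L‖)))
  rwa [mul_zero] at this

/-- `(v, A)` is the limit in `L²` of `(φ, ∇φ)` for test fields `φ` of class `C²`. -/
structure InClosure {d : ℕ} (G : Geometry d) (v : Vec d → Vec d) (A : Vec d → Ten d) : Prop where
  meas : AEStronglyMeasurable v G.vol
  meas_grad : AEStronglyMeasurable A G.vol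
  approx : ∃ φ : ℕ → Vec d → Vec d, (∀ n, IsTest 2 G (φ n)) ∧
    Tendsto (fun n => eLpNorm (φ n - v) 2 G.vol) atTop (𝓝 0) ∧
    Tendsto (fun n => eLpNorm (grad (φ n) - A) 2 G.vol) atTop (𝓝 0)

/-- Class `C²` is all that Korn's identity needs, and the truncated classical velocities used below
are not known to be smoother. -/
lemma IsW12WithGrad.inClosure {d : ℕ} {G : Geometry d} {v : Vec d → Vec d} {A : Vec d → Ten d}
    (h : IsW12WithGrad G v A) : InClosure G v A := by
  obtain ⟨h1, h2, φ, h3, h4, h5⟩ := h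
  exact ⟨h1, h2, φ, fun n => (h3 n).isTest 2, h4, h5⟩

lemma IsTest.memLp {d : ℕ} {F : Type*} [NormedAddCommGroup F] [NormedSpace ℝ F] {n : ℕ}
    {G : Geometry d} {φ : Vec d → F} (h : IsTest n G φ) (p : ℝ≥0∞) : MemLp φ p G.vol :=
  continuous_memLp G h.1.continuous p

lemma IsTest.memLp_grad {d : ℕ} {G : Geometry d} {φ : Vec d → Vec d} (h : IsTest 2 G φ)
    (p : ℝ≥0∞) : MemLp (grad φ) p G.vol :=
  continuous_memLp G (h.of_le one_le_two).continuous_grad p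

lemma InClosure.memLp {d : ℕ} {G : Geometry d} {v : Vec d → Vec d} {A : Vec d → Ten d}
    (h : InClosure G v A) : MemLp v 2 G.vol := by
  obtain ⟨φ, h3, h4, h5⟩ := h.approx
  exact MemLp.of_tendsto_eLpNorm (fun n => (h3 n).memLp 2) h.meas h4

lemma InClosure.memLp_grad {d : ℕ} {G : Geometry d} {v : Vec d → Vec d} {A : Vec d → Ten d}
    (h : InClosure G v A) : MemLp A 2 G.vol := by
  obtain ⟨φ, h3, h4, h5⟩ := h.approx
  exact MemLp.of_tendsto_eLpNorm (fun n => (h3 n).memLp_grad 2) h.meas_grad h5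

lemma grad_sub {d : ℕ} {v w : Vec d → Vec d} {x : Vec d} (hv : DifferentiableAt ℝ v x)
    (hw : DifferentiableAt ℝ w x) : grad (v - w) x = grad v x - grad w x := by
  rw [grad_eq, grad_eq, grad_eq, fderiv_sub hv hw, map_sub]

lemma IsTest.sub {d : ℕ} {F : Type*} [NormedAddCommGroup F] [NormedSpace ℝ F] {n : ℕ}
    {G : Geometry d} {f g : Vec d → F} (hf : IsTest n G f) (hg : IsTest n G g) :
    IsTest n G (f - g) := by
  obtain ⟨K, h1, h2, h3⟩ := hf.support
  obtain ⟨L, g1, g2, g3⟩ := hg.support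
  refine ⟨hf.1.sub hg.1, hf.2.comp₂ hg.2 (fun a b => a - b), K ∪ L, h1.union g1,
    union_subset h2 g2, fun x hx => ?_⟩
  simp only [mem_union, not_or] at hx
  simp [h3 x hx.1, g3 x hx.2]

lemma InClosure.sub {d : ℕ} {G : Geometry d} {v w : Vec d → Vec d} {A B : Vec d → Ten d}
    (h : InClosure G v A) (h' : InClosure G w B) : InClosure G (v - w) (A - B) := by
  obtain ⟨φ, h3, h4, h5⟩ := h.approx
  obtain ⟨ψ, g3, g4, g5⟩ := h'.approx
  have tri : ∀ {F : Type} [NormedAddCommGroup F] (a b : ℕ → Vec d → F) (a' b' : Vec d → F),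
      (∀ n, AEStronglyMeasurable (a n - a') G.vol) → (∀ n, AEStronglyMeasurable (b n - b') G.vol) →
      Tendsto (fun n => eLpNorm (a n - a') 2 G.vol) atTop (𝓝 0) →
      Tendsto (fun n => eLpNorm (b n - b') 2 G.vol) atTop (𝓝 0) →
      Tendsto (fun n => eLpNorm (a n - b n - (a' - b')) 2 G.vol) atTop (𝓝 0) := by
    intro F _ a b a' b' ha hb h1 h2
    refine tendsto_of_tendsto_of_tendsto_of_le_of_le tendsto_const_nhds
      (by simpa using h1.add h2) (fun _ => zero_le) fun n => ?_
    have : a n - b n - (a' - b') = (a n - a') - (b n - b') := by abel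
    simp only [this]
    exact eLpNorm_sub_le (ha n) (hb n) (by norm_num)
  have hd : ∀ {φ : Vec d → Vec d}, IsTest 2 G φ → Differentiable ℝ φ := fun h =>
    h.1.differentiable (by norm_num)
  refine ⟨h.meas.sub h'.meas, h.meas_grad.sub h'.meas_grad, fun n => φ n - ψ n,
    fun n => (h3 n).sub (g3 n), ?_, ?_⟩
  · exact tri φ ψ v w (fun n => ((h3 n).memLp 2).1.sub h.meas)
      (fun n => ((g3 n).memLp 2).1.sub h'.meas) h4 g4
  · have : ∀ n, grad (φ n - ψ n) = grad (φ n) - grad (ψ n) := fun n => by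
      ext1 x; exact grad_sub (hd (h3 n) x) (hd (g3 n) x)
    simp only [this]
    exact tri _ _ A B (fun n => ((h3 n).memLp_grad 2).1.sub h.meas_grad)
      (fun n => ((g3 n).memLp_grad 2).1.sub h'.meas_grad) h5 g5

/-- Both sides are continuous under `L²` convergence of the gradients. -/
lemma InClosure.korn {d : ℕ} (hd : 0 < d) (P : Params d) {G : Geometry d} {v : Vec d → Vec d}
    {A : Vec d → Ten d} (h : InClosure G v A) :
    P.mu * ∫ x, ‖A x‖ ^ 2 ∂G.vol ≤ ∫ x, inner ℝ (P.stress (A x)) (A x) ∂G.vol := by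
  obtain ⟨φ, h3, h4, h5⟩ := h.approx
  have m := fun n => (h3 n).memLp_grad 2
  have hs : ∀ {B : Vec d → Ten d}, MemLp B 2 G.vol → MemLp (fun x => P.stressL (B x)) 2 G.vol :=
    fun hB => P.stressL.comp_memLp' hB
  have l1 := (tendsto_integral_inner m h.memLp_grad m h.memLp_grad h5 h5).const_mul P.mu
  have l2 := tendsto_integral_inner (fun n => hs (m n)) (hs h.memLp_grad) m h.memLp_grad
    (tendsto_eLpNorm_comp P.stressL h5) h5
  simp only [stressL_apply] at l2
  have := le_of_tendsto_of_tendsto' l1 l2 fun n => (h3 n).korn hd P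
  simpa only [real_inner_self_eq_norm_sq] using this

/-- The Poincaré inequality, with a weight whose total mass is bounded below. -/
lemma InClosure.poincare {d : ℕ} (hd : 0 < d) (G : Geometry d) {N m : ℝ} (hm : 0 < m)
    (hN : 0 ≤ N) : ∃ C : ℝ, 0 ≤ C ∧ ∀ v A, InClosure G v A → ∀ w : Vec d → ℝ,
      AEStronglyMeasurable w G.vol → (∀ᵐ x ∂G.vol, 0 ≤ w x ∧ w x ≤ N) → m ≤ ∫ x, w x ∂G.vol →
      ∫ x, ‖v x‖ ^ 2 ∂G.vol ≤ C * (∫ x, ‖A x‖ ^ 2 ∂G.vol + ∫ x, w x * ‖v x‖ ^ 2 ∂G.vol) := by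
  have test : ∃ C : ℝ, 0 ≤ C ∧ ∀ φ : Vec d → Vec d, IsTest 1 G φ → ∀ w : Vec d → ℝ,
      AEStronglyMeasurable w G.vol → (∀ᵐ x ∂G.vol, 0 ≤ w x ∧ w x ≤ N) → m ≤ ∫ x, w x ∂G.vol →
      ∫ x, ‖φ x‖ ^ 2 ∂G.vol
        ≤ C * (∫ x, ‖grad φ x‖ ^ 2 ∂G.vol + ∫ x, w x * ‖φ x‖ ^ 2 ∂G.vol) := by
    cases G with
    | torus => exact IsTest.poincare_torus d hm hN
    | bounded Ω hΩ =>
      obtain ⟨C, hC, h⟩ := IsTest.poincare_bounded hd Ω hΩ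
      refine ⟨C, hC, fun φ hφ w hw hwN hwm => (h φ hφ).trans ?_⟩
      refine mul_le_mul_of_nonneg_left ?_ hC
      refine le_add_of_nonneg_right (integral_nonneg_of_ae ?_)
      filter_upwards [hwN] with x hx
      have := hx.1
      simp only [Pi.zero_apply]; positivity
  obtain ⟨C, hC, test⟩ := test
  refine ⟨C, hC, fun v A h w hw hwN hwm => ?_⟩
  obtain ⟨φ, h3, h4, h5⟩ := h.approx
  have mg := fun n => (h3 n).memLp_grad 2
  have mf := fun n => (h3 n).memLp 2
  have hwn : ∀ᵐ x ∂G.vol, ‖w x‖ ≤ N := by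
    filter_upwards [hwN] with x hx
    rw [Real.norm_of_nonneg hx.1]; exact hx.2
  have mul_w : ∀ {f : Vec d → Vec d}, MemLp f 2 G.vol → MemLp (fun x => w x • f x) 2 G.vol := by
    intro f hf
    refine MemLp.of_le_mul (c := N) hf (hw.smul hf.1) ?_
    filter_upwards [hwn] with x hx
    rw [norm_smul]; exact mul_le_mul_of_nonneg_right hx (norm_nonneg _)
  have l1 := tendsto_integral_inner mg h.memLp_grad mg h.memLp_grad h5 h5
  have l2 := tendsto_integral_inner mf h.memLp mf h.memLp h4 h4
  have l3 := tendsto_integral_inner (fun n => mul_w (mf n)) (mul_w h.memLp) mf h.memLp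
    (by
      have h1 : ∀ n, eLpNorm ((fun x => w x • φ n x) - fun x => w x • v x) 2 G.vol
          ≤ ENNReal.ofReal N * eLpNorm (φ n - v) 2 G.vol := fun n =>
        eLpNorm_le_mul_eLpNorm_of_ae_le_mul (by
          filter_upwards [hwn] with x hx
          simp only [Pi.sub_apply, ← smul_sub, norm_smul]
          exact mul_le_mul_of_nonneg_right hx (norm_nonneg _)) 2
      refine tendsto_of_tendsto_of_tendsto_of_le_of_le tendsto_const_nhds ?_ (fun _ => zero_le) h1
      have := ENNReal.Tendsto.const_mul h4 (Or.inr (ENNReal.ofReal_ne_top (r := N)))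
      rwa [mul_zero] at this) h4
  simp only [real_inner_smul_left, real_inner_self_eq_norm_sq] at l1 l2 l3
  exact le_of_tendsto_of_tendsto' l2 ((l1.add l3).const_mul C) fun n =>
    test (φ n) ((h3 n).of_le one_le_two) w hw hwN hwm

/-- Integration by parts of a matrix field against a test field. -/
lemma IsTest.integral_inner_grad {d : ℕ} {G : Geometry d} {φ : Vec d → Vec d} (h : IsTest 1 G φ)
    {S : Vec d → Ten d} (hS : ContDiffOn ℝ 1 S G.region) (hc : G.Compatible S) :
    ∫ x, (inner ℝ (S x) (grad φ x) + inner ℝ (divT S x) (φ x)) ∂G.vol = 0 := by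
  -- The identity integrates the divergence of the field with components `∑ᵢ S_{ij} φᵢ`, which is
  -- admissible because `φ` vanishes before the regularity of `S` is lost.
  have hT : ∀ i j, IsTest 1 G (fun x => S x (i, j) * φ x i) := fun i j => by
    have h2 : IsTest 1 G (fun x => φ x i) := h.clm (EuclideanSpace.proj i)
    exact h2.bilinear (g := fun x => S x (i, j))
      ((EuclideanSpace.proj (𝕜 := ℝ) (i, j)).contDiff.comp_contDiffOn hS)
      (hc.comp fun A => A (i, j)) (ContinuousLinearMap.mul ℝ ℝ)
  have key : ∀ x ∈ G.cell, inner ℝ (S x) (grad φ x) + inner ℝ (divT S x) (φ x)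
      = ∑ i, ∑ j, fderiv ℝ (fun x => S x (i, j) * φ x i) x (basisVec j) := by
    intro x hx
    have hd1 : DifferentiableAt ℝ φ x := (h.1.differentiable (by norm_num)) x
    have hd2 : DifferentiableAt ℝ S x := (hS.differentiableOn (by norm_num)).differentiableAt
      (G.isOpen_region.mem_nhds (G.cell_subset_region hx))
    have hder : ∀ i j, fderiv ℝ (fun x => S x (i, j) * φ x i) x (basisVec j)
        = S x (i, j) * fderiv ℝ φ x (basisVec j) i + fderiv ℝ S x (basisVec j) (i, j) * φ x i := by
      intro i j
      have e1 : HasFDerivAt (fun x => φ x i)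
          ((EuclideanSpace.proj i : Vec d →L[ℝ] ℝ).comp (fderiv ℝ φ x)) x :=
        (EuclideanSpace.proj i : Vec d →L[ℝ] ℝ).hasFDerivAt.comp x hd1.hasFDerivAt
      have e2 : HasFDerivAt (fun x => S x (i, j))
          ((EuclideanSpace.proj (i, j) : Ten d →L[ℝ] ℝ).comp (fderiv ℝ S x)) x :=
        (EuclideanSpace.proj (i, j) : Ten d →L[ℝ] ℝ).hasFDerivAt.comp x hd2.hasFDerivAt
      rw [(e2.fun_mul e1).fderiv]
      simp; ring
    simp only [hder, Finset.sum_add_distrib]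
    simp only [PiLp.inner_apply, Fintype.sum_prod_type, grad, divT, RCLike.inner_apply,
      conj_trivial, Finset.mul_sum]
    congr 1
    · exact Finset.sum_congr rfl fun i _ => Finset.sum_congr rfl fun j _ => by ring
    · exact Finset.sum_congr rfl fun i _ => Finset.sum_congr rfl fun j _ => by ring
  have hint : ∀ i j, Integrable (fun x => fderiv ℝ (fun x => S x (i, j) * φ x i) x (basisVec j))
      G.vol := fun i j => continuous_integrable G
    (((hT i j).1.continuous_fderiv (by norm_num)).clm_apply continuous_const)
  rw [G.integral_congr key, integral_finsetSum _ fun i _ => integrable_finsetSum _ fun j _ => hint i j]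
  refine Finset.sum_eq_zero fun i _ => ?_
  rw [integral_finsetSum _ fun j _ => hint i j]
  exact Finset.sum_eq_zero fun j _ => (hT i j).integral_fderiv _

/-- Integration by parts of a matrix field against a field in the closure. -/
lemma InClosure.integral_inner_grad {d : ℕ} {G : Geometry d} {v : Vec d → Vec d}
    {A : Vec d → Ten d} (h : InClosure G v A)
    {S : Vec d → Ten d} (hS : ContDiffOn ℝ 1 S G.region) (hc : G.Compatible S)
    (m1 : MemLp S 2 G.vol) (m2 : MemLp (divT S) 2 G.vol) :
    ∫ x, (inner ℝ (S x) (A x) + inner ℝ (divT S x) (v x)) ∂G.vol = 0 := by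
  obtain ⟨φ, h3, h4, h5⟩ := h.approx
  have hzero : ∀ {F : Type} [NormedAddCommGroup F] (f : Vec d → F),
      Tendsto (fun _ : ℕ => eLpNorm (f - f) 2 G.vol) atTop (𝓝 0) := by
    intro F _ f; simp
  have l1 := tendsto_integral_inner (fun _ => m1) m1 (fun n => (h3 n).memLp_grad 2) h.memLp_grad
    (hzero S) h5
  have l2 := tendsto_integral_inner (fun _ => m2) m2 (fun n => (h3 n).memLp 2) h.memLp
    (hzero _) h4
  have ii : ∀ {F : Type} [NormedAddCommGroup F] [InnerProductSpace ℝ F] {f g : Vec d → F},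
      MemLp f 2 G.vol → MemLp g 2 G.vol → Integrable (fun x => inner ℝ (f x) (g x)) G.vol :=
    fun hf hg => integrable_inner_of_memLp hf hg
  have l3 := l1.add l2
  rw [← integral_add (ii m1 h.memLp_grad) (ii m2 h.memLp)] at l3
  refine tendsto_nhds_unique l3 ?_
  have : ∀ n, (∫ x, inner ℝ (S x) (grad (φ n) x) ∂G.vol) + ∫ x, inner ℝ (divT S x) (φ n x) ∂G.vol
      = 0 := fun n => by
    rw [← integral_add (ii m1 ((h3 n).memLp_grad 2)) (ii m2 ((h3 n).memLp 2))]
    exact ((h3 n).of_le one_le_two).integral_inner_grad hS hc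
  simp [this]

lemma isTest_of_contDiffOn {d : ℕ} {F : Type*} [NormedAddCommGroup F] [NormedSpace ℝ F] {n : ℕ}
    {G : Geometry d} {f : Vec d → F} (hf : ContDiffOn ℝ n f G.region) (hc : G.Compatible f)
    {K : Set (Vec d)} (h1 : IsClosed K) (h2 : K ⊆ G.region) (h3 : ∀ x ∉ K, f x = 0) :
    IsTest n G f := by
  refine ⟨contDiff_iff_contDiffAt.2 fun x => ?_, hc, K, h1, h2, h3⟩
  by_cases hx : x ∈ K
  · exact hf.contDiffAt (G.isOpen_region.mem_nhds (h2 hx))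
  · have : f =ᶠ[𝓝 x] fun _ => 0 := by
      filter_upwards [h1.isOpen_compl.mem_nhds hx] with y hy using h3 y hy
    exact contDiffAt_const.congr_of_eventuallyEq this

/-- Fields which vanish on the boundary are limits of test fields. -/
lemma inClosure_of_frontier {d : ℕ} {G : Geometry d} {u : Vec d → Vec d} {M : ℝ}
    (h2 : ContDiffOn ℝ 2 u G.region) (hc : ContinuousOn u (closure G.region))
    (hp : G.Compatible u) (h0 : ∀ x ∈ frontier G.region, u x = 0)
    (hM : ∀ x ∈ G.cell, ‖fderiv ℝ u x‖ ≤ M) : InClosure G u (grad u) := by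
  cases G with
  | torus =>
    have ht : IsTest 2 .torus u :=
      isTest_of_contDiffOn (by exact_mod_cast h2) hp isClosed_univ subset_rfl (by simp)
    refine ⟨(ht.memLp 2).1, (ht.memLp_grad 2).1, fun _ => u, fun _ => ht, ?_, ?_⟩ <;> simp
  | bounded Ω hΩ =>
    set G := Geometry.bounded Ω hΩ
    change ContDiffOn ℝ 2 u Ω at h2
    change ContinuousOn u (closure Ω) at hc
    change ∀ x ∈ frontier Ω, u x = 0 at h0
    obtain ⟨η, C, hC, e1, e2, e3, e4, e5⟩ := exists_truncation (Vec d)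
    have hO : IsOpen Ω := hΩ.isOpen
    obtain ⟨Mu, hMu⟩ := (hΩ.isBounded.isCompact_closure).exists_bound_of_continuousOn hc
    -- `η n` annihilates vectors shorter than `1 / (n + 1)`, so `η n ∘ u` lives on the closed set
    -- where `‖u‖ ≥ 1 / (n + 1)`. This set does not meet the boundary, where `u = 0`.
    let φ : ℕ → Vec d → Vec d := fun n => (closure Ω).indicator fun x => η n (u x)
    have hφ : ∀ n, ∀ x ∈ Ω, φ n =ᶠ[𝓝 x] fun x => η n (u x) := fun n x hx => by
      filter_upwards [hO.mem_nhds hx] with y hy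
      exact indicator_of_mem (subset_closure hy) _
    have hd : ∀ x ∈ Ω, DifferentiableAt ℝ u x := fun x hx =>
      (h2.differentiableOn (by norm_num)).differentiableAt (hO.mem_nhds hx)
    have hηd : ∀ n, Differentiable ℝ (η n) := fun n => (e1 n 1).differentiable (by norm_num)
    have hfd : ∀ n, ∀ x ∈ Ω, fderiv ℝ (φ n) x = (fderiv ℝ (η n) (u x)).comp (fderiv ℝ u x) :=
      fun n x hx => by
        rw [(hφ n x hx).fderiv_eq]
        exact ((hηd n _).hasFDerivAt.comp x (hd x hx).hasFDerivAt).fderiv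
    have ht : ∀ n, IsTest 2 G (φ n) := by
      intro n
      let K : Set (Vec d) := {x ∈ closure Ω | 1 / ((n : ℝ) + 1) ≤ ‖u x‖}
      have hK : IsClosed K := isClosed_closure.isClosed_le continuousOn_const hc.norm
      have hKΩ : K ⊆ Ω := by
        rintro x ⟨hx1, hx2⟩
        by_contra hx
        have : x ∈ frontier Ω := by
          rw [frontier, hO.interior_eq]; exact ⟨hx1, hx⟩
        rw [h0 x this, norm_zero] at hx2
        have : 0 < 1 / ((n : ℝ) + 1) := by positivity
        linarith
      refine isTest_of_contDiffOn (K := K) ?_ trivial hK hKΩ ?_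
      · refine ContDiffOn.congr (f := fun x => η n (u x)) ?_ fun x hx => ?_
        · exact (e1 n 2).comp_contDiffOn (by exact_mod_cast h2)
        · exact indicator_of_mem (subset_closure hx) _
      · intro x hx
        by_cases hxc : x ∈ closure Ω
        · have : ‖u x‖ ≤ 1 / ((n : ℝ) + 1) := by
            by_contra h; exact hx ⟨hxc, (not_le.1 h).le⟩
          simp only [φ, indicator_of_mem hxc]
          exact e2 n _ this
        · exact indicator_of_notMem hxc _
    have mu : AEStronglyMeasurable u G.vol := (hc.mono subset_closure).aestronglyMeasurable hO.measurableSet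
    have mg : AEStronglyMeasurable (grad u) G.vol := by
      have : ContinuousOn (grad u) Ω := (matL d).continuous.comp_continuousOn
        (h2.continuousOn_fderiv_of_isOpen hO (by norm_num))
      exact this.aestronglyMeasurable hO.measurableSet
    have hn1 : ∀ L : Vec d →L[ℝ] Vec d, ‖matL d L‖ ≤ ‖matL d‖ * ‖L‖ := fun L => (matL d).le_opNorm L
    refine ⟨mu, mg, φ, ht, ?_, ?_⟩
    · refine tendsto_eLpNorm_two_of_bounded (M := Mu) (fun n => ((ht n).memLp 2).1) (fun n => ?_)
        (MemLp.of_bound mu Mu ?_) ?_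
      · filter_upwards [G.ae_mem_cell] with x hx
        simp only [φ, indicator_of_mem (subset_closure hx : x ∈ closure Ω)]
        exact (e3 n _).trans (hMu x (subset_closure hx))
      · filter_upwards [G.ae_mem_cell] with x hx using hMu x (subset_closure hx)
      · filter_upwards [G.ae_mem_cell] with x hx
        simp only [φ, indicator_of_mem (subset_closure hx : x ∈ closure Ω)]
        by_cases hz : u x = 0
        · have : ∀ n, η n (u x) = u x := fun n => by
            rw [hz]; exact e2 n 0 (by simp; positivity)
          simp [this]
        · refine tendsto_const_nhds.congr' ?_
          filter_upwards [e5 _ hz] with n hn using hn.eq_of_nhds.symm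
    · refine tendsto_eLpNorm_two_of_bounded (M := ‖matL d‖ * (C * M)) (fun n => ((ht n).memLp_grad 2).1)
        (fun n => ?_) (MemLp.of_bound mg (‖matL d‖ * M) ?_) ?_
      · filter_upwards [G.ae_mem_cell] with x hx
        rw [grad_eq, hfd n x hx]
        refine (hn1 _).trans (mul_le_mul_of_nonneg_left ?_ (matL d).opNorm_nonneg)
        exact (ContinuousLinearMap.opNorm_comp_le _ _).trans
          (mul_le_mul (e4 n _) (hM x hx) (norm_nonneg _) hC)
      · filter_upwards [G.ae_mem_cell] with x hx
        exact (hn1 _).trans (mul_le_mul_of_nonneg_left (hM x hx) (matL d).opNorm_nonneg)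
      -- Where `u ≠ 0` the gradients agree for large `n`; on the zero set of `u` both gradients
      -- vanish almost everywhere.
      · have := ae_restrict_of_ae (s := Ω) (ae_fderiv_eq_zero_of_eq_zero
          (volume : Measure (Vec d)) hO (h2.differentiableOn (by norm_num)))
        filter_upwards [G.ae_mem_cell, this] with x hx hx0
        simp only [grad_eq, hfd _ x hx]
        by_cases hz : u x = 0
        · simp [hx0 hx hz]
        · refine tendsto_const_nhds.congr' ?_
          filter_upwards [e5 _ hz] with n hn
          rw [hn.fderiv_eq, fderiv_id, ContinuousLinearMap.id_comp]

/-! ### Fields of class `C¹` on the closed cylinder -/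

section

variable {d : ℕ} {F F' : Type*} [NormedAddCommGroup F] [NormedSpace ℝ F]
  [NormedAddCommGroup F'] [NormedSpace ℝ F'] {G : Geometry d} {T : ℝ} {φ : ℝ → Vec d → F}

lemma isOpen_cylinder (G : Geometry d) (T : ℝ) : IsOpen (Ioo 0 T ×ˢ G.region) :=
  isOpen_Ioo.prod G.isOpen_region

lemma cylinder_subset (G : Geometry d) (T : ℝ) :
    Ioo 0 T ×ˢ G.region ⊆ Icc 0 T ×ˢ closure G.region :=
  prod_mono Ioo_subset_Icc_self subset_closure

lemma isCompact_cylinder (G : Geometry d) (T : ℝ) : IsCompact (Icc 0 T ×ˢ closure G.cell) :=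
  isCompact_Icc.prod G.isCompact_closure_cell

lemma IsC1.hasFDerivAt (h : IsC1 G T φ) {t : ℝ} {x : Vec d} (ht : t ∈ Ioo 0 T)
    (hx : x ∈ G.region) : HasFDerivAt (fun z : ℝ × Vec d => φ z.1 z.2)
      (fderiv ℝ (fun z : ℝ × Vec d => φ z.1 z.2) (t, x)) (t, x) :=
  ((h.contDiffOn.differentiableOn (by norm_num)).differentiableAt
    ((isOpen_cylinder G T).mem_nhds ⟨ht, hx⟩)).hasFDerivAt

lemma IsC1.hasFDerivAt_space (h : IsC1 G T φ) {t : ℝ} {x : Vec d} (ht : t ∈ Ioo 0 T)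
    (hx : x ∈ G.region) : HasFDerivAt (φ t)
      ((fderiv ℝ (fun z : ℝ × Vec d => φ z.1 z.2) (t, x)).comp
        (ContinuousLinearMap.inr ℝ ℝ (Vec d))) x :=
  (h.hasFDerivAt ht hx).comp x (hasFDerivAt_prodMk_right t x)

lemma IsC1.hasDerivAt_time (h : IsC1 G T φ) {t : ℝ} {x : Vec d} (ht : t ∈ Ioo 0 T)
    (hx : x ∈ G.region) : HasDerivAt (fun s => φ s x)
      (fderiv ℝ (fun z : ℝ × Vec d => φ z.1 z.2) (t, x) (1, 0)) t := by
  have := (h.hasFDerivAt ht hx).comp_hasDerivAt t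
    ((hasDerivAt_id t).prodMk (hasDerivAt_const t x))
  exact this

lemma IsC1.deriv_eq (h : IsC1 G T φ) {t : ℝ} {x : Vec d} (ht : t ∈ Ioo 0 T)
    (hx : x ∈ G.region) : deriv (fun s => φ s x) t
      = fderiv ℝ (fun z : ℝ × Vec d => φ z.1 z.2) (t, x) (1, 0) := (h.hasDerivAt_time ht hx).deriv

lemma IsC1.fderiv_eq (h : IsC1 G T φ) {t : ℝ} {x : Vec d} (ht : t ∈ Ioo 0 T)
    (hx : x ∈ G.region) : fderiv ℝ (φ t) x
      = (fderiv ℝ (fun z : ℝ × Vec d => φ z.1 z.2) (t, x)).comp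
        (ContinuousLinearMap.inr ℝ ℝ (Vec d)) := (h.hasFDerivAt_space ht hx).fderiv

/-- Compactness is available on the closure of the cell, not on that of the region, which is
unbounded for the torus. The derivative is bounded through its continuous extension, hence only at
points of the open cylinder. -/
lemma IsC1.bound (h : IsC1 G T φ) : ∃ M, 0 ≤ M ∧
    (∀ t ∈ Icc 0 T, ∀ x ∈ closure G.cell, ‖φ t x‖ ≤ M) ∧
    (∀ t ∈ Ioo 0 T, ∀ x ∈ closure G.cell, x ∈ G.region →
      ‖fderiv ℝ (fun z : ℝ × Vec d => φ z.1 z.2) (t, x)‖ ≤ M) := by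
  obtain ⟨D, hD, hDe⟩ := h.extends_deriv
  have hsub : Icc 0 T ×ˢ closure G.cell ⊆ Icc 0 T ×ˢ closure G.region :=
    prod_mono subset_rfl G.closure_cell_subset
  obtain ⟨M1, h1⟩ := (isCompact_cylinder G T).exists_bound_of_continuousOn (h.continuousOn.mono hsub)
  obtain ⟨M2, h2⟩ := (isCompact_cylinder G T).exists_bound_of_continuousOn (hD.mono hsub)
  refine ⟨max (max M1 M2) 0, le_max_right _ _, fun t ht x hx => ?_, fun t ht x hx hx' => ?_⟩
  · exact (h1 (t, x) ⟨ht, hx⟩).trans ((le_max_left _ _).trans (le_max_left _ _))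
  · rw [← hDe ⟨ht, hx'⟩]
    exact (h2 (t, x) ⟨Ioo_subset_Icc_self ht, hx⟩).trans ((le_max_right _ _).trans (le_max_left _ _))

/-- The open set `U` allows functions that are singular elsewhere, such as real powers of a positive
density. -/
lemma IsC1.comp (h : IsC1 G T φ) {U : Set F} (hU : IsOpen U) {g : F → F'}
    (hg : ContDiffOn ℝ 1 g U) (hφ : ∀ t ∈ Icc 0 T, ∀ x ∈ closure G.region, φ t x ∈ U) :
    IsC1 G T (fun t x => g (φ t x)) := by
  have hmap : MapsTo (fun z : ℝ × Vec d => φ z.1 z.2) (Icc 0 T ×ˢ closure G.region) U :=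
    fun z hz => hφ z.1 hz.1 z.2 hz.2
  refine ⟨fun t ht => (h.compatible t ht).comp g, hg.continuousOn.comp h.continuousOn hmap,
    hg.comp h.contDiffOn (hmap.mono_left (cylinder_subset G T)), ?_⟩
  obtain ⟨D, hD, hDe⟩ := h.extends_deriv
  refine ⟨fun z => (fderiv ℝ g (φ z.1 z.2)).comp (D z), ?_, fun z hz => ?_⟩
  · exact ((hg.continuousOn_fderiv_of_isOpen hU (by norm_num)).comp h.continuousOn hmap).clm_comp hD
  · have hz' : φ z.1 z.2 ∈ U := hmap (cylinder_subset G T hz)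
    simp only [hDe hz]
    exact (HasFDerivAt.comp (f := fun z : ℝ × Vec d => φ z.1 z.2) z
      (((hg.differentiableOn (by norm_num)).differentiableAt (hU.mem_nhds hz')).hasFDerivAt)
      (h.hasFDerivAt hz.1 hz.2)).fderiv.symm

lemma IsC1.prodMk {ψ : ℝ → Vec d → F'} (h : IsC1 G T φ) (h' : IsC1 G T ψ) :
    IsC1 G T (fun t x => (φ t x, ψ t x)) := by
  refine ⟨fun t ht => (h.compatible t ht).comp₂ (h'.compatible t ht) Prod.mk,
    h.continuousOn.prodMk h'.continuousOn, h.contDiffOn.prodMk h'.contDiffOn, ?_⟩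
  obtain ⟨D, hD, hDe⟩ := h.extends_deriv
  obtain ⟨D', hD', hDe'⟩ := h'.extends_deriv
  refine ⟨fun z => (D z).prod (D' z), ?_, fun z hz => ?_⟩
  · exact (ContinuousLinearMap.prodₗᵢ ℝ : ((ℝ × Vec d →L[ℝ] F) × (ℝ × Vec d →L[ℝ] F')) ≃ₗᵢ[ℝ] _
      ).continuous.comp_continuousOn (hD.prodMk hD')
  · simp only [hDe hz, hDe' hz]
    exact ((h.hasFDerivAt hz.1 hz.2).prodMk (h'.hasFDerivAt hz.1 hz.2)).fderiv.symm

lemma IsC1.congr {ψ : ℝ → Vec d → F} (h : IsC1 G T φ)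
    (he : ∀ t ∈ Icc 0 T, ∀ x ∈ closure G.region, ψ t x = φ t x) : IsC1 G T ψ := by
  have he' : EqOn (fun z : ℝ × Vec d => ψ z.1 z.2) (fun z : ℝ × Vec d => φ z.1 z.2)
      (Icc 0 T ×ˢ closure G.region) := fun z hz => he z.1 hz.1 z.2 hz.2
  have he'' := he'.mono (cylinder_subset G T)
  refine ⟨fun t ht => ?_, h.continuousOn.congr he', h.contDiffOn.congr he'', ?_⟩
  · cases G with
    | torus =>
      intro x i
      have hu : ∀ y, y ∈ closure (Geometry.torus (d := d)).region := fun y => subset_closure trivial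
      rw [he t ht _ (hu _), he t ht _ (hu _)]
      exact h.compatible t ht x i
    | bounded Ω hΩ => trivial
  · obtain ⟨D, hD, hDe⟩ := h.extends_deriv
    refine ⟨D, hD, fun z hz => ?_⟩
    rw [hDe hz]
    exact ((he''.eventuallyEq_of_mem ((isOpen_cylinder G T).mem_nhds hz)).fderiv_eq).symm

lemma prod_measure_eq (G : Geometry d) (T : ℝ) : (timeMeasure T).prod G.vol
    = (volume.prod volume).restrict (Ioo 0 T ×ˢ G.cell) := Measure.prod_restrict _ _

lemma measurableSet_cylinder (G : Geometry d) (T : ℝ) : MeasurableSet (Ioo 0 T ×ˢ G.cell) :=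
  measurableSet_Ioo.prod G.measurableSet_cell

lemma ae_mem_cylinder (G : Geometry d) (T : ℝ) :
    ∀ᵐ z ∂((timeMeasure T).prod G.vol), z.1 ∈ Ioo 0 T ∧ z.2 ∈ G.cell := by
  rw [prod_measure_eq]
  exact ae_restrict_mem (measurableSet_cylinder G T)

lemma aestronglyMeasurable_cylinder {E : Type*} [NormedAddCommGroup E] {f : ℝ × Vec d → E}
    (hf : ContinuousOn f (Ioo 0 T ×ˢ G.region)) :
    AEStronglyMeasurable f ((timeMeasure T).prod G.vol) := by
  rw [prod_measure_eq]
  exact (hf.mono (prod_mono subset_rfl G.cell_subset_region)).aestronglyMeasurable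
    (measurableSet_cylinder G T)

lemma IsC1.aestronglyMeasurable (h : IsC1 G T φ) :
    AEStronglyMeasurable (fun z : ℝ × Vec d => φ z.1 z.2) ((timeMeasure T).prod G.vol) :=
  aestronglyMeasurable_cylinder h.contDiffOn.continuousOn

lemma IsC1.continuousOn_fderiv (h : IsC1 G T φ) :
    ContinuousOn (fderiv ℝ fun z : ℝ × Vec d => φ z.1 z.2) (Ioo 0 T ×ˢ G.region) :=
  h.contDiffOn.continuousOn_fderiv_of_isOpen (isOpen_cylinder G T) (by norm_num)

/-- The time derivative and the spatial derivative are measurable in space-time. -/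
lemma IsC1.aestronglyMeasurable_deriv (h : IsC1 G T φ) :
    AEStronglyMeasurable (fun z : ℝ × Vec d => deriv (fun s => φ s z.2) z.1)
      ((timeMeasure T).prod G.vol) := by
  have : AEStronglyMeasurable (fun z : ℝ × Vec d =>
      (fderiv ℝ fun z : ℝ × Vec d => φ z.1 z.2) z (1, 0)) ((timeMeasure T).prod G.vol) :=
    aestronglyMeasurable_cylinder (h.continuousOn_fderiv.clm_apply continuousOn_const)
  refine this.congr ?_
  filter_upwards [ae_mem_cylinder G T] with z hz
  exact (h.deriv_eq hz.1 (G.cell_subset_region hz.2)).symm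

lemma IsC1.aestronglyMeasurable_fderiv (h : IsC1 G T φ) :
    AEStronglyMeasurable (fun z : ℝ × Vec d => fderiv ℝ (φ z.1) z.2)
      ((timeMeasure T).prod G.vol) := by
  have : AEStronglyMeasurable (fun z : ℝ × Vec d =>
      ((fderiv ℝ fun z : ℝ × Vec d => φ z.1 z.2) z).comp (ContinuousLinearMap.inr ℝ ℝ (Vec d)))
      ((timeMeasure T).prod G.vol) :=
    aestronglyMeasurable_cylinder (h.continuousOn_fderiv.clm_comp continuousOn_const)
  refine this.congr ?_
  filter_upwards [ae_mem_cylinder G T] with z hz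
  exact (h.fderiv_eq hz.1 (G.cell_subset_region hz.2)).symm

lemma IsC1.norm_deriv_le (h : IsC1 G T φ) {t : ℝ} {x : Vec d} (ht : t ∈ Ioo 0 T)
    (hx : x ∈ G.region) : ‖deriv (fun s => φ s x) t‖
      ≤ ‖fderiv ℝ (fun z : ℝ × Vec d => φ z.1 z.2) (t, x)‖ := by
  rw [h.deriv_eq ht hx]
  refine (ContinuousLinearMap.le_opNorm _ _).trans ?_
  simp

lemma IsC1.norm_fderiv_le (h : IsC1 G T φ) {t : ℝ} {x : Vec d} (ht : t ∈ Ioo 0 T)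
    (hx : x ∈ G.region) : ‖fderiv ℝ (φ t) x‖
      ≤ ‖fderiv ℝ (fun z : ℝ × Vec d => φ z.1 z.2) (t, x)‖ := by
  rw [h.fderiv_eq ht hx]
  refine (ContinuousLinearMap.opNorm_comp_le _ _).trans ?_
  exact mul_le_of_le_one_right (norm_nonneg _) (ContinuousLinearMap.norm_inr_le_one ℝ ℝ (Vec d))

lemma ae_timeMeasure_mem (T : ℝ) : ∀ᵐ t ∂(timeMeasure T), t ∈ Ioo 0 T :=
  ae_restrict_mem measurableSet_Ioo

/-- The space integral of a `C¹` field is absolutely continuous in time. -/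
lemma IsC1.integral_deriv [CompleteSpace F] (h : IsC1 G T φ) {τ : ℝ} (hτ : τ ∈ Ioo 0 T) :
    (∫ t in (0)..τ, ∫ x, deriv (fun s => φ s x) t ∂G.vol)
      = (∫ x, φ τ x ∂G.vol) - ∫ x, φ 0 x ∂G.vol := by
  obtain ⟨M, hM0, hM1, hM2⟩ := h.bound
  have hint : Integrable (fun z : ℝ × Vec d => deriv (fun s => φ s z.2) z.1)
      ((timeMeasure T).prod G.vol) := by
    refine Integrable.of_bound h.aestronglyMeasurable_deriv M ?_
    filter_upwards [ae_mem_cylinder G T] with z hz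
    have hz2 := G.cell_subset_region hz.2
    exact (h.norm_deriv_le hz.1 hz2).trans (hM2 _ hz.1 _ (subset_closure hz.2) hz2)
  have hsub : Ioc 0 τ ⊆ Ioo 0 T := fun s hs => ⟨hs.1, hs.2.trans_lt hτ.2⟩
  have hint' : Integrable (fun z : ℝ × Vec d => deriv (fun s => φ s z.2) z.1)
      ((volume.restrict (Ioc 0 τ)).prod G.vol) := hint.mono_measure (by
      rw [prod_measure_eq, Geometry.vol, Measure.prod_restrict]
      exact Measure.restrict_mono (prod_mono hsub subset_rfl) le_rfl)
  have hc : ∀ t ∈ Icc 0 T, Integrable (φ t) G.vol := fun t ht => by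
    have hcont : ContinuousOn (φ t) (closure G.region) :=
      h.continuousOn.comp (f := fun x => (t, x)) (by fun_prop) fun x hx => ⟨ht, hx⟩
    refine Integrable.of_bound ((hcont.mono
      (G.cell_subset_region.trans subset_closure)).aestronglyMeasurable G.measurableSet_cell) M ?_
    filter_upwards [G.ae_mem_cell] with x hx using hM1 t ht x (subset_closure hx)
  rw [intervalIntegral.integral_of_le hτ.1.le, integral_integral_swap hint',
    ← integral_sub (hc τ ⟨hτ.1.le, hτ.2.le⟩) (hc 0 ⟨le_rfl, (hτ.1.trans hτ.2).le⟩)]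
  have hi : ∀ᵐ x ∂G.vol, Integrable (fun t => deriv (fun s => φ s x) t) (volume.restrict (Ioc 0 τ)) :=
    hint'.prod_left_ae
  refine integral_congr_ae ?_
  filter_upwards [G.ae_mem_cell, hi] with x hx hxi
  have hxr := G.cell_subset_region hx
  rw [← intervalIntegral.integral_of_le hτ.1.le]
  -- At time `0` only continuity is known, and this form of the fundamental theorem asks for
  -- differentiability in the open interval alone.
  refine intervalIntegral.integral_eq_sub_of_hasDerivAt_of_le (f := fun t => φ t x)
    (f' := fun t => deriv (fun s => φ s x) t) hτ.1.le ?_ (fun t ht => ?_) ?_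
  · exact h.continuousOn.comp (f := fun t => (t, x)) (by fun_prop)
      fun t ht => ⟨⟨ht.1, ht.2.trans hτ.2.le⟩, subset_closure hxr⟩
  · have ht' : t ∈ Ioo 0 T := ⟨ht.1, ht.2.trans hτ.2⟩
    exact (h.hasDerivAt_time ht' hxr).differentiableAt.hasDerivAt
  · rw [intervalIntegrable_iff_integrableOn_Ioc_of_le hτ.1.le]; exact hxi

end

/-! ### Fields with vanishing tangential trace on a Lipschitz boundary -/

/-- The algebra behind `curl (η F) = η curl F + ∇η × F`. -/
lemma curlL_smulRight {d : ℕ} (hd : d ≤ 3) (w : Vec d) (v : Vec 3) :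
    curlL d ((innerSL ℝ w).smulRight v) = cross (lift3 w) v := by
  interval_cases d <;> ext k <;> fin_cases k <;>
    simp [curlL, partialL, cross, lift3, basisVec, crossProduct, EuclideanSpace.inner_single_right]

/-- Where the graph function is differentiable, the boundary has an outward unit normal. -/
lemma isOutwardNormal_of_graph {d : ℕ} {Ω : Set (Vec d)} {e w p : Vec d} {g : Vec d → ℝ} {r : ℝ}
    (he : ‖e‖ = 1) (hge : ∀ y (s : ℝ), g (y + s • e) = g y) (hr : 0 < r)
    (hΩ : ∀ y ∈ Metric.ball p r, (y ∈ Ω ↔ inner ℝ y e < g y)) (hp : inner ℝ p e = g p)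
    (hd : HasFDerivAt g (innerSL ℝ w) p) :
    1 ≤ ‖e - w‖ ∧ IsOutwardNormal Ω p (‖e - w‖⁻¹ • (e - w)) := by
  have hee : inner ℝ e e = (1 : ℝ) := by rw [real_inner_self_eq_norm_sq, he]; norm_num
  -- `g` is constant along `e`, so its gradient `w` is orthogonal to `e`; therefore `‖e - w‖ ≥ 1`,
  -- and `e - w` can be normalized.
  have hwe : inner ℝ w e = (0 : ℝ) := by
    have h1 : HasDerivAt (fun s : ℝ => p + s • e) e 0 := by
      simpa using ((hasDerivAt_id (0 : ℝ)).smul_const e).const_add p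
    have h2 : HasDerivAt (fun s : ℝ => g (p + s • e)) (innerSL ℝ w e) 0 :=
      HasFDerivAt.comp_hasDerivAt (f := fun s : ℝ => p + s • e) 0 (by simpa using hd) h1
    simp only [hge] at h2
    simpa using h2.unique (hasDerivAt_const 0 (g p))
  have hN : 1 ≤ ‖e - w‖ := by
    have h1 := real_inner_le_norm (e - w) e
    rw [inner_sub_left, hee, hwe, he] at h1
    linarith
  have hN0 : 0 < ‖e - w‖ := by linarith
  refine ⟨hN, ?_, ?_, fun ε hε => ?_⟩
  · have hpΩ : p ∉ Ω := by
      rw [hΩ p (Metric.mem_ball_self hr), hp]; exact lt_irrefl _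
    refine ⟨?_, fun h => hpΩ (interior_subset h)⟩
    have hlim : Tendsto (fun s : ℝ => p + s • e) (𝓝[<] 0) (𝓝 p) := by
      have : Tendsto (fun s : ℝ => p + s • e) (𝓝 0) (𝓝 (p + (0 : ℝ) • e)) :=
        (by fun_prop : Continuous fun s : ℝ => p + s • e).tendsto 0
      rw [zero_smul, add_zero] at this
      exact this.mono_left nhdsWithin_le_nhds
    refine mem_closure_of_tendsto hlim ?_
    filter_upwards [hlim.eventually (Metric.ball_mem_nhds p hr), self_mem_nhdsWithin] with s h1 h2
    rw [hΩ _ h1, hge, inner_add_left, real_inner_smul_left, hee, hp]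
    have : s < 0 := h2
    linarith
  · rw [norm_smul, norm_inv, norm_norm, inv_mul_cancel₀ hN0.ne']
  · have ho := hd.isLittleO.def (half_pos hε)
    obtain ⟨δ, hδ, hδ'⟩ := Metric.eventually_nhds_iff.1 ho
    refine ⟨min δ r, lt_min hδ hr, fun y hy => ?_⟩
    have hy1 : dist y p < δ := (Metric.mem_ball.1 hy).trans_le (min_le_left _ _)
    have hy2 : y ∈ Metric.ball p r := Metric.ball_subset_ball (min_le_right _ _) hy
    have h1 := abs_le.1 ((Real.norm_eq_abs _).symm.trans_le (hδ' hy1))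
    have h3 : innerSL ℝ w (y - p) = inner ℝ (y - p) w := by
      rw [innerSL_apply_apply, real_inner_comm]
    have h4 : inner ℝ (y - p) (‖e - w‖⁻¹ • (e - w))
        = ‖e - w‖⁻¹ * (inner ℝ y e - g p - inner ℝ (y - p) w) := by
      rw [real_inner_smul_right, inner_sub_right, inner_sub_left y p e, hp]
    rw [h3] at h1
    have h5 : 0 ≤ ε * ‖y - p‖ := by positivity
    rw [h4, hΩ y hy2, ← div_eq_inv_mul]
    have h6 : 0 ≤ ε * ‖y - p‖ * (‖e - w‖ - 1) := mul_nonneg h5 (by linarith)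
    constructor
    · intro h
      rw [div_lt_iff₀ hN0] at h
      nlinarith [h1.1]
    · intro h
      rw [lt_div_iff₀ hN0] at h
      nlinarith [h1.2]

/-- The measure of a thin strip along a graph. -/
lemma measure_strip_le {d : ℕ} {e : Vec d} {g : Vec d → ℝ} (he : ‖e‖ = 1) (hg : Continuous g)
    (hge : ∀ y (s : ℝ), g (y + s • e) = g y) (x₀ : Vec d) (r : ℝ) :
    ∃ V : ℝ, 0 ≤ V ∧ ∀ δ : ℝ, 0 < δ → δ ≤ 1 →
      (volume : Measure (Vec d)).real {y ∈ Metric.closedBall x₀ r |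
        δ ≤ g y - inner ℝ y e ∧ g y - inner ℝ y e < 2 * δ} ≤ V * δ := by
  have hee : inner ℝ e e = (1 : ℝ) := by rw [real_inner_self_eq_norm_sq, he]; norm_num
  refine ⟨(volume : Measure (Vec d)).real (Metric.closedBall x₀ (r + 2)), measureReal_nonneg,
    fun δ hδ hδ1 => ?_⟩
  set S : Set (Vec d) := {y ∈ Metric.closedBall x₀ r |
    δ ≤ g y - inner ℝ y e ∧ g y - inner ℝ y e < 2 * δ} with hS
  have hcont : Continuous fun y : Vec d => g y - inner ℝ y e := by fun_prop
  have hSm : MeasurableSet S := by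
    refine Metric.isClosed_closedBall.measurableSet.inter
      ((measurableSet_le measurable_const hcont.measurable).inter
        (measurableSet_lt hcont.measurable measurable_const))
  -- The vertical translates of the strip by `0, δ, …, (N - 1)δ` are disjoint, as they occupy
  -- different ranges of depth. They stay in the ball of radius `r + 2` because `Nδ ≤ 1 + δ ≤ 2`, so
  -- at least `δ⁻¹` copies of the strip fit into a fixed volume.
  let N : ℕ := ⌈δ⁻¹⌉₊
  let A : ℕ → Set (Vec d) := fun k => (fun y => y + ((k : ℝ) * δ) • e) ⁻¹' S
  have hAm : ∀ k, MeasurableSet (A k) := fun k => hSm.preimage (by fun_prop)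
  have hAv : ∀ k, (volume : Measure (Vec d)).real (A k) = (volume : Measure (Vec d)).real S :=
    fun k => by simp only [Measure.real, A, measure_preimage_add_right]
  have hval : ∀ k y, y ∈ A k → (((k : ℝ) + 1) * δ ≤ g y - inner ℝ y e ∧
      g y - inner ℝ y e < ((k : ℝ) + 2) * δ) := by
    intro k y hy
    have h : δ ≤ g (y + ((k : ℝ) * δ) • e) - inner ℝ (y + ((k : ℝ) * δ) • e) e ∧
      g (y + ((k : ℝ) * δ) • e) - inner ℝ (y + ((k : ℝ) * δ) • e) e < 2 * δ := hy.2
    rw [hge, inner_add_left, real_inner_smul_left, hee] at h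
    constructor <;> nlinarith [h.1, h.2]
  have hdisj : PairwiseDisjoint (Finset.range N : Set ℕ) A := by
    intro i _ j _ hij
    refine Set.disjoint_left.2 fun y hi hj => ?_
    have h1 := hval i y hi
    have h2 := hval j y hj
    rcases lt_or_gt_of_ne hij with h | h
    · have : (i : ℝ) + 1 ≤ j := by exact_mod_cast h
      nlinarith
    · have : (j : ℝ) + 1 ≤ i := by exact_mod_cast h
      nlinarith
  have hsub : (⋃ k ∈ Finset.range N, A k) ⊆ Metric.closedBall x₀ (r + 2) := by
    refine iUnion₂_subset fun k hk y hy => ?_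
    have h1 : ‖y + ((k : ℝ) * δ) • e - x₀‖ ≤ r := by
      simpa [dist_eq_norm] using (show _ ∈ S from hy).1
    have h2 : (k : ℝ) * δ ≤ 2 := by
      have h3 : (k : ℝ) ≤ N := by exact_mod_cast (Finset.mem_range.1 hk).le
      have h4 : (N : ℝ) < δ⁻¹ + 1 := Nat.ceil_lt_add_one (by positivity)
      have h5 : δ⁻¹ * δ = 1 := inv_mul_cancel₀ hδ.ne'
      nlinarith
    rw [Metric.mem_closedBall, dist_eq_norm]
    have h6 : y - x₀ = (y + ((k : ℝ) * δ) • e - x₀) - ((k : ℝ) * δ) • e := by abel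
    rw [h6]
    refine (norm_sub_le _ _).trans (add_le_add h1 ?_)
    rw [norm_smul, he, mul_one, Real.norm_of_nonneg (by positivity)]
    exact h2
  have hfin : (volume : Measure (Vec d)) (Metric.closedBall x₀ (r + 2)) ≠ ⊤ :=
    (measure_closedBall_lt_top).ne
  have hsum := measureReal_biUnion_finset (μ := (volume : Measure (Vec d))) hdisj (fun k _ => hAm k)
    (fun k hk => ((measure_mono ((subset_biUnion_of_mem (u := A) hk).trans hsub)).trans_lt
      (measure_closedBall_lt_top)).ne)
  have hle := measureReal_mono hsub hfin
  rw [hsum] at hle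
  simp only [hAv, Finset.sum_const, Finset.card_range, nsmul_eq_mul] at hle
  have h1 : δ⁻¹ ≤ N := Nat.le_ceil _
  have h2 : δ⁻¹ * (volume : Measure (Vec d)).real S
      ≤ (volume : Measure (Vec d)).real (Metric.closedBall x₀ (r + 2)) :=
    (mul_le_mul_of_nonneg_right h1 measureReal_nonneg).trans hle
  calc (volume : Measure (Vec d)).real S = (δ⁻¹ * (volume : Measure (Vec d)).real S) * δ := by
        field_simp
    _ ≤ _ := mul_le_mul_of_nonneg_right h2 hδ.le

/-- Integration by parts against a Lipschitz function. -/
lemma integral_curlL_smulRight {d : ℕ} {χ : Vec d → ℝ} {L : ℝ≥0} (hχ : LipschitzWith L χ)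
    {H : Vec d → Vec 3} (hH : ContDiff ℝ 1 H) (hs : HasCompactSupport H) :
    ∫ y, curlL d ((fderiv ℝ χ y).smulRight (H y)) = - ∫ y, χ y • curl H y := by
  have hHd : Differentiable ℝ H := hH.differentiable (by norm_num)
  have hs' : HasCompactSupport (fderiv ℝ H) := hs.fderiv (𝕜 := ℝ)
  have hcH : ∀ (v : Vec d) (k : Fin 3), Integrable (fun y => χ y * fderiv ℝ H y v k) := fun v k => by
    refine Continuous.integrable_of_hasCompactSupport ?_ ?_
    · exact hχ.continuous.mul ((EuclideanSpace.proj (𝕜 := ℝ) k).continuous.comp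
        ((hH.continuous_fderiv (by norm_num)).clm_apply continuous_const))
    · exact (hs'.comp_left (g := fun A : Vec d →L[ℝ] Vec 3 => A v k) (by simp)).mul_left
  have hmeasχ : ∀ v : Vec d, AEStronglyMeasurable (fun y => fderiv ℝ χ y v) :=
    fun v => (measurable_fderiv_apply_const ℝ χ v).aestronglyMeasurable
  have hcχ : ∀ (v : Vec d) (k : Fin 3), Integrable (fun y => fderiv ℝ χ y v * H y k) := fun v k => by
    have hHk : Integrable (fun y => H y k) := Continuous.integrable_of_hasCompactSupport
      ((EuclideanSpace.proj (𝕜 := ℝ) k).continuous.comp hH.continuous)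
      (hs.comp_left (g := fun a : Vec 3 => a k) (by simp))
    refine hHk.bdd_mul (hmeasχ v) (c := L * ‖v‖) (Eventually.of_forall fun y => ?_)
    exact ((fderiv ℝ χ y).le_opNorm v).trans (mul_le_mul_of_nonneg_right
      (norm_fderiv_le_of_lipschitz ℝ hχ) (norm_nonneg _))
  have ibp : ∀ (v : Vec d) (k : Fin 3), ∫ y, fderiv ℝ χ y v * H y k
      = - ∫ y, χ y * fderiv ℝ H y v k := by
    intro v k
    have hk1 : ContDiff ℝ 1 (fun y => H y k) := (EuclideanSpace.proj (𝕜 := ℝ) k).contDiff.comp hH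
    have hk2 : HasCompactSupport (fun y => H y k) := hs.comp_left (g := fun a : Vec 3 => a k) (by simp)
    obtain ⟨C, hC⟩ := ContDiff.lipschitzWith_of_hasCompactSupport hk2 hk1 (by norm_num)
    -- As `χ` is merely Lipschitz, integration by parts is done with line derivatives; these agree
    -- with `fderiv` almost everywhere by Rademacher's theorem.
    have h1 := hχ.integral_lineDeriv_mul_eq (μ := volume) hC hk2 v
    have h2 : ∫ y, fderiv ℝ χ y v * H y k = ∫ y, lineDeriv ℝ χ y v * H y k := by
      refine integral_congr_ae ?_
      filter_upwards [hχ.ae_differentiableAt_of_real] with y hy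
      rw [hy.lineDeriv_eq_fderiv]
    have h3 : ∀ y, lineDeriv ℝ (fun y => H y k) y (-v) = - fderiv ℝ H y v k := fun y => by
      have e1 : HasFDerivAt (fun y => H y k)
          ((EuclideanSpace.proj k : Vec 3 →L[ℝ] ℝ).comp (fderiv ℝ H y)) y :=
        (EuclideanSpace.proj k : Vec 3 →L[ℝ] ℝ).hasFDerivAt.comp y (hHd y).hasFDerivAt
      rw [e1.differentiableAt.lineDeriv_eq_fderiv, e1.fderiv]
      simp
    rw [h2, h1, ← integral_neg]
    congr 1; funext y
    rw [h3]; ring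
  have hA : ∀ (a : Vec d) (w : Vec 3) (A : Vec d →L[ℝ] ℝ) (k : ℕ) (i : Fin 3),
      partialL d k (A.smulRight w) i = if h : k < d then A (basisVec ⟨k, h⟩) * w i else 0 := by
    intro a w A k i
    unfold partialL; split_ifs <;> simp
  have hB : ∀ (A : Vec d →L[ℝ] Vec 3) (k : ℕ) (i : Fin 3),
      partialL d k A i = if h : k < d then A (basisVec ⟨k, h⟩) i else 0 := by
    intro A k i
    unfold partialL; split_ifs <;> simp
  have hP : ∀ (k : ℕ) (i : Fin 3), Integrable (fun y => partialL d k ((fderiv ℝ χ y).smulRight (H y)) i)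
      ∧ Integrable (fun y => χ y * partialL d k (fderiv ℝ H y) i) ∧
      ∫ y, partialL d k ((fderiv ℝ χ y).smulRight (H y)) i
        = - ∫ y, χ y * partialL d k (fderiv ℝ H y) i := by
    intro k i
    simp only [hA 0, hB]
    by_cases h : k < d
    · simp only [h, dif_pos]; exact ⟨hcχ _ _, hcH _ _, ibp _ _⟩
    · simp [h]
  have hcomp : ∀ (A : Vec d →L[ℝ] Vec 3), curlL d A
      = !₂[partialL d 1 A 2 - partialL d 2 A 1, partialL d 2 A 0 - partialL d 0 A 2,
        partialL d 0 A 1 - partialL d 1 A 0] := fun A => rfl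
  have hvec : ∀ f g : Vec d → Vec 3, (∀ i, Integrable (fun y => f y i)) →
      (∀ i, Integrable (fun y => g y i)) → (∀ i, ∫ y, f y i = - ∫ y, g y i) →
      ∫ y, f y = - ∫ y, g y := by
    intro f g hf hg h
    ext i
    have hf' : Integrable f := integrable_piLp_iff.2 hf
    have hg' : Integrable g := integrable_piLp_iff.2 hg
    have e1 := (EuclideanSpace.proj i : Vec 3 →L[ℝ] ℝ).integral_comp_comm hf'
    have e2 := (EuclideanSpace.proj i : Vec 3 →L[ℝ] ℝ).integral_comp_comm hg'
    simp only [PiLp.proj_apply] at e1 e2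
    rw [PiLp.neg_apply, ← e1, ← e2]
    exact h i
  simp only [curl_eq]
  refine hvec _ _ (fun i => ?_) (fun i => ?_) (fun i => ?_)
  · fin_cases i <;> simp only [hcomp] <;> simp <;> exact (hP _ _).1.sub (hP _ _).1
  · fin_cases i <;> simp only [hcomp] <;> simp [mul_sub] <;> exact (hP _ _).2.1.sub (hP _ _).2.1
  · fin_cases i <;> simp only [hcomp] <;> simp [mul_sub] <;>
      rw [integral_sub (hP _ _).1 (hP _ _).1, integral_sub (hP _ _).2.1 (hP _ _).2.1,
        (hP _ _).2.2, (hP _ _).2.2] <;> ring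

lemma smoothTransition_lipschitz : ∃ C : ℝ≥0, LipschitzWith C Real.smoothTransition ∧
    (∀ s, |deriv Real.smoothTransition s| ≤ C) ∧
    ∀ s, deriv Real.smoothTransition s ≠ 0 → 0 < s ∧ s < 1 := by
  have hd : Differentiable ℝ Real.smoothTransition :=
    (Real.smoothTransition.contDiff (n := 1)).differentiable (by norm_num)
  -- Outside `(0, 1)` the function attains its minimum `0` or its maximum `1`.
  have hz : ∀ s, deriv Real.smoothTransition s ≠ 0 → 0 < s ∧ s < 1 := by
    intro s hs
    by_contra hcon
    rw [not_and_or, not_lt, not_lt] at hcon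
    rcases hcon with h | h
    · refine hs (IsLocalMin.deriv_eq_zero (Eventually.of_forall fun y => ?_))
      rw [Real.smoothTransition.zero_of_nonpos h]
      exact Real.smoothTransition.nonneg y
    · refine hs (IsLocalMax.deriv_eq_zero (Eventually.of_forall fun y => ?_))
      rw [Real.smoothTransition.one_of_one_le h]
      exact Real.smoothTransition.le_one y
  have hc : Continuous (deriv Real.smoothTransition) :=
    (Real.smoothTransition.contDiff (n := 1)).continuous_deriv (by norm_num)
  obtain ⟨M, hM⟩ := (isCompact_Icc (a := (0 : ℝ)) (b := 1)).exists_bound_of_continuousOn hc.continuousOn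
  have hb : ∀ s, |deriv Real.smoothTransition s| ≤ M.toNNReal := fun s => by
    by_cases h : deriv Real.smoothTransition s = 0
    · rw [h, abs_zero]; exact NNReal.coe_nonneg _
    · exact (hM s ⟨(hz s h).1.le, (hz s h).2.le⟩).trans (Real.le_coe_toNNReal M)
  refine ⟨M.toNNReal, lipschitzWith_of_nnnorm_deriv_le hd fun s => ?_, hb, hz⟩
  rw [← NNReal.coe_le_coe]; exact hb s

lemma cross_swap (v w : Vec 3) : cross v w = - cross w v := by
  ext k; simp only [cross, crossProduct]; fin_cases k <;> simp <;> ring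

lemma curl_smul {d : ℕ} {η : Vec d → ℝ} {F : Vec d → Vec 3} {y : Vec d}
    (h1 : DifferentiableAt ℝ η y) (h2 : DifferentiableAt ℝ F y) :
    curl (fun y => η y • F y) y = η y • curl F y + curlL d ((fderiv ℝ η y).smulRight (F y)) := by
  rw [curl_eq, curl_eq, fderiv_fun_smul h1 h2, map_add, map_smul]

lemma curl_congr {d : ℕ} {F F' : Vec d → Vec 3} {y : Vec d} (h : F =ᶠ[𝓝 y] F') :
    curl F y = curl F' y := by rw [curl_eq, curl_eq, h.fderiv_eq]

lemma curl_zero {d : ℕ} (y : Vec d) : curl (fun _ : Vec d => (0 : Vec 3)) y = 0 := by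
  rw [curl_eq]; simp

/-- A chart of a Lipschitz domain: in the ball, `Ω` is the region below a Lipschitz graph. -/
structure IsGraphChart {d : ℕ} (Ω : Set (Vec d)) (x₀ e : Vec d) (L : ℝ≥0) (g : Vec d → ℝ)
    (r : ℝ) : Prop where
  norm_e : ‖e‖ = 1
  lipschitz : LipschitzWith L g
  invariant : ∀ y (s : ℝ), g (y + s • e) = g y
  pos : 0 < r
  mem_iff : ∀ y ∈ Metric.ball x₀ r, (y ∈ Ω ↔ inner ℝ y e < g y)

/-- A field on `Ω` with zero tangential trace and bounded curl. -/
structure IsTangentialZero {d : ℕ} (Ω : Set (Vec d)) (F : Vec d → Vec 3) (M : ℝ) : Prop where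
  contDiffOn : ContDiffOn ℝ 1 F Ω
  continuousOn : ContinuousOn F (closure Ω)
  cross_eq : ∀ x n, IsOutwardNormal Ω x n → cross (F x) (lift3 n) = 0
  curl_le : ∀ x ∈ Ω, ‖curl F x‖ ≤ M

/-- The cutoff along a graph is almost orthogonal to the field. -/
lemma norm_cutoff_le {d : ℕ} (hd : d ≤ 3) {Ω : Set (Vec d)} {x₀ e : Vec d} {L : ℝ≥0}
    {g : Vec d → ℝ} {r : ℝ} (hch : IsGraphChart Ω x₀ e L g r) {F : Vec d → Vec 3} {M : ℝ}
    (hF : IsTangentialZero Ω F M) {ε δ : ℝ}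
    (hu : ∀ y ∈ closure Ω, ∀ p ∈ closure Ω, dist y p < 2 * δ → ‖F y - F p‖ ≤ ε)
    {r₁ : ℝ} (hr₁ : r₁ + 2 * δ < r) {y : Vec d} (hy : y ∈ Metric.ball x₀ r₁)
    (hy1 : 0 < g y - inner ℝ y e) (hy2 : g y - inner ℝ y e < 2 * δ) {w : Vec d}
    (hw : HasFDerivAt g (innerSL ℝ w) y) :
    ‖cross (lift3 (w - e)) (F y)‖ ≤ (L + 1) * ε := by
  have hee : inner ℝ e e = (1 : ℝ) := by
    rw [real_inner_self_eq_norm_sq, hch.norm_e]; norm_num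
  set s := g y - inner ℝ y e
  -- `p` is the point of the graph vertically above `y`. Since `g` does not change along `e`, it is
  -- differentiable at `p` with the same gradient; so the boundary has a normal at `p`, parallel to
  -- `e - w`, and `F p` is parallel to it. What remains is the oscillation of `F` between `y` and
  -- `p`, times `‖w - e‖ ≤ L + 1`.
  set p := y + s • e
  have hyp : dist y p = s := by
    rw [dist_eq_norm]
    have : y - p = -(s • e) := by simp [p]
    rw [this, norm_neg, norm_smul, hch.norm_e, mul_one, Real.norm_of_nonneg hy1.le]
  have hpball : p ∈ Metric.ball x₀ r := by
    rw [Metric.mem_ball] at hy ⊢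
    have := dist_triangle_left p x₀ y
    linarith [dist_comm y x₀]
  have hyball : y ∈ Metric.ball x₀ r := by
    rw [Metric.mem_ball] at hy ⊢; linarith
  have hyΩ : y ∈ Ω := (hch.mem_iff y hyball).2 (by linarith)
  have hpe : inner ℝ p e = g p := by
    simp only [p, hch.invariant, inner_add_left, real_inner_smul_left, hee]
    simp [s]
  have hwp : HasFDerivAt g (innerSL ℝ w) p := by
    have h1 : (fun z => g (z + (-s) • e)) = g := funext fun z => hch.invariant z _
    have h2 : p + (-s) • e = y := by simp [p]
    rw [← h1]
    have h3 : HasFDerivAt g (innerSL ℝ w) (p + (-s) • e) := by rw [h2]; exact hw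
    exact (hasFDerivAt_comp_add_right _).2 h3
  obtain ⟨ρ, hρ, hρ'⟩ := Metric.isOpen_iff.1 Metric.isOpen_ball p hpball
  obtain ⟨hN, hn⟩ := isOutwardNormal_of_graph hch.norm_e hch.invariant hρ
    (fun z hz => hch.mem_iff z (hρ' hz)) hpe hwp
  have hpΩ : p ∈ closure Ω := frontier_subset_closure hn.1
  have h0 : cross (lift3 (w - e)) (F p) = 0 := by
    have h1 := hF.cross_eq p _ hn
    rw [cross_swap, neg_eq_zero] at h1
    have h2 : w - e = (-‖e - w‖) • (‖e - w‖⁻¹ • (e - w)) := by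
      rw [smul_smul, neg_mul, mul_inv_cancel₀ (by linarith), neg_one_smul, neg_sub]
    rw [h2, ← liftL_apply, map_smul, ← crossL_apply, map_smul, ContinuousLinearMap.smul_apply,
      crossL_apply, liftL_apply, h1, smul_zero]
  have h1 : cross (lift3 (w - e)) (F y) = cross (lift3 (w - e)) (F y - F p) := by
    have : crossL (lift3 (w - e)) (F y - F p) = crossL (lift3 (w - e)) (F y)
      - crossL (lift3 (w - e)) (F p) := map_sub _ _ _
    simp only [crossL_apply] at this
    rw [this, h0, sub_zero]
  have hwL : ‖w‖ ≤ L := by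
    have := norm_fderiv_le_of_lipschitz ℝ hch.lipschitz (x₀ := y)
    rwa [hw.fderiv, innerSL_apply_norm] at this
  rw [h1]
  refine (norm_cross_le _ _).trans (mul_le_mul ?_ (hu y (subset_closure hyΩ) p hpΩ (by
    rw [hyp]; exact hy2)) (norm_nonneg _) (by positivity))
  rw [norm_lift3 hd]
  exact (norm_sub_le _ _).trans (by rw [hch.norm_e]; gcongr)

/-- The curl of a localized field with vanishing tangential trace has integral zero. -/
lemma integral_curl_smul_eq_zero {d : ℕ} (hd : d ≤ 3) {Ω : Set (Vec d)}
    (hΩ : IsBoundedLipschitz Ω) {x₀ e : Vec d} {L : ℝ≥0} {g : Vec d → ℝ} {r : ℝ}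
    (hch : IsGraphChart Ω x₀ e L g r) {F : Vec d → Vec 3} {M : ℝ} (hF : IsTangentialZero Ω F M)
    {η : Vec d → ℝ} (hη : ContDiff ℝ 1 η) (hs : tsupport η ⊆ Metric.ball x₀ r) :
    ∫ x in Ω, curl (fun y => η y • F y) x = 0 := by
  set G := Geometry.bounded Ω hΩ
  have hO : IsOpen Ω := hΩ.isOpen
  have hηd : Differentiable ℝ η := hη.differentiable (by norm_num)
  have hFd : ∀ y ∈ Ω, DifferentiableAt ℝ F y := fun y hy =>
    (hF.contDiffOn.differentiableOn (by norm_num)).differentiableAt (hO.mem_nhds hy)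
  have hcs : HasCompactSupport η :=
    Metric.isCompact_of_isClosed_isBounded (isClosed_tsupport η) (Metric.isBounded_ball.subset hs)
  obtain ⟨r₁, hr₁, hs₁⟩ := exists_lt_subset_ball (isClosed_tsupport η) hs
  obtain ⟨V, hV0, hV⟩ := measure_strip_le hch.norm_e hch.lipschitz.continuous hch.invariant x₀ r₁
  obtain ⟨C₀, hC₀, hC₁, hC₂⟩ := smoothTransition_lipschitz
  obtain ⟨Mη, hMη⟩ := hcs.exists_bound_of_continuous hη.continuous
  obtain ⟨Mη', hMη'⟩ := (hcs.fderiv (𝕜 := ℝ)).exists_bound_of_continuous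
    (hη.continuous_fderiv (by norm_num))
  obtain ⟨MF, hMF⟩ := hΩ.isBounded.isCompact_closure.exists_bound_of_continuousOn hF.continuousOn
  have hMη0 : 0 ≤ Mη := (norm_nonneg _).trans (hMη 0)
  have hgc : Continuous fun y => g y - inner ℝ y e := by
    have := hch.lipschitz.continuous; fun_prop
  -- With the depth `g y - ⟪y, e⟫` below the graph, `χ δ` is `0` up to depth `δ` and `1` from depth
  -- `2δ` on.
  let χ : ℝ → Vec d → ℝ := fun δ y => Real.smoothTransition ((g y - inner ℝ y e) / δ - 1)
  have hχpos : ∀ δ > 0, ∀ y, χ δ y ≠ 0 → δ < g y - inner ℝ y e := by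
    intro δ hδ y hy
    by_contra h
    refine hy (Real.smoothTransition.zero_of_nonpos ?_)
    rw [sub_nonpos, div_le_one hδ]; exact not_lt.1 h
  have hχLip : ∀ δ > 0, ∃ L', LipschitzWith L' (χ δ) := by
    intro δ hδ
    have h1 : LipschitzWith 1 (fun y : Vec d => (inner ℝ y e : ℝ)) := by
      refine LipschitzWith.of_dist_le_mul fun y z => ?_
      rw [Real.dist_eq, ← inner_sub_left, dist_eq_norm]
      have := abs_real_inner_le_norm (y - z) e
      rw [hch.norm_e] at this
      simpa using this
    have h2 : LipschitzWith (Real.toNNReal δ⁻¹) (fun t : ℝ => t / δ - 1) := by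
      refine LipschitzWith.of_dist_le_mul fun y z => ?_
      rw [Real.dist_eq, Real.dist_eq, Real.coe_toNNReal _ (by positivity)]
      have : y / δ - 1 - (z / δ - 1) = δ⁻¹ * (y - z) := by ring
      rw [this, abs_mul, abs_of_pos (inv_pos.2 hδ)]
    exact ⟨_, hC₀.comp (h2.comp (hch.lipschitz.sub h1))⟩
  have hcurlΩ : ∀ y ∈ Ω, ‖curl (fun y => η y • F y) y‖
      ≤ Mη * M + ‖curlL d‖ * (Mη' * MF) := by
    intro y hy
    rw [curl_smul (hηd y) (hFd y hy)]
    refine (norm_add_le _ _).trans (add_le_add ?_ ?_)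
    · rw [norm_smul]
      exact mul_le_mul (hMη y) (hF.curl_le y hy) (norm_nonneg _) hMη0
    · refine ((curlL d).le_opNorm _).trans (mul_le_mul_of_nonneg_left ?_ (curlL d).opNorm_nonneg)
      rw [ContinuousLinearMap.norm_smulRight_apply]
      exact mul_le_mul (hMη' y) (hMF y (subset_closure hy)) (norm_nonneg _)
        ((norm_nonneg _).trans (hMη' 0))
  have hcurl_cont : ContinuousOn (curl fun y => η y • F y) Ω := by
    have h1 : ContDiffOn ℝ 1 (fun y => η y • F y) Ω := hη.contDiffOn.smul hF.contDiffOn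
    have h2 := (curlL d).continuous.comp_continuousOn
      (h1.continuousOn_fderiv_of_isOpen hO (by norm_num))
    exact h2.congr fun y _ => curl_eq _ _
  have hcurl0 : ∀ y, y ∉ tsupport η → curl (fun y => η y • F y) y = 0 := by
    intro y hy
    have : (fun y => η y • F y) =ᶠ[𝓝 y] fun _ => 0 := by
      filter_upwards [(isClosed_tsupport η).isOpen_compl.mem_nhds hy] with z hz
      rw [image_eq_zero_of_notMem_tsupport hz, zero_smul]
    rw [curl_congr this, curl_zero]
  -- Integration by parts moves the curl onto `χ δ`. Its gradient is of order `1/δ` on a strip of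
  -- measure of order `δ`, which alone gives only boundedness; the smallness `ε` comes from `∇χ ×
  -- F`, because `F` is almost normal near the boundary.
  have key : ∀ ε > 0, ∀ᶠ δ in 𝓝[>] (0 : ℝ), ‖∫ y in Ω, χ δ y • curl (fun y => η y • F y) y‖
      ≤ C₀ * (Mη * ((L + 1) * ε)) * V := by
    intro ε hε
    obtain ⟨δ₁, hδ₁, hu⟩ := Metric.uniformContinuousOn_iff.1
      (hΩ.isBounded.isCompact_closure.uniformContinuousOn_of_continuous hF.continuousOn) ε hε
    have hsmall : ∀ᶠ δ in 𝓝[>] (0 : ℝ), δ < min 1 (min (δ₁ / 2) ((r - r₁) / 2)) :=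
      nhdsWithin_le_nhds (gt_mem_nhds (by
        refine lt_min one_pos (lt_min (by positivity) (by linarith))))
    filter_upwards [hsmall, self_mem_nhdsWithin] with δ hδs hδ
    have hδ0 : 0 < δ := hδ
    rw [lt_min_iff, lt_min_iff] at hδs
    obtain ⟨hd1, hd2, hd3⟩ := hδs
    obtain ⟨L', hL'⟩ := hχLip δ hδ0
    -- `η F` is not regular across the boundary. A second, smooth cutoff, equal to `1` at the points
    -- of the support of `η` that have depth at least `δ/2`, makes it a test field without changing
    -- it where `χ δ ≠ 0`.
    obtain ⟨β, hβ0, hβ1, hβ2⟩ := exists_contMDiffMap_zero_one_of_isClosed (n := (1 : ℕ∞))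
      (modelWithCornersSelf ℝ (Vec d)) (s := {y | g y - inner ℝ y e ≤ δ / 4})
      (t := tsupport η ∩ {y | δ / 2 ≤ g y - inner ℝ y e})
      (isClosed_le hgc continuous_const)
      ((isClosed_tsupport η).inter (isClosed_le continuous_const hgc))
      (Set.disjoint_left.2 fun y h1 h2 => by
        have h3 : g y - inner ℝ y e ≤ δ / 4 := h1
        have h4 : δ / 2 ≤ g y - inner ℝ y e := h2.2
        linarith)
    have hβc : ContDiff ℝ 1 β := β.contMDiff.contDiff
    let H : Vec d → Vec 3 := fun y => β y • (η y • F y)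
    have hH : IsTest 1 G H := by
      refine isTest_of_contDiffOn (K := tsupport η ∩ {y | δ / 4 ≤ g y - inner ℝ y e}) ?_ trivial
        ((isClosed_tsupport η).inter (isClosed_le continuous_const hgc)) ?_ ?_
      · have : ContDiffOn ℝ 1 H Ω := hβc.contDiffOn.smul (hη.contDiffOn.smul hF.contDiffOn)
        exact_mod_cast this
      · rintro y ⟨h1, h2⟩
        have h3 : δ / 4 ≤ g y - inner ℝ y e := h2
        exact (hch.mem_iff y (hs h1)).2 (by linarith)
      · intro y hy
        by_cases h1 : y ∈ tsupport η
        · have h2 : g y - inner ℝ y e ≤ δ / 4 := by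
            by_contra h3; exact hy ⟨h1, (not_le.1 h3).le⟩
          simp only [H, show β y = 0 from hβ0 h2, zero_smul]
        · simp only [H, image_eq_zero_of_notMem_tsupport h1, zero_smul, smul_zero]
    have hint := integral_curlL_smulRight hL' (by exact_mod_cast hH.1 : ContDiff ℝ 1 H)
      hH.hasCompactSupport
    have hHeq : ∀ y, χ δ y ≠ 0 → curl H y = curl (fun y => η y • F y) y := by
      intro y hy
      refine curl_congr ?_
      have h1 : ∀ᶠ z in 𝓝 y, δ / 2 < g z - inner ℝ z e :=
        hgc.continuousAt.eventually (lt_mem_nhds (by linarith [hχpos δ hδ0 y hy]))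
      filter_upwards [h1] with z hz
      by_cases h2 : z ∈ tsupport η
      · have h3 : β z = 1 := hβ1 ⟨h2, hz.le⟩
        simp only [H, h3, one_smul]
      · simp only [H, image_eq_zero_of_notMem_tsupport h2, zero_smul, smul_zero]
    have hleft : ∫ y, χ δ y • curl H y = ∫ y in Ω, χ δ y • curl (fun y => η y • F y) y := by
      have e1 : ∀ y, χ δ y • curl H y = χ δ y • curl (fun y => η y • F y) y := fun y => by
        by_cases h : χ δ y = 0
        · rw [h, zero_smul, zero_smul]
        · rw [hHeq y h]
      simp only [e1]
      symm
      refine setIntegral_eq_integral_of_forall_compl_eq_zero fun y hy => ?_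
      by_cases h : χ δ y = 0
      · rw [h, zero_smul]
      · rw [hcurl0 y fun h1 => hy ((hch.mem_iff y (hs h1)).2 (by linarith [hχpos δ hδ0 y h])), smul_zero]
    set S : Set (Vec d) := {y ∈ Metric.closedBall x₀ r₁ |
      δ ≤ g y - inner ℝ y e ∧ g y - inner ℝ y e < 2 * δ} with hSdef
    have hSm : MeasurableSet S :=
      Metric.isClosed_closedBall.measurableSet.inter
        ((measurableSet_le measurable_const hgc.measurable).inter
          (measurableSet_lt hgc.measurable measurable_const))
    have hSfin : (volume : Measure (Vec d)) S ≠ ⊤ :=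
      ((measure_mono (sep_subset _ _)).trans_lt (measure_closedBall_lt_top)).ne
    set B : ℝ := C₀ / δ * (Mη * ((L + 1) * ε)) with hBdef
    have hpt : ∀ᵐ y, ‖curlL d ((fderiv ℝ (χ δ) y).smulRight (H y))‖ ≤ S.indicator (fun _ => B) y := by
      filter_upwards [hch.lipschitz.ae_differentiableAt_of_real (μ := (volume : Measure (Vec d)))]
        with y hy
      obtain ⟨w, hw⟩ : ∃ w, innerSL ℝ w = fderiv ℝ g y :=
        ⟨(InnerProductSpace.toDual ℝ (Vec d)).symm (fderiv ℝ g y),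
          (InnerProductSpace.toDual ℝ (Vec d)).apply_symm_apply _⟩
      have hwd : HasFDerivAt g (innerSL ℝ w) y := by rw [hw]; exact hy.hasFDerivAt
      set s := (g y - inner ℝ y e) / δ - 1 with hsdef
      have hχd : HasFDerivAt (χ δ) ((deriv Real.smoothTransition s / δ) • innerSL ℝ (w - e)) y := by
        have h1 : HasFDerivAt (fun y : Vec d => (inner ℝ y e : ℝ)) (innerSL ℝ e) y := by
          simp only [real_inner_comm e]; exact (innerSL ℝ e).hasFDerivAt
        have h2 : HasFDerivAt (fun y => (g y - inner ℝ y e) / δ - 1)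
            (δ⁻¹ • (innerSL ℝ w - innerSL ℝ e)) y := by
          simp only [div_eq_inv_mul]
          exact ((hwd.sub h1).const_mul δ⁻¹).sub_const 1
        have h3 := ((Real.smoothTransition.contDiff (n := 1)).differentiable (by norm_num)
          s).hasDerivAt.comp_hasFDerivAt y h2
        rw [map_sub, div_eq_mul_inv, ← smul_smul]
        exact h3
      have hcurl : curlL d ((fderiv ℝ (χ δ) y).smulRight (H y))
          = (deriv Real.smoothTransition s / δ * (β y * η y)) • cross (lift3 (w - e)) (F y) := by
        rw [hχd.fderiv]
        have h1 : ((deriv Real.smoothTransition s / δ) • innerSL ℝ (w - e)).smulRight (H y)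
            = (deriv Real.smoothTransition s / δ * (β y * η y)) •
              (innerSL ℝ (w - e)).smulRight (F y) := by
          ext1 z
          simp only [ContinuousLinearMap.smulRight_apply, ContinuousLinearMap.smul_apply, H, smul_smul,
            smul_eq_mul]
          congr 1; ring
        rw [h1, map_smul, curlL_smulRight hd]
      rw [hcurl]
      by_cases hc : deriv Real.smoothTransition s = 0
      · simp only [hc, zero_div, zero_mul, zero_smul, norm_zero]
        exact indicator_nonneg (fun _ _ => by positivity) _
      · by_cases hηy : η y = 0
        · simp only [hηy, mul_zero, zero_smul, norm_zero]
          exact indicator_nonneg (fun _ _ => by positivity) _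
        · have hyt : y ∈ tsupport η := subset_tsupport _ hηy
          have hsr := hC₂ s hc
          have h1 : δ < g y - inner ℝ y e := by
            have := hsr.1; rw [hsdef, sub_pos, one_lt_div hδ0] at this; exact this
          have h2 : g y - inner ℝ y e < 2 * δ := by
            have : (g y - inner ℝ y e) / δ < 2 := by linarith [hsr.2]
            rwa [div_lt_iff₀ hδ0] at this
          have hyS : y ∈ S := ⟨Metric.ball_subset_closedBall (hs₁ hyt), h1.le, h2⟩
          rw [indicator_of_mem hyS, norm_smul, hBdef]
          have h3 := norm_cutoff_le hd hch hF (ε := ε) (δ := δ)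
            (fun a ha b hb hab => by
              rw [← dist_eq_norm]
              exact (hu a ha b hb (by linarith)).le)
            (by linarith) (hs₁ hyt) (by linarith) h2 hwd
          have h4 : ‖deriv Real.smoothTransition s / δ * (β y * η y)‖ ≤ C₀ / δ * Mη := by
            rw [norm_mul, norm_div, Real.norm_of_nonneg hδ0.le, norm_mul]
            refine mul_le_mul ?_ ?_ (by positivity) (by positivity)
            · gcongr; exact hC₁ s
            · rw [Real.norm_of_nonneg (hβ2 y).1]
              calc β y * ‖η y‖ ≤ 1 * Mη :=
                    mul_le_mul (hβ2 y).2 (hMη y) (norm_nonneg _) zero_le_one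
                _ = Mη := one_mul _
          calc _ ≤ (C₀ / δ * Mη) * ((L + 1) * ε) :=
                mul_le_mul h4 h3 (norm_nonneg _) (by positivity)
            _ = _ := by ring
    rw [← hleft, ← norm_neg, ← hint]
    have hiS : Integrable (S.indicator fun _ => B) (volume : Measure (Vec d)) :=
      (integrable_indicator_iff hSm).2 (integrableOn_const hSfin)
    refine (norm_integral_le_of_norm_le hiS hpt).trans ?_
    rw [integral_indicator hSm, setIntegral_const, smul_eq_mul]
    calc (volume : Measure (Vec d)).real S * B ≤ (V * δ) * B :=
          mul_le_mul_of_nonneg_right (hV δ hδ0 hd1.le) (by positivity)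
      _ = C₀ * (Mη * ((L + 1) * ε)) * V := by rw [hBdef]; field_simp
  -- Every point of `Ω` in the support of `η` has positive depth, so `χ δ` is eventually `1` there;
  -- the bound on the curl of `F` gives the dominating constant.
  have hlim : Tendsto (fun δ => ∫ y in Ω, χ δ y • curl (fun y => η y • F y) y) (𝓝[>] (0 : ℝ))
      (𝓝 (∫ y in Ω, curl (fun y => η y • F y) y)) := by
    have hfin : IsFiniteMeasure ((volume : Measure (Vec d)).restrict Ω) :=
      inferInstanceAs (IsFiniteMeasure G.vol)
    refine tendsto_integral_filter_of_dominated_convergence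
      (fun _ => Mη * M + ‖curlL d‖ * (Mη' * MF)) ?_ ?_ (integrable_const _) ?_
    · filter_upwards [self_mem_nhdsWithin] with δ hδ
      obtain ⟨L', hL'⟩ := hχLip δ hδ
      exact (hL'.continuous.continuousOn.smul hcurl_cont).aestronglyMeasurable hO.measurableSet
    · refine Eventually.of_forall fun δ => ?_
      filter_upwards [ae_restrict_mem hO.measurableSet] with y hy
      rw [norm_smul, Real.norm_of_nonneg (Real.smoothTransition.nonneg _)]
      exact (mul_le_of_le_one_left (norm_nonneg _) (Real.smoothTransition.le_one _)).trans (hcurlΩ y hy)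
    · filter_upwards [ae_restrict_mem hO.measurableSet] with y hy
      by_cases hyt : y ∈ tsupport η
      · have h1 : 0 < g y - inner ℝ y e := by
          have := (hch.mem_iff y (hs hyt)).1 hy; linarith
        refine tendsto_const_nhds.congr' ?_
        filter_upwards [self_mem_nhdsWithin, nhdsWithin_le_nhds
          (gt_mem_nhds (show (0 : ℝ) < (g y - inner ℝ y e) / 2 by positivity))] with δ hδ hδ2
        have hδ0 : 0 < δ := hδ
        have : χ δ y = 1 := by
          refine Real.smoothTransition.one_of_one_le ?_
          rw [le_sub_iff_add_le, le_div_iff₀ hδ0]; linarith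
        rw [this, one_smul]
      · simp only [hcurl0 y hyt, smul_zero]; exact tendsto_const_nhds
  have hle : ∀ ε > 0, ‖∫ y in Ω, curl (fun y => η y • F y) y‖ ≤ C₀ * (Mη * ((L + 1) * ε)) * V :=
    fun ε hε => le_of_tendsto hlim.norm (key ε hε)
  rw [← norm_le_zero_iff]
  have hz : Tendsto (fun ε : ℝ => C₀ * (Mη * ((L + 1) * ε)) * V) (𝓝[>] 0) (𝓝 0) := by
    have : Tendsto (fun ε : ℝ => C₀ * (Mη * ((L + 1) * ε)) * V) (𝓝 0)
        (𝓝 (C₀ * (Mη * ((L + 1) * 0)) * V)) :=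
      (by fun_prop : Continuous fun ε : ℝ => C₀ * (Mη * ((L + 1) * ε)) * V).tendsto 0
    simp only [mul_zero, zero_mul] at this
    exact this.mono_left nhdsWithin_le_nhds
  refine ge_of_tendsto hz ?_
  filter_upwards [self_mem_nhdsWithin] with ε hε using hle ε hε

/-! ### Weak curls, mollification, and testing Ampère's law up to the boundary. -/

/-- `C` is the distributional curl of `V` on the whole space. -/
def IsWeakCurl {d : ℕ} (V C : Vec d → Vec 3) : Prop :=
  ∀ η : Vec d → ℝ, ContDiff ℝ 1 η → HasCompactSupport η →
    ∫ y, (η y • C y + curlL d ((fderiv ℝ η y).smulRight (V y))) = 0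

/-- At a fixed `x` this is the definition of the weak curl with the test function `y ↦ κ (x - y)`.
-/
lemma IsWeakCurl.curl_convolution {d : ℕ} {V C : Vec d → Vec 3} (h : IsWeakCurl V C)
    (hV : LocallyIntegrable V) (hC : LocallyIntegrable C) {κ : Vec d → ℝ} (hκ : ContDiff ℝ 1 κ)
    (hs : HasCompactSupport κ) (x : Vec d) :
    curl (convolution κ V (ContinuousLinearMap.lsmul ℝ ℝ) volume) x
      = convolution κ C (ContinuousLinearMap.lsmul ℝ ℝ) volume x := by
  have hd : Differentiable ℝ κ := hκ.differentiable (by norm_num)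
  let η : Vec d → ℝ := fun y => κ (x - y)
  have hη : ContDiff ℝ 1 η := hκ.comp (contDiff_const.sub contDiff_id)
  have hηs : HasCompactSupport η := hs.comp_homeomorph (Homeomorph.subLeft x)
  have hη' : ∀ y, fderiv ℝ η y = - fderiv ℝ κ (x - y) := fun y => by
    have h1 : HasFDerivAt (fun y => x - y) (-ContinuousLinearMap.id ℝ (Vec d)) y := by
      simpa using (hasFDerivAt_id y).const_sub x
    have := ((hd (x - y)).hasFDerivAt.comp y h1).fderiv
    rw [show η = κ ∘ fun y => x - y from rfl, this]; ext z; simp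
  have h4 : ∀ y, ((ContinuousLinearMap.lsmul ℝ ℝ).precompL (Vec d)) (fderiv ℝ κ (x - y)) (V y)
      = - (fderiv ℝ η y).smulRight (V y) := fun y => by
    ext1 z; rw [hη']; simp [ContinuousLinearMap.precompL_apply]
  have hi1 : Integrable (fun y => (fderiv ℝ η y).smulRight (V y)) := by
    have h5 := ((hs.fderiv (𝕜 := ℝ)).convolutionExists_left
      ((ContinuousLinearMap.lsmul ℝ ℝ).precompL (Vec d)) (hκ.continuous_fderiv (by norm_num)) hV
        x).integrable_swap
    simp only [h4] at h5
    simpa using h5.neg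
  have hi2 : Integrable (fun y => η y • C y) := hC.integrable_smul_left_of_hasCompactSupport hη.continuous hηs
  rw [curl_eq, (hs.hasFDerivAt_convolution_left (ContinuousLinearMap.lsmul ℝ ℝ) hκ hV x).fderiv,
    convolution_eq_swap, convolution_eq_swap]
  have h3 := h η hη hηs
  rw [integral_add hi2 ((curlL d).integrable_comp hi1), (curlL d).integral_comp_comm hi1] at h3
  simp only [h4]
  rw [integral_neg, map_neg, neg_eq_iff_add_eq_zero, add_comm]
  exact h3

/-- Shifting and mollifying a field below a graph moves its support into the region. -/
lemma IsGraphChart.shift_mem {d : ℕ} {Ω : Set (Vec d)} {x₀ e : Vec d} {L : ℝ≥0}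
    {g : Vec d → ℝ} {r : ℝ} (hch : IsGraphChart Ω x₀ e L g r) {r₁ s ε : ℝ} (hs : 0 < s)
    (hε0 : 0 ≤ ε) (hε : (L + 1) * ε < s) (hr : r₁ + s + ε < r) {x y : Vec d}
    (hy : y ∈ closure Ω) (hyb : y ∈ Metric.ball x₀ r₁) (hxy : dist (x + s • e) y ≤ ε) : x ∈ Ω := by
  have hee : inner ℝ e e = (1 : ℝ) := by
    rw [real_inner_self_eq_norm_sq, hch.norm_e]; norm_num
  rw [Metric.mem_ball] at hyb
  have h1 : dist x (x + s • e) = s := by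
    rw [dist_eq_norm, show x - (x + s • e) = -(s • e) by simp, norm_neg, norm_smul, hch.norm_e,
      mul_one, Real.norm_of_nonneg hs.le]
  have hxb : x ∈ Metric.ball x₀ r := by
    rw [Metric.mem_ball]
    linarith [dist_triangle x (x + s • e) x₀, dist_triangle (x + s • e) y x₀]
  have hle : inner ℝ y e ≤ g y := by
    have hcl : y ∈ closure (Metric.ball x₀ r ∩ Ω) :=
      Metric.isOpen_ball.inter_closure ⟨by rw [Metric.mem_ball]; linarith, hy⟩
    have hclosed : IsClosed {z | inner ℝ z e ≤ g z} :=
      isClosed_le (by fun_prop) hch.lipschitz.continuous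
    refine closure_minimal (fun z hz => ?_) hclosed hcl
    exact ((hch.mem_iff z hz.1).1 hz.2).le
  rw [hch.mem_iff x hxb]
  -- The shift increases the depth by `s`, while replacing `x + s • e` by the nearby point `y` costs
  -- at most `(L + 1) ε`, which is less than `s`.
  have h2 : g (x + s • e) = g x := hch.invariant x s
  have h3 : g y - g (x + s • e) ≤ L * ε := by
    have := hch.lipschitz.dist_le_mul y (x + s • e)
    rw [Real.dist_eq, dist_comm] at this
    calc _ ≤ |g y - g (x + s • e)| := le_abs_self _
      _ ≤ _ := this
      _ ≤ _ := by gcongr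
  have h4 : inner ℝ (x + s • e) e - inner ℝ y e ≤ ε := by
    rw [← inner_sub_left]
    refine (real_inner_le_norm _ _).trans ?_
    rw [hch.norm_e, mul_one, ← dist_eq_norm]; exact hxy
  rw [inner_add_left, real_inner_smul_left, hee] at h4
  nlinarith

lemma norm_convolution_normed_le {d : ℕ} (φ : ContDiffBump (0 : Vec d)) {V : Vec d → Vec 3} {M : ℝ}
    (hV : AEStronglyMeasurable V volume) (hM : ∀ x, ‖V x‖ ≤ M) (x : Vec d) :
    ‖convolution (φ.normed volume) V (ContinuousLinearMap.lsmul ℝ ℝ) volume x‖ ≤ 3 * M := by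
  -- A field bounded by `M` oscillates by at most `2M`; adding the value itself gives `3M`. Any
  -- uniform bound would do.
  have h := φ.dist_normed_convolution_le (μ := volume) (x₀ := x) (ε := 2 * M) hV fun y _ => by
    rw [dist_eq_norm]; linarith [norm_sub_le (V y) (V x), hM y, hM x]
  rw [dist_eq_norm] at h
  have := norm_sub_norm_le (convolution (φ.normed volume) V (ContinuousLinearMap.lsmul ℝ ℝ) volume x)
    (V x)
  linarith [hM x]

/-- Shifted mollifications converge at every point of `Ω`, where `W` is continuous, and are
uniformly bounded; hence dominated convergence with the integrable factor `a`. -/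
lemma tendsto_integral_mollify {d : ℕ} {Ω : Set (Vec d)} (hO : IsOpen Ω)
    {φ : ℕ → ContDiffBump (0 : Vec d)} (hφ : Tendsto (fun n => (φ n).rOut) atTop (𝓝 0))
    {s : ℕ → ℝ} (hs : Tendsto s atTop (𝓝 0)) (e : Vec d) {a W : Vec d → Vec 3} {N : ℝ}
    (ha : IntegrableOn a Ω) (hWm : AEStronglyMeasurable (Ω.indicator W) volume)
    (hWl : LocallyIntegrable (Ω.indicator W) volume) (hN : ∀ x, ‖Ω.indicator W x‖ ≤ N)
    (hW : ContinuousOn W Ω) :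
    Tendsto (fun n => ∫ x in Ω, inner ℝ (a x) (convolution ((φ n).normed volume) (Ω.indicator W)
      (ContinuousLinearMap.lsmul ℝ ℝ) volume (x + s n • e))) atTop
      (𝓝 (∫ x in Ω, inner ℝ (a x) (W x))) := by
  refine tendsto_integral_of_dominated_convergence (fun x => ‖a x‖ * (3 * N)) (fun n => ?_)
    (ha.norm.mul_const _) (fun n => Eventually.of_forall fun x => ?_) ?_
  · have hc : Continuous (convolution ((φ n).normed volume) (Ω.indicator W)
      (ContinuousLinearMap.lsmul ℝ ℝ) volume) :=
      ((φ n).hasCompactSupport_normed.contDiff_convolution_left (n := 1) _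
        ((φ n).contDiff_normed (n := 1)) hWl).continuous
    exact ha.aestronglyMeasurable.inner (hc.comp (by fun_prop)).aestronglyMeasurable
  · exact (norm_inner_le_norm _ _).trans (mul_le_mul_of_nonneg_left
      (norm_convolution_normed_le (φ n) hWm hN _) (norm_nonneg _))
  · filter_upwards [ae_restrict_mem hO.measurableSet] with x hx
    refine tendsto_const_nhds.inner (ContDiffBump.convolution_tendsto_right (φ := φ)
      (g := fun _ => Ω.indicator W) (x₀ := x) hφ (Eventually.of_forall fun _ => hWm) ?_ ?_)
    · have h1 : Tendsto (Ω.indicator W) (𝓝 x) (𝓝 (W x)) := by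
        refine (hW.continuousAt (hO.mem_nhds hx)).tendsto.congr' ?_
        filter_upwards [hO.mem_nhds hx] with y hy
        rw [indicator_of_mem hy]
      exact h1.comp tendsto_snd
    · simpa using (hs.smul_const e).const_add x

/-- `j = curl b` in the sense of distributions, tested with fields supported in the region. -/
def HasWeakCurl {d : ℕ} (G : Geometry d) (b j : Vec d → Vec 3) : Prop :=
  ∀ ψ : Vec d → Vec 3, IsTest 1 G ψ →
    ∫ x, inner ℝ (j x) (ψ x) ∂G.vol = ∫ x, inner ℝ (b x) (curl ψ x) ∂G.vol

/-- Near a boundary point `θ F` is not compactly supported in `Ω`. Because of the vanishing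
tangential trace its extension by zero has the extended curl as weak curl; shifted downwards and
mollified, it becomes an admissible test field whose curl is the mollified curl, and the limit is
taken on both sides. -/
lemma HasWeakCurl.integral_chart {d : ℕ} (hd : d ≤ 3) {Ω : Set (Vec d)}
    (hΩ : IsBoundedLipschitz Ω) {x₀ e : Vec d} {L : ℝ≥0} {g : Vec d → ℝ} {r : ℝ}
    (hch : IsGraphChart Ω x₀ e L g r) {F : Vec d → Vec 3} {M : ℝ} (hF : IsTangentialZero Ω F M)
    {θ : Vec d → ℝ} (hθ : ContDiff ℝ 1 θ) (hs : tsupport θ ⊆ Metric.ball x₀ r)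
    {b j : Vec d → Vec 3} (h : HasWeakCurl (.bounded Ω hΩ) b j) (hb : IntegrableOn b Ω)
    (hj : IntegrableOn j Ω) :
    ∫ x in Ω, inner ℝ (j x) (θ x • F x) = ∫ x in Ω, inner ℝ (b x) (curl (fun y => θ y • F y) x) := by
  have hO : IsOpen Ω := hΩ.isOpen
  have hθd : Differentiable ℝ θ := hθ.differentiable (by norm_num)
  have hFd : ∀ y ∈ Ω, DifferentiableAt ℝ F y := fun y hy =>
    (hF.contDiffOn.differentiableOn (by norm_num)).differentiableAt (hO.mem_nhds hy)
  have hcs : HasCompactSupport θ :=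
    Metric.isCompact_of_isClosed_isBounded (isClosed_tsupport θ) (Metric.isBounded_ball.subset hs)
  obtain ⟨r₁, hr₁, hs₁⟩ := exists_lt_subset_ball (isClosed_tsupport θ) hs
  obtain ⟨Mθ, hMθ⟩ := hcs.exists_bound_of_continuous hθ.continuous
  obtain ⟨Mθ', hMθ'⟩ := (hcs.fderiv (𝕜 := ℝ)).exists_bound_of_continuous
    (hθ.continuous_fderiv (by norm_num))
  obtain ⟨MF, hMF⟩ := hΩ.isBounded.isCompact_closure.exists_bound_of_continuousOn hF.continuousOn
  have hMθ0 : 0 ≤ Mθ := (norm_nonneg _).trans (hMθ 0)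
  set f : Vec d → Vec 3 := fun y => θ y • F y with hf
  set V := Ω.indicator f with hVdef
  set C := Ω.indicator (curl f) with hCdef
  have hfC : ContDiffOn ℝ 1 f Ω := hθ.contDiffOn.smul hF.contDiffOn
  have hcurl_cont : ContinuousOn (curl f) Ω :=
    ((curlL d).continuous.comp_continuousOn
      (hfC.continuousOn_fderiv_of_isOpen hO (by norm_num))).congr fun y _ => curl_eq _ _
  have hVM : ∀ x, ‖V x‖ ≤ Mθ * max MF 0 := fun x => by
    by_cases hx : x ∈ Ω
    · rw [hVdef, indicator_of_mem hx, hf, norm_smul]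
      exact mul_le_mul (hMθ x) ((hMF x (subset_closure hx)).trans (le_max_left _ _)) (norm_nonneg _)
        hMθ0
    · rw [hVdef, indicator_of_notMem hx, norm_zero]; positivity
  have hCM : ∃ MC, ∀ x, ‖C x‖ ≤ MC := by
    refine ⟨max (Mθ * M + ‖curlL d‖ * (Mθ' * MF)) 0, fun y => ?_⟩
    by_cases hy : y ∈ Ω
    · refine le_trans ?_ (le_max_left _ _)
      rw [hCdef, indicator_of_mem hy, hf, curl_smul (hθd y) (hFd y hy)]
      refine (norm_add_le _ _).trans (add_le_add ?_ ?_)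
      · rw [norm_smul]
        exact mul_le_mul (hMθ y) (hF.curl_le y hy) (norm_nonneg _) hMθ0
      · refine ((curlL d).le_opNorm _).trans (mul_le_mul_of_nonneg_left ?_ (curlL d).opNorm_nonneg)
        rw [ContinuousLinearMap.norm_smulRight_apply]
        exact mul_le_mul (hMθ' y) (hMF y (subset_closure hy)) (norm_nonneg _)
          ((norm_nonneg _).trans (hMθ' 0))
    · rw [hCdef, indicator_of_notMem hy, norm_zero]; exact le_max_right _ _
  obtain ⟨MC, hCM⟩ := hCM
  have hVm : AEStronglyMeasurable V volume :=
    (aestronglyMeasurable_indicator_iff hO.measurableSet).2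
      (hfC.continuousOn.aestronglyMeasurable hO.measurableSet)
  have hCm : AEStronglyMeasurable C volume :=
    (aestronglyMeasurable_indicator_iff hO.measurableSet).2
      (hcurl_cont.aestronglyMeasurable hO.measurableSet)
  have hfin : (volume : Measure (Vec d)) Ω ≠ ⊤ := hΩ.isBounded.measure_lt_top.ne
  have hloc : ∀ {W : Vec d → Vec 3} {N : ℝ}, AEStronglyMeasurable (Ω.indicator W) volume →
      (∀ x, ‖Ω.indicator W x‖ ≤ N) → LocallyIntegrable (Ω.indicator W) volume := by
    intro W N hm hN
    refine Integrable.locallyIntegrable ((integrable_indicator_iff hO.measurableSet).2 ?_)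
    refine IntegrableOn.of_bound hfin.lt_top
      ((aestronglyMeasurable_indicator_iff hO.measurableSet).1 hm) N ?_
    filter_upwards [ae_restrict_mem hO.measurableSet] with x hx
    have := hN x; rwa [indicator_of_mem hx] at this
  have hVl := hloc hVm hVM
  have hCl := hloc hCm hCM
  -- Testing with `η` integrates the curl of `(η θ) F`, which is a localized field in the same
  -- chart. No boundary term appears.
  have hweak : IsWeakCurl V C := by
    intro η hη _
    have h0 := integral_curl_smul_eq_zero hd hΩ hch hF (hη.mul hθ)
      ((tsupport_mul_subset_right (f := η) (g := θ)).trans hs)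
    rw [← integral_indicator hO.measurableSet] at h0
    rw [← h0]
    refine integral_congr_ae (Eventually.of_forall fun y => ?_)
    by_cases hy : y ∈ Ω
    · have e1 : (fun y => (η * θ) y • F y) = fun y => η y • f y := by
        ext1 y; simp only [hf, smul_smul, Pi.mul_apply]
      simp only [hVdef, hCdef, indicator_of_mem hy]
      have e2 : curl (fun y => (η y * θ y) • F y) y = curl (fun y => η y • f y) y := by
        rw [← e1]; rfl
      rw [e2, curl_smul (hη.differentiable (by norm_num) y)
        ((hfC.differentiableOn (by norm_num)).differentiableAt (hO.mem_nhds hy))]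
    · simp [hVdef, hCdef, indicator_of_notMem hy]
  let s : ℕ → ℝ := fun n => (r - r₁) / 2 * (1 / ((n : ℝ) + 1))
  have hs0 : ∀ n, 0 < s n := fun n => mul_pos (by linarith) Nat.one_div_pos_of_nat
  have hs1 : ∀ n, s n ≤ (r - r₁) / 2 := fun n => by
    refine mul_le_of_le_one_right (by linarith) ?_
    rw [div_le_one (by positivity)]; linarith [Nat.cast_nonneg (α := ℝ) n]
  have hst : Tendsto s atTop (𝓝 0) := by
    have := (tendsto_one_div_add_atTop_nhds_zero_nat (𝕜 := ℝ)).const_mul ((r - r₁) / 2)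
    rwa [mul_zero] at this
  -- The mollification radius is `c` times the shift. With `(L + 1) c = 1/4 < 1` smearing cannot
  -- undo the shift, and `s n ≤ (r - r₁) / 2` keeps everything in the ball of the chart.
  let c : ℝ := (4 * (1 + (L : ℝ)))⁻¹
  have hc0 : 0 < c := by positivity
  have hc1 : (L + 1) * c = 1 / 4 := by
    have : (1 + (L : ℝ)) ≠ 0 := by positivity
    simp only [c]; field_simp; ring
  have hc2 : c ≤ 1 / 4 := by rw [← hc1]; nlinarith [L.coe_nonneg]
  let φ : ℕ → ContDiffBump (0 : Vec d) := fun n =>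
    ⟨c * s n / 2, c * s n, by have := hs0 n; positivity, by have := mul_pos hc0 (hs0 n); linarith⟩
  let κ : ℕ → Vec d → ℝ := fun n => (φ n).normed volume
  have hκ : ∀ n, ContDiff ℝ 1 (κ n) := fun n => (φ n).contDiff_normed (n := 1)
  have hκs : ∀ n, HasCompactSupport (κ n) := fun n => (φ n).hasCompactSupport_normed
  let v : ℕ → Vec d → Vec 3 := fun n => convolution (κ n) V (ContinuousLinearMap.lsmul ℝ ℝ) volume
  let w : ℕ → Vec d → Vec 3 := fun n => convolution (κ n) C (ContinuousLinearMap.lsmul ℝ ℝ) volume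
  have hv : ∀ n, ContDiff ℝ 1 (v n) := fun n =>
    (hκs n).contDiff_convolution_left (n := 1) _ (hκ n) hVl
  -- Evaluating at `x + s n • e` moves the field in the direction `-e`, that is, into `Ω`.
  let ψ : ℕ → Vec d → Vec 3 := fun n x => v n (x + s n • e)
  have hψcurl : ∀ n x, curl (ψ n) x = w n (x + s n • e) := fun n x => by
    refine Eq.trans ?_ (hweak.curl_convolution hVl hCl (hκ n) (hκs n) (x + s n • e))
    rw [curl_eq, curl_eq]
    exact congrArg _ (fderiv_comp_add_right _)
  have hψ : ∀ n, IsTest 1 (.bounded Ω hΩ) (ψ n) := by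
    intro n
    refine ⟨by exact_mod_cast (hv n).comp (contDiff_id.add contDiff_const), trivial,
      {x | x + s n • e ∈ Metric.cthickening (c * s n) (tsupport θ ∩ closure Ω)}, ?_, ?_, ?_⟩
    · exact Metric.isClosed_cthickening.preimage (by fun_prop)
    · intro x hx
      rw [mem_ofPred_eq, (hcs.isCompact.inter_right isClosed_closure).cthickening_eq_biUnion_closedBall
        (mul_pos hc0 (hs0 n)).le, mem_iUnion₂] at hx
      obtain ⟨y, hy, hxy⟩ := hx
      have h1 := hs0 n
      have h2 := hs1 n
      exact hch.shift_mem (hs0 n) (mul_pos hc0 (hs0 n)).le (by rw [← mul_assoc, hc1]; linarith)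
        (by nlinarith) hy.2 (hs₁ hy.1) hxy
    · intro x hx
      simp only [ψ, v, convolution_def]
      refine integral_eq_zero_of_ae (Eventually.of_forall fun t => ?_)
      simp only [ContinuousLinearMap.lsmul_apply, Pi.zero_apply]
      by_contra hne
      obtain ⟨h1, h2⟩ := smul_ne_zero_iff.1 hne
      have h3 : t ∈ Function.support (κ n) := h1
      rw [(φ n).support_normed_eq, Metric.mem_ball] at h3
      have h4 : x + s n • e - t ∈ Ω := by
        by_contra h; exact h2 (indicator_of_notMem h _)
      have h5 : θ (x + s n • e - t) ≠ 0 := fun h => h2 (by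
        rw [hVdef, indicator_of_mem h4, hf]; simp [h])
      have h6 : x + s n • e - t ∈ tsupport θ ∩ closure Ω := ⟨subset_tsupport _ h5, subset_closure h4⟩
      have h7 : dist (x + s n • e) (x + s n • e - t) ≤ c * s n := by
        rw [dist_eq_norm, sub_sub_cancel, ← dist_zero_right]; exact h3.le
      have h8 := Metric.mem_cthickening_of_dist_le (x + s n • e) (x + s n • e - t) (c * s n) _ h6 h7
      exact hx h8
  have hφ : Tendsto (fun n => (φ n).rOut) atTop (𝓝 0) := by simpa using hst.const_mul c
  refine tendsto_nhds_unique (tendsto_integral_mollify hO hφ hst e hj hVm hVl hVM hfC.continuousOn) ?_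
  refine (tendsto_integral_mollify hO hφ hst e hb hCm hCl hCM hcurl_cont).congr fun n => ?_
  have := h (ψ n) (hψ n)
  simp only [hψcurl] at this
  exact this.symm

lemma integrable_inner_of_bound {α F : Type*} [MeasurableSpace α] [NormedAddCommGroup F]
    [InnerProductSpace ℝ F] {μ : Measure α} {a W : α → F} {N : ℝ} (ha : Integrable a μ)
    (hW : AEStronglyMeasurable W μ) (hN : ∀ᵐ x ∂μ, ‖W x‖ ≤ N) :
    Integrable (fun x => (inner ℝ (a x) (W x) : ℝ)) μ := by
  refine (ha.norm.mul_const N).mono' (ha.aestronglyMeasurable.inner hW) ?_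
  filter_upwards [hN] with x hx
  exact (norm_inner_le_norm _ _).trans (mul_le_mul_of_nonneg_left hx (norm_nonneg _))

lemma norm_curl_smul_le {d : ℕ} {Ω : Set (Vec d)} (hO : IsOpen Ω) {F : Vec d → Vec 3} {M : ℝ}
    (hb : Bornology.IsBounded Ω) (hF : IsTangentialZero Ω F M) {θ : Vec d → ℝ} (hθ : ContDiff ℝ 1 θ) :
    ∃ N, ∀ x ∈ Ω, ‖θ x • F x‖ ≤ N ∧ ‖curl (fun y => θ y • F y) x‖ ≤ N := by
  obtain ⟨Mθ, hMθ⟩ := hb.isCompact_closure.exists_bound_of_continuousOn hθ.continuous.continuousOn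
  obtain ⟨Mθ', hMθ'⟩ := hb.isCompact_closure.exists_bound_of_continuousOn
    (hθ.continuous_fderiv (by norm_num)).continuousOn
  obtain ⟨MF, hMF⟩ := hb.isCompact_closure.exists_bound_of_continuousOn hF.continuousOn
  refine ⟨max (Mθ * MF) (Mθ * M + ‖curlL d‖ * (Mθ' * MF)), fun y hy => ⟨?_, ?_⟩⟩
  · refine le_trans ?_ (le_max_left _ _)
    have hy' := subset_closure hy
    rw [norm_smul]
    exact mul_le_mul (hMθ y hy') (hMF y hy') (norm_nonneg _) ((norm_nonneg _).trans (hMθ y hy'))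
  · refine le_trans ?_ (le_max_right _ _)
    have hy' := subset_closure hy
    rw [curl_smul (hθ.differentiable (by norm_num) y)
      ((hF.contDiffOn.differentiableOn (by norm_num)).differentiableAt (hO.mem_nhds hy))]
    refine (norm_add_le _ _).trans (add_le_add ?_ ?_)
    · rw [norm_smul]
      exact mul_le_mul (hMθ y hy') (hF.curl_le y hy) (norm_nonneg _)
        ((norm_nonneg _).trans (hMθ y hy'))
    · refine ((curlL d).le_opNorm _).trans (mul_le_mul_of_nonneg_left ?_ (curlL d).opNorm_nonneg)
      rw [ContinuousLinearMap.norm_smulRight_apply]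
      exact mul_le_mul (hMθ' y hy') (hMF y hy') (norm_nonneg _) ((norm_nonneg _).trans (hMθ' y hy'))

/-- A partition of unity on the closure of `Ω` splits `F` into pieces supported inside `Ω`, which
are test fields already, and pieces in boundary charts. -/
lemma HasWeakCurl.integral_bounded {d : ℕ} (hd : d ≤ 3) {Ω : Set (Vec d)}
    (hΩ : IsBoundedLipschitz Ω) {F : Vec d → Vec 3} {M : ℝ} (hF : IsTangentialZero Ω F M)
    {b j : Vec d → Vec 3} (h : HasWeakCurl (.bounded Ω hΩ) b j) (hb : IntegrableOn b Ω)
    (hj : IntegrableOn j Ω) :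
    ∫ x in Ω, inner ℝ (j x) (F x) = ∫ x in Ω, inner ℝ (b x) (curl F x) := by
  have hO : IsOpen Ω := hΩ.isOpen
  have hloc : ∀ x ∈ closure Ω, ∃ U : Set (Vec d), IsOpen U ∧ x ∈ U ∧ ∀ θ : Vec d → ℝ,
      ContDiff ℝ 1 θ → tsupport θ ⊆ U → ∫ x in Ω, inner ℝ (j x) (θ x • F x)
        = ∫ x in Ω, inner ℝ (b x) (curl (fun y => θ y • F y) x) := by
    intro x hx
    by_cases hxΩ : x ∈ Ω
    · refine ⟨Ω, hO, hxΩ, fun θ hθ hs => h _ ?_⟩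
      refine isTest_of_contDiffOn (K := tsupport θ) ?_ trivial (isClosed_tsupport θ) hs ?_
      · have : ContDiffOn ℝ 1 (fun x => θ x • F x) Ω := hθ.contDiffOn.smul hF.contDiffOn
        exact_mod_cast this
      · intro y hy
        rw [image_eq_zero_of_notMem_tsupport hy, zero_smul]
    · obtain ⟨e, L, g, r, h1, h2, h3, h4, h5⟩ := hΩ.graph x (by
        rw [hO.frontier_eq]; exact ⟨hx, hxΩ⟩)
      exact ⟨Metric.ball x r, Metric.isOpen_ball, Metric.mem_ball_self h4, fun θ hθ hs =>
        h.integral_chart hd hΩ ⟨h1, h2, h3, h4, h5⟩ hF hθ hs hb hj⟩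
  choose! U hU1 hU2 hU3 using hloc
  obtain ⟨t, ht1, ht2⟩ := hΩ.isBounded.isCompact_closure.elim_nhds_subcover U
    fun x hx => (hU1 x hx).mem_nhds (hU2 x hx)
  obtain ⟨f, hf⟩ := SmoothPartitionOfUnity.exists_isSubordinate
    (modelWithCornersSelf ℝ (Vec d)) (isClosed_closure (s := Ω)) (fun i : t => U i)
    (fun i => hU1 i (ht1 i i.2)) (by
      intro x hx
      obtain ⟨i, hi, hxi⟩ := mem_iUnion₂.1 (ht2 hx)
      exact mem_iUnion.2 ⟨⟨i, hi⟩, hxi⟩)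
  have hfs : ∀ i, ContDiff ℝ 1 (f i) := fun i => (f i).contMDiff.contDiff.of_le (by exact_mod_cast le_top)
  have hsum : ∀ x ∈ Ω, ∑ i, f i x = 1 := fun x hx => by
    rw [← finsum_eq_sum_of_fintype]; exact f.sum_eq_one (subset_closure hx)
  have hFd : ∀ y ∈ Ω, DifferentiableAt ℝ F y := fun y hy =>
    (hF.contDiffOn.differentiableOn (by norm_num)).differentiableAt (hO.mem_nhds hy)
  have e1 : ∀ x ∈ Ω, (inner ℝ (j x) (F x) : ℝ) = ∑ i, inner ℝ (j x) (f i x • F x) := fun x hx => by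
    rw [← inner_sum, ← Finset.sum_smul, hsum x hx, one_smul]
  have e2 : ∀ x ∈ Ω, (inner ℝ (b x) (curl F x) : ℝ)
      = ∑ i, inner ℝ (b x) (curl (fun y => f i y • F y) x) := fun x hx => by
    rw [← inner_sum]
    congr 1
    have : F =ᶠ[𝓝 x] fun y => ∑ i, f i y • F y := by
      filter_upwards [hO.mem_nhds hx] with y hy
      rw [← Finset.sum_smul, hsum y hy, one_smul]
    have hdi : ∀ i ∈ (Finset.univ : Finset t), DifferentiableAt ℝ (fun y => f i y • F y) x :=
      fun i _ => ((hfs i).differentiable (by norm_num) x).smul (hFd x hx)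
    rw [curl_congr this, curl_eq, fderiv_fun_sum hdi, map_sum]
    simp only [curl_eq]
  rw [setIntegral_congr_fun hO.measurableSet e1, setIntegral_congr_fun hO.measurableSet e2,
    integral_finsetSum, integral_finsetSum]
  · exact Finset.sum_congr rfl fun i _ => hU3 i (ht1 i i.2) (f i) (hfs i) (hf i)
  · intro i _
    obtain ⟨N, hN⟩ := norm_curl_smul_le hO hΩ.isBounded hF (hfs i)
    refine integrable_inner_of_bound (N := N) hb ?_ ?_
    · have h1 : ContDiffOn ℝ 1 (fun y => f i y • F y) Ω := (hfs i).contDiffOn.smul hF.contDiffOn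
      exact ((curlL d).continuous.comp_continuousOn
        (h1.continuousOn_fderiv_of_isOpen hO (by norm_num)) |>.congr fun y _ => curl_eq _ _
        ).aestronglyMeasurable hO.measurableSet
    · filter_upwards [ae_restrict_mem hO.measurableSet] with x hx using (hN x hx).2
  · intro i _
    obtain ⟨N, hN⟩ := norm_curl_smul_le hO hΩ.isBounded hF (hfs i)
    refine integrable_inner_of_bound (N := N) hj ?_ ?_
    · exact ((hfs i).continuous.continuousOn.smul hF.contDiffOn.continuousOn
        ).aestronglyMeasurable hO.measurableSet
    · filter_upwards [ae_restrict_mem hO.measurableSet] with x hx using (hN x hx).1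

/-- A weak curl may be tested with fields of vanishing tangential trace. -/
lemma HasWeakCurl.integral_eq {d : ℕ} (hd : d ≤ 3) {G : Geometry d} {F : Vec d → Vec 3} {M : ℝ}
    (h1 : ContDiffOn ℝ 1 F G.region) (h2 : ContinuousOn F (closure G.region))
    (h3 : ∀ x n, IsOutwardNormal G.region x n → cross (F x) (lift3 n) = 0)
    (h4 : ∀ x ∈ G.cell, ‖curl F x‖ ≤ M) (hc : G.Compatible F)
    {b j : Vec d → Vec 3} (h : HasWeakCurl G b j) (hb : Integrable b G.vol)
    (hj : Integrable j G.vol) :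
    ∫ x, inner ℝ (j x) (F x) ∂G.vol = ∫ x, inner ℝ (b x) (curl F x) ∂G.vol := by
  cases G with
  | torus =>
    refine h F (isTest_of_contDiffOn (K := univ) ?_ hc isClosed_univ subset_rfl
      fun x hx => (hx trivial).elim)
    exact_mod_cast h1
  | bounded Ω hΩ => exact h.integral_bounded hd hΩ ⟨h1, h2, h3, h4⟩ hb hj

/-! ### Space-time integrability -/

section

variable {d : ℕ} {F : Type*} [NormedAddCommGroup F] {G : Geometry d} {T : ℝ}

/-- The measure `dx dt` on `(0, τ] × Ω`. -/
def slabMeasure (G : Geometry d) (τ : ℝ) : Measure (ℝ × Vec d) :=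
  (volume.restrict (Ioc 0 τ)).prod G.vol

lemma slabMeasure_le {τ : ℝ} (hτ : τ ∈ Ioo 0 T) :
    slabMeasure G τ ≤ (timeMeasure T).prod G.vol := by
  rw [prod_measure_eq, slabMeasure, Geometry.vol, Measure.prod_restrict]
  have hsub : Ioc 0 τ ⊆ Ioo 0 T := fun s hs => ⟨hs.1, hs.2.trans_lt hτ.2⟩
  exact Measure.restrict_mono (prod_mono hsub subset_rfl) le_rfl

lemma integral_slab [NormedSpace ℝ F] {f : ℝ → Vec d → F}
    (hf : Integrable (fun z : ℝ × Vec d => f z.1 z.2) ((timeMeasure T).prod G.vol)) {τ : ℝ}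
    (hτ : τ ∈ Ioo 0 T) :
    ∫ t in (0)..τ, ∫ x, f t x ∂G.vol = ∫ z, f z.1 z.2 ∂(slabMeasure G τ) := by
  rw [intervalIntegral.integral_of_le hτ.1.le]
  exact (integral_prod _ (hf.mono_measure (slabMeasure_le hτ))).symm

lemma eLpNorm_prod {p : ℝ≥0∞} (hp : p ≠ 0) (hp' : p ≠ ⊤) {f : ℝ → Vec d → F}
    (hf : AEStronglyMeasurable (fun z : ℝ × Vec d => f z.1 z.2) ((timeMeasure T).prod G.vol)) :
    eLpNorm (fun z : ℝ × Vec d => f z.1 z.2) p ((timeMeasure T).prod G.vol)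
      = eLpNorm (fun t => eLpNorm (f t) p G.vol) p (timeMeasure T) := by
  have h0 : p.toReal ≠ 0 := (ENNReal.toReal_pos hp hp').ne'
  rw [eLpNorm_eq_lintegral_rpow_enorm_toReal hp hp', eLpNorm_eq_lintegral_rpow_enorm_toReal hp hp',
    lintegral_prod _ (hf.enorm.pow_const _)]
  congr 1
  refine lintegral_congr fun t => ?_
  rw [enorm_eq_self, eLpNorm_eq_lintegral_rpow_enorm_toReal hp hp', ← ENNReal.rpow_mul,
    one_div, inv_mul_cancel₀ h0, ENNReal.rpow_one]

lemma aemeasurable_eLpNorm {p : ℝ≥0∞} (hp : p ≠ 0) (hp' : p ≠ ⊤) {f : ℝ → Vec d → F}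
    (hf : AEStronglyMeasurable (fun z : ℝ × Vec d => f z.1 z.2) ((timeMeasure T).prod G.vol)) :
    AEMeasurable (fun t => eLpNorm (f t) p G.vol) (timeMeasure T) := by
  simp only [eLpNorm_eq_lintegral_rpow_enorm_toReal hp hp']
  exact ((hf.enorm.pow_const p.toReal).lintegral_prod_right').pow_const _

/-- Both measures are finite, so Hölder's inequality lowers the exponents in space and in time to
the common value `q`, and Tonelli's theorem identifies the mixed norm with the norm in space-time.
-/
lemma MemLrLp.memLp {r p q : ℝ≥0∞} (hq : q ≠ 0) (hqr : q ≤ r) (hqp : q ≤ p) (hp : p ≠ ⊤)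
    {f : ℝ → Vec d → F} (hf : MemLrLp G T r p f) :
    MemLp (fun z : ℝ × Vec d => f z.1 z.2) q ((timeMeasure T).prod G.vol) := by
  have hq' : q ≠ ⊤ := (hqp.trans_lt hp.lt_top).ne
  have hp0 : p ≠ 0 := (hq.bot_lt.trans_le hqp).ne'
  have hqr' : 0 < q.toReal := ENNReal.toReal_pos hq hq'
  refine ⟨hf.1, ?_⟩
  rw [eLpNorm_prod hq hq' hf.1]
  set c : ℝ≥0∞ := G.vol univ ^ (1 / q.toReal - 1 / p.toReal)
  have hc : c ≠ ⊤ := ENNReal.rpow_ne_top_of_nonneg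
    (sub_nonneg.2 (one_div_le_one_div_of_le hqr' (ENNReal.toReal_mono hp hqp))) (measure_ne_top _ _)
  have h1 : eLpNorm (fun t => eLpNorm (f t) q G.vol) q (timeMeasure T)
      ≤ c * eLpNorm (fun t => eLpNorm (f t) p G.vol) q (timeMeasure T) := by
    have : eLpNorm (fun t => eLpNorm (f t) q G.vol) q (timeMeasure T)
        ≤ eLpNorm (fun t => eLpNorm (f t) p G.vol * c) q (timeMeasure T) := by
      refine eLpNorm_mono_enorm_ae ?_
      filter_upwards [hf.1.prodMk_left] with t ht
      simp only [enorm_eq_self]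
      exact eLpNorm_le_eLpNorm_mul_rpow_measure_univ hqp ht
    refine this.trans (le_of_eq ?_)
    rw [eLpNorm_eq_lintegral_rpow_enorm_toReal hq hq', eLpNorm_eq_lintegral_rpow_enorm_toReal hq hq']
    simp only [enorm_eq_self, ENNReal.mul_rpow_of_nonneg _ _ hqr'.le]
    rw [lintegral_mul_const' _ _ (ENNReal.rpow_ne_top_of_nonneg hqr'.le hc),
      ENNReal.mul_rpow_of_nonneg _ _ (by positivity), ← ENNReal.rpow_mul, mul_one_div_cancel hqr'.ne',
      ENNReal.rpow_one, mul_comm]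
  have h2 := eLpNorm_le_eLpNorm_mul_rpow_measure_univ (μ := timeMeasure T) hqr
    (aemeasurable_eLpNorm hp0 hp hf.1).aestronglyMeasurable
  refine (h1.trans (mul_le_mul_right h2 c)).trans_lt (ENNReal.mul_lt_top hc.lt_top
    (ENNReal.mul_lt_top hf.2 ?_))
  refine (ENNReal.rpow_ne_top_of_nonneg ?_ (measure_ne_top _ _)).lt_top
  rcases eq_or_ne r ⊤ with rfl | hr
  · simp
  · exact sub_nonneg.2 (one_div_le_one_div_of_le hqr' (ENNReal.toReal_mono hr hqr))

lemma MemLp.ae_slice {p : ℝ≥0∞} (hp : p ≠ 0) (hp' : p ≠ ⊤) {f : ℝ → Vec d → F}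
    (hf : MemLp (fun z : ℝ × Vec d => f z.1 z.2) p ((timeMeasure T).prod G.vol)) :
    ∀ᵐ t ∂(timeMeasure T), MemLp (f t) p G.vol := by
  have h1 := (eLpNorm_lt_top_iff_lintegral_rpow_enorm_lt_top hp hp').1 hf.2
  rw [lintegral_prod _ (hf.1.enorm.pow_const _)] at h1
  filter_upwards [hf.1.prodMk_left,
    ae_lt_top' (hf.1.enorm.pow_const p.toReal).lintegral_prod_right' h1.ne] with t h2 h3
  exact ⟨h2, (eLpNorm_lt_top_iff_lintegral_rpow_enorm_lt_top hp hp').2 h3⟩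

/-- A function whose primitive vanishes almost everywhere is zero. -/
lemma ae_eq_zero_of_primitive (hT : 0 < T) {f : ℝ → ℝ} (hf : Integrable f (timeMeasure T))
    (h : ∀ᵐ τ ∂(timeMeasure T), ∫ t in (0)..τ, f t = 0) : ∀ᵐ t ∂(timeMeasure T), f t = 0 := by
  have hi : IntervalIntegrable f volume 0 T :=
    (intervalIntegrable_iff_integrableOn_Ioo_of_le hT.le).2 hf
  have hc : ContinuousOn (fun τ => ∫ t in (0)..τ, f t) (Icc 0 T) := by
    have := intervalIntegral.continuousOn_primitive_interval (μ := volume) (f := f) (a := 0) (b := T)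
      (by rw [uIcc_of_le hT.le, integrableOn_Icc_iff_integrableOn_Ioo]; exact hf)
    rwa [uIcc_of_le hT.le] at this
  -- The primitive is continuous and vanishes on a dense set. Lebesgue's differentiation theorem
  -- then recovers `f`.
  have hz : ∀ τ ∈ Ioo 0 T, ∫ t in (0)..τ, f t = 0 := by
    intro τ hτ
    by_contra hne
    have h1 : ∀ᶠ σ in 𝓝 τ, ∫ t in (0)..σ, f t ≠ 0 :=
      (hc.continuousAt (Icc_mem_nhds hτ.1 hτ.2)).eventually_ne hne
    have h2 : ∀ᶠ σ in 𝓝 τ, σ ∈ Ioo 0 T := Ioo_mem_nhds hτ.1 hτ.2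
    rw [timeMeasure, ae_restrict_iff' measurableSet_Ioo] at h
    have h3 := mem_closure_iff_frequently.1 (Measure.dense_of_ae h τ)
    obtain ⟨σ, h4, h5, h6⟩ := (h3.and_eventually (h1.and h2)).exists
    exact h5 (h4 h6)
  have hd := hi.ae_hasDerivAt_integral
  rw [timeMeasure, ae_restrict_iff' measurableSet_Ioo]
  filter_upwards [hd] with t ht htm
  rw [uIcc_of_le hT.le] at ht
  have h1 := ht (Ioo_subset_Icc_self htm) 0 ⟨le_rfl, hT.le⟩
  have h2 : (fun τ => ∫ t in (0)..τ, f t) =ᶠ[𝓝 t] fun _ => 0 := by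
    filter_upwards [Ioo_mem_nhds htm.1 htm.2] with τ hτ using hz τ hτ
  exact h1.unique ((hasDerivAt_const t (0 : ℝ)).congr_of_eventuallyEq h2)

lemma IsTest.isC1c [NormedSpace ℝ F] {ψ : Vec d → F} (h : IsTest 1 G ψ) (T : ℝ) :
    IsC1c G T (fun _ => ψ) := by
  obtain ⟨K, h1, h2, h3⟩ := h.support
  have hc : ContDiff ℝ 1 (fun z : ℝ × Vec d => ψ z.2) := by
    have : ContDiff ℝ 1 ψ := by exact_mod_cast h.1
    exact this.comp contDiff_snd
  exact ⟨⟨fun _ _ => h.compatible, hc.continuous.continuousOn, hc.contDiffOn,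
    _, (hc.continuous_fderiv (by norm_num)).continuousOn, fun _ _ => rfl⟩, K, h1, h2,
    fun _ _ => h3⟩

lemma integrable_pair [InnerProductSpace ℝ F] {a : ℝ → Vec d → F} {ψ : Vec d → F}
    (ha : MemLp (fun z : ℝ × Vec d => a z.1 z.2) 2 ((timeMeasure T).prod G.vol))
    (hψ : Continuous ψ) :
    Integrable (fun z : ℝ × Vec d => (inner ℝ (a z.1 z.2) (ψ z.2) : ℝ))
      ((timeMeasure T).prod G.vol) := by
  obtain ⟨M, hM⟩ := G.isCompact_closure_cell.exists_bound_of_continuousOn hψ.continuousOn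
  refine integrable_inner_of_bound (N := M) (ha.integrable (by norm_num))
    (hψ.comp continuous_snd).aestronglyMeasurable ?_
  filter_upwards [ae_mem_cylinder G T] with z hz using hM _ (subset_closure hz.2)

/-- Ampère's law in space-time gives Ampère's law at almost every time. -/
lemma ae_hasWeakCurl (hT : 0 < T) {b j : ℝ → Vec d → Vec 3}
    (hb : MemLp (fun z : ℝ × Vec d => b z.1 z.2) 2 ((timeMeasure T).prod G.vol))
    (hj : MemLp (fun z : ℝ × Vec d => j z.1 z.2) 2 ((timeMeasure T).prod G.vol))
    (h : ∀ φ : ℝ → Vec d → Vec 3, IsC1c G T φ → ∀ᵐ τ ∂(timeMeasure T),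
      (∫ t in (0)..τ, ∫ x, inner ℝ (j t x) (φ t x) ∂G.vol)
        = ∫ t in (0)..τ, ∫ x, inner ℝ (b t x) (curl (φ t) x) ∂G.vol) :
    ∀ᵐ t ∂(timeMeasure T), HasWeakCurl G (b t) (j t) := by
  have hcurl : ∀ ψ : Vec d → Vec 3, IsTest 1 G ψ → Continuous (curl ψ) := fun ψ hψ => by
    have h1 : Continuous (fderiv ℝ ψ) := hψ.1.continuous_fderiv (by norm_num)
    have : curl ψ = fun x => curlL d (fderiv ℝ ψ x) := funext (curl_eq ψ)
    rw [this]; exact (curlL d).continuous.comp h1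
  have hone : ∀ ψ : Vec d → Vec 3, IsTest 1 G ψ → ∀ᵐ t ∂(timeMeasure T),
      ∫ x, inner ℝ (j t x) (ψ x) ∂G.vol = ∫ x, inner ℝ (b t x) (curl ψ x) ∂G.vol := by
    intro ψ hψ
    have i1 := integrable_pair hj hψ.1.continuous
    have i2 := integrable_pair hb (hcurl ψ hψ)
    have h0 := ae_eq_zero_of_primitive hT (i1.integral_prod_left.sub i2.integral_prod_left) (by
      filter_upwards [h _ (hψ.isC1c T), ae_timeMeasure_mem T] with τ hτ hτm
      have hsub : Ioc 0 τ ⊆ Ioo 0 T := fun s hs => ⟨hs.1, hs.2.trans_lt hτm.2⟩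
      have hii : ∀ {f : ℝ → ℝ}, Integrable f (timeMeasure T) → IntervalIntegrable f volume 0 τ :=
        fun hf => (intervalIntegrable_iff_integrableOn_Ioc_of_le hτm.1.le).2
          (hf.mono_measure (Measure.restrict_mono hsub le_rfl))
      simp only [Pi.sub_apply]
      rw [intervalIntegral.integral_sub (hii i1.integral_prod_left) (hii i2.integral_prod_left),
        hτ, sub_self])
    filter_upwards [h0] with t ht using sub_eq_zero.1 ht
  have hfact : Fact ((2 : ℝ≥0∞) ≠ ⊤) := ⟨by simp⟩
  have hsc : SecondCountableTopology (Lp (Vec 3) 2 G.vol) := inferInstance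
  have hsep : TopologicalSpace.SeparableSpace (Lp (Vec 3) 2 G.vol × Lp (Vec 3) 2 G.vol) :=
    inferInstance
  -- For each single `ψ` the law holds off a null set of times that depends on `ψ`. The pairs `(ψ,
  -- curl ψ)` form a separable set in `L² × L²`; a countable dense subset removes the dependence,
  -- since both sides are continuous there.
  let S : Set (Lp (Vec 3) 2 G.vol × Lp (Vec 3) 2 G.vol) :=
    {p | ∃ ψ, IsTest 1 G ψ ∧ p.1 =ᵐ[G.vol] ψ ∧ p.2 =ᵐ[G.vol] curl ψ}
  obtain ⟨c, hcS, hc, hcd⟩ :=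
    (TopologicalSpace.IsSeparable.of_separableSpace S).exists_countable_dense_subset
  have hall : ∀ᵐ t ∂(timeMeasure T), ∀ p ∈ c,
      ∫ x, inner ℝ (j t x) (p.1 x) ∂G.vol = ∫ x, inner ℝ (b t x) (p.2 x) ∂G.vol := by
    refine (ae_ball_iff hc).2 fun p hp => ?_
    obtain ⟨ψ, hψ, h1, h2⟩ := hcS hp
    filter_upwards [hone ψ hψ] with t ht
    rw [integral_congr_ae (g := fun x => inner ℝ (j t x) (ψ x)), ht]
    · refine integral_congr_ae ?_
      filter_upwards [h2] with x hx; rw [hx]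
    · filter_upwards [h1] with x hx; rw [hx]
  filter_upwards [hall, MemLp.ae_slice (by norm_num) (by norm_num) hb,
    MemLp.ae_slice (by norm_num) (by norm_num) hj] with t ht hbt hjt ψ hψ
  have hψ1 : MemLp ψ 2 G.vol := continuous_memLp G hψ.1.continuous 2
  have hψ2 : MemLp (curl ψ) 2 G.vol := continuous_memLp G (hcurl ψ hψ) 2
  have hclosed : IsClosed {p : Lp (Vec 3) 2 G.vol × Lp (Vec 3) 2 G.vol |
      (inner ℝ (hjt.toLp (j t)) p.1 : ℝ) = inner ℝ (hbt.toLp (b t)) p.2} :=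
    isClosed_eq (by fun_prop) (by fun_prop)
  have hin : ∀ {a : Vec d → Vec 3} (ha : MemLp a 2 G.vol) (p : Lp (Vec 3) 2 G.vol),
      (inner ℝ (ha.toLp a) p : ℝ) = ∫ x, inner ℝ (a x) (p x) ∂G.vol := fun ha p => by
    rw [L2.inner_def]
    refine integral_congr_ae ?_
    filter_upwards [ha.coeFn_toLp] with x hx; rw [hx]
  have hmem := hclosed.closure_subset_iff.2 (fun p hp => by
    rw [mem_ofPred_eq, hin, hin]; exact ht p hp)
    (hcd (show (hψ1.toLp ψ, hψ2.toLp (curl ψ)) ∈ S from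
      ⟨ψ, hψ, hψ1.coeFn_toLp, hψ2.coeFn_toLp⟩))
  rw [mem_ofPred_eq, hin, hin] at hmem
  rw [integral_congr_ae (g := fun x => inner ℝ (j t x) (hψ1.toLp ψ x)), hmem]
  · refine integral_congr_ae ?_
    filter_upwards [hψ2.coeFn_toLp] with x hx; rw [hx]
  · filter_upwards [hψ1.coeFn_toLp] with x hx; rw [hx]

end

/-! ### Truncation in space-time of fields that vanish on the boundary. -/

/-- Approximation of a `C¹` field that vanishes on the boundary by fields of compact support. -/
structure IsTruncation {d : ℕ} (G : Geometry d) (T : ℝ) (u : ℝ → Vec d → Vec d)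
    (φ : ℕ → ℝ → Vec d → Vec d) (M : ℝ) : Prop where
  nonneg : 0 ≤ M
  isC1c : ∀ n, IsC1c G T (φ n)
  norm_le : ∀ n, ∀ t ∈ Icc 0 T, ∀ x ∈ closure G.cell, ‖φ n t x‖ ≤ M
  norm_fderiv_le : ∀ n, ∀ t ∈ Ioo 0 T, ∀ x ∈ G.cell,
    ‖fderiv ℝ (fun z : ℝ × Vec d => φ n z.1 z.2) (t, x)‖ ≤ M
  norm_grad_le : ∀ n, ∀ t ∈ Ioo 0 T, ∀ x ∈ G.closedCell, ‖grad (φ n t) x‖ ≤ M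
  tendsto : ∀ t ∈ Icc 0 T, ∀ x ∈ closure G.cell, Tendsto (fun n => φ n t x) atTop (𝓝 (u t x))
  eventually_eq : ∀ᵐ z ∂((timeMeasure T).prod G.vol), ∀ᶠ n in atTop,
    φ n z.1 z.2 = u z.1 z.2 ∧ fderiv ℝ (fun z : ℝ × Vec d => φ n z.1 z.2) z
      = fderiv ℝ (fun z : ℝ × Vec d => u z.1 z.2) z

/-- The approximations are `η n ∘ u` with the maps of `exists_truncation`. Their derivatives
converge almost everywhere in space-time, because the space-time derivative of `u` vanishes at
almost every zero of `u`. -/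
lemma exists_isTruncation {d : ℕ} {G : Geometry d} {T : ℝ} {u : ℝ → Vec d → Vec d}
    (hu : IsC1 G T u) (h0 : ∀ t ∈ Icc 0 T, ∀ x ∈ frontier G.region, u t x = 0) :
    ∃ φ M, IsTruncation G T u φ M := by
  obtain ⟨η, M₀, hM₀, hη1, hη2, hη3, hη4, hη5⟩ := exists_truncation (Vec d)
  obtain ⟨M, hM, hM1, hM2⟩ := hu.bound
  let φ : ℕ → ℝ → Vec d → Vec d := fun n t => (closure G.region).indicator fun x => η n (u t x)
  have hη0 : ∀ n, η n 0 = 0 := fun n => hη2 n 0 (by rw [norm_zero]; positivity)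
  have hφ : ∀ n t, ∀ x ∈ closure G.region, φ n t x = η n (u t x) := fun n t x hx =>
    indicator_of_mem hx _
  have hC1 : ∀ n, IsC1 G T (fun t x => η n (u t x)) := fun n =>
    hu.comp isOpen_univ (hη1 n 1).contDiffOn fun _ _ _ _ => mem_univ _
  have hφC1 : ∀ n, IsC1 G T (φ n) := fun n => (hC1 n).congr fun t _ x hx => hφ n t x hx
  have hsupp : ∀ n, ∃ K, IsClosed K ∧ K ⊆ G.region ∧ ∀ t ∈ Icc 0 T, ∀ x ∉ K, φ n t x = 0 := by
    intro n
    cases G with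
    | torus => exact ⟨univ, isClosed_univ, subset_rfl, fun t _ x hx => (hx trivial).elim⟩
    | bounded Ω hΩ =>
      -- The set where `‖u‖ ≥ 1 / (n + 1)` is compact in space-time; its projection to space is a
      -- support that serves all times at once.
      let Z : Set (ℝ × Vec d) := (Icc 0 T ×ˢ closure Ω) ∩
        (fun z : ℝ × Vec d => u z.1 z.2) ⁻¹' {v | 1 / ((n : ℝ) + 1) ≤ ‖v‖}
      have hZ : IsCompact Z := by
        have hcyl : IsCompact (Icc 0 T ×ˢ closure Ω) :=
          isCompact_Icc.prod hΩ.isBounded.isCompact_closure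
        refine hcyl.of_isClosed_subset ?_ inter_subset_left
        exact hu.continuousOn.preimage_isClosed_of_isClosed hcyl.isClosed
          (isClosed_le continuous_const continuous_norm)
      refine ⟨Prod.snd '' Z, (hZ.image continuous_snd).isClosed, ?_, fun t ht x hx => ?_⟩
      · rintro _ ⟨⟨t, x⟩, ⟨⟨ht, hx⟩, hux⟩, rfl⟩
        by_contra hxΩ
        have hfr : x ∈ frontier Ω := by
          rw [hΩ.isOpen.frontier_eq]; exact ⟨hx, hxΩ⟩
        have h1 : (1 : ℝ) / ((n : ℝ) + 1) ≤ ‖u t x‖ := hux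
        rw [h0 t ht x hfr, norm_zero] at h1
        exact absurd h1 (not_le.2 (by positivity))
      · by_cases hxc : x ∈ closure Ω
        · refine (hφ n t x hxc).trans (hη2 n _ ?_)
          by_contra hlt
          exact hx ⟨(t, x), ⟨⟨ht, hxc⟩, (not_le.1 hlt).le⟩, rfl⟩
        · exact indicator_of_notMem hxc _
  have hφeq : ∀ n, ∀ z ∈ Ioo 0 T ×ˢ G.region, (fun z : ℝ × Vec d => φ n z.1 z.2)
      =ᶠ[𝓝 z] fun z : ℝ × Vec d => η n (u z.1 z.2) := fun n z hz => by
    filter_upwards [(isOpen_cylinder G T).mem_nhds hz] with w hw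
    exact hφ n _ _ (subset_closure hw.2)
  have hder : ∀ n, ∀ t ∈ Ioo 0 T, ∀ x ∈ G.region,
      fderiv ℝ (fun z : ℝ × Vec d => φ n z.1 z.2) (t, x) = (fderiv ℝ (η n) (u t x)).comp
        (fderiv ℝ (fun z : ℝ × Vec d => u z.1 z.2) (t, x)) := fun n t ht x hx => by
    rw [(hφeq n _ ⟨ht, hx⟩).fderiv_eq]
    exact (HasFDerivAt.comp (f := fun z : ℝ × Vec d => u z.1 z.2) (t, x)
      ((hη1 n 1).differentiable (by norm_num) _).hasFDerivAt (hu.hasFDerivAt ht hx)).fderiv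
  have hderle : ∀ n, ∀ t ∈ Ioo 0 T, ∀ x ∈ closure G.cell, x ∈ G.region →
      ‖fderiv ℝ (fun z : ℝ × Vec d => φ n z.1 z.2) (t, x)‖ ≤ M₀ * M := fun n t ht x hx hx' => by
    rw [hder n t ht x hx']
    exact (ContinuousLinearMap.opNorm_comp_le _ _).trans
      (mul_le_mul (hη4 n _) (hM2 t ht x hx hx') (norm_nonneg _) hM₀)
  have h1 : M₀ * M ≤ M + M₀ * M + ‖matL d‖ * (M₀ * M) := by
    have : 0 ≤ ‖matL d‖ * (M₀ * M) := by positivity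
    linarith
  have h2 : ‖matL d‖ * (M₀ * M) ≤ M + M₀ * M + ‖matL d‖ * (M₀ * M) := by
    have : 0 ≤ M₀ * M := by positivity
    linarith
  refine ⟨φ, M + M₀ * M + ‖matL d‖ * (M₀ * M), by positivity, fun n => ⟨hφC1 n, hsupp n⟩, ?_, ?_, ?_,
    ?_, ?_⟩
  · intro n t ht x hx
    rw [hφ n t x (G.closure_cell_subset hx)]
    have : 0 ≤ M₀ * M + ‖matL d‖ * (M₀ * M) := by positivity
    linarith [hη3 n (u t x), hM1 t ht x hx]
  · exact fun n t ht x hx => (hderle n t ht x (subset_closure hx) (G.cell_subset_region hx)).trans h1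
  · intro n t ht x hx
    by_cases hxr : x ∈ G.region
    · rw [grad_eq]
      refine ((matL d).le_opNorm _).trans (le_trans ?_ h2)
      gcongr
      exact ((hφC1 n).norm_fderiv_le ht hxr).trans (hderle n t ht x (G.closedCell_subset hx) hxr)
    -- Boundary points matter here since the defect measures may charge them. There the truncated
    -- field vanishes in a neighbourhood.
    · obtain ⟨K, hK1, hK2, hK3⟩ := hsupp n
      have : φ n t =ᶠ[𝓝 x] fun _ => 0 := by
        filter_upwards [hK1.isOpen_compl.mem_nhds fun h => hxr (hK2 h)] with y hy
        exact hK3 t (Ioo_subset_Icc_self ht) y hy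
      rw [grad_eq, this.fderiv_eq]
      simp only [fderiv_fun_const, Pi.zero_apply, map_zero, norm_zero]
      positivity
  · intro t ht x hx
    simp only [hφ _ t x (G.closure_cell_subset hx)]
    by_cases hux : u t x = 0
    · simp only [hux, hη0]; exact tendsto_const_nhds
    · refine tendsto_const_nhds.congr' ?_
      filter_upwards [hη5 _ hux] with n hn
      exact hn.self_of_nhds.symm
  · have hnull : ∀ᵐ z ∂((timeMeasure T).prod G.vol), z ∈ Ioo 0 T ×ˢ G.region → u z.1 z.2 = 0 →
        fderiv ℝ (fun z : ℝ × Vec d => u z.1 z.2) z = 0 := by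
      rw [prod_measure_eq]
      exact ae_restrict_of_ae (ae_fderiv_eq_zero_of_eq_zero _ (isOpen_cylinder G T)
        (hu.contDiffOn.differentiableOn (by norm_num)))
    filter_upwards [ae_mem_cylinder G T, hnull] with z hz hzn
    have hzr : z ∈ Ioo 0 T ×ˢ G.region := ⟨hz.1, G.cell_subset_region hz.2⟩
    by_cases huz : u z.1 z.2 = 0
    · refine Eventually.of_forall fun n => ⟨?_, ?_⟩
      · rw [hφ n _ _ (subset_closure hzr.2), huz, hη0]
      · rw [hder n z.1 hzr.1 z.2 hzr.2, hzn hzr huz, ContinuousLinearMap.comp_zero]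
    · filter_upwards [hη5 _ huz] with n hn
      refine ⟨?_, ?_⟩
      · rw [hφ n _ _ (subset_closure hzr.2)]; exact hn.self_of_nhds
      · rw [hder n z.1 hzr.1 z.2 hzr.2, hn.fderiv_eq, fderiv_id, ContinuousLinearMap.id_comp]

lemma inner_tensorT_tensorT {d : ℕ} (v w v' w' : Vec d) :
    (inner ℝ (tensorT v w) (tensorT v' w') : ℝ) = inner ℝ v v' * inner ℝ w w' := by
  rw [inner_tensorT]
  have : mulT (tensorT v' w') w = (inner ℝ w w' : ℝ) • v' := by
    ext i
    simp only [mulT, tensorT, PiLp.smul_apply, PiLp.inner_apply, smul_eq_mul, Finset.sum_mul]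
    exact Finset.sum_congr rfl fun j _ => by simp; ring
  rw [this, real_inner_smul_right, mul_comm]

lemma norm_tensorT {d : ℕ} (v w : Vec d) : ‖tensorT v w‖ = ‖v‖ * ‖w‖ := by
  have h := inner_tensorT_tensorT v w v w
  rw [real_inner_self_eq_norm_sq, real_inner_self_eq_norm_sq, real_inner_self_eq_norm_sq] at h
  nlinarith [norm_nonneg (tensorT v w), mul_nonneg (norm_nonneg v) (norm_nonneg w),
    sq_eq_sq₀ (norm_nonneg (tensorT v w)) (mul_nonneg (norm_nonneg v) (norm_nonneg w)) |>.1
      (by rw [h]; ring)]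

lemma continuous_tensorT {d : ℕ} : Continuous fun p : Vec d × Vec d => tensorT p.1 p.2 := by
  refine (PiLp.continuous_toLp 2 _).comp (continuous_pi fun p => ?_)
  fun_prop

lemma continuous_cross : Continuous fun p : Vec 3 × Vec 3 => cross p.1 p.2 := by
  simp only [← crossL_apply]; fun_prop

lemma integrable_cross {α : Type*} [MeasurableSpace α] {μ : Measure α} {a b : α → Vec 3}
    (ha : MemLp a 2 μ) (hb : MemLp b 2 μ) : Integrable (fun x => cross (a x) (b x)) μ := by
  have h1 := ((memLp_two_iff_integrable_sq_norm ha.1).1 ha).add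
    ((memLp_two_iff_integrable_sq_norm hb.1).1 hb)
  refine h1.mono' (continuous_cross.comp_aestronglyMeasurable (ha.1.prodMk hb.1)) ?_
  refine Eventually.of_forall fun x => (norm_cross_le _ _).trans ?_
  simp only [Pi.add_apply]
  nlinarith [sq_nonneg (‖a x‖ - ‖b x‖), sq_nonneg ‖a x‖, sq_nonneg ‖b x‖]

/-! ### Integrability properties of dissipative weak solutions -/

section

variable {d : ℕ} {P : Params d} {G : Geometry d} {T : ℝ}
  {ρ₀ : Vec d → ℝ} {m₀ B₀ : Vec d → Vec d} {ρ : ℝ → Vec d → ℝ} {u B : ℝ → Vec d → Vec d}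
  {E : ℝ → Vec d → Vec 3} {Du : ℝ → Vec d → Ten d}
  {μc : ℝ → VectorMeasure G.closedCell (Ten d)} {μB : ℝ → VectorMeasure G.closedCell (Vec d)}
  {𝔇 : ℝ → Measure G.closedCell} {ℭ : Measure (Icc (0 : ℝ) T × G.closedCell)}

namespace IsDissipativeWeakSolution

lemma memLp_density (h : IsDissipativeWeakSolution P G T ρ₀ m₀ B₀ ρ u B E Du μc μB 𝔇 ℭ) :
    MemLp (fun z : ℝ × Vec d => ρ z.1 z.2) (ENNReal.ofReal P.γ) ((timeMeasure T).prod G.vol) :=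
  h.density_mem.memLp (by simpa using one_pos.trans P.one_lt_γ) le_top le_rfl (by simp)

lemma integrable_density (h : IsDissipativeWeakSolution P G T ρ₀ m₀ B₀ ρ u B E Du μc μB 𝔇 ℭ) :
    Integrable (fun z : ℝ × Vec d => ρ z.1 z.2) ((timeMeasure T).prod G.vol) :=
  h.memLp_density.integrable (by simpa using P.one_lt_γ.le)

lemma integrable_rpow (h : IsDissipativeWeakSolution P G T ρ₀ m₀ B₀ ρ u B E Du μc μB 𝔇 ℭ) :
    Integrable (fun z : ℝ × Vec d => ρ z.1 z.2 ^ P.γ) ((timeMeasure T).prod G.vol) := by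
  have hγ := one_pos.trans P.one_lt_γ
  have h1 := h.memLp_density.integrable_norm_rpow (by simpa using hγ) (by simp)
  refine h1.congr ?_
  filter_upwards [h.density_nonneg] with z hz
  rw [ENNReal.toReal_ofReal hγ.le, Real.norm_of_nonneg hz]

lemma integrable_kinetic (h : IsDissipativeWeakSolution P G T ρ₀ m₀ B₀ ρ u B E Du μc μB 𝔇 ℭ) :
    Integrable (fun z : ℝ × Vec d => ρ z.1 z.2 * ‖u z.1 z.2‖ ^ 2) ((timeMeasure T).prod G.vol) := by
  have h1 := (h.kinetic_mem.memLp (q := 2) (by norm_num) le_top le_rfl (by norm_num)).integrable_norm_pow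
    (by norm_num)
  refine h1.congr ?_
  filter_upwards [h.density_nonneg] with z hz
  rw [norm_smul, mul_pow, Real.norm_of_nonneg (Real.sqrt_nonneg _), Real.sq_sqrt hz]

lemma integrable_momentum (h : IsDissipativeWeakSolution P G T ρ₀ m₀ B₀ ρ u B E Du μc μB 𝔇 ℭ) :
    Integrable (fun z : ℝ × Vec d => ρ z.1 z.2 • u z.1 z.2) ((timeMeasure T).prod G.vol) := by
  refine (h.integrable_density.add h.integrable_kinetic).mono'
    (h.density_mem.1.smul h.velocity_meas) ?_
  filter_upwards [h.density_nonneg] with z hz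
  rw [norm_smul, Real.norm_of_nonneg hz]
  simp only [Pi.add_apply]
  -- The bound used is `ρ‖u‖ ≤ ρ + ρ‖u‖²`.
  nlinarith [sq_nonneg (‖u z.1 z.2‖ - 1), norm_nonneg (u z.1 z.2)]

lemma integrable_tensor (h : IsDissipativeWeakSolution P G T ρ₀ m₀ B₀ ρ u B E Du μc μB 𝔇 ℭ) :
    Integrable (fun z : ℝ × Vec d => ρ z.1 z.2 • tensorT (u z.1 z.2) (u z.1 z.2))
      ((timeMeasure T).prod G.vol) := by
  refine h.integrable_kinetic.mono' (h.density_mem.1.smul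
    (continuous_tensorT.comp_aestronglyMeasurable (h.velocity_meas.prodMk h.velocity_meas))) ?_
  filter_upwards [h.density_nonneg] with z hz
  rw [norm_smul, Real.norm_of_nonneg hz, norm_tensorT, sq]

lemma memLp_magnetic (h : IsDissipativeWeakSolution P G T ρ₀ m₀ B₀ ρ u B E Du μc μB 𝔇 ℭ) :
    MemLp (fun z : ℝ × Vec d => B z.1 z.2) 2 ((timeMeasure T).prod G.vol) :=
  h.magnetic_mem.memLp (by norm_num) le_top le_rfl (by norm_num)

lemma memLp_grad (h : IsDissipativeWeakSolution P G T ρ₀ m₀ B₀ ρ u B E Du μc μB 𝔇 ℭ) :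
    MemLp (fun z : ℝ × Vec d => Du z.1 z.2) 2 ((timeMeasure T).prod G.vol) :=
  h.grad_mem.memLp (by norm_num) le_rfl le_rfl (by norm_num)

lemma memLp_stress (h : IsDissipativeWeakSolution P G T ρ₀ m₀ B₀ ρ u B E Du μc μB 𝔇 ℭ) :
    MemLp (fun z : ℝ × Vec d => P.stress (Du z.1 z.2)) 2 ((timeMeasure T).prod G.vol) := by
  simp only [← stressL_apply]
  exact P.stressL.comp_memLp' h.memLp_grad

lemma memLp_current (h : IsDissipativeWeakSolution P G T ρ₀ m₀ B₀ ρ u B E Du μc μB 𝔇 ℭ) :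
    MemLp (fun z : ℝ × Vec d => current (E z.1 z.2) (u z.1 z.2) (B z.1 z.2)) 2
      ((timeMeasure T).prod G.vol) :=
  h.current_mem.memLp (by norm_num) le_rfl le_rfl (by norm_num)

lemma integrable_electric (h : IsDissipativeWeakSolution P G T ρ₀ m₀ B₀ ρ u B E Du μc μB 𝔇 ℭ) :
    Integrable (fun z : ℝ × Vec d => E z.1 z.2) ((timeMeasure T).prod G.vol) := by
  have h1 : (1 : ℝ≥0∞) ≤ 3 / 2 := by
    rw [ENNReal.le_div_iff_mul_le (by norm_num) (by norm_num)]; norm_num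
  exact memLp_one_iff_integrable.1 (h.electric_mem.memLp (by norm_num) (by norm_num) h1
    (ENNReal.div_lt_top (by norm_num) (by norm_num)).ne)

lemma memLp_lift (h : IsDissipativeWeakSolution P G T ρ₀ m₀ B₀ ρ u B E Du μc μB 𝔇 ℭ) :
    MemLp (fun z : ℝ × Vec d => lift3 (B z.1 z.2)) 2 ((timeMeasure T).prod G.vol) := by
  simp only [← liftL_apply]
  exact (liftL d).comp_memLp' h.memLp_magnetic

lemma integrable_lorentz (h : IsDissipativeWeakSolution P G T ρ₀ m₀ B₀ ρ u B E Du μc μB 𝔇 ℭ) :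
    Integrable (fun z : ℝ × Vec d => cross (current (E z.1 z.2) (u z.1 z.2) (B z.1 z.2))
      (lift3 (B z.1 z.2))) ((timeMeasure T).prod G.vol) := by
  exact integrable_cross h.memLp_current h.memLp_lift

end IsDissipativeWeakSolution

end

/-! ### Testing the momentum equation with the classical velocity -/

/-- Here `x` collects the fluxes, which are only integrable, and `y n` a test field with its
derivative, bounded uniformly in `n`. The product bound on `Φ` provides the dominating function. -/
lemma tendsto_integral_of_eventually_eq {Z X Y : Type*} [MeasurableSpace Z] {μ : Measure Z}
    [NormedAddCommGroup X] [NormedAddCommGroup Y] {Φ : X → Y → ℝ} {C M : ℝ}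
    (hΦ : Continuous fun p : X × Y => Φ p.1 p.2) (hC : ∀ x y, |Φ x y| ≤ C * (‖x‖ * ‖y‖))
    (hC0 : 0 ≤ C) {x : Z → X} (hx : Integrable x μ) {y : ℕ → Z → Y} {y' : Z → Y}
    (hy : ∀ n, AEStronglyMeasurable (y n) μ) (hM : ∀ n, ∀ᵐ z ∂μ, ‖y n z‖ ≤ M)
    (hyy : ∀ᵐ z ∂μ, Tendsto (fun n => y n z) atTop (𝓝 (y' z))) :
    Tendsto (fun n => ∫ z, Φ (x z) (y n z) ∂μ) atTop (𝓝 (∫ z, Φ (x z) (y' z) ∂μ)) := by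
  refine tendsto_integral_of_dominated_convergence (fun z => C * (‖x z‖ * M)) (fun n => ?_)
    ((hx.norm.mul_const M).const_mul C) (fun n => ?_) ?_
  · exact hΦ.comp_aestronglyMeasurable (hx.aestronglyMeasurable.prodMk (hy n))
  · filter_upwards [hM n] with z hz
    exact (hC _ _).trans (by gcongr)
  · filter_upwards [hyy] with z hz
    exact (hΦ.tendsto (x z, y' z)).comp (tendsto_const_nhds.prodMk_nhds hz)

lemma integrable_of_bilinear_bound {Z X Y : Type*} [MeasurableSpace Z] {μ : Measure Z}
    [NormedAddCommGroup X] [NormedAddCommGroup Y] {Φ : X → Y → ℝ} {C M : ℝ}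
    (hΦ : Continuous fun p : X × Y => Φ p.1 p.2) (hC : ∀ x y, |Φ x y| ≤ C * (‖x‖ * ‖y‖))
    (hC0 : 0 ≤ C) {x : Z → X} (hx : Integrable x μ) {y : Z → Y}
    (hy : AEStronglyMeasurable y μ) (hM : ∀ᵐ z ∂μ, ‖y z‖ ≤ M) :
    Integrable (fun z => Φ (x z) (y z)) μ := by
  refine ((hx.norm.mul_const M).const_mul C).mono'
    (hΦ.comp_aestronglyMeasurable (hx.aestronglyMeasurable.prodMk hy)) ?_
  filter_upwards [hM] with z hz
  exact (hC _ _).trans (by gcongr)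

/-- The weak momentum balance as a bilinear expression in the fluxes and the test field. -/
def momentumForm {d : ℕ} (x : Vec d × Ten d × ℝ × Ten d × Vec 3)
    (y : (ℝ × Vec d →L[ℝ] Vec d) × Vec d) : ℝ :=
  inner ℝ x.1 (y.1 (1, 0))
    + inner ℝ x.2.1 (matL d (y.1.comp (ContinuousLinearMap.inr ℝ ℝ (Vec d))))
    + x.2.2.1 * traceL d (matL d (y.1.comp (ContinuousLinearMap.inr ℝ ℝ (Vec d))))
    - inner ℝ x.2.2.2.1 (matL d (y.1.comp (ContinuousLinearMap.inr ℝ ℝ (Vec d))))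
    + inner ℝ x.2.2.2.2 (liftL d y.2)

lemma continuous_momentumForm {d : ℕ} : Continuous fun p : (Vec d × Ten d × ℝ × Ten d × Vec 3) ×
    ((ℝ × Vec d →L[ℝ] Vec d) × Vec d) => momentumForm p.1 p.2 := by
  unfold momentumForm; fun_prop

lemma momentumForm_le {d : ℕ} : ∃ C, 0 ≤ C ∧ ∀ (x : Vec d × Ten d × ℝ × Ten d × Vec 3)
    (y : (ℝ × Vec d →L[ℝ] Vec d) × Vec d), |momentumForm x y| ≤ C * (‖x‖ * ‖y‖) := by
  set R : (ℝ × Vec d →L[ℝ] Vec d) → Ten d := fun L =>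
    matL d (L.comp (ContinuousLinearMap.inr ℝ ℝ (Vec d)))
  have hR : ∀ L, ‖R L‖ ≤ ‖matL d‖ * ‖L‖ := fun L => by
    refine ((matL d).le_opNorm _).trans ?_
    gcongr
    exact (ContinuousLinearMap.opNorm_comp_le _ _).trans
      (mul_le_of_le_one_right (norm_nonneg _) (ContinuousLinearMap.norm_inr_le_one ℝ ℝ (Vec d)))
  refine ⟨1 + ‖matL d‖ + ‖traceL d‖ * ‖matL d‖ + ‖matL d‖ + ‖liftL d‖, by positivity, ?_⟩
  rintro ⟨a, A, p, S, l⟩ ⟨L, v⟩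
  set x := (a, A, p, S, l)
  set y := (L, v)
  have ha : ‖a‖ ≤ ‖x‖ := norm_fst_le x
  have h2 : ‖x.2‖ ≤ ‖x‖ := norm_snd_le x
  have hA : ‖A‖ ≤ ‖x‖ := (norm_fst_le x.2).trans h2
  have h3 : ‖x.2.2‖ ≤ ‖x‖ := (norm_snd_le x.2).trans h2
  have hp : ‖p‖ ≤ ‖x‖ := (norm_fst_le x.2.2).trans h3
  have h4 : ‖x.2.2.2‖ ≤ ‖x‖ := (norm_snd_le x.2.2).trans h3
  have hS : ‖S‖ ≤ ‖x‖ := (norm_fst_le x.2.2.2).trans h4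
  have hl : ‖l‖ ≤ ‖x‖ := (norm_snd_le x.2.2.2).trans h4
  have hL : ‖L‖ ≤ ‖y‖ := norm_fst_le y
  have hv : ‖v‖ ≤ ‖y‖ := norm_snd_le y
  have hRy : ‖R L‖ ≤ ‖matL d‖ * ‖y‖ := (hR L).trans (by gcongr)
  have e1 : |(inner ℝ a (L (1, 0)) : ℝ)| ≤ ‖x‖ * ‖y‖ := by
    refine (abs_real_inner_le_norm _ _).trans (mul_le_mul ha ?_ (norm_nonneg _) (norm_nonneg _))
    refine (L.le_opNorm _).trans (le_trans (le_of_eq ?_) hL); simp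
  have e2 : ∀ A : Ten d, ‖A‖ ≤ ‖x‖ → |(inner ℝ A (R L) : ℝ)| ≤ ‖matL d‖ * (‖x‖ * ‖y‖) := fun A hA =>
    (abs_real_inner_le_norm _ _).trans ((mul_le_mul hA hRy (norm_nonneg _) (norm_nonneg _)).trans
      (le_of_eq (by ring)))
  have e3 : |p * traceL d (R L)| ≤ ‖traceL d‖ * ‖matL d‖ * (‖x‖ * ‖y‖) := by
    rw [abs_mul]
    have : |traceL d (R L)| ≤ ‖traceL d‖ * (‖matL d‖ * ‖y‖) :=
      ((traceL d).le_opNorm _).trans (by gcongr)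
    exact (mul_le_mul hp this (abs_nonneg _) (norm_nonneg _)).trans (le_of_eq (by ring))
  have e5 : |(inner ℝ l (liftL d v) : ℝ)| ≤ ‖liftL d‖ * (‖x‖ * ‖y‖) := by
    refine (abs_real_inner_le_norm _ _).trans
      ((mul_le_mul hl (((liftL d).le_opNorm v).trans
        (mul_le_mul_of_nonneg_left hv (norm_nonneg _))) (norm_nonneg _) (norm_nonneg _)).trans
      (le_of_eq (by ring)))
  have e4 := e2 S hS
  have e2' := e2 A hA
  rw [abs_le] at e1 e2' e3 e4 e5 ⊢
  simp only [momentumForm, x, y]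
  simp only [R, x, y] at *
  constructor <;> linarith

section

variable {d : ℕ} {P : Params d} {G : Geometry d} {T : ℝ}
  {ρ₀ : Vec d → ℝ} {m₀ B₀ : Vec d → Vec d} {ρ : ℝ → Vec d → ℝ} {u B : ℝ → Vec d → Vec d}
  {E : ℝ → Vec d → Vec 3} {Du : ℝ → Vec d → Ten d}
  {μc : ℝ → VectorMeasure G.closedCell (Ten d)} {μB : ℝ → VectorMeasure G.closedCell (Vec d)}
  {𝔇 : ℝ → Measure G.closedCell} {ℭ : Measure (Icc (0 : ℝ) T × G.closedCell)}

/-- The integrand of the weak momentum balance. -/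
def momentumIntegrand (P : Params d) (ρ : ℝ → Vec d → ℝ) (u B : ℝ → Vec d → Vec d)
    (E : ℝ → Vec d → Vec 3) (Du : ℝ → Vec d → Ten d) (φ : ℝ → Vec d → Vec d) (t : ℝ) (x : Vec d) :
    ℝ :=
  inner ℝ (ρ t x • u t x) (deriv (fun s => φ s x) t)
    + inner ℝ (ρ t x • tensorT (u t x) (u t x)) (grad (φ t) x)
    + P.pressure (ρ t x) * div (φ t) x
    - inner ℝ (P.stress (Du t x)) (grad (φ t) x)
    + inner ℝ (cross (current (E t x) (u t x) (B t x)) (lift3 (B t x))) (lift3 (φ t x))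

lemma momentumIntegrand_eq {φ : ℝ → Vec d → Vec d} (hφ : IsC1 G T φ) {t : ℝ} {x : Vec d}
    (ht : t ∈ Ioo 0 T) (hx : x ∈ G.region) :
    momentumIntegrand P ρ u B E Du φ t x = momentumForm (ρ t x • u t x,
      ρ t x • tensorT (u t x) (u t x), P.pressure (ρ t x), P.stress (Du t x),
      cross (current (E t x) (u t x) (B t x)) (lift3 (B t x)))
      (fderiv ℝ (fun z : ℝ × Vec d => φ z.1 z.2) (t, x), φ t x) := by
  simp only [momentumIntegrand, momentumForm, hφ.deriv_eq ht hx, grad_eq, div_eq, hφ.fderiv_eq ht hx,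
    traceL_apply, liftL_apply]

lemma norm_integral_vectorMeasure_le {X : Type*} [MeasurableSpace X] {V : Type*}
    [NormedAddCommGroup V] [InnerProductSpace ℝ V] {M : ℝ} (μ : VectorMeasure X V) {f : X → V}
    (hf : ∀ x, ‖f x‖ ≤ M) : ‖∫ᵛ x, f x ∂[innerSL ℝ; μ]‖ₑ ≤ ENNReal.ofReal M * μ.variation univ := by
  refine (VectorMeasure.enorm_integral_le_of_enorm_le_const (C := ENNReal.ofReal M)
    (Eventually.of_forall fun x => ?_)).trans ?_
  · rw [← ofReal_norm]; exact ENNReal.ofReal_le_ofReal (hf x)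
  · have : ‖(innerSL ℝ : V →L[ℝ] V →L[ℝ] ℝ)‖ₑ ≤ 1 := by
      rw [← ofReal_norm, ← ENNReal.ofReal_one]
      exact ENNReal.ofReal_le_ofReal (norm_innerSL_le ℝ)
    calc _ ≤ ENNReal.ofReal M * 1 * μ.variation univ := by gcongr
      _ = _ := by rw [mul_one]

/-- The estimate in extended norms requires no measurability of `f`, so it applies directly to the
pairings of the test field with the defect measures at time `t`. -/
lemma enorm_intervalIntegral_le {f : ℝ → ℝ} {g : ℝ → ℝ≥0∞} {M : ℝ} {τ : ℝ} (hτ : τ ∈ Ioo 0 T)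
    (h : ∀ t ∈ Ioo 0 T, ‖f t‖ₑ ≤ ENNReal.ofReal M * g t) :
    ‖∫ t in (0)..τ, f t‖ₑ ≤ ENNReal.ofReal M * ∫⁻ t in Ioc 0 τ, g t := by
  rw [intervalIntegral.integral_of_le hτ.1.le, ← lintegral_const_mul' _ _ ENNReal.ofReal_ne_top]
  refine (enorm_integral_le_lintegral_enorm _).trans ?_
  exact setLIntegral_mono' measurableSet_Ioc fun t ht => h t ⟨ht.1, ht.2.trans_lt hτ.2⟩

namespace IsDissipativeWeakSolution

lemma integrable_fluxes (h : IsDissipativeWeakSolution P G T ρ₀ m₀ B₀ ρ u B E Du μc μB 𝔇 ℭ) :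
    Integrable (fun z : ℝ × Vec d => (ρ z.1 z.2 • u z.1 z.2,
      ρ z.1 z.2 • tensorT (u z.1 z.2) (u z.1 z.2), P.pressure (ρ z.1 z.2), P.stress (Du z.1 z.2),
      cross (current (E z.1 z.2) (u z.1 z.2) (B z.1 z.2)) (lift3 (B z.1 z.2))))
      ((timeMeasure T).prod G.vol) :=
  h.integrable_momentum.prodMk (h.integrable_tensor.prodMk
    ((h.integrable_rpow.const_mul P.a).prodMk
      ((h.memLp_stress.integrable (by norm_num)).prodMk h.integrable_lorentz)))

lemma integrable_momentumIntegrand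
    (h : IsDissipativeWeakSolution P G T ρ₀ m₀ B₀ ρ u B E Du μc μB 𝔇 ℭ) {φ : ℝ → Vec d → Vec d}
    (hφ : IsC1 G T φ) :
    Integrable (fun z : ℝ × Vec d => momentumIntegrand P ρ u B E Du φ z.1 z.2)
      ((timeMeasure T).prod G.vol) := by
  obtain ⟨C, hC0, hC⟩ := momentumForm_le (d := d)
  obtain ⟨M, hM0, hM1, hM2⟩ := hφ.bound
  refine (integrable_of_bilinear_bound (M := M) continuous_momentumForm hC hC0 h.integrable_fluxes
    (y := fun z => (fderiv ℝ (fun z : ℝ × Vec d => φ z.1 z.2) z, φ z.1 z.2))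
    ((aestronglyMeasurable_cylinder hφ.continuousOn_fderiv).prodMk hφ.aestronglyMeasurable) ?_).congr ?_
  · filter_upwards [ae_mem_cylinder G T] with z hz
    exact max_le (hM2 _ hz.1 _ (subset_closure hz.2) (G.cell_subset_region hz.2))
      (hM1 _ (Ioo_subset_Icc_self hz.1) _ (subset_closure hz.2))
  · filter_upwards [ae_mem_cylinder G T] with z hz
    exact (momentumIntegrand_eq hφ hz.1 (G.cell_subset_region hz.2)).symm

/-- The momentum equation may be tested with a field that only vanishes on the boundary, up to
the defect measures. -/
lemma momentum_defect (h : IsDissipativeWeakSolution P G T ρ₀ m₀ B₀ ρ u B E Du μc μB 𝔇 ℭ)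
    (hm₀ : Integrable m₀ G.vol) {w : ℝ → Vec d → Vec d} (hw : IsC1 G T w)
    (h0 : ∀ t ∈ Icc 0 T, ∀ x ∈ frontier G.region, w t x = 0) (hT : 0 < T) :
    ∃ M : ℝ, ∀ᵐ τ ∂(timeMeasure T),
      ‖(∫ t in (0)..τ, ∫ x, momentumIntegrand P ρ u B E Du w t x ∂G.vol)
        - ((∫ x, inner ℝ (ρ τ x • u τ x) (w τ x) ∂G.vol) - ∫ x, inner ℝ (m₀ x) (w 0 x) ∂G.vol)‖ₑ
      ≤ ENNReal.ofReal M * ((∫⁻ t in Ioc 0 τ, (μc t).variation univ)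
        + ∫⁻ t in Ioc 0 τ, (μB t).variation univ) := by
  obtain ⟨φ, M, hφ⟩ := exists_isTruncation hw h0
  refine ⟨M, ?_⟩
  obtain ⟨C, hC0, hC⟩ := momentumForm_le (d := d)
  have hlim0 : ∀ t ∈ Icc 0 T, ∀ a : Vec d → Vec d, Integrable a G.vol →
      Tendsto (fun n => ∫ x, inner ℝ (a x) (φ n t x) ∂G.vol) atTop
        (𝓝 (∫ x, inner ℝ (a x) (w t x) ∂G.vol)) := by
    intro t ht a ha
    refine tendsto_integral_of_eventually_eq (C := 1) (M := M) (Φ := fun x y : Vec d => inner ℝ x y)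
      (by fun_prop) (fun x y => by rw [one_mul]; exact abs_real_inner_le_norm _ _) zero_le_one ha
      (fun n => ?_) (fun n => ?_) ?_
    · have : ContinuousOn (φ n t) (closure G.region) :=
        (hφ.isC1c n).1.continuousOn.comp (f := fun x => (t, x)) (by fun_prop) fun x hx => ⟨ht, hx⟩
      exact (this.mono (G.cell_subset_region.trans subset_closure)).aestronglyMeasurable
        G.measurableSet_cell
    · filter_upwards [G.ae_mem_cell] with x hx using hφ.norm_le n t ht x (subset_closure hx)
    · filter_upwards [G.ae_mem_cell] with x hx using hφ.tendsto t ht x (subset_closure hx)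
  have hall := ae_all_iff.2 fun n => h.momentum (φ n) (hφ.isC1c n)
  filter_upwards [hall, ae_timeMeasure_mem T, h.integrable_momentum.prod_right_ae] with τ hτ hτm hτi
  have hslab := slabMeasure_le (G := G) hτm
  have hlim1 : Tendsto (fun n => ∫ t in (0)..τ, ∫ x, momentumIntegrand P ρ u B E Du (φ n) t x ∂G.vol)
      atTop (𝓝 (∫ t in (0)..τ, ∫ x, momentumIntegrand P ρ u B E Du w t x ∂G.vol)) := by
    simp only [integral_slab (h.integrable_momentumIntegrand (hφ.isC1c _).1) hτm,
      integral_slab (h.integrable_momentumIntegrand hw) hτm]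
    have hcyl : ∀ᵐ z ∂(slabMeasure G τ), z.1 ∈ Ioo 0 T ∧ z.2 ∈ G.cell :=
      ae_mono hslab (ae_mem_cylinder G T)
    have e1 : ∀ ψ, IsC1 G T ψ → ∫ z, momentumIntegrand P ρ u B E Du ψ z.1 z.2 ∂(slabMeasure G τ)
        = ∫ z, momentumForm (ρ z.1 z.2 • u z.1 z.2,
      ρ z.1 z.2 • tensorT (u z.1 z.2) (u z.1 z.2), P.pressure (ρ z.1 z.2), P.stress (Du z.1 z.2),
      cross (current (E z.1 z.2) (u z.1 z.2) (B z.1 z.2)) (lift3 (B z.1 z.2)))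
      (fderiv ℝ (fun z : ℝ × Vec d => ψ z.1 z.2) z, ψ z.1 z.2) ∂(slabMeasure G τ) := by
      intro ψ hψ
      refine integral_congr_ae ?_
      filter_upwards [hcyl] with z hz
      exact momentumIntegrand_eq hψ hz.1 (G.cell_subset_region hz.2)
    simp only [fun n => e1 _ (hφ.isC1c n).1, e1 _ hw]
    refine tendsto_integral_of_eventually_eq (M := M) continuous_momentumForm hC hC0
      (h.integrable_fluxes.mono_measure hslab)
      (y := fun n z => (fderiv ℝ (fun z : ℝ × Vec d => φ n z.1 z.2) z, φ n z.1 z.2))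
      (y' := fun z => (fderiv ℝ (fun z : ℝ × Vec d => w z.1 z.2) z, w z.1 z.2))
      (fun n => ?_) (fun n => ?_) ?_
    · exact ((aestronglyMeasurable_cylinder (hφ.isC1c n).1.continuousOn_fderiv).prodMk
        (hφ.isC1c n).1.aestronglyMeasurable).mono_measure hslab
    · filter_upwards [hcyl] with z hz
      exact max_le (hφ.norm_fderiv_le n _ hz.1 _ hz.2)
        (hφ.norm_le n _ (Ioo_subset_Icc_self hz.1) _ (subset_closure hz.2))
    · filter_upwards [ae_mono hslab hφ.eventually_eq] with z hz
      refine tendsto_const_nhds.congr' ?_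
      filter_upwards [hz] with n hn
      rw [hn.1, hn.2]
  -- Only the bulk terms pass to the limit. The pairings with the defect measures are merely bounded
  -- uniformly in `n`, so the behaviour of `∇φ n` on the supports of these measures is irrelevant.
  refine le_of_tendsto (((hlim1.sub ((hlim0 τ (Ioo_subset_Icc_self hτm) _ hτi).sub
    (hlim0 0 ⟨le_rfl, hT.le⟩ _ hm₀))).enorm)) (Eventually.of_forall fun n => ?_)
  have hn := hτ n
  have e2 : (∫ t in (0)..τ, ∫ x, momentumIntegrand P ρ u B E Du (φ n) t x ∂G.vol)
      - ((∫ x, inner ℝ (ρ τ x • u τ x) (φ n τ x) ∂G.vol) - ∫ x, inner ℝ (m₀ x) (φ n 0 x) ∂G.vol)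
      = -((∫ t in (0)..τ, ∫ᵛ x, grad (φ n t) x ∂[innerSL ℝ; μc t])
        + ∫ t in (0)..τ, ∫ᵛ x, φ n t x ∂[innerSL ℝ; μB t]) := by
    simp only [momentumIntegrand]
    rw [← hn]; ring
  rw [e2, enorm_neg, mul_add]
  refine (enorm_add_le _ _).trans (add_le_add ?_ ?_)
  · exact enorm_intervalIntegral_le hτm fun t ht => norm_integral_vectorMeasure_le (μc t)
      fun x => hφ.norm_grad_le n t ht x x.2
  · exact enorm_intervalIntegral_le hτm fun t ht => norm_integral_vectorMeasure_le (μB t)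
      fun x => hφ.norm_le n t (Ioo_subset_Icc_self ht) x (G.closedCell_subset x.2)

end IsDissipativeWeakSolution

end

/-! ### The relative energy inequality -/

/-- The derivative `H'` of the pressure potential. -/
def Params.dpotential {d : ℕ} (P : Params d) (s : ℝ) : ℝ := P.a * P.γ / (P.γ - 1) * s ^ (P.γ - 1)

/-- This relation turns the part of the relative energy that involves `ρ'` alone into the pressure
`p(ρ')`. -/
lemma Params.pressure_eq {d : ℕ} (P : Params d) {s : ℝ} (hs : 0 < s) :
    P.pressure s = P.dpotential s * s - P.potential s := by
  have h1 : P.γ - 1 ≠ 0 := (sub_pos.2 P.one_lt_γ).ne'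
  have h2 : s ^ (P.γ - 1) * s = s ^ P.γ := by
    rw [← Real.rpow_add_one hs.ne', sub_add_cancel]
  rw [pressure, dpotential, potential, mul_assoc, h2]
  field_simp

lemma integral_combination {α : Type*} [MeasurableSpace α] {μ : Measure α}
    {f₁ f₂ f₃ f₄ f₅ f₆ : α → ℝ} (h₁ : Integrable f₁ μ) (h₂ : Integrable f₂ μ) (h₃ : Integrable f₃ μ)
    (h₄ : Integrable f₄ μ) (h₅ : Integrable f₅ μ) (h₆ : Integrable f₆ μ) :
    ∫ x, (f₁ x - f₂ x + f₃ x + f₄ x - f₅ x + f₆ x) ∂μ = (∫ x, f₁ x ∂μ) - (∫ x, f₂ x ∂μ)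
      + (∫ x, f₃ x ∂μ) + (∫ x, f₄ x ∂μ) - (∫ x, f₅ x ∂μ) + ∫ x, f₆ x ∂μ := by
  rw [integral_add (f := fun x => f₁ x - f₂ x + f₃ x + f₄ x - f₅ x)
      ((((h₁.sub h₂).add h₃).add h₄).sub h₅) h₆,
    integral_sub (f := fun x => f₁ x - f₂ x + f₃ x + f₄ x) (((h₁.sub h₂).add h₃).add h₄) h₅,
    integral_add (f := fun x => f₁ x - f₂ x + f₃ x) ((h₁.sub h₂).add h₃) h₄,
    integral_add (f := fun x => f₁ x - f₂ x) (h₁.sub h₂) h₃, integral_sub h₁ h₂]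

section C1

variable {d : ℕ} {F : Type*} [NormedAddCommGroup F] [NormedSpace ℝ F] {G : Geometry d} {T : ℝ}

lemma IsC1.continuousOn_slice {φ : ℝ → Vec d → F} (h : IsC1 G T φ) {t : ℝ} (ht : t ∈ Icc 0 T) :
    ContinuousOn (φ t) (closure G.cell) :=
  h.continuousOn.comp (f := fun x => (t, x)) (by fun_prop) fun _ hx => ⟨ht, G.closure_cell_subset hx⟩

lemma integrable_of_continuousOn {F : Type*} [NormedAddCommGroup F] {f : Vec d → F} (h : ContinuousOn f (closure G.cell)) :
    Integrable f G.vol := by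
  obtain ⟨M, hM⟩ := G.isCompact_closure_cell.exists_bound_of_continuousOn h
  refine Integrable.of_bound ((h.mono subset_closure).aestronglyMeasurable G.measurableSet_cell) M ?_
  filter_upwards [G.ae_mem_cell] with x hx using hM x (subset_closure hx)

lemma IsC1.integrable {φ : ℝ → Vec d → F} (h : IsC1 G T φ) :
    Integrable (fun z : ℝ × Vec d => φ z.1 z.2) ((timeMeasure T).prod G.vol) := by
  obtain ⟨M, hM0, hM1, hM2⟩ := h.bound
  refine Integrable.of_bound h.aestronglyMeasurable M ?_
  filter_upwards [ae_mem_cylinder G T] with z hz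
  exact hM1 _ (Ioo_subset_Icc_self hz.1) _ (subset_closure hz.2)

lemma IsC1.integrable_deriv {φ : ℝ → Vec d → F} (h : IsC1 G T φ) :
    Integrable (fun z : ℝ × Vec d => deriv (fun s => φ s z.2) z.1) ((timeMeasure T).prod G.vol) := by
  obtain ⟨M, hM0, hM1, hM2⟩ := h.bound
  refine Integrable.of_bound h.aestronglyMeasurable_deriv M ?_
  filter_upwards [ae_mem_cylinder G T] with z hz
  exact (h.norm_deriv_le hz.1 (G.cell_subset_region hz.2)).trans
    (hM2 _ hz.1 _ (subset_closure hz.2) (G.cell_subset_region hz.2))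

end C1

section

variable {d : ℕ} {P : Params d} {G : Geometry d} {T : ℝ}
  {ρ₀ : Vec d → ℝ} {u₀ m₀ B₀ : Vec d → Vec d} {ρ : ℝ → Vec d → ℝ} {u B : ℝ → Vec d → Vec d}
  {E : ℝ → Vec d → Vec 3} {Du : ℝ → Vec d → Ten d}
  {μc : ℝ → VectorMeasure G.closedCell (Ten d)} {μB : ℝ → VectorMeasure G.closedCell (Vec d)}
  {𝔇 : ℝ → Measure G.closedCell} {ℭ : Measure (Icc (0 : ℝ) T × G.closedCell)}
  {ρ' : ℝ → Vec d → ℝ} {u' B' : ℝ → Vec d → Vec d} {E' : ℝ → Vec d → Vec 3}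

/-- The test function `½ |u|² - H'(ρ)` for the continuity equation. -/
def continuityTest (P : Params d) (ρ' : ℝ → Vec d → ℝ) (u' : ℝ → Vec d → Vec d) (t : ℝ) (x : Vec d) :
    ℝ := 1 / 2 * ‖u' t x‖ ^ 2 - P.dpotential (ρ' t x)

/-- The relative energy density. -/
def relEnergy (P : Params d) (ρ ρ' : ℝ → Vec d → ℝ) (u u' B B' : ℝ → Vec d → Vec d) (t : ℝ)
    (x : Vec d) : ℝ :=
  1 / 2 * ρ t x * ‖u t x - u' t x‖ ^ 2 + 1 / 2 * ‖B t x - B' t x‖ ^ 2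
    + (P.potential (ρ t x) - P.dpotential (ρ' t x) * (ρ t x - ρ' t x) - P.potential (ρ' t x))

/-- The integrand of the weak continuity equation. -/
def continuityIntegrand (ρ : ℝ → Vec d → ℝ) (u : ℝ → Vec d → Vec d) (φ : ℝ → Vec d → ℝ) (t : ℝ)
    (x : Vec d) : ℝ :=
  ρ t x * deriv (fun s => φ s x) t + inner ℝ (ρ t x • u t x) (gradient (φ t) x)

/-- The integrand of the weak Maxwell equation. -/
def maxwellIntegrand (B : ℝ → Vec d → Vec d) (E : ℝ → Vec d → Vec 3) (φ : ℝ → Vec d → Vec d) (t : ℝ)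
    (x : Vec d) : ℝ :=
  inner ℝ (B t x) (deriv (fun s => φ s x) t) - inner ℝ (E t x) (curl (fun y => lift3 (φ t y)) x)

/-- The integrand on the right-hand side of the relative energy inequality. -/
def relIntegrand (P : Params d) (ρ ρ' : ℝ → Vec d → ℝ) (u u' B B' : ℝ → Vec d → Vec d)
    (E : ℝ → Vec d → Vec 3) (Du : ℝ → Vec d → Ten d) (t : ℝ) (x : Vec d) : ℝ :=
  - momentumIntegrand P ρ u B E Du u' t x + continuityIntegrand ρ u (continuityTest P ρ' u') t x
    + deriv (fun s => P.pressure (ρ' s x)) t - maxwellIntegrand B E B' t x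
    + deriv (fun s => 1 / 2 * ‖B' s x‖ ^ 2) t
    - (inner ℝ (P.stress (Du t x)) (Du t x) + ‖current (E t x) (u t x) (B t x)‖ ^ 2)

namespace IsClassicalSolution

/-- For `γ < 2` the function `H'` is not `C¹` at `0`; positivity of the classical density keeps the
argument away from there. -/
lemma continuityTest_C1 (h : IsClassicalSolution P G T ρ₀ u₀ B₀ ρ' u' B' E') :
    IsC1 G T (continuityTest P ρ' u') := by
  have h1 : ContDiffOn ℝ 1 (fun p : ℝ × Vec d => 1 / 2 * ‖p.2‖ ^ 2 - P.dpotential p.1)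
      (Ioi 0 ×ˢ univ) := by
    refine ContDiffOn.sub ?_ ?_
    · exact (contDiff_const.mul ((contDiff_norm_sq ℝ).comp contDiff_snd)).contDiffOn
    · exact contDiffOn_const.mul (contDiff_fst.contDiffOn.rpow_const_of_ne fun p hp => hp.1.ne')
  exact (h.density_C1.prodMk h.velocity_C1).comp (isOpen_Ioi.prod isOpen_univ) h1
    fun t ht x hx => ⟨h.density_pos t ht x hx, trivial⟩

lemma pressure_C1 (h : IsClassicalSolution P G T ρ₀ u₀ B₀ ρ' u' B' E') :
    IsC1 G T (fun t x => P.pressure (ρ' t x)) := by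
  have h1 : ContDiffOn ℝ 1 P.pressure (Ioi 0) :=
    contDiffOn_const.mul (contDiff_id.contDiffOn.rpow_const_of_ne fun p hp =>
      (ne_of_gt hp : p ≠ 0))
  exact h.density_C1.comp isOpen_Ioi h1 fun t ht x hx => h.density_pos t ht x hx

lemma magneticEnergy_C1 (h : IsClassicalSolution P G T ρ₀ u₀ B₀ ρ' u' B' E') :
    IsC1 G T (fun t x => 1 / 2 * ‖B' t x‖ ^ 2) :=
  h.magnetic_C1.comp (g := fun b : Vec d => 1 / 2 * ‖b‖ ^ 2) isOpen_univ
    (contDiff_const.mul (contDiff_norm_sq ℝ)).contDiffOn fun _ _ _ _ => trivial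

/-- The relative energy of the data vanishes. -/
lemma initial_balance (h : IsClassicalSolution P G T ρ₀ u₀ B₀ ρ' u' B' E') (hT : 0 < T) :
    (∫ x, (1 / 2 * (‖ρ₀ x • u₀ x‖ ^ 2 / ρ₀ x) + 1 / 2 * ‖B₀ x‖ ^ 2 + P.potential (ρ₀ x)) ∂G.vol)
      - (∫ x, inner ℝ (ρ₀ x • u₀ x) (u' 0 x) ∂G.vol)
      + (∫ x, ρ₀ x * continuityTest P ρ' u' 0 x ∂G.vol) + (∫ x, P.pressure (ρ' 0 x) ∂G.vol)
      - (∫ x, inner ℝ (B₀ x) (B' 0 x) ∂G.vol) + (∫ x, 1 / 2 * ‖B' 0 x‖ ^ 2 ∂G.vol) = 0 := by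
  have h0 : (0 : ℝ) ∈ Icc 0 T := ⟨le_rfl, hT.le⟩
  have hcl : ∀ x ∈ G.cell, x ∈ closure G.region := fun x hx => subset_closure (G.cell_subset_region hx)
  have hpos : ∀ x ∈ closure G.cell, 0 < ρ' 0 x := fun x hx =>
    h.density_pos 0 h0 x (G.closure_cell_subset hx)
  have cρ := h.density_C1.continuousOn_slice h0
  have cu := h.velocity_C1.continuousOn_slice h0
  have cB := h.magnetic_C1.continuousOn_slice h0
  have cH : ContinuousOn (fun x => P.potential (ρ' 0 x)) (closure G.cell) :=
    continuousOn_const.mul (cρ.rpow_const fun x hx => Or.inl (hpos x hx).ne')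
  have e1 : ∫ x, (1 / 2 * (‖ρ₀ x • u₀ x‖ ^ 2 / ρ₀ x) + 1 / 2 * ‖B₀ x‖ ^ 2 + P.potential (ρ₀ x)) ∂G.vol
      = ∫ x, (1 / 2 * (ρ' 0 x * ‖u' 0 x‖ ^ 2) + 1 / 2 * ‖B' 0 x‖ ^ 2 + P.potential (ρ' 0 x)) ∂G.vol := by
    refine G.integral_congr fun x hx => ?_
    have hp := hpos x (subset_closure hx)
    rw [← h.initial_density x (hcl x hx), ← h.initial_velocity x (hcl x hx),
      ← h.initial_magnetic x (hcl x hx), norm_smul, Real.norm_of_nonneg hp.le]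
    field_simp
  have e2 : ∫ x, inner ℝ (ρ₀ x • u₀ x) (u' 0 x) ∂G.vol = ∫ x, ρ' 0 x * ‖u' 0 x‖ ^ 2 ∂G.vol := by
    refine G.integral_congr fun x hx => ?_
    rw [← h.initial_density x (hcl x hx), ← h.initial_velocity x (hcl x hx), real_inner_smul_left,
      real_inner_self_eq_norm_sq]
  have e3 : ∫ x, ρ₀ x * continuityTest P ρ' u' 0 x ∂G.vol
      = ∫ x, ρ' 0 x * continuityTest P ρ' u' 0 x ∂G.vol := by
    refine G.integral_congr fun x hx => ?_
    rw [← h.initial_density x (hcl x hx)]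
  have e4 : ∫ x, inner ℝ (B₀ x) (B' 0 x) ∂G.vol = ∫ x, ‖B' 0 x‖ ^ 2 ∂G.vol := by
    refine G.integral_congr fun x hx => ?_
    rw [← h.initial_magnetic x (hcl x hx), real_inner_self_eq_norm_sq]
  have i1 : Integrable (fun x => 1 / 2 * (ρ' 0 x * ‖u' 0 x‖ ^ 2) + 1 / 2 * ‖B' 0 x‖ ^ 2
      + P.potential (ρ' 0 x)) G.vol := integrable_of_continuousOn (by fun_prop)
  have i2 : Integrable (fun x => ρ' 0 x * ‖u' 0 x‖ ^ 2) G.vol :=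
    integrable_of_continuousOn (by fun_prop)
  have i3 : Integrable (fun x => ρ' 0 x * continuityTest P ρ' u' 0 x) G.vol :=
    integrable_of_continuousOn (cρ.mul (h.continuityTest_C1.continuousOn_slice h0))
  have i4 : Integrable (fun x => P.pressure (ρ' 0 x)) G.vol :=
    integrable_of_continuousOn (h.pressure_C1.continuousOn_slice h0)
  have i5 : Integrable (fun x => ‖B' 0 x‖ ^ 2) G.vol := integrable_of_continuousOn (by fun_prop)
  have i6 : Integrable (fun x => 1 / 2 * ‖B' 0 x‖ ^ 2) G.vol := i5.const_mul _
  rw [e1, e2, e3, e4, ← integral_combination i1 i2 i3 i4 i5 i6,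
    G.integral_congr (g := fun _ => 0), integral_zero]
  intro x hx
  have := P.pressure_eq (hpos x (subset_closure hx))
  simp only [continuityTest]
  rw [this]; ring

end IsClassicalSolution

lemma abs_dual_le {V : Type*} [NormedAddCommGroup V] [NormedSpace ℝ V] (x : V) (y : V →L[ℝ] ℝ) :
    |y x| ≤ 1 * (‖x‖ * ‖y‖) := by
  rw [one_mul, mul_comm]; exact y.le_opNorm x

namespace IsDissipativeWeakSolution

lemma integrable_continuityIntegrand
    (h : IsDissipativeWeakSolution P G T ρ₀ m₀ B₀ ρ u B E Du μc μB 𝔇 ℭ) {φ : ℝ → Vec d → ℝ}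
    (hφ : IsC1 G T φ) :
    Integrable (fun z : ℝ × Vec d => continuityIntegrand ρ u φ z.1 z.2)
      ((timeMeasure T).prod G.vol) := by
  obtain ⟨M, hM0, hM1, hM2⟩ := hφ.bound
  refine (integrable_of_bilinear_bound (M := M)
    (Φ := fun (x : ℝ × Vec d) (y : ℝ × Vec d →L[ℝ] ℝ) => y x) (by fun_prop) abs_dual_le zero_le_one
    (h.integrable_density.prodMk h.integrable_momentum)
    (aestronglyMeasurable_cylinder hφ.continuousOn_fderiv) ?_).congr ?_
  · filter_upwards [ae_mem_cylinder G T] with z hz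
    exact hM2 _ hz.1 _ (subset_closure hz.2) (G.cell_subset_region hz.2)
  · filter_upwards [ae_mem_cylinder G T] with z hz
    have hzr := G.cell_subset_region hz.2
    rw [continuityIntegrand, hφ.deriv_eq hz.1 hzr, real_inner_comm, inner_gradient_left,
      hφ.fderiv_eq hz.1 hzr, ContinuousLinearMap.comp_apply, ContinuousLinearMap.inr_apply]
    have : (ρ z.1 z.2, ρ z.1 z.2 • u z.1 z.2)
        = ρ z.1 z.2 • ((1 : ℝ), (0 : Vec d)) + (0, ρ z.1 z.2 • u z.1 z.2) := by simp
    rw [this, map_add, map_smul, smul_eq_mul]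

lemma integrable_maxwellIntegrand
    (h : IsDissipativeWeakSolution P G T ρ₀ m₀ B₀ ρ u B E Du μc μB 𝔇 ℭ) {φ : ℝ → Vec d → Vec d}
    (hφ : IsC1 G T φ) :
    Integrable (fun z : ℝ × Vec d => maxwellIntegrand B E φ z.1 z.2)
      ((timeMeasure T).prod G.vol) := by
  obtain ⟨M, hM0, hM1, hM2⟩ := hφ.bound
  have hM2' : ∀ᵐ z ∂((timeMeasure T).prod G.vol), ‖fderiv ℝ (fun z : ℝ × Vec d => φ z.1 z.2) z‖ ≤ M := by
    filter_upwards [ae_mem_cylinder G T] with z hz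
    exact hM2 _ hz.1 _ (subset_closure hz.2) (G.cell_subset_region hz.2)
  have hcurl : ∀ᵐ z ∂((timeMeasure T).prod G.vol), curl (fun y => lift3 (φ z.1 y)) z.2
      = curlL d ((liftL d).comp (fderiv ℝ (φ z.1) z.2)) := by
    filter_upwards [ae_mem_cylinder G T] with z hz
    have h1 := (hφ.hasFDerivAt_space hz.1 (G.cell_subset_region hz.2)).differentiableAt
    simp only [← liftL_apply]
    rw [curl_eq]
    exact congrArg _ (((liftL d).hasFDerivAt.comp z.2 h1.hasFDerivAt).fderiv)
  refine (integrable_inner_of_bound (N := M) (h.memLp_magnetic.integrable (by norm_num))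
    hφ.aestronglyMeasurable_deriv ?_).sub (integrable_inner_of_bound
      (N := ‖curlL d‖ * (‖liftL d‖ * M)) h.integrable_electric ?_ ?_)
  · filter_upwards [ae_mem_cylinder G T, hM2'] with z hz hz'
    exact (hφ.norm_deriv_le hz.1 (G.cell_subset_region hz.2)).trans hz'
  · refine AEStronglyMeasurable.congr ?_ (hcurl.mono fun z hz => hz.symm)
    exact (curlL d).continuous.comp_aestronglyMeasurable
      (((ContinuousLinearMap.compL ℝ (Vec d) (Vec d) (Vec 3)) (liftL d)).continuous.comp_aestronglyMeasurable
        hφ.aestronglyMeasurable_fderiv)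
  · filter_upwards [ae_mem_cylinder G T, hM2', hcurl] with z hz hz' hzc
    rw [hzc]
    refine ((curlL d).le_opNorm _).trans ?_
    gcongr
    refine (ContinuousLinearMap.opNorm_comp_le _ _).trans ?_
    gcongr
    exact (hφ.norm_fderiv_le hz.1 (G.cell_subset_region hz.2)).trans hz'

lemma integrable_dissipation
    (h : IsDissipativeWeakSolution P G T ρ₀ m₀ B₀ ρ u B E Du μc μB 𝔇 ℭ) :
    Integrable (fun z : ℝ × Vec d => inner ℝ (P.stress (Du z.1 z.2)) (Du z.1 z.2)
      + ‖current (E z.1 z.2) (u z.1 z.2) (B z.1 z.2)‖ ^ 2) ((timeMeasure T).prod G.vol) :=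
  (integrable_inner_of_memLp h.memLp_stress h.memLp_grad).add
    ((memLp_two_iff_integrable_sq_norm h.memLp_current.1).1 h.memLp_current)

lemma integrable_energy
    (h : IsDissipativeWeakSolution P G T ρ₀ m₀ B₀ ρ u B E Du μc μB 𝔇 ℭ) :
    Integrable (fun z : ℝ × Vec d => 1 / 2 * ρ z.1 z.2 * ‖u z.1 z.2‖ ^ 2
      + 1 / 2 * ‖B z.1 z.2‖ ^ 2 + P.potential (ρ z.1 z.2)) ((timeMeasure T).prod G.vol) := by
  simp only [mul_assoc]
  exact ((h.integrable_kinetic.const_mul _).add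
    (((memLp_two_iff_integrable_sq_norm h.memLp_magnetic.1).1 h.memLp_magnetic).const_mul _)).add
    (h.integrable_rpow.const_mul _)

lemma integrable_inner_momentum
    (h : IsDissipativeWeakSolution P G T ρ₀ m₀ B₀ ρ u B E Du μc μB 𝔇 ℭ) {φ : ℝ → Vec d → Vec d}
    (hφ : IsC1 G T φ) : Integrable (fun z : ℝ × Vec d =>
      (inner ℝ (ρ z.1 z.2 • u z.1 z.2) (φ z.1 z.2) : ℝ)) ((timeMeasure T).prod G.vol) := by
  obtain ⟨M, hM0, hM1, hM2⟩ := hφ.bound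
  refine integrable_inner_of_bound (N := M) h.integrable_momentum hφ.aestronglyMeasurable ?_
  filter_upwards [ae_mem_cylinder G T] with z hz
  exact hM1 _ (Ioo_subset_Icc_self hz.1) _ (subset_closure hz.2)

lemma integrable_inner_magnetic
    (h : IsDissipativeWeakSolution P G T ρ₀ m₀ B₀ ρ u B E Du μc μB 𝔇 ℭ) {φ : ℝ → Vec d → Vec d}
    (hφ : IsC1 G T φ) : Integrable (fun z : ℝ × Vec d =>
      (inner ℝ (B z.1 z.2) (φ z.1 z.2) : ℝ)) ((timeMeasure T).prod G.vol) := by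
  obtain ⟨M, hM0, hM1, hM2⟩ := hφ.bound
  refine integrable_inner_of_bound (N := M) (h.memLp_magnetic.integrable (by norm_num))
    hφ.aestronglyMeasurable ?_
  filter_upwards [ae_mem_cylinder G T] with z hz
  exact hM1 _ (Ioo_subset_Icc_self hz.1) _ (subset_closure hz.2)

lemma integrable_density_mul
    (h : IsDissipativeWeakSolution P G T ρ₀ m₀ B₀ ρ u B E Du μc μB 𝔇 ℭ) {φ : ℝ → Vec d → ℝ}
    (hφ : IsC1 G T φ) : Integrable (fun z : ℝ × Vec d => ρ z.1 z.2 * φ z.1 z.2)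
      ((timeMeasure T).prod G.vol) := by
  obtain ⟨M, hM0, hM1, hM2⟩ := hφ.bound
  refine (integrable_inner_of_bound (N := M) h.integrable_density hφ.aestronglyMeasurable ?_).congr
    (Eventually.of_forall fun z => by simp [mul_comm])
  filter_upwards [ae_mem_cylinder G T] with z hz
  exact hM1 _ (Ioo_subset_Icc_self hz.1) _ (subset_closure hz.2)

/-- Expanding the squares, the relative energy is the energy minus `ρu · u'` plus `ρ (½|u'|² -
H'(ρ'))` plus `p(ρ')` minus `B · B'` plus `½|B'|²`. Each part is integrable, and each is the
quantity balanced by one of the relations combined in `relative_energy`. -/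
lemma integrable_relEnergy
    (h : IsDissipativeWeakSolution P G T ρ₀ (fun x => ρ₀ x • u₀ x) B₀ ρ u B E Du μc μB 𝔇 ℭ)
    (hc : IsClassicalSolution P G T ρ₀ u₀ B₀ ρ' u' B' E') :
    Integrable (fun z : ℝ × Vec d => relEnergy P ρ ρ' u u' B B' z.1 z.2)
      ((timeMeasure T).prod G.vol) := by
  refine (((((h.integrable_energy.sub (h.integrable_inner_momentum hc.velocity_C1)).add
    (h.integrable_density_mul hc.continuityTest_C1)).add hc.pressure_C1.integrable).sub
    (h.integrable_inner_magnetic hc.magnetic_C1)).add hc.magneticEnergy_C1.integrable).congr ?_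
  filter_upwards [ae_mem_cylinder G T] with z hz
  have := P.pressure_eq (hc.density_pos z.1 (Ioo_subset_Icc_self hz.1) z.2
    (subset_closure (G.cell_subset_region hz.2)))
  simp only [Pi.add_apply, Pi.sub_apply, continuityTest, relEnergy, norm_sub_sq_real, this,
    real_inner_smul_left]
  ring

lemma integrable_relIntegrand
    (h : IsDissipativeWeakSolution P G T ρ₀ (fun x => ρ₀ x • u₀ x) B₀ ρ u B E Du μc μB 𝔇 ℭ)
    (hc : IsClassicalSolution P G T ρ₀ u₀ B₀ ρ' u' B' E') :
    Integrable (fun z : ℝ × Vec d => relIntegrand P ρ ρ' u u' B B' E Du z.1 z.2)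
      ((timeMeasure T).prod G.vol) :=
  (((((h.integrable_momentumIntegrand hc.velocity_C1).neg.add
    (h.integrable_continuityIntegrand hc.continuityTest_C1)).add hc.pressure_C1.integrable_deriv).sub
    (h.integrable_maxwellIntegrand hc.magnetic_C1)).add hc.magneticEnergy_C1.integrable_deriv).sub
    h.integrable_dissipation

/-- The relative energy inequality. -/
lemma relative_energy
    (h : IsDissipativeWeakSolution P G T ρ₀ (fun x => ρ₀ x • u₀ x) B₀ ρ u B E Du μc μB 𝔇 ℭ)
    (hc : IsClassicalSolution P G T ρ₀ u₀ B₀ ρ' u' B' E') (hT : 0 < T) :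
    ∃ M : ℝ, ∀ᵐ τ ∂(timeMeasure T),
      ENNReal.ofReal ((∫ x, relEnergy P ρ ρ' u u' B B' τ x ∂G.vol) + (𝔇 τ).real univ
        + ℭ.real {z | (z.1 : ℝ) ≤ τ}
        - ∫ t in (0)..τ, ∫ x, relIntegrand P ρ ρ' u u' B B' E Du t x ∂G.vol)
      ≤ ENNReal.ofReal M * ((∫⁻ t in Ioc 0 τ, (μc t).variation univ)
        + ∫⁻ t in Ioc 0 τ, (μB t).variation univ) := by
  have h0 : (0 : ℝ) ∈ Icc 0 T := ⟨le_rfl, hT.le⟩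
  have hm₀ : Integrable (fun x => ρ₀ x • u₀ x) G.vol := by
    have : Integrable (fun x => ρ' 0 x • u' 0 x) G.vol := integrable_of_continuousOn
      ((hc.density_C1.continuousOn_slice h0).smul (hc.velocity_C1.continuousOn_slice h0))
    refine this.congr ?_
    filter_upwards [G.ae_mem_cell] with x hx
    have hx' : x ∈ closure G.region := subset_closure (G.cell_subset_region hx)
    rw [hc.initial_density x hx', hc.initial_velocity x hx']
  obtain ⟨M, hM⟩ := h.momentum_defect hm₀ hc.velocity_C1 hc.noslip hT
  refine ⟨M, ?_⟩
  have j1 := h.integrable_momentumIntegrand hc.velocity_C1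
  have j2 := h.integrable_continuityIntegrand hc.continuityTest_C1
  have j3 := hc.pressure_C1.integrable_deriv
  have j4 := h.integrable_maxwellIntegrand hc.magnetic_C1
  have j5 := hc.magneticEnergy_C1.integrable_deriv
  have j6 := h.integrable_dissipation
  have k1 := h.integrable_energy
  have k2 := h.integrable_inner_momentum hc.velocity_C1
  have k3 := h.integrable_density_mul hc.continuityTest_C1
  have k4 := hc.pressure_C1.integrable
  have k5 := h.integrable_inner_magnetic hc.magnetic_C1
  have k6 := hc.magneticEnergy_C1.integrable
  filter_upwards [hM, ae_timeMeasure_mem T, h.energy, h.continuity _ hc.continuityTest_C1,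
    h.maxwell _ hc.magnetic_C1 hc.magnetic_normal, k1.prod_right_ae, k2.prod_right_ae,
    k3.prod_right_ae, k4.prod_right_ae, k5.prod_right_ae, k6.prod_right_ae]
    with τ hMτ hτ hen hco hma l1 l2 l3 l4 l5 l6
  have hs := slabMeasure_le (G := G) hτ
  have eX : ∫ x, relEnergy P ρ ρ' u u' B B' τ x ∂G.vol = _ :=
    (G.integral_congr (f := fun x => relEnergy P ρ ρ' u u' B B' τ x) fun x hx => by
      have := P.pressure_eq (hc.density_pos τ (Ioo_subset_Icc_self hτ) x
        (subset_closure (G.cell_subset_region hx)))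
      simp only [continuityTest, relEnergy, norm_sub_sq_real, this, real_inner_smul_left]
      ring).trans (integral_combination l1 l2 l3 l4 l5 l6)
  have eQ : ∫ t in (0)..τ, ∫ x, relIntegrand P ρ ρ' u u' B B' E Du t x ∂G.vol = _ :=
    (integral_slab (h.integrable_relIntegrand hc) hτ).trans <|
      (integral_congr_ae (Eventually.of_forall fun z => by
        simp only [relIntegrand, Pi.neg_apply]; ring)).trans
      (integral_combination (j2.mono_measure hs) (j1.mono_measure hs) (j3.mono_measure hs)
        (j5.mono_measure hs) (j4.mono_measure hs) (j6.mono_measure hs).neg)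
  simp only [Pi.neg_apply, integral_neg] at eQ
  rw [← integral_slab j1 hτ, ← integral_slab j2 hτ, 
    ← integral_slab (f := fun t x => deriv (fun s => P.pressure (ρ' s x)) t) j3 hτ,
    ← integral_slab j4 hτ,
    ← integral_slab (f := fun t x => deriv (fun s => 1 / 2 * ‖B' s x‖ ^ 2) t) j5 hτ,
    ← integral_slab (f := fun t x => inner ℝ (P.stress (Du t x)) (Du t x)
      + ‖current (E t x) (u t x) (B t x)‖ ^ 2) j6 hτ] at eQ
  have hini := hc.initial_balance hT
  have f3 := hc.pressure_C1.integral_deriv hτ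
  have f5 := hc.magneticEnergy_C1.integral_deriv hτ
  -- The energy inequality is combined with the momentum, continuity and Maxwell equations and with
  -- the exact time balances of `p(ρ')` and `½|B'|²`. The initial terms cancel by `initial_balance`,
  -- and the error comes from the momentum equation only.
  refine le_trans ?_ hMτ
  rw [← ofReal_norm]
  refine ENNReal.ofReal_le_ofReal (le_trans ?_ (Real.le_norm_self _))
  have hco' : ∫ t in (0)..τ, ∫ x, continuityIntegrand ρ u (continuityTest P ρ' u') t x ∂G.vol = _ := hco
  have hma' : ∫ t in (0)..τ, ∫ x, maxwellIntegrand B E B' t x ∂G.vol = _ := hma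
  rw [eX, eQ]
  linarith

end IsDissipativeWeakSolution

end

/-! ### Control of the defect measures -/

/-- An inequality tested with continuous functions of time localizes to `(0, τ]`. -/
lemma lintegral_Ioc_le_of_test {T : ℝ} {X : Type*} [MeasurableSpace X] {a b : ℝ → ℝ≥0∞}
    {ν : Measure (Icc (0 : ℝ) T × X)} [IsFiniteMeasure ν] (hb : AEMeasurable b (timeMeasure T))
    (hb' : ∫⁻ t, b t ∂(timeMeasure T) ≠ ⊤)
    (h : ∀ ψ : ℝ → ℝ, ContinuousOn ψ (Icc 0 T) → (∀ t ∈ Icc 0 T, 0 ≤ ψ t) →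
      ∫⁻ t, ENNReal.ofReal (ψ t) * a t ∂(timeMeasure T)
        ≤ (∫⁻ t, ENNReal.ofReal (ψ t) * b t ∂(timeMeasure T)) + ∫⁻ z, ENNReal.ofReal (ψ z.1) ∂ν)
    {τ : ℝ} (hτ : τ ∈ Ioo 0 T) :
    ∫⁻ t in Ioc 0 τ, a t ≤ (∫⁻ t in Ioc 0 τ, b t) + ν {z | (z.1 : ℝ) ≤ τ} := by
  -- `ψ n` is `1` up to `τ` and falls linearly to `0` at `τ + 1/n`. As it is exactly `1` on `(0,
  -- τ]`, the left side needs no limit and `a` no measurability; the right side converges by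
  -- domination.
  let ψ : ℕ → ℝ → ℝ := fun n t => max 0 (min 1 (1 - n * (t - τ)))
  have hψc : ∀ n, Continuous (ψ n) := fun n => by fun_prop
  have hψ0 : ∀ n t, 0 ≤ ψ n t := fun n t => le_max_left _ _
  have hψ1 : ∀ n t, ψ n t ≤ 1 := fun n t => max_le zero_le_one (min_le_left _ _)
  have hψ2 : ∀ n t, t ≤ τ → ψ n t = 1 := fun n t ht => by
    have : 1 ≤ 1 - n * (t - τ) := by nlinarith [Nat.cast_nonneg (α := ℝ) n]
    simp only [ψ, min_eq_left this, zero_le_one, max_eq_right]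
  have hlim : ∀ t, Tendsto (fun n => ENNReal.ofReal (ψ n t)) atTop
      (𝓝 ((Iic τ).indicator (fun _ => 1) t)) := by
    intro t
    by_cases ht : t ≤ τ
    · simp only [hψ2 _ t ht, ENNReal.ofReal_one, indicator_of_mem (mem_Iic.2 ht)]
      exact tendsto_const_nhds
    · rw [indicator_of_notMem (by simpa using ht)]
      refine tendsto_const_nhds.congr' ?_
      obtain ⟨N, hN⟩ := exists_nat_gt (1 / (t - τ))
      filter_upwards [eventually_ge_atTop N] with n hn
      have h1 : 0 < t - τ := sub_pos.2 (not_le.1 ht)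
      have h2 : (1 : ℝ) / (t - τ) < n := hN.trans_le (by exact_mod_cast hn)
      rw [div_lt_iff₀ h1] at h2
      have h3 : ψ n t = 0 := max_eq_left ((min_le_right _ _).trans (by linarith))
      rw [h3, ENNReal.ofReal_zero]
  have hle : ∀ n, ∫⁻ t in Ioc 0 τ, a t ≤ (∫⁻ t, ENNReal.ofReal (ψ n t) * b t ∂(timeMeasure T))
      + ∫⁻ z, ENNReal.ofReal (ψ n z.1) ∂ν := by
    intro n
    refine le_trans ?_ (h (ψ n) (hψc n).continuousOn fun t _ => hψ0 n t)
    have hsub : Ioc 0 τ ⊆ Ioo 0 T := fun s hs => ⟨hs.1, hs.2.trans_lt hτ.2⟩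
    calc ∫⁻ t in Ioc 0 τ, a t = ∫⁻ t in Ioc 0 τ, ENNReal.ofReal (ψ n t) * a t :=
          setLIntegral_congr_fun measurableSet_Ioc fun t ht => by
            simp only [hψ2 n t ht.2, ENNReal.ofReal_one, one_mul]
      _ ≤ _ := lintegral_mono' (Measure.restrict_mono hsub le_rfl) le_rfl
  refine ge_of_tendsto' (x := atTop) (Tendsto.add ?_ ?_) hle
  · have h1 : ∫⁻ t in Ioc 0 τ, b t = ∫⁻ t, (Iic τ).indicator (fun _ => 1) t * b t ∂(timeMeasure T) := by
      have e1 : ∀ t, (Iic τ).indicator (fun _ => (1 : ℝ≥0∞)) t * b t = (Iic τ).indicator b t := fun t => by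
        by_cases ht : t ∈ Iic τ <;> simp [ht]
      simp only [e1]
      rw [lintegral_indicator measurableSet_Iic, timeMeasure, Measure.restrict_restrict measurableSet_Iic]
      congr 2
      ext t
      simp only [mem_Ioc, mem_inter_iff, mem_Iic, mem_Ioo]
      exact ⟨fun ht => ⟨ht.2, ht.1, ht.2.trans_lt hτ.2⟩, fun ht => ⟨ht.2.1, ht.1⟩⟩
    rw [h1]
    refine tendsto_lintegral_of_dominated_convergence' b (fun n => ?_) (fun n => ?_) hb' ?_
    · exact ((hψc n).measurable.ennreal_ofReal.aemeasurable).mul hb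
    · refine Eventually.of_forall fun t => mul_le_of_le_one_left' ?_
      rw [← ENNReal.ofReal_one]; exact ENNReal.ofReal_le_ofReal (hψ1 n t)
    · have : ∀ᵐ t ∂(timeMeasure T), b t < ⊤ := ae_lt_top' hb hb'
      filter_upwards [this] with t ht
      exact ENNReal.Tendsto.mul_const (hlim t) (Or.inr ht.ne)
  · have hm : MeasurableSet {z : Icc (0 : ℝ) T × X | (z.1 : ℝ) ≤ τ} :=
      measurableSet_le (measurable_subtype_coe.comp measurable_fst) measurable_const
    have h1 : ν {z | (z.1 : ℝ) ≤ τ} = ∫⁻ z, (Iic τ).indicator (fun _ => 1) (z.1 : ℝ) ∂ν := by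
      rw [← lintegral_indicator_one hm]; rfl
    rw [h1]
    refine tendsto_lintegral_of_dominated_convergence (fun _ => 1) (fun n => ?_) (fun n => ?_) ?_ ?_
    · exact ((hψc n).measurable.comp (measurable_subtype_coe.comp measurable_fst)).ennreal_ofReal
    · refine Eventually.of_forall fun z => ?_
      rw [← ENNReal.ofReal_one]; exact ENNReal.ofReal_le_ofReal (hψ1 n _)
    · simp
    · exact Eventually.of_forall fun z => hlim _

section

variable {d : ℕ} {P : Params d} {G : Geometry d} {T : ℝ}
  {ρ₀ : Vec d → ℝ} {u₀ m₀ B₀ : Vec d → Vec d} {ρ : ℝ → Vec d → ℝ} {u B : ℝ → Vec d → Vec d}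
  {E : ℝ → Vec d → Vec 3} {Du : ℝ → Vec d → Ten d}
  {μc : ℝ → VectorMeasure G.closedCell (Ten d)} {μB : ℝ → VectorMeasure G.closedCell (Vec d)}
  {𝔇 : ℝ → Measure G.closedCell} {ℭ : Measure (Icc (0 : ℝ) T × G.closedCell)}
  {ρ' : ℝ → Vec d → ℝ} {u' B' : ℝ → Vec d → Vec d} {E' : ℝ → Vec d → Vec 3}

namespace IsDissipativeWeakSolution

lemma lintegral_defect_ne_top (h : IsDissipativeWeakSolution P G T ρ₀ m₀ B₀ ρ u B E Du μc μB 𝔇 ℭ) :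
    ∫⁻ t, 𝔇 t univ ∂(timeMeasure T) ≠ ⊤ := by
  have h1 : AEStronglyMeasurable (fun t => 𝔇 t univ) (timeMeasure T) :=
    (h.energyDefect_meas univ MeasurableSet.univ).aestronglyMeasurable
  have h2 := eLpNorm_le_eLpNorm_mul_rpow_measure_univ (p := 1) (q := ⊤) le_top h1
  rw [eLpNorm_one_eq_lintegral_enorm] at h2
  simp only [enorm_eq_self] at h2
  refine (h2.trans_lt (ENNReal.mul_lt_top h.energyDefect_mem ?_)).ne
  exact (ENNReal.rpow_ne_top_of_nonneg (by simp) (measure_ne_top _ _)).lt_top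

lemma integrable_defect (h : IsDissipativeWeakSolution P G T ρ₀ m₀ B₀ ρ u B E Du μc μB 𝔇 ℭ) :
    Integrable (fun t => (𝔇 t).real univ) (timeMeasure T) :=
  integrable_toReal_of_lintegral_ne_top (h.energyDefect_meas univ MeasurableSet.univ)
    h.lintegral_defect_ne_top

lemma lintegral_defect_eq (h : IsDissipativeWeakSolution P G T ρ₀ m₀ B₀ ρ u B E Du μc μB 𝔇 ℭ)
    {τ : ℝ} (hτ : τ ∈ Ioo 0 T) :
    ∫⁻ t in Ioc 0 τ, 𝔇 t univ = ENNReal.ofReal (∫ t in (0)..τ, (𝔇 t).real univ) := by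
  have hsub : Ioc 0 τ ⊆ Ioo 0 T := fun s hs => ⟨hs.1, hs.2.trans_lt hτ.2⟩
  have hle : volume.restrict (Ioc 0 τ) ≤ timeMeasure T := Measure.restrict_mono hsub le_rfl
  have hm := h.energyDefect_meas univ MeasurableSet.univ
  rw [intervalIntegral.integral_of_le hτ.1.le]
  have h1 : ∀ᵐ t ∂(volume.restrict (Ioc 0 τ)), 𝔇 t univ < ⊤ :=
    ae_mono hle (ae_lt_top' hm h.lintegral_defect_ne_top)
  rw [show (fun t => (𝔇 t).real univ) = fun t => (𝔇 t univ).toReal from rfl,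
    integral_toReal (hm.mono_measure hle) h1, ENNReal.ofReal_toReal]
  exact ((lintegral_mono' hle le_rfl).trans_lt h.lintegral_defect_ne_top.lt_top).ne

/-- The relative energy inequality with the concentration defects absorbed. -/
lemma relative_energy_absorbed
    (h : IsDissipativeWeakSolution P G T ρ₀ (fun x => ρ₀ x • u₀ x) B₀ ρ u B E Du μc μB 𝔇 ℭ)
    (hc : IsClassicalSolution P G T ρ₀ u₀ B₀ ρ' u' B' E') (hT : 0 < T) :
    ∃ K : ℝ, 0 ≤ K ∧ ∀ᵐ τ ∂(timeMeasure T),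
      (∫ x, relEnergy P ρ ρ' u u' B B' τ x ∂G.vol) + (𝔇 τ).real univ
        + 1 / 2 * ℭ.real {z | (z.1 : ℝ) ≤ τ}
      ≤ (∫ t in (0)..τ, ∫ x, relIntegrand P ρ ρ' u u' B B' E Du t x ∂G.vol)
        + K * ∫ t in (0)..τ, (𝔇 t).real univ := by
  have := h.dissipationDefect_finite
  have hm := h.energyDefect_meas univ MeasurableSet.univ
  obtain ⟨M, hM⟩ := h.relative_energy hc hT
  obtain ⟨C₁, hC₁⟩ := h.compat_muc
  obtain ⟨C₂, hC₂⟩ := h.compat_muB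
  set N : ℝ≥0 := M.toNNReal with hN
  have hMN : ENNReal.ofReal M = N := rfl
  -- With this choice the contribution of `ℭ` on the right is at most `½ ℭ`, and half of `ℭ`
  -- survives on the left. The price is a large but fixed factor `ε⁻¹` in front of the integral of
  -- `𝔇`.
  set ε : ℝ≥0 := (2 * (N * C₂ + 1))⁻¹ with hε
  have hε0 : 0 < ε := by positivity
  have hεle : (N * C₂ * ε : ℝ) ≤ 1 / 2 := by
    rw [hε]
    push_cast
    rw [← div_eq_mul_inv, div_le_div_iff₀ (by positivity) (by norm_num)]
    linarith
  have htop := h.lintegral_defect_ne_top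
  have b1 : ∀ τ ∈ Ioo 0 T, ∫⁻ t in Ioc 0 τ, (μc t).variation univ
      ≤ C₁ * ∫⁻ t in Ioc 0 τ, 𝔇 t univ := by
    intro τ hτ
    have := lintegral_Ioc_le_of_test (X := G.closedCell) (ν := (0 : Measure _))
      (b := fun t => C₁ * 𝔇 t univ) (a := fun t => (μc t).variation univ) (hm.const_mul _)
      (by rw [lintegral_const_mul' _ _ ENNReal.coe_ne_top]
          exact ENNReal.mul_ne_top ENNReal.coe_ne_top htop)
      (fun ψ h1 h2 => by
        refine (hC₁ ψ h1 h2).trans (le_of_eq ?_)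
        rw [← lintegral_const_mul' _ _ ENNReal.coe_ne_top, lintegral_zero_measure, add_zero]
        refine lintegral_congr fun t => by ring) hτ
    rwa [lintegral_const_mul' _ _ ENNReal.coe_ne_top, Measure.coe_zero, Pi.zero_apply, add_zero] at this
  have b2 : ∀ τ ∈ Ioo 0 T, ∫⁻ t in Ioc 0 τ, (μB t).variation univ
      ≤ C₂ * ((ε⁻¹ : ℝ≥0) * ∫⁻ t in Ioc 0 τ, 𝔇 t univ) + C₂ * ε * ℭ {z | (z.1 : ℝ) ≤ τ} := by
    intro τ hτ
    have := lintegral_Ioc_le_of_test (X := G.closedCell) (ν := (C₂ * ε) • ℭ)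
      (b := fun t => (C₂ * (ε⁻¹ : ℝ≥0)) * 𝔇 t univ) (a := fun t => (μB t).variation univ) (hm.const_mul _)
      (by rw [lintegral_const_mul' _ _ (by finiteness)]
          exact ENNReal.mul_ne_top (by finiteness) htop)
      (fun ψ h1 h2 => by
        refine (hC₂ ε hε0 ψ h1 h2).trans (le_of_eq ?_)
        rw [lintegral_smul_measure, mul_add, ← mul_assoc, ← lintegral_const_mul' _ _ (by finiteness)]
        congr 1
        · exact lintegral_congr fun t => by ring
        · rw [← mul_assoc, ENNReal.smul_def, smul_eq_mul, ENNReal.coe_mul]) hτ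
    rw [lintegral_const_mul' _ _ (by finiteness), mul_assoc] at this
    refine this.trans (le_of_eq ?_)
    rw [Measure.smul_apply, ENNReal.smul_def, smul_eq_mul, ENNReal.coe_mul]
  refine ⟨N * C₁ + N * C₂ * (ε⁻¹ : ℝ≥0), by positivity, ?_⟩
  filter_upwards [hM, ae_timeMeasure_mem T] with τ hMτ hτ
  set I := ∫ t in (0)..τ, (𝔇 t).real univ
  have hI : 0 ≤ I := intervalIntegral.integral_nonneg hτ.1.le fun t _ => measureReal_nonneg
  set c := ℭ.real {z | (z.1 : ℝ) ≤ τ} with hcdef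
  have hc0 : 0 ≤ c := measureReal_nonneg
  have hcc : ℭ {z | (z.1 : ℝ) ≤ τ} = ENNReal.ofReal c := by
    rw [hcdef, measureReal_def, ENNReal.ofReal_toReal (measure_ne_top _ _)]
  have b1τ := b1 τ hτ
  have b2τ := b2 τ hτ
  rw [h.lintegral_defect_eq hτ] at b1τ b2τ
  rw [hcc] at b2τ
  have hfin := hMτ.trans (mul_le_mul_right (add_le_add b1τ b2τ) _)
  rw [hMN] at hfin
  have e1 : (N : ℝ≥0∞) * (C₁ * ENNReal.ofReal I + (C₂ * ((ε⁻¹ : ℝ≥0) * ENNReal.ofReal I)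
      + C₂ * ε * ENNReal.ofReal c)) = ENNReal.ofReal (N * (C₁ * I + (C₂ * ((ε⁻¹ : ℝ≥0) * I)
      + C₂ * ε * c))) := by
    rw [ENNReal.ofReal_mul (by positivity), ENNReal.ofReal_add (by positivity) (by positivity),
      ENNReal.ofReal_add (by positivity) (by positivity), ENNReal.ofReal_mul (by positivity),
      ENNReal.ofReal_mul (by positivity), ENNReal.ofReal_mul (by positivity),
      ENNReal.ofReal_mul (by positivity), ENNReal.ofReal_mul (by positivity)]
    simp only [ENNReal.ofReal_coe_nnreal]
  rw [e1, ENNReal.ofReal_le_ofReal_iff (by positivity)] at hfin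
  have h5 : N * C₂ * ε * c ≤ 1 / 2 * c := mul_le_mul_of_nonneg_right hεle hc0
  nlinarith

end IsDissipativeWeakSolution

end

/-! ### The relative pressure potential -/

/-- The relative potential `H(r) - H'(s)(r - s) - H(s)`. -/
def Params.relPotential {d : ℕ} (P : Params d) (r s : ℝ) : ℝ :=
  P.potential r - P.dpotential s * (r - s) - P.potential s

lemma Params.coeff_pos {d : ℕ} (P : Params d) : 0 < P.a / (P.γ - 1) :=
  div_pos P.a_pos (sub_pos.2 P.one_lt_γ)

lemma Params.hasDerivAt_potential {d : ℕ} (P : Params d) {s : ℝ} (hs : 0 < s) :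
    HasDerivAt P.potential (P.dpotential s) s := by
  have := (Real.hasDerivAt_rpow_const (x := s) (p := P.γ) (Or.inl hs.ne')).const_mul (P.a / (P.γ - 1))
  refine this.congr_deriv ?_
  rw [dpotential]; ring

lemma Params.hasDerivAt_dpotential {d : ℕ} (P : Params d) {s : ℝ} (hs : 0 < s) :
    HasDerivAt P.dpotential (P.a * P.γ * s ^ (P.γ - 2)) s := by
  have := (Real.hasDerivAt_rpow_const (x := s) (p := P.γ - 1) (Or.inl hs.ne')).const_mul
    (P.a * P.γ / (P.γ - 1))
  have h1 : P.γ - 1 ≠ 0 := (sub_pos.2 P.one_lt_γ).ne'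
  refine this.congr_deriv ?_
  rw [show P.γ - 1 - 1 = P.γ - 2 by ring]
  field_simp

lemma Params.convexOn_relPotential {d : ℕ} (P : Params d) (s : ℝ) :
    ConvexOn ℝ (Ici 0) (fun r => P.relPotential r s) := by
  have h1 : ConvexOn ℝ (Ici 0) P.potential :=
    (convexOn_rpow P.one_lt_γ.le).smul P.coeff_pos.le
  have h2 : ConvexOn ℝ (Ici (0 : ℝ)) fun r => -(P.dpotential s * (r - s)) - P.potential s := by
    refine ⟨convex_Ici 0, fun x _ y _ a b _ _ hab => le_of_eq ?_⟩
    have : b = 1 - a := by linarith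
    subst this
    simp only [smul_eq_mul]; ring
  refine (h1.add h2).congr fun r _ => ?_
  simp only [relPotential, Pi.add_apply]; ring

lemma Params.relPotential_self {d : ℕ} (P : Params d) (s : ℝ) : P.relPotential s s = 0 := by
  simp [relPotential]

/-- Near `s` the relative potential dominates the square of the distance. -/
lemma Params.sq_le_relPotential {d : ℕ} (P : Params d) {l m : ℝ} (hl : 0 < l) :
    ∃ c > 0, ∀ r ∈ Ioo l m, ∀ s ∈ Ioo l m, c * (r - s) ^ 2 ≤ P.relPotential r s := by
  have hγ := one_pos.trans P.one_lt_γ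
  have ha := P.a_pos
  -- `b` bounds `r ^ (γ - 2)` from below on the interval. The minimum over both ends covers either
  -- sign of `γ - 2`.
  set b := min (l ^ (P.γ - 2)) (max l m ^ (P.γ - 2)) with hb
  have hm : 0 < max l m := lt_max_of_lt_left hl
  have hb0 : 0 < b := lt_min (Real.rpow_pos_of_pos hl _) (Real.rpow_pos_of_pos hm _)
  have hbr : ∀ r ∈ Ioo l m, b ≤ r ^ (P.γ - 2) := by
    intro r hr
    rcases le_total 0 (P.γ - 2) with h | h
    · exact (min_le_left _ _).trans (Real.rpow_le_rpow hl.le hr.1.le h)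
    · exact (min_le_right _ _).trans (Real.rpow_le_rpow_of_nonpos (hl.trans hr.1)
        (hr.2.le.trans (le_max_right _ _)) h)
  refine ⟨P.a * P.γ * b / 2, by positivity, fun r hr s hs => ?_⟩
  -- Since `H''(r) = aγ r ^ (γ - 2) ≥ aγ b`, the function `H` stays convex after subtraction of this
  -- quadratic. Its tangent inequality at `s` is the claim.
  set f : ℝ → ℝ := fun r => P.potential r - P.a * P.γ * b / 2 * r ^ 2 with hf
  have hpos : ∀ r ∈ Ioo l m, 0 < r := fun r hr => hl.trans hr.1
  have hf1 : ∀ r ∈ Ioo l m, HasDerivAt f (P.dpotential r - P.a * P.γ * b * r) r := fun r hr => by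
    have := (P.hasDerivAt_potential (hpos r hr)).sub
      ((hasDerivAt_pow 2 r).const_mul (P.a * P.γ * b / 2))
    refine this.congr_deriv ?_
    push_cast; ring
  have hf2 : ∀ r ∈ Ioo l m, HasDerivAt (fun r => P.dpotential r - P.a * P.γ * b * r)
      (P.a * P.γ * r ^ (P.γ - 2) - P.a * P.γ * b) r := fun r hr => by
    have := (P.hasDerivAt_dpotential (hpos r hr)).sub ((hasDerivAt_id r).const_mul (P.a * P.γ * b))
    rw [mul_one] at this; exact this
  have hconv : ConvexOn ℝ (Ioo l m) f := by
    refine convexOn_of_hasDerivWithinAt2_nonneg (f' := fun r => P.dpotential r - P.a * P.γ * b * r)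
      (f'' := fun r => P.a * P.γ * r ^ (P.γ - 2) - P.a * P.γ * b) (convex_Ioo l m)
      (fun r hr => (hf1 r hr).continuousAt.continuousWithinAt) ?_ ?_ ?_
    · intro r hr; rw [interior_Ioo] at hr ⊢; exact (hf1 r hr).hasDerivWithinAt
    · intro r hr; rw [interior_Ioo] at hr ⊢; exact (hf2 r hr).hasDerivWithinAt
    · intro r hr; rw [interior_Ioo] at hr
      rw [← mul_sub]
      exact mul_nonneg (by positivity) (sub_nonneg.2 (hbr r hr))
  have htan : f s + (P.dpotential s - P.a * P.γ * b * s) * (r - s) ≤ f r := by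
    rcases lt_trichotomy s r with h | h | h
    · have := hconv.le_slope_of_hasDerivAt hs hr h (hf1 s hs)
      rw [slope_def_field, le_div_iff₀ (sub_pos.2 h)] at this
      linarith
    · rw [h]; simp
    · have := hconv.slope_le_of_hasDerivAt hr hs h (hf1 s hs)
      rw [slope_def_field, div_le_iff₀ (sub_pos.2 h)] at this
      linarith
  simp only [hf] at htan
  rw [relPotential]
  nlinarith

/-- Away from `s` the relative potential dominates the distance. -/
lemma Params.relPotential_bound {d : ℕ} (P : Params d) {m M : ℝ} (hm : 0 < m) :
    ∃ C ≥ 0, ∀ s ∈ Icc m M, ∀ r, 0 ≤ r → 0 ≤ P.relPotential r s ∧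
      ((r - s) ^ 2 ≤ C * P.relPotential r s ∨ |r - s| ≤ C * P.relPotential r s) := by
  obtain ⟨c, hc, hcs⟩ := P.sq_le_relPotential (l := m / 4) (m := M + m) (by positivity)
  -- If `|r - s| ≤ m/2`, both points lie in `(m/4, M + m)` and the quadratic bound applies. Farther
  -- away convexity gives growth at least linear.
  refine ⟨max c⁻¹ ((c * (m / 2))⁻¹), by positivity, fun s hs r hr => ?_⟩
  have hsI : s ∈ Ioo (m / 4) (M + m) := ⟨by linarith [hs.1], by linarith [hs.2]⟩
  by_cases hrs : |r - s| ≤ m / 2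
  · rw [abs_le] at hrs
    have h1 := hcs r ⟨by linarith [hs.1], by linarith [hs.2]⟩ s hsI
    have h0 : 0 ≤ P.relPotential r s := le_trans (by positivity) h1
    refine ⟨h0, Or.inl ?_⟩
    calc (r - s) ^ 2 = c⁻¹ * (c * (r - s) ^ 2) := by field_simp
      _ ≤ c⁻¹ * P.relPotential r s := by gcongr
      _ ≤ _ := by gcongr; exact le_max_left _ _
  · have hrs' := not_le.1 hrs
    have hpos : 0 < |r - s| := lt_trans (by positivity) hrs'
    -- `θ` is chosen so that `θ r + (1 - θ) s` has distance exactly `m/2` from `s`. The relative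
    -- potential vanishes at `s`, so by convexity its value at this point is at most `θ` times its
    -- value at `r`.
    set θ := m / 2 / |r - s| with hθ
    have hθ0 : 0 < θ := by positivity
    have hθ1 : θ ≤ 1 := (div_le_one hpos).2 hrs'.le
    have hθa : θ * |r - s| = m / 2 := by rw [hθ]; field_simp
    have h2 := (P.convexOn_relPotential s).2 (show r ∈ Ici (0 : ℝ) from hr)
      (show s ∈ Ici (0 : ℝ) from hm.le.trans hs.1) hθ0.le (sub_nonneg.2 hθ1) (by ring)
    simp only [smul_eq_mul, P.relPotential_self, mul_zero, add_zero] at h2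
    have h3 : θ * r + (1 - θ) * s - s = θ * (r - s) := by ring
    have h4 : |θ * (r - s)| = m / 2 := by rw [abs_mul, abs_of_pos hθ0, hθa]
    have h5 := abs_le.1 h4.le
    have h6 := hcs (θ * r + (1 - θ) * s) ⟨by linarith [hs.1], by linarith [hs.2]⟩ s hsI
    rw [h3, ← sq_abs, h4] at h6
    have h7 : c * (m / 2) ^ 2 ≤ θ * P.relPotential r s := h6.trans h2
    have h8 : c * (m / 2) * |r - s| ≤ P.relPotential r s := by
      have : c * (m / 2) ^ 2 * |r - s| ≤ θ * |r - s| * P.relPotential r s := by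
        calc _ ≤ (θ * P.relPotential r s) * |r - s| := by gcongr
          _ = _ := by ring
      rw [hθa] at this
      have hm2 : 0 < m / 2 := by positivity
      nlinarith
    have h0 : 0 ≤ P.relPotential r s := le_trans (by positivity) h8
    refine ⟨h0, Or.inr ?_⟩
    calc |r - s| = (c * (m / 2))⁻¹ * (c * (m / 2) * |r - s|) := by field_simp
      _ ≤ (c * (m / 2))⁻¹ * P.relPotential r s := by gcongr
      _ ≤ _ := by gcongr; exact le_max_right _ _

/-- The error term of the density is absorbed by the relative energy. -/
lemma Params.mul_le_relPotential {d : ℕ} (P : Params d) {m M δ : ℝ} (hm : 0 < m) (hmM : m ≤ M)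
    (hδ : 0 < δ) :
    ∃ C ≥ 0, ∀ s ∈ Icc m M, ∀ r, 0 ≤ r → ∀ x, 0 ≤ x →
      |r - s| * x ≤ C * (P.relPotential r s + r * x ^ 2) + δ * x ^ 2 := by
  obtain ⟨C, hC, h⟩ := P.relPotential_bound (M := M) hm
  have hM : 0 < M := hm.trans_le hmM
  refine ⟨C / (4 * δ) + M * C / (4 * δ) + C + 1, by positivity, fun s hs r hr x hx => ?_⟩
  obtain ⟨h0, h1⟩ := h s hs r hr
  have hyoung : ∀ y : ℝ, y * x ≤ y ^ 2 / (4 * δ) + δ * x ^ 2 := fun y => by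
    have : 0 ≤ (y - 2 * δ * x) ^ 2 / (4 * δ) := by positivity
    have e : (y - 2 * δ * x) ^ 2 / (4 * δ) = y ^ 2 / (4 * δ) - y * x + δ * x ^ 2 := by
      field_simp; ring
    linarith
  have hrx : 0 ≤ r * x ^ 2 := by positivity
  have p1 : 0 ≤ C / (4 * δ) * P.relPotential r s := by positivity
  have p2 : 0 ≤ M * C / (4 * δ) * P.relPotential r s := by positivity
  have p3 : 0 ≤ C * P.relPotential r s := by positivity
  have p4 : 0 ≤ (C / (4 * δ) + M * C / (4 * δ) + C) * (r * x ^ 2) := by positivity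
  have hx2 : 0 ≤ δ * x ^ 2 := by positivity
  rcases h1 with h1 | h1
  · have h2 := hyoung |r - s|
    rw [sq_abs] at h2
    have h3 : (r - s) ^ 2 / (4 * δ) ≤ C / (4 * δ) * P.relPotential r s := by
      rw [div_mul_eq_mul_div]; gcongr
    nlinarith
  -- In the linear regime there are two cases. If `r ≥ s`, then `x ≤ 1 + x²` and `|r - s| ≤ r` lead
  -- to the kinetic term `r x²`; if `r ≤ s`, then `|r - s| ≤ M`, so the linear bound implies a
  -- quadratic one and Young's inequality applies.
  · rcases le_total s r with hsr | hsr
    · have h2 : |r - s| * x ≤ |r - s| * (1 + x ^ 2) := by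
        gcongr; nlinarith [sq_nonneg (x - 1)]
      have h3 : |r - s| ≤ r := by
        rw [abs_of_nonneg (sub_nonneg.2 hsr)]; linarith [hs.1]
      have h4 : |r - s| * x ^ 2 ≤ r * x ^ 2 := by gcongr
      nlinarith
    · have h2 := hyoung |r - s|
      have h3 : |r - s| ≤ M := by
        rw [abs_of_nonpos (sub_nonpos.2 hsr)]; linarith [hs.2]
      have h4 : |r - s| ^ 2 / (4 * δ) ≤ M * C / (4 * δ) * P.relPotential r s := by
        rw [div_mul_eq_mul_div]
        gcongr
        calc |r - s| ^ 2 = |r - s| * |r - s| := sq _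
          _ ≤ M * (C * P.relPotential r s) := by gcongr
          _ = _ := by ring
      nlinarith

/-! ### The pointwise identity for the integrand of the relative energy inequality -/

lemma mulT_add {d : ℕ} (A : Ten d) (v w : Vec d) : mulT A (v + w) = mulT A v + mulT A w := by
  ext i; simp [mulT, mul_add, Finset.sum_add_distrib]

lemma mulT_smul {d : ℕ} (A : Ten d) (c : ℝ) (v : Vec d) : mulT A (c • v) = c • mulT A v := by
  ext i; simp only [mulT, PiLp.smul_apply, smul_eq_mul, Finset.mul_sum]
  exact Finset.sum_congr rfl fun j _ => by ring

lemma stress_sub {d : ℕ} (P : Params d) (A B : Ten d) :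
    P.stress (A - B) = P.stress A - P.stress B := by
  rw [← stressL_apply, map_sub, stressL_apply, stressL_apply]

lemma lift3_sub {d : ℕ} (v w : Vec d) : lift3 (v - w) = lift3 v - lift3 w := (liftL d).map_sub v w

/-- All derivatives at one point are replaced by free variables: `st`, `ut`, `bt` stand for time
derivatives of the classical fields, `gs` and `A` for the gradients of its density and velocity, `X`
for `accelForce`, `c` for its current and `Ce` for the curl of its electric field. The hypothesis
`hh` is `H''(s) s = p'(s)`. The last three groups added on the left are work terms whose space
integrals vanish. -/
lemma relative_algebra {d : ℕ} (hd : d ≤ 3) (P : Params d) {r s st pr ps p₁ h₂ : ℝ}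
    {u u' ut gs dS X B B' bt : Vec d} {U A : Ten d} {E c Ce : Vec 3} (hs : s ≠ 0) (hh : h₂ * s = p₁)
    (hρ : st + inner ℝ gs u' + s * traceT A = 0) (hX : X = s • ut + s • mulT A u' + p₁ • gs)
    (hm : lift3 X = lift3 dS + cross c (lift3 B')) (hB : lift3 bt + Ce = 0) :
    -(inner ℝ (r • u) ut + inner ℝ (r • tensorT u u) A + pr * traceT A - inner ℝ (P.stress U) A
        + inner ℝ (cross (E + cross (lift3 u) (lift3 B)) (lift3 B)) (lift3 u'))
      + (r * (inner ℝ u' ut - h₂ * st) + (inner ℝ u' (mulT A (r • u)) - h₂ * inner ℝ gs (r • u)))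
      + p₁ * st - (inner ℝ B bt - inner ℝ E c) + inner ℝ B' bt
      - (inner ℝ (P.stress U) U + ‖E + cross (lift3 u) (lift3 B)‖ ^ 2)
      + (ps * traceT A + p₁ * inner ℝ gs u')
      + (inner ℝ (P.stress A) (U - A) + inner ℝ dS (u - u'))
      - (inner ℝ (lift3 (B - B')) Ce - inner ℝ (E + cross (lift3 u) (lift3 B) - c)
        (c - cross (lift3 u') (lift3 B')))
    = -inner ℝ (P.stress (U - A)) (U - A) - ‖E + cross (lift3 u) (lift3 B) - c‖ ^ 2
      + (-(r * inner ℝ (u - u') (mulT A (u - u'))) - (r - s) / s * inner ℝ X (u - u')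
        - (pr - p₁ * (r - s) - ps) * traceT A
        + inner ℝ (E + cross (lift3 u) (lift3 B) - c) (cross (lift3 u') (lift3 (B - B')))
        - inner ℝ c (cross (lift3 (u - u')) (lift3 (B - B')))) := by
  have e1 := lorentz_identity E c (lift3 u) (lift3 u') (lift3 B) (lift3 B')
  simp only [← lift3_sub] at e1
  have e2 : (inner ℝ X (u - u') : ℝ)
      = inner ℝ dS (u - u') + inner ℝ (cross c (lift3 B')) (lift3 (u - u')) := by
    rw [← inner_lift3 hd, hm, inner_add_left, inner_lift3 hd]
  have e3 : (inner ℝ (lift3 (B - B')) Ce : ℝ) = -(inner ℝ B bt - inner ℝ B' bt) := by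
    rw [eq_neg_of_add_eq_zero_right hB, inner_neg_right, inner_lift3 hd, inner_sub_left]
  have e4 : (inner ℝ (P.stress (U - A)) (U - A) : ℝ) = inner ℝ (P.stress U) U
      - inner ℝ (P.stress U) A - inner ℝ (P.stress A) (U - A) := by
    rw [stress_sub, inner_sub_left, inner_sub_right (P.stress U)]
  have hu : u = (u - u') + u' := by abel
  have e5 : (inner ℝ X (u - u') : ℝ)
      = s * (inner ℝ (u - u') ut + inner ℝ (u - u') (mulT A u')) + p₁ * inner ℝ gs (u - u') := by
    rw [hX, inner_add_left, inner_add_left, real_inner_smul_left, real_inner_smul_left,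
      real_inner_smul_left, real_inner_comm ut, real_inner_comm (mulT A u')]
    ring
  have e6 : (inner ℝ u (mulT A u) : ℝ) - inner ℝ u' (mulT A u)
      = inner ℝ (u - u') (mulT A (u - u')) + inner ℝ (u - u') (mulT A u') := by
    rw [← inner_sub_left, ← inner_add_right, ← mulT_add, sub_add_cancel]
  have e7 : (inner ℝ u ut : ℝ) - inner ℝ u' ut = inner ℝ (u - u') ut := by rw [inner_sub_left]
  have e8 : (inner ℝ gs (u - u') : ℝ) = inner ℝ gs u - inner ℝ gs u' := inner_sub_right _ _ _
  -- Splitting `(r - s)/s` into `r/s - 1` separates the part to be expanded by the definition of `X`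
  -- from the part to be replaced by means of the momentum balance `e2`.
  have e9 : (r - s) / s * inner ℝ X (u - u') = r * (inner ℝ (u - u') ut
      + inner ℝ (u - u') (mulT A u')) + r * h₂ * inner ℝ gs (u - u') - inner ℝ X (u - u') := by
    have : r / s * inner ℝ X (u - u') = r * (inner ℝ (u - u') ut
      + inner ℝ (u - u') (mulT A u')) + r * h₂ * inner ℝ gs (u - u') := by
      rw [e5, ← hh]; field_simp
    rw [← this]; field_simp
  have e10 : r * h₂ * (st + inner ℝ gs u' + s * traceT A) = 0 := by rw [hρ, mul_zero]
  have e11 : p₁ * (st + inner ℝ gs u' + s * traceT A) = 0 := by rw [hρ, mul_zero]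
  have e12 : r * h₂ * (s * traceT A) = r * p₁ * traceT A := by rw [← hh]; ring
  rw [e3, e4, e9, e2, e8]
  simp only [real_inner_smul_left, real_inner_smul_right, inner_tensorT, mulT_smul]
  have e6' := congrArg (r * ·) e6
  have e7' := congrArg (r * ·) e7
  beta_reduce at e6' e7'
  linear_combination e1 - e10 + e12 + e11 - e6' - e7'

section

variable {d : ℕ} {P : Params d} {G : Geometry d} {T : ℝ}
  {ρ₀ : Vec d → ℝ} {u₀ B₀ : Vec d → Vec d} {ρ : ℝ → Vec d → ℝ} {u B : ℝ → Vec d → Vec d}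
  {E : ℝ → Vec d → Vec 3} {Du : ℝ → Vec d → Ten d}
  {ρ' : ℝ → Vec d → ℝ} {u' B' : ℝ → Vec d → Vec d} {E' : ℝ → Vec d → Vec 3}

lemma Params.hasDerivAt_pressure (P : Params d) {s : ℝ} (hs : 0 < s) :
    HasDerivAt P.pressure (P.a * P.γ * s ^ (P.γ - 1)) s := by
  refine ((Real.hasDerivAt_rpow_const (x := s) (p := P.γ) (Or.inl hs.ne')).const_mul P.a).congr_deriv ?_
  ring

/-- The relative pressure is a multiple of the relative potential. -/
lemma Params.relPressure_eq (P : Params d) {r s : ℝ} :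
    P.pressure r - P.a * P.γ * s ^ (P.γ - 1) * (r - s) - P.pressure s
      = (P.γ - 1) * P.relPotential r s := by
  have h1 : P.γ - 1 ≠ 0 := (sub_pos.2 P.one_lt_γ).ne'
  simp only [relPotential, potential, pressure, dpotential]
  field_simp

lemma divT_apply {M : Vec d → Ten d} {x : Vec d} (hM : DifferentiableAt ℝ M x) (i : Fin d) :
    divT M x i = ∑ j, fderiv ℝ (fun y => M y (i, j)) x (basisVec j) := by
  simp only [divT]
  refine Finset.sum_congr rfl fun j _ => ?_
  have := ((EuclideanSpace.proj (i, j) : Ten d →L[ℝ] ℝ).hasFDerivAt.comp x hM.hasFDerivAt).fderiv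
  have h2 : fderiv ℝ (fun y => M y (i, j)) x = _ := this
  rw [h2]; rfl

lemma div_smul {f : Vec d → ℝ} {v : Vec d → Vec d} {x : Vec d} (hf : DifferentiableAt ℝ f x)
    (hv : DifferentiableAt ℝ v x) :
    div (fun y => f y • v y) x = fderiv ℝ f x (v x) + f x * div v x := by
  have h : fderiv ℝ (fun y => f y • v y) x = _ := (hf.hasFDerivAt.fun_smul hv.hasFDerivAt).fderiv
  rw [div, div, traceT, traceT]
  simp only [grad, h]
  have h3 : fderiv ℝ f x (v x) = ∑ j, v x j * fderiv ℝ f x (basisVec j) := by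
    conv_lhs => rw [vec_eq_sum (v x)]
    simp
  simp [h3, Finset.sum_add_distrib, Finset.mul_sum, mul_comm, add_comm]

lemma differentiableAt_tensorT {v w : Vec d → Vec d} {x : Vec d} (hv : DifferentiableAt ℝ v x)
    (hw : DifferentiableAt ℝ w x) : DifferentiableAt ℝ (fun y => tensorT (v y) (w y)) x := by
  rw [differentiableAt_euclidean]
  intro p
  exact ((differentiableAt_euclidean.1 hv) p.1).mul ((differentiableAt_euclidean.1 hw) p.2)

/-- In this form the first summand cancels against the time derivative of the density by
conservation of mass. -/
lemma divT_smul_tensorT {f : Vec d → ℝ} {v : Vec d → Vec d} {x : Vec d}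
    (hf : DifferentiableAt ℝ f x) (hv : DifferentiableAt ℝ v x) :
    divT (fun y => f y • tensorT (v y) (v y)) x
      = div (fun y => f y • v y) x • v x + f x • mulT (grad v x) (v x) := by
  have hvi := differentiableAt_euclidean.1 hv
  have hfv : DifferentiableAt ℝ (fun y => f y • v y) x := hf.fun_smul hv
  have hfvi := differentiableAt_euclidean.1 hfv
  have hco : ∀ {w : Vec d → Vec d}, DifferentiableAt ℝ w x → ∀ i z,
      fderiv ℝ (fun y => w y i) x z = fderiv ℝ w x z i := fun {w} hw i z => by
    have : fderiv ℝ (fun y => w y i) x = _ :=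
      ((EuclideanSpace.proj i : Vec d →L[ℝ] ℝ).hasFDerivAt.comp x hw.hasFDerivAt).fderiv
    rw [this]; rfl
  ext i
  rw [divT_apply (hf.fun_smul (differentiableAt_tensorT hv hv))]
  have e : ∀ j, (fun y => (f y • tensorT (v y) (v y)) (i, j)) = fun y => v y i * (f y • v y) j := by
    intro j; ext y; simp [tensorT]; ring
  have e2 : ∀ j, fderiv ℝ (fun y => v y i * (f y • v y) j) x = _ := fun j =>
    ((hvi i).hasFDerivAt.fun_mul (hfvi j).hasFDerivAt).fderiv
  have e3 : ∀ j, fderiv ℝ (fun y => (f y • tensorT (v y) (v y)) (i, j)) x (basisVec j)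
      = fderiv ℝ (fun y => f y • v y) x (basisVec j) j * v x i
        + f x * (fderiv ℝ v x (basisVec j) i * v x j) := fun j => by
    rw [e, e2, add_apply, smul_apply, smul_apply, hco hv, hco hfv]
    simp only [smul_eq_mul, PiLp.smul_apply]; ring
  rw [Finset.sum_congr rfl fun j _ => e3 j]
  simp only [PiLp.add_apply, PiLp.smul_apply, mulT, grad, div, traceT, Finset.sum_add_distrib,
    Finset.mul_sum, Finset.sum_mul, smul_eq_mul]

lemma divT_smul_idT {f : Vec d → ℝ} {x : Vec d} (hf : DifferentiableAt ℝ f x) :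
    divT (fun y => f y • idT d) x = gradient f x := by
  ext i
  rw [divT_apply (hf.smul_const _)]
  have e : ∀ j, fderiv ℝ (fun y => (f y • idT d) (i, j)) x = (idT d (i, j)) • fderiv ℝ f x := fun j => by
    have : (fun y => (f y • idT d) (i, j)) = fun y => f y * idT d (i, j) := by ext y; simp
    rw [this]; exact (hf.hasFDerivAt.mul_const _).fderiv
  have e2 : gradient f x i = fderiv ℝ f x (basisVec i) := by
    rw [← inner_gradient_left, basisVec, real_inner_comm, EuclideanSpace.inner_single_left]; simp
  rw [e2, Finset.sum_congr rfl fun j _ => by rw [e j, smul_apply]]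
  simp [idT]

lemma inner_smul_idT (c : ℝ) (A : Ten d) : (inner ℝ (c • idT d) A : ℝ) = c * traceT A := by
  rw [real_inner_smul_left]
  simp [PiLp.inner_apply, idT, traceT, Fintype.sum_prod_type]

/-- The momentum balance per unit volume, without the part that vanishes by mass balance. -/
def accelForce (P : Params d) (ρ' : ℝ → Vec d → ℝ) (u' : ℝ → Vec d → Vec d) (t : ℝ) (x : Vec d) :
    Vec d :=
  ρ' t x • deriv (fun s => u' s x) t + ρ' t x • mulT (grad (u' t) x) (u' t x)
    + gradient (fun y => P.pressure (ρ' t y)) x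

/-- The error terms in the relative energy inequality. -/
def relRemainder (P : Params d) (ρ ρ' : ℝ → Vec d → ℝ) (u u' B B' : ℝ → Vec d → Vec d)
    (E E' : ℝ → Vec d → Vec 3) (t : ℝ) (x : Vec d) : ℝ :=
  -(ρ t x * inner ℝ (u t x - u' t x) (mulT (grad (u' t) x) (u t x - u' t x)))
    - (ρ t x - ρ' t x) / ρ' t x * inner ℝ (accelForce P ρ' u' t x) (u t x - u' t x)
    - (P.γ - 1) * P.relPotential (ρ t x) (ρ' t x) * div (u' t) x
    + inner ℝ (current (E t x) (u t x) (B t x) - current (E' t x) (u' t x) (B' t x))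
      (cross (lift3 (u' t x)) (lift3 (B t x - B' t x)))
    - inner ℝ (current (E' t x) (u' t x) (B' t x))
      (cross (lift3 (u t x - u' t x)) (lift3 (B t x - B' t x)))

namespace IsClassicalSolution

variable {t : ℝ} {x : Vec d}

lemma hasFDerivAt_density (hc : IsClassicalSolution P G T ρ₀ u₀ B₀ ρ' u' B' E')
    (ht : t ∈ Ioo 0 T) (hx : x ∈ G.region) : HasFDerivAt (ρ' t) (fderiv ℝ (ρ' t) x) x :=
  (hc.density_C1.hasFDerivAt_space ht hx).differentiableAt.hasFDerivAt

lemma gradient_pressure (hc : IsClassicalSolution P G T ρ₀ u₀ B₀ ρ' u' B' E')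
    (ht : t ∈ Ioo 0 T) (hx : x ∈ G.region) : gradient (fun y => P.pressure (ρ' t y)) x
      = (P.a * P.γ * ρ' t x ^ (P.γ - 1)) • gradient (ρ' t) x := by
  have hpos := hc.density_pos t (Ioo_subset_Icc_self ht) x (subset_closure hx)
  have h1 := (P.hasDerivAt_pressure hpos).comp_hasFDerivAt x (hc.hasFDerivAt_density ht hx)
  have h2 : fderiv ℝ (fun y => P.pressure (ρ' t y)) x = _ := h1.fderiv
  rw [gradient, h2, map_smul, gradient]

/-- The momentum equation, simplified by means of the continuity equation. -/
lemma momentum_eq (hc : IsClassicalSolution P G T ρ₀ u₀ B₀ ρ' u' B' E')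
    (ht : t ∈ Ioo 0 T) (hx : x ∈ G.region) : lift3 (accelForce P ρ' u' t x)
      = lift3 (divT (fun y => P.stress (grad (u' t) y)) x)
        + cross (current (E' t x) (u' t x) (B' t x)) (lift3 (B' t x)) := by
  rw [← hc.momentum t ht x hx]
  congr 1
  have hρ := (hc.hasFDerivAt_density ht hx).differentiableAt
  have hu := (hc.velocity_C1.hasFDerivAt_space ht hx).differentiableAt
  have h1 := (hc.density_C1.hasDerivAt_time ht hx).differentiableAt.hasDerivAt.fun_smul
    (hc.velocity_C1.hasDerivAt_time ht hx).differentiableAt.hasDerivAt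
  rw [h1.deriv, divT_smul_tensorT hρ hu, accelForce]
  have h2 : deriv (fun s => ρ' s x) t = -div (fun y => ρ' t y • u' t y) x :=
    eq_neg_of_add_eq_zero_left (hc.continuity t ht x hx)
  rw [h2, neg_smul]
  abel

/-- The pointwise identity for the integrand of the relative energy inequality. -/
lemma relIntegrand_eq (hc : IsClassicalSolution P G T ρ₀ u₀ B₀ ρ' u' B' E') (hd : d ≤ 3)
    (ht : t ∈ Ioo 0 T) (hx : x ∈ G.region) :
    relIntegrand P ρ ρ' u u' B B' E Du t x
      + (inner ℝ (P.pressure (ρ' t x) • idT d) (grad (u' t) x)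
        + inner ℝ (divT (fun y => P.pressure (ρ' t y) • idT d) x) (u' t x))
      + (inner ℝ (P.stress (grad (u' t) x)) (Du t x - grad (u' t) x)
        + inner ℝ (divT (fun y => P.stress (grad (u' t) y)) x) (u t x - u' t x))
      - (inner ℝ (lift3 (B t x - B' t x)) (curl (E' t) x)
        - inner ℝ (current (E t x) (u t x) (B t x) - current (E' t x) (u' t x) (B' t x)) (E' t x))
    = -inner ℝ (P.stress (Du t x - grad (u' t) x)) (Du t x - grad (u' t) x)
      - ‖current (E t x) (u t x) (B t x) - current (E' t x) (u' t x) (B' t x)‖ ^ 2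
      + relRemainder P ρ ρ' u u' B B' E E' t x := by
  have hpos := hc.density_pos t (Ioo_subset_Icc_self ht) x (subset_closure hx)
  have hρ := (hc.hasFDerivAt_density ht hx).differentiableAt
  have hu := (hc.velocity_C1.hasFDerivAt_space ht hx).differentiableAt
  have hρt := (hc.density_C1.hasDerivAt_time ht hx).differentiableAt.hasDerivAt
  have hut := (hc.velocity_C1.hasDerivAt_time ht hx).differentiableAt.hasDerivAt
  have hBt := (hc.magnetic_C1.hasDerivAt_time ht hx).differentiableAt.hasDerivAt
  have hpt := ((P.hasDerivAt_pressure hpos).comp t hρt).deriv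
  have hpp : DifferentiableAt ℝ (fun y => P.pressure (ρ' t y)) x :=
    ((P.hasDerivAt_pressure hpos).comp_hasFDerivAt x hρ.hasFDerivAt).differentiableAt
  have e1 : deriv (fun s => continuityTest P ρ' u' s x) t
      = inner ℝ (u' t x) (deriv (fun s => u' s x) t)
        - P.a * P.γ * ρ' t x ^ (P.γ - 2) * deriv (fun s => ρ' s x) t := by
    refine ((hut.norm_sq.const_mul (1 / 2)).sub ((P.hasDerivAt_dpotential hpos).comp t hρt)
      |>.congr_deriv ?_).deriv
    ring
  have e2 : ∀ w, (inner ℝ w (gradient (continuityTest P ρ' u' t) x) : ℝ)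
      = inner ℝ (u' t x) (mulT (grad (u' t) x) w)
        - P.a * P.γ * ρ' t x ^ (P.γ - 2) * inner ℝ (gradient (ρ' t) x) w := by
    intro w
    have h1 : HasFDerivAt (continuityTest P ρ' u' t) _ x :=
      (hu.hasFDerivAt.norm_sq.const_mul (1 / 2)).sub
        ((P.hasDerivAt_dpotential hpos).comp_hasFDerivAt x hρ.hasFDerivAt)
    rw [real_inner_comm, inner_gradient_left, h1.fderiv, inner_gradient_left, grad_eq, mulT_matL]
    simp
  have e3 : deriv (fun s => 1 / 2 * ‖B' s x‖ ^ 2) t = inner ℝ (B' t x) (deriv (fun s => B' s x) t) := by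
    refine ((hBt.norm_sq.const_mul (1 / 2)).congr_deriv ?_).deriv
    ring
  have e4 : deriv (fun s => P.pressure (ρ' s x)) t
      = P.a * P.γ * ρ' t x ^ (P.γ - 1) * deriv (fun s => ρ' s x) t := hpt
  have hh : P.a * P.γ * ρ' t x ^ (P.γ - 2) * ρ' t x = P.a * P.γ * ρ' t x ^ (P.γ - 1) := by
    rw [mul_assoc, ← Real.rpow_add_one hpos.ne']; congr 2; ring
  have hcont : deriv (fun s => ρ' s x) t + inner ℝ (gradient (ρ' t) x) (u' t x)
      + ρ' t x * traceT (grad (u' t) x) = 0 := by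
    rw [inner_gradient_left, add_assoc, ← div, ← div_smul hρ hu]
    exact hc.continuity t ht x hx
  have hm := hc.momentum_eq ht hx
  have hB := hc.maxwell t ht x hx
  have ha := hc.ampere t ht x hx
  have hE : E' t x = current (E' t x) (u' t x) (B' t x) - cross (lift3 (u' t x)) (lift3 (B' t x)) := by
    rw [current, add_sub_cancel_right]
  have key := relative_algebra hd P (r := ρ t x) (pr := P.pressure (ρ t x))
    (ps := P.pressure (ρ' t x)) (u := u t x) (B := B t x) (U := Du t x) (E := E t x)
    hpos.ne' hh hcont (by rw [accelForce, hc.gradient_pressure ht hx]) hm hB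
  rw [P.relPressure_eq, ← hE] at key
  rw [inner_smul_idT, divT_smul_idT hpp, hc.gradient_pressure ht hx, real_inner_smul_left]
  simp only [relIntegrand, momentumIntegrand, continuityIntegrand, maxwellIntegrand, relRemainder,
    e1, e2, e3, e4, ← ha]
  exact key

end IsClassicalSolution

end

/-! ### Terms whose space integral vanishes -/

section

variable {d : ℕ} {P : Params d} {G : Geometry d} {T : ℝ}

lemma memLp_of_continuousOn_region {F : Type*} [NormedAddCommGroup F] {f : Vec d → F} {M : ℝ}
    (hf : ContinuousOn f G.region) (hM : ∀ x ∈ G.cell, ‖f x‖ ≤ M) (p : ℝ≥0∞) : MemLp f p G.vol := by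
  refine MemLp.of_bound ((hf.mono G.cell_subset_region).aestronglyMeasurable G.measurableSet_cell) M ?_
  filter_upwards [G.ae_mem_cell] with x hx using hM x hx

lemma continuousOn_divT {S : Vec d → Ten d} (hS : ContDiffOn ℝ 1 S G.region) :
    ContinuousOn (divT S) G.region := by
  have h := hS.continuousOn_fderiv_of_isOpen G.isOpen_region (by norm_num)
  refine (PiLp.continuous_toLp 2 _).comp_continuousOn (continuousOn_pi.2 fun i => ?_)
  refine continuousOn_finsetSum _ fun j _ => ?_
  exact (EuclideanSpace.proj (i, j) : Ten d →L[ℝ] ℝ).continuous.comp_continuousOn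
    (h.clm_apply continuousOn_const)

lemma continuousOn_curl {F : Vec d → Vec 3} (hF : ContDiffOn ℝ 1 F G.region) :
    ContinuousOn (curl F) G.region := by
  have h := hF.continuousOn_fderiv_of_isOpen G.isOpen_region (by norm_num)
  exact ((curlL d).continuous.comp_continuousOn h).congr fun x _ => curl_eq F x

/-- This is `div (b × ψ) = curl b · ψ - b · curl ψ`, stated for the derivatives `L` of `b` and `M`
of `ψ`; missing coordinates contribute nothing. -/
lemma sum_partialL_cross (b ψ : Vec 3) (L M : Vec d →L[ℝ] Vec 3) :
    ∑ k : Fin 3, (cross (partialL d k L) ψ + cross b (partialL d k M)) k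
      = inner ℝ (curlL d L) ψ - inner ℝ b (curlL d M) := by
  have hc : ∀ L : Vec d →L[ℝ] Vec 3, curlL d L = !₂[partialL d 1 L 2 - partialL d 2 L 1,
        partialL d 2 L 0 - partialL d 0 L 2, partialL d 0 L 1 - partialL d 1 L 0] := fun _ => rfl
  rw [hc, hc]
  simp only [PiLp.inner_apply, cross, Fin.sum_univ_three, crossProduct, Fin.val_zero, Fin.val_one,
    Fin.val_two]
  simp
  ring

/-- The curl of a field of class `C¹` is its weak curl. -/
lemma hasWeakCurl_curl {b : Vec d → Vec 3} (hb : ContDiffOn ℝ 1 b G.region) (hc : G.Compatible b)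
    (i1 : Integrable b G.vol) (i2 : Integrable (curl b) G.vol) : HasWeakCurl G b (curl b) := by
  intro ψ hψ
  have hψd : Continuous (fderiv ℝ ψ) := hψ.1.continuous_fderiv (by norm_num)
  have hψc : Continuous (curl ψ) := by
    rw [show curl ψ = fun x => curlL d (fderiv ℝ ψ x) from funext (curl_eq ψ)]
    exact (curlL d).continuous.comp hψd
  obtain ⟨N1, hN1⟩ := G.isCompact_closure_cell.exists_bound_of_continuousOn hψ.1.continuous.continuousOn
  obtain ⟨N2, hN2⟩ := G.isCompact_closure_cell.exists_bound_of_continuousOn hψc.continuousOn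
  have j1 : Integrable (fun x => (inner ℝ (curl b x) (ψ x) : ℝ)) G.vol :=
    integrable_inner_of_bound i2 hψ.1.continuous.aestronglyMeasurable
      (G.ae_mem_cell.mono fun x hx => hN1 x (subset_closure hx))
  have j2 : Integrable (fun x => (inner ℝ (b x) (curl ψ x) : ℝ)) G.vol :=
    integrable_inner_of_bound i1 hψc.aestronglyMeasurable
      (G.ae_mem_cell.mono fun x hx => hN2 x (subset_closure hx))
  rw [← sub_eq_zero, ← integral_sub j1 j2]
  have ht : IsTest 1 G (fun x => crossL (b x) (ψ x)) := hψ.bilinear (by exact_mod_cast hb) hc crossL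
  have hk : ∀ k : Fin 3, IsTest 1 G (fun x => crossL (b x) (ψ x) k) := fun k =>
    ht.clm (EuclideanSpace.proj k)
  have hd1 := (ht.1.differentiable (by norm_num))
  have hpart : ∀ k : Fin 3, ∀ x, partialL d k (fderiv ℝ (fun x => crossL (b x) (ψ x)) x) k
      = if h : (k : ℕ) < d then fderiv ℝ (fun x => crossL (b x) (ψ x) k) x (basisVec ⟨k, h⟩) else 0 := by
    intro k x
    have h1 : fderiv ℝ (fun x => crossL (b x) (ψ x) k) x = _ :=
      ((EuclideanSpace.proj k : Vec 3 →L[ℝ] ℝ).hasFDerivAt.comp x (hd1 x).hasFDerivAt).fderiv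
    unfold partialL
    split_ifs with h
    · rw [h1]; rfl
    · rfl
  have key : ∀ x ∈ G.cell, (inner ℝ (curl b x) (ψ x) : ℝ) - inner ℝ (b x) (curl ψ x)
      = ∑ k : Fin 3, partialL d k (fderiv ℝ (fun x => crossL (b x) (ψ x)) x) k := by
    intro x hx
    have hbx : DifferentiableAt ℝ b x := (hb.differentiableOn (by norm_num)).differentiableAt
      (G.isOpen_region.mem_nhds (G.cell_subset_region hx))
    have hψx : DifferentiableAt ℝ ψ x := hψ.1.differentiable (by norm_num) x
    rw [curl_eq, curl_eq, ← sum_partialL_cross]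
    refine Finset.sum_congr rfl fun k _ => ?_
    have h1 := (crossL.hasFDerivAt_of_bilinear hbx.hasFDerivAt hψx.hasFDerivAt).fderiv
    rw [h1]
    unfold partialL
    split_ifs with h
    · simp [add_comm]
    · simp [cross]
  rw [G.integral_congr key, integral_finsetSum]
  · refine Finset.sum_eq_zero fun k _ => ?_
    simp only [hpart]
    split_ifs with h
    · exact (hk k).integral_fderiv _
    · simp
  · intro k _
    simp only [hpart]
    split_ifs with h
    · exact continuous_integrable G (((hk k).1.continuous_fderiv (by norm_num)).clm_apply continuous_const)
    · simp

lemma HasWeakCurl.sub {b b' j j' : Vec d → Vec 3} (h : HasWeakCurl G b j) (h' : HasWeakCurl G b' j')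
    (hb : Integrable b G.vol) (hj : Integrable j G.vol) (hb' : Integrable b' G.vol)
    (hj' : Integrable j' G.vol) :
    HasWeakCurl G (fun x => b x - b' x) (fun x => j x - j' x) := by
  intro ψ hψ
  have hψd : Continuous (fderiv ℝ ψ) := hψ.1.continuous_fderiv (by norm_num)
  have hψc : Continuous (curl ψ) := by
    rw [show curl ψ = fun x => curlL d (fderiv ℝ ψ x) from funext (curl_eq ψ)]
    exact (curlL d).continuous.comp hψd
  have hi : ∀ {f g : Vec d → Vec 3}, Integrable f G.vol → Continuous g →
      Integrable (fun x => (inner ℝ (f x) (g x) : ℝ)) G.vol := by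
    intro f g hf hg
    obtain ⟨N, hN⟩ := G.isCompact_closure_cell.exists_bound_of_continuousOn hg.continuousOn
    exact integrable_inner_of_bound hf hg.aestronglyMeasurable
      (G.ae_mem_cell.mono fun x hx => hN x (subset_closure hx))
  simp only [inner_sub_left]
  rw [integral_sub (hi hj hψ.1.continuous) (hi hj' hψ.1.continuous),
    integral_sub (hi hb hψc) (hi hb' hψc), h ψ hψ, h' ψ hψ]

end

section

variable {d : ℕ} {P : Params d} {G : Geometry d} {T : ℝ}
  {ρ₀ : Vec d → ℝ} {u₀ m₀ B₀ : Vec d → Vec d} {ρ : ℝ → Vec d → ℝ} {u B : ℝ → Vec d → Vec d}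
  {E : ℝ → Vec d → Vec 3} {Du : ℝ → Vec d → Ten d}
  {ρ' : ℝ → Vec d → ℝ} {u' B' : ℝ → Vec d → Vec d} {E' : ℝ → Vec d → Vec 3}

/-- Bounds for a classical solution and for its derivatives. -/
structure ClassicalBounds (P : Params d) (ρ' : ℝ → Vec d → ℝ) (u' B' : ℝ → Vec d → Vec d)
    (E' : ℝ → Vec d → Vec 3) (m M t : ℝ) (x : Vec d) : Prop where
  density_ge : m ≤ ρ' t x
  density_le : ρ' t x ≤ M
  pressure_le : ‖P.pressure (ρ' t x) • idT d‖ ≤ M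
  gradient_le : ‖gradient (fun y => P.pressure (ρ' t y)) x‖ ≤ M
  velocity_le : ‖u' t x‖ ≤ M
  fderiv_le : ‖fderiv ℝ (u' t) x‖ ≤ M
  grad_le : ‖grad (u' t) x‖ ≤ M
  div_le : |div (u' t) x| ≤ M
  accel_le : ‖accelForce P ρ' u' t x‖ ≤ M
  stress_le : ‖P.stress (grad (u' t) x)‖ ≤ M
  viscous_le : ‖divT (fun y => P.stress (grad (u' t) y)) x‖ ≤ M
  magnetic_le : ‖B' t x‖ ≤ M
  current_le : ‖current (E' t x) (u' t x) (B' t x)‖ ≤ M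
  curl_le : ‖curl (E' t) x‖ ≤ M

namespace IsClassicalSolution

/-- The second derivatives of `u'` and the derivatives of `E'` exist only inside, without bounds up
to the boundary. Their relevant combinations are bounded through the equations: the viscous force by
the momentum balance, `curl E'` by the Maxwell equation, and the current by Ampère's law. -/
lemma exists_bounds (hc : IsClassicalSolution P G T ρ₀ u₀ B₀ ρ' u' B' E') (hd : d ≤ 3) :
    ∃ m M : ℝ, 0 < m ∧ m ≤ M ∧ ∀ t ∈ Ioo 0 T, ∀ x ∈ G.cell, ClassicalBounds P ρ' u' B' E' m M t x := by
  obtain ⟨R, hR0, hR1, hR2⟩ := hc.density_C1.bound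
  obtain ⟨U, hU0, hU1, hU2⟩ := hc.velocity_C1.bound
  obtain ⟨W, hW0, hW1, hW2⟩ := hc.magnetic_C1.bound
  obtain ⟨Q, hQ0, hQ1, hQ2⟩ := hc.pressure_C1.bound
  have hsub : Icc 0 T ×ˢ closure G.cell ⊆ Icc 0 T ×ˢ closure G.region :=
    prod_mono subset_rfl G.closure_cell_subset
  obtain ⟨I, hI⟩ := (isCompact_cylinder G T).exists_bound_of_continuousOn
    ((hc.density_C1.continuousOn.mono hsub).inv₀ fun z hz =>
      (hc.density_pos z.1 hz.1 z.2 (hsub hz).2).ne')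
  set A := ‖matL d‖ * U with hA
  set X := R * U + R * (A * U) + Q with hX
  set J := ‖curlL d‖ * (‖liftL d‖ * W) with hJ
  have hA0 : 0 ≤ A := by positivity
  have hX0 : 0 ≤ X := by positivity
  have hJ0 : 0 ≤ J := by positivity
  set M := R + Q * ‖idT d‖ + Q + U + A + ‖traceL d‖ * A + X + ‖P.stressL‖ * A + (X + J * W) + W + J
    + (|I| + 1)⁻¹ with hM
  have p1 : 0 ≤ Q * ‖idT d‖ := by positivity
  have p2 : 0 ≤ ‖traceL d‖ * A := by positivity
  have p3 : 0 ≤ ‖P.stressL‖ * A := by positivity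
  have p4 : 0 ≤ J * W := by positivity
  have p5 : 0 < (|I| + 1)⁻¹ := by positivity
  refine ⟨(|I| + 1)⁻¹, M, p5, by linarith, fun t ht x hx => ?_⟩
  have ht' := Ioo_subset_Icc_self ht
  have hxr := G.cell_subset_region hx
  have hxc : x ∈ closure G.cell := subset_closure hx
  have hpos := hc.density_pos t ht' x (subset_closure hxr)
  have r1 := hR1 t ht' x hxc
  have u1 := hU1 t ht' x hxc
  have b1 := hW1 t ht' x hxc
  have q1 := hQ1 t ht' x hxc
  have u2 := hU2 t ht x hxc hxr
  have b2 := hW2 t ht x hxc hxr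
  have q2 := hQ2 t ht x hxc hxr
  have ut := (hc.velocity_C1.norm_deriv_le ht hxr).trans u2
  have bt := (hc.magnetic_C1.norm_deriv_le ht hxr).trans b2
  have ux := (hc.velocity_C1.norm_fderiv_le ht hxr).trans u2
  have bx := (hc.magnetic_C1.norm_fderiv_le ht hxr).trans b2
  have qx := (hc.pressure_C1.norm_fderiv_le ht hxr).trans q2
  have hgrad : ‖grad (u' t) x‖ ≤ A := by
    rw [grad_eq]; exact (matL d).le_opNorm_of_le ux
  have hgp : ‖gradient (fun y => P.pressure (ρ' t y)) x‖ ≤ Q := by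
    rw [gradient, LinearIsometryEquiv.norm_map]; exact qx
  have hacc : ‖accelForce P ρ' u' t x‖ ≤ X := by
    refine (norm_add_le _ _).trans (add_le_add ((norm_add_le _ _).trans (add_le_add ?_ ?_)) hgp)
    · rw [norm_smul]; gcongr
    · rw [norm_smul]; gcongr
      exact (norm_mulT_le _ _).trans (by gcongr)
  have hj : ‖current (E' t x) (u' t x) (B' t x)‖ ≤ J := by
    rw [hc.ampere t ht x hxr, curl_eq]
    refine (curlL d).le_opNorm_of_le ?_
    have : fderiv ℝ (fun y => lift3 (B' t y)) x = _ :=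
      ((liftL d).hasFDerivAt.comp x (hc.magnetic_C1.hasFDerivAt_space ht hxr).differentiableAt.hasFDerivAt).fderiv
    rw [this]
    exact (ContinuousLinearMap.opNorm_comp_le _ _).trans (by gcongr)
  refine ⟨?_, ?_, ?_, ?_, ?_, ?_, ?_, ?_, ?_, ?_, ?_, ?_, ?_, ?_⟩
  · have h1 : (ρ' t x)⁻¹ ≤ |I| + 1 := by
      have : (ρ' t x)⁻¹ ≤ I := (le_abs_self _).trans (hI (t, x) ⟨ht', hxc⟩)
      have h2 := le_abs_self I
      linarith
    exact inv_le_of_inv_le₀ hpos h1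
  · have := (le_abs_self _).trans r1
    linarith
  · rw [norm_smul]
    have : ‖P.pressure (ρ' t x)‖ * ‖idT d‖ ≤ Q * ‖idT d‖ := by gcongr
    linarith
  · linarith
  · linarith
  · linarith
  · linarith
  · have : ‖traceL d (grad (u' t) x)‖ ≤ ‖traceL d‖ * A := (traceL d).le_opNorm_of_le hgrad
    have e : |div (u' t) x| = ‖traceL d (grad (u' t) x)‖ := rfl
    linarith
  · linarith
  · have : ‖P.stressL (grad (u' t) x)‖ ≤ ‖P.stressL‖ * A := P.stressL.le_opNorm_of_le hgrad
    rw [stressL_apply] at this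
    linarith
  · have e : lift3 (divT (fun y => P.stress (grad (u' t) y)) x) = lift3 (accelForce P ρ' u' t x)
        - cross (current (E' t x) (u' t x) (B' t x)) (lift3 (B' t x)) := by
      rw [hc.momentum_eq ht hxr]; abel
    rw [← norm_lift3 hd, e]
    have h1 := norm_sub_le (lift3 (accelForce P ρ' u' t x))
      (cross (current (E' t x) (u' t x) (B' t x)) (lift3 (B' t x)))
    have h2 : ‖cross (current (E' t x) (u' t x) (B' t x)) (lift3 (B' t x))‖ ≤ J * W := by
      refine (norm_cross_le _ _).trans ?_
      rw [norm_lift3 hd]; gcongr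
    rw [norm_lift3 hd] at h1
    linarith
  · linarith
  · linarith
  · have e : curl (E' t) x = -lift3 (deriv (fun s => B' s x) t) :=
      eq_neg_of_add_eq_zero_right (hc.maxwell t ht x hxr)
    rw [e, norm_neg, norm_lift3 hd]
    linarith

end IsClassicalSolution

end

/-! ### The right-hand side of the relative energy inequality at a fixed time -/

section

variable {d : ℕ} {P : Params d} {G : Geometry d} {T : ℝ}
  {ρ₀ : Vec d → ℝ} {u₀ m₀ B₀ : Vec d → Vec d} {ρ : ℝ → Vec d → ℝ} {u B : ℝ → Vec d → Vec d}
  {E : ℝ → Vec d → Vec 3} {Du : ℝ → Vec d → Ten d}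
  {μc : ℝ → VectorMeasure G.closedCell (Ten d)} {μB : ℝ → VectorMeasure G.closedCell (Vec d)}
  {𝔇 : ℝ → Measure G.closedCell} {ℭ : Measure (Icc (0 : ℝ) T × G.closedCell)}
  {ρ' : ℝ → Vec d → ℝ} {u' B' : ℝ → Vec d → Vec d} {E' : ℝ → Vec d → Vec 3}

lemma IsC1.contDiffOn_slice {F : Type*} [NormedAddCommGroup F] [NormedSpace ℝ F]
    {φ : ℝ → Vec d → F} (h : IsC1 G T φ) {t : ℝ} (ht : t ∈ Ioo 0 T) :
    ContDiffOn ℝ 1 (φ t) G.region :=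
  h.contDiffOn.comp (f := fun x => (t, x)) (by fun_prop) fun _ hx => ⟨ht, hx⟩

lemma continuousOn_slice_region {F : Type*} [NormedAddCommGroup F] {φ : ℝ → Vec d → F}
    (h : ContinuousOn (fun z : ℝ × Vec d => φ z.1 z.2) (Icc 0 T ×ˢ closure G.region)) {t : ℝ}
    (ht : t ∈ Icc 0 T) : ContinuousOn (φ t) (closure G.region) :=
  h.comp (f := fun x => (t, x)) (by fun_prop) fun _ hx => ⟨ht, hx⟩

namespace IsClassicalSolution

lemma inClosure (hc : IsClassicalSolution P G T ρ₀ u₀ B₀ ρ' u' B' E') (hd : d ≤ 3) {t : ℝ}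
    (ht : t ∈ Ioo 0 T) : InClosure G (u' t) (grad (u' t)) := by
  obtain ⟨m, M, hm, hmM, hb⟩ := hc.exists_bounds hd
  have ht' := Ioo_subset_Icc_self ht
  exact inClosure_of_frontier (hc.velocity_C2 t ht)
    (continuousOn_slice_region hc.velocity_C1.continuousOn ht') (hc.velocity_C1.compatible t ht')
    (hc.noslip t ht') fun x hx => (hb t ht x hx).fderiv_le

/-- `p div u' + ∇p · u'` is a divergence, and `u'` lies in the closure of the test fields, so there
is no boundary contribution. -/
lemma pressure_work (hc : IsClassicalSolution P G T ρ₀ u₀ B₀ ρ' u' B' E') (hd : d ≤ 3) {t : ℝ}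
    (ht : t ∈ Ioo 0 T) :
    Integrable (fun x => (inner ℝ (P.pressure (ρ' t x) • idT d) (grad (u' t) x)
        + inner ℝ (divT (fun y => P.pressure (ρ' t y) • idT d) x) (u' t x) : ℝ)) G.vol ∧
    ∫ x, (inner ℝ (P.pressure (ρ' t x) • idT d) (grad (u' t) x)
        + inner ℝ (divT (fun y => P.pressure (ρ' t y) • idT d) x) (u' t x)) ∂G.vol = 0 := by
  obtain ⟨m, M, hm, hmM, hb⟩ := hc.exists_bounds hd
  have ht' := Ioo_subset_Icc_self ht
  have hp := hc.pressure_C1.contDiffOn_slice ht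
  have hS : ContDiffOn ℝ 1 (fun y => P.pressure (ρ' t y) • idT d) G.region := hp.smul contDiffOn_const
  have m1 := memLp_of_continuousOn_region hS.continuousOn (fun x hx => (hb t ht x hx).pressure_le) 2
  have m2 : MemLp (divT fun y => P.pressure (ρ' t y) • idT d) 2 G.vol :=
    memLp_of_continuousOn_region (M := M) (continuousOn_divT hS) (fun x hx => by
      rw [divT_smul_idT ((hp.differentiableOn (by norm_num)).differentiableAt
        (G.isOpen_region.mem_nhds (G.cell_subset_region hx)))]
      exact (hb t ht x hx).gradient_le) 2
  have hi := hc.inClosure hd ht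
  exact ⟨(integrable_inner_of_memLp m1 hi.memLp_grad).add (integrable_inner_of_memLp m2 hi.memLp),
    hi.integral_inner_grad hS ((hc.pressure_C1.compatible t ht').comp fun p => p • idT d) m1 m2⟩

/-- The field `v` will be `u - u'`, which lies in the closure of the test fields although it is not
regular. -/
lemma viscous_work (hc : IsClassicalSolution P G T ρ₀ u₀ B₀ ρ' u' B' E') (hd : d ≤ 3) {t : ℝ}
    (ht : t ∈ Ioo 0 T) {v : Vec d → Vec d} {A : Vec d → Ten d} (hi : InClosure G v A) :
    Integrable (fun x => (inner ℝ (P.stress (grad (u' t) x)) (A x)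
        + inner ℝ (divT (fun y => P.stress (grad (u' t) y)) x) (v x) : ℝ)) G.vol ∧
    ∫ x, (inner ℝ (P.stress (grad (u' t) x)) (A x)
        + inner ℝ (divT (fun y => P.stress (grad (u' t) y)) x) (v x)) ∂G.vol = 0 := by
  obtain ⟨m, M, hm, hmM, hb⟩ := hc.exists_bounds hd
  have ht' := Ioo_subset_Icc_self ht
  have hS : ContDiffOn ℝ 1 (fun y => P.stress (grad (u' t) y)) G.region := by
    simp only [← stressL_apply, grad_eq]
    exact P.stressL.contDiff.comp_contDiffOn ((matL d).contDiff.comp_contDiffOn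
      ((hc.velocity_C2 t ht).fderiv_of_isOpen G.isOpen_region (by norm_num)))
  have m1 := memLp_of_continuousOn_region hS.continuousOn (fun x hx => (hb t ht x hx).stress_le) 2
  have m2 := memLp_of_continuousOn_region (continuousOn_divT hS)
    (fun x hx => (hb t ht x hx).viscous_le) 2
  exact ⟨(integrable_inner_of_memLp m1 hi.memLp_grad).add (integrable_inner_of_memLp m2 hi.memLp),
    hi.integral_inner_grad hS ((hc.velocity_C1.compatible t ht').fderiv_compatible.comp
      fun L => P.stress (matL d L)) m1 m2⟩

lemma memLp_current (hc : IsClassicalSolution P G T ρ₀ u₀ B₀ ρ' u' B' E') (hd : d ≤ 3) {t : ℝ}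
    (ht : t ∈ Ioo 0 T) : MemLp (fun x => current (E' t x) (u' t x) (B' t x)) 2 G.vol := by
  obtain ⟨m, M, hm, hmM, hb⟩ := hc.exists_bounds hd
  have h1 := (hc.electric_C1 t ht).continuousOn
  have h2 := (hc.velocity_C1.contDiffOn_slice ht).continuousOn
  have h3 := (hc.magnetic_C1.contDiffOn_slice ht).continuousOn
  have h4 : ContinuousOn (fun x => crossL (liftL d (u' t x)) (liftL d (B' t x))) G.region := by fun_prop
  exact memLp_of_continuousOn_region (f := fun x => current (E' t x) (u' t x) (B' t x)) (h1.add h4)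
    (fun x hx => (hb t ht x hx).current_le) 2

lemma memLp_magnetic (hc : IsClassicalSolution P G T ρ₀ u₀ B₀ ρ' u' B' E') (hd : d ≤ 3) {t : ℝ}
    (ht : t ∈ Ioo 0 T) : MemLp (B' t) 2 G.vol := by
  obtain ⟨m, M, hm, hmM, hb⟩ := hc.exists_bounds hd
  exact memLp_of_continuousOn_region (hc.magnetic_C1.contDiffOn_slice ht).continuousOn
    (fun x hx => (hb t ht x hx).magnetic_le) 2

/-- The electric field of the classical solution is tested with the difference of the magnetic
fields. -/
lemma electric_work (hc : IsClassicalSolution P G T ρ₀ u₀ B₀ ρ' u' B' E') (hd : d ≤ 3) {t : ℝ}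
    (ht : t ∈ Ioo 0 T) {b : Vec d → Vec d} {j : Vec d → Vec 3} (hb : MemLp b 2 G.vol)
    (hj : MemLp j 2 G.vol) (hw : HasWeakCurl G (fun x => lift3 (b x)) j) :
    Integrable (fun x => (inner ℝ (lift3 (b x - B' t x)) (curl (E' t) x)
        - inner ℝ (j x - current (E' t x) (u' t x) (B' t x)) (E' t x) : ℝ)) G.vol ∧
    ∫ x, (inner ℝ (lift3 (b x - B' t x)) (curl (E' t) x)
        - inner ℝ (j x - current (E' t x) (u' t x) (B' t x)) (E' t x)) ∂G.vol = 0 := by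
  obtain ⟨m, M, hm, hmM, hbd⟩ := hc.exists_bounds hd
  have ht' := Ioo_subset_Icc_self ht
  have hB := hc.memLp_magnetic hd ht
  have hj' := hc.memLp_current hd ht
  have hlift : ∀ {f : Vec d → Vec d}, MemLp f 2 G.vol → Integrable (fun x => lift3 (f x)) G.vol :=
    fun hf => ((liftL d).comp_memLp' hf).integrable (by norm_num)
  have ij' := hj'.integrable (by norm_num)
  have hjc : curl (fun y => lift3 (B' t y)) =ᵐ[G.vol] fun x => current (E' t x) (u' t x) (B' t x) := by
    filter_upwards [G.ae_mem_cell] with x hx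
    exact (hc.ampere t ht x (G.cell_subset_region hx)).symm
  have w1 : HasWeakCurl G (fun x => lift3 (B' t x)) (curl fun y => lift3 (B' t y)) :=
    hasWeakCurl_curl ((liftL d).contDiff.comp_contDiffOn (hc.magnetic_C1.contDiffOn_slice ht))
      ((hc.magnetic_C1.compatible t ht').comp lift3) (hlift hB) (ij'.congr hjc.symm)
  have w2 : HasWeakCurl G (fun x => lift3 (B' t x)) fun x => current (E' t x) (u' t x) (B' t x) := by
    intro ψ hψ
    rw [← w1 ψ hψ]
    exact integral_congr_ae (hjc.mono fun x hx => by simp only [hx])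
  -- `B - B'` has the weak curl `j - j'` but no prescribed tangential trace. The boundary term
  -- disappears because the tangential trace of the test field `E'` is zero.
  have w3 := hw.sub w2 (hlift hb) (hj.integrable (by norm_num)) (hlift hB) ij'
  simp only [← lift3_sub] at w3
  have ib := hlift (hb.sub hB)
  have ij := (hj.sub hj').integrable (q := 2) (by norm_num)
  have hEc := continuousOn_slice_region hc.electric_continuous ht'
  have key := w3.integral_eq hd (hc.electric_C1 t ht) hEc (hc.electric_tangential t ht')
    (fun x hx => (hbd t ht x hx).curl_le) (hc.electric_compatible t ht') ib ij
  obtain ⟨N, hN⟩ := G.isCompact_closure_cell.exists_bound_of_continuousOn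
    (hEc.mono G.closure_cell_subset)
  have mE := memLp_of_continuousOn_region (hc.electric_C1 t ht).continuousOn
    (fun x hx => hN x (subset_closure hx)) 2
  have mC := memLp_of_continuousOn_region (continuousOn_curl (hc.electric_C1 t ht))
    (fun x hx => (hbd t ht x hx).curl_le) 2
  have i1 : Integrable (fun x => (inner ℝ (lift3 (b x - B' t x)) (curl (E' t) x) : ℝ)) G.vol :=
    integrable_inner_of_bound ib mC.1 (G.ae_mem_cell.mono fun x hx => (hbd t ht x hx).curl_le)
  have i2 : Integrable (fun x => (inner ℝ (j x - current (E' t x) (u' t x) (B' t x)) (E' t x) : ℝ))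
      G.vol := integrable_inner_of_bound ij mE.1 (G.ae_mem_cell.mono fun x hx => hN x (subset_closure hx))
  refine ⟨i1.sub i2, ?_⟩
  rw [integral_sub i1 i2, key, sub_self]

end IsClassicalSolution

/-- The right-hand side of the relative energy inequality, integrated over space. -/
lemma IsDissipativeWeakSolution.integral_relIntegrand_eq
    (h : IsDissipativeWeakSolution P G T ρ₀ (fun x => ρ₀ x • u₀ x) B₀ ρ u B E Du μc μB 𝔇 ℭ)
    (hc : IsClassicalSolution P G T ρ₀ u₀ B₀ ρ' u' B' E') (hd : d ≤ 3) (hT : 0 < T) :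
    ∀ᵐ t ∂(timeMeasure T),
      InClosure G (u t - u' t) (Du t - grad (u' t)) ∧
      MemLp (fun x => current (E t x) (u t x) (B t x) - current (E' t x) (u' t x) (B' t x)) 2 G.vol ∧
      Integrable (fun x => relRemainder P ρ ρ' u u' B B' E E' t x) G.vol ∧
      ∫ x, relIntegrand P ρ ρ' u u' B B' E Du t x ∂G.vol
        = -(∫ x, inner ℝ (P.stress (Du t x - grad (u' t) x)) (Du t x - grad (u' t) x) ∂G.vol)
          - (∫ x, ‖current (E t x) (u t x) (B t x) - current (E' t x) (u' t x) (B' t x)‖ ^ 2 ∂G.vol)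
          + ∫ x, relRemainder P ρ ρ' u u' B B' E E' t x ∂G.vol := by
  filter_upwards [ae_timeMeasure_mem T, h.velocity_grad,
    ae_hasWeakCurl hT h.memLp_lift h.memLp_current h.ampere,
    MemLp.ae_slice (f := fun t x => current (E t x) (u t x) (B t x)) two_ne_zero
      ENNReal.ofNat_ne_top h.memLp_current,
    MemLp.ae_slice two_ne_zero ENNReal.ofNat_ne_top h.memLp_magnetic,
    (h.integrable_relIntegrand hc).prod_right_ae] with t ht hg hw hj hB hQ
  have hi := hg.inClosure.sub (hc.inClosure hd ht)
  have hk := hj.sub (hc.memLp_current hd ht)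
  obtain ⟨n1, z1⟩ := hc.pressure_work hd ht
  obtain ⟨n2, z2⟩ := hc.viscous_work hd ht hi
  obtain ⟨n3, z3⟩ := hc.electric_work hd ht hB hj hw
  have e := fun x (hx : x ∈ G.cell) => hc.relIntegrand_eq (ρ := ρ) (u := u) (B := B) (E := E) (Du := Du)
    hd ht (G.cell_subset_region hx)
  have hV : MemLp (fun x => P.stressL (Du t x - grad (u' t) x)) 2 G.vol :=
    P.stressL.comp_memLp' hi.memLp_grad
  simp only [stressL_apply] at hV
  have iV : Integrable (fun x => (inner ℝ (P.stress (Du t x - grad (u' t) x)) (Du t x - grad (u' t) x) : ℝ))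
      G.vol := integrable_inner_of_memLp hV hi.memLp_grad
  have iK : Integrable (fun x => ‖current (E t x) (u t x) (B t x)
      - current (E' t x) (u' t x) (B' t x)‖ ^ 2) G.vol := (memLp_two_iff_integrable_sq_norm hk.1).1 hk
  have iL := ((hQ.add n1).add n2).sub n3
  have iR : Integrable (fun x => relRemainder P ρ ρ' u u' B B' E E' t x) G.vol := by
    refine ((iL.add iV).add iK).congr ?_
    filter_upwards [G.ae_mem_cell] with x hx
    have := e x hx
    simp only [Pi.add_apply, Pi.sub_apply] at this ⊢
    linarith
  refine ⟨hi, hk, iR, ?_⟩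
  have e1 := integral_sub ((hQ.add n1).add n2) n3
  have e2 := integral_add (hQ.add n1) n2
  have e3 := integral_add hQ n1
  have e4 := integral_add (iV.neg.sub iK) iR
  have e5 := integral_sub iV.neg iK
  have e6 := integral_neg (μ := G.vol) (fun x =>
    (inner ℝ (P.stress (Du t x - grad (u' t) x)) (Du t x - grad (u' t) x) : ℝ))
  have e7 := G.integral_congr e
  simp only [Pi.add_apply, Pi.sub_apply, Pi.neg_apply] at e1 e2 e3 e4 e5 e6 z2
  linarith

end

/-! ### The estimate of the error terms -/

section

variable {d : ℕ} {P : Params d} {G : Geometry d} {T : ℝ}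
  {ρ₀ : Vec d → ℝ} {u₀ m₀ B₀ : Vec d → Vec d} {ρ : ℝ → Vec d → ℝ} {u B : ℝ → Vec d → Vec d}
  {E : ℝ → Vec d → Vec 3} {Du : ℝ → Vec d → Ten d}
  {μc : ℝ → VectorMeasure G.closedCell (Ten d)} {μB : ℝ → VectorMeasure G.closedCell (Vec d)}
  {𝔇 : ℝ → Measure G.closedCell} {ℭ : Measure (Icc (0 : ℝ) T × G.closedCell)}
  {ρ' : ℝ → Vec d → ℝ} {u' B' : ℝ → Vec d → Vec d} {E' : ℝ → Vec d → Vec 3}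

lemma relEnergy_eq (t : ℝ) (x : Vec d) : relEnergy P ρ ρ' u u' B B' t x
    = 1 / 2 * ρ t x * ‖u t x - u' t x‖ ^ 2 + 1 / 2 * ‖B t x - B' t x‖ ^ 2
      + P.relPotential (ρ t x) (ρ' t x) := rfl

lemma relEnergy_lower {m M : ℝ} (hm : 0 < m) {t : ℝ} {x : Vec d}
    (hb : ClassicalBounds P ρ' u' B' E' m M t x) (hr : 0 ≤ ρ t x) :
    0 ≤ relEnergy P ρ ρ' u u' B B' t x ∧
      ρ t x * ‖u t x - u' t x‖ ^ 2 ≤ 2 * relEnergy P ρ ρ' u u' B B' t x := by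
  obtain ⟨C, _, h⟩ := P.relPotential_bound (M := M) hm
  have h0 := (h _ ⟨hb.density_ge, hb.density_le⟩ _ hr).1
  have h1 : 0 ≤ ρ t x * ‖u t x - u' t x‖ ^ 2 := by positivity
  have h2 : 0 ≤ ‖B t x - B' t x‖ ^ 2 := by positivity
  rw [relEnergy_eq]
  constructor <;> linarith

/-- Each error term is at most quadratic in the differences, except the one with `|ρ - ρ'| |u -
u'|`, which `mul_le_relPotential` handles. A small multiple of `‖u - u'‖²` without the factor `ρ` is
unavoidable since `ρ` may vanish; the viscosity will absorb it. -/
lemma relRemainder_le (hd : d ≤ 3) {m M δ : ℝ} (hm : 0 < m) (hmM : m ≤ M) (hδ : 0 < δ) :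
    ∃ C, 0 ≤ C ∧ ∀ (ρ ρ' : ℝ → Vec d → ℝ) (u u' B B' : ℝ → Vec d → Vec d) (E E' : ℝ → Vec d → Vec 3)
      (t : ℝ) (x : Vec d), ClassicalBounds P ρ' u' B' E' m M t x → 0 ≤ ρ t x →
      relRemainder P ρ ρ' u u' B B' E E' t x ≤ C * relEnergy P ρ ρ' u u' B B' t x
        + δ * ‖u t x - u' t x‖ ^ 2
        + 1 / 2 * ‖current (E t x) (u t x) (B t x) - current (E' t x) (u' t x) (B' t x)‖ ^ 2 := by
  have hM : 0 < M := hm.trans_le hmM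
  -- The density term carries the factor `M / m`, so this choice makes its share of `‖u - u'‖²`
  -- equal to `δ/2`. The other half is spent on the last electromagnetic term.
  have hδ' : 0 < δ * m / (2 * M) := by positivity
  have hγ : 0 < P.γ - 1 := sub_pos.2 P.one_lt_γ
  obtain ⟨C₁, hC₁, h1⟩ := P.mul_le_relPotential hm hmM hδ'
  obtain ⟨C₂, _, h2⟩ := P.relPotential_bound (M := M) hm
  refine ⟨2 * M + 2 * (M / m * C₁) + M / m * C₁ + (P.γ - 1) * M + M ^ 2 + M ^ 2 / δ, by positivity, ?_⟩
  intro ρ ρ' u u' B B' E E' t x hb hr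
  have hs : ρ' t x ∈ Icc m M := ⟨hb.density_ge, hb.density_le⟩
  have hh := (h2 _ hs _ hr).1
  have hp := h1 _ hs _ hr ‖u t x - u' t x‖ (norm_nonneg _)
  rw [relRemainder, relEnergy_eq]
  set r := ρ t x
  set s := ρ' t x
  set v := u t x - u' t x
  set b := B t x - B' t x
  set k := current (E t x) (u t x) (B t x) - current (E' t x) (u' t x) (B' t x)
  set h := P.relPotential r s
  have hv := norm_nonneg v
  have hbb := norm_nonneg b
  have hk := norm_nonneg k
  have hspos : 0 < s := hm.trans_le hs.1
  have t1 : -(r * inner ℝ v (mulT (grad (u' t) x) v)) ≤ M * (r * ‖v‖ ^ 2) := by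
    have e : |(inner ℝ v (mulT (grad (u' t) x) v) : ℝ)| ≤ ‖v‖ * (M * ‖v‖) :=
      (abs_real_inner_le_norm _ _).trans (by
        gcongr
        exact (norm_mulT_le _ _).trans (by gcongr; exact hb.grad_le))
    have e2 := neg_le_of_abs_le e
    nlinarith
  have t2 : -((r - s) / s * inner ℝ (accelForce P ρ' u' t x) v) ≤ M / m * (|r - s| * ‖v‖) := by
    refine (neg_le_abs _).trans ?_
    rw [abs_mul, abs_div, abs_of_pos hspos]
    calc |r - s| / s * |(inner ℝ (accelForce P ρ' u' t x) v : ℝ)|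
        ≤ |r - s| / m * (M * ‖v‖) := by
          gcongr
          · exact hs.1
          · exact (abs_real_inner_le_norm _ _).trans (by gcongr; exact hb.accel_le)
      _ = _ := by ring
  have t3 : -((P.γ - 1) * h * div (u' t) x) ≤ (P.γ - 1) * M * h := by
    have := neg_le_of_abs_le hb.div_le
    have e : 0 ≤ (P.γ - 1) * h := by positivity
    nlinarith
  have t4 : inner ℝ k (cross (lift3 (u' t x)) (lift3 b)) ≤ 1 / 2 * ‖k‖ ^ 2 + M ^ 2 / 2 * ‖b‖ ^ 2 := by
    have e : inner ℝ k (cross (lift3 (u' t x)) (lift3 b)) ≤ ‖k‖ * (M * ‖b‖) :=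
      (real_inner_le_norm _ _).trans (by
        gcongr
        refine (norm_cross_le _ _).trans ?_
        rw [norm_lift3 hd, norm_lift3 hd]
        gcongr
        exact hb.velocity_le)
    nlinarith [sq_nonneg (‖k‖ - M * ‖b‖)]
  have t5 : -inner ℝ (current (E' t x) (u' t x) (B' t x)) (cross (lift3 v) (lift3 b))
      ≤ δ / 2 * ‖v‖ ^ 2 + M ^ 2 / δ / 2 * ‖b‖ ^ 2 := by
    have e : |(inner ℝ (current (E' t x) (u' t x) (B' t x)) (cross (lift3 v) (lift3 b)) : ℝ)|
        ≤ M * (‖v‖ * ‖b‖) :=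
      (abs_real_inner_le_norm _ _).trans (by
        have := norm_cross_le (lift3 v) (lift3 b)
        rw [norm_lift3 hd, norm_lift3 hd] at this
        gcongr
        exact hb.current_le)
    have e2 : M * (‖v‖ * ‖b‖) ≤ δ / 2 * ‖v‖ ^ 2 + M ^ 2 / δ / 2 * ‖b‖ ^ 2 := by
      have : 0 ≤ (δ * ‖v‖ - M * ‖b‖) ^ 2 / (2 * δ) := by positivity
      have e3 : (δ * ‖v‖ - M * ‖b‖) ^ 2 / (2 * δ)
          = δ / 2 * ‖v‖ ^ 2 + M ^ 2 / δ / 2 * ‖b‖ ^ 2 - M * (‖v‖ * ‖b‖) := by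
        field_simp; ring
      linarith
    exact (neg_le_abs _).trans (e.trans e2)
  have t6 : M / m * (|r - s| * ‖v‖) ≤ M / m * C₁ * h + M / m * C₁ * (r * ‖v‖ ^ 2) + δ / 2 * ‖v‖ ^ 2 := by
    calc M / m * (|r - s| * ‖v‖)
        ≤ M / m * (C₁ * (h + r * ‖v‖ ^ 2) + δ * m / (2 * M) * ‖v‖ ^ 2) := by gcongr
      _ = _ := by field_simp
  have q0 : 0 ≤ r * ‖v‖ ^ 2 := by positivity
  have q1 : 0 ≤ ‖b‖ ^ 2 := by positivity
  set c := M / m * C₁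
  have hc : 0 ≤ c := by positivity
  set a := M ^ 2 / δ
  have ha : 0 ≤ a := by positivity
  have w1 : 0 ≤ ((P.γ - 1) * M) * (r * ‖v‖ ^ 2) := by positivity
  have w2 : 0 ≤ M ^ 2 * (r * ‖v‖ ^ 2) := by positivity
  have w3 : 0 ≤ a * (r * ‖v‖ ^ 2) := by positivity
  have w4 : 0 ≤ c * (r * ‖v‖ ^ 2) := by positivity
  have w5 : 0 ≤ (2 * M + 2 * c + c + (P.γ - 1) * M) * ‖b‖ ^ 2 := by positivity
  have w6 : 0 ≤ (2 * M + 2 * c + M ^ 2 + a) * h := by positivity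
  nlinarith

lemma isC1_const (c : ℝ) : IsC1 G T fun _ (_ : Vec d) => c := by
  refine ⟨fun t _ => ?_, continuousOn_const, contDiffOn_const, fun _ => 0, continuousOn_const, ?_⟩
  · cases G with
    | torus => intro x i; rfl
    | bounded Ω hΩ => trivial
  · intro z _; simp

namespace IsDissipativeWeakSolution

/-- Conservation of mass. -/
lemma mass_eq (h : IsDissipativeWeakSolution P G T ρ₀ m₀ B₀ ρ u B E Du μc μB 𝔇 ℭ) :
    ∀ᵐ t ∂(timeMeasure T), ∫ x, ρ t x ∂G.vol = ∫ x, ρ₀ x ∂G.vol := by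
  filter_upwards [h.continuity _ (isC1_const 1)] with t ht
  have e : ∀ x : Vec d, gradient (fun _ : Vec d => (1 : ℝ)) x = 0 := fun x => by
    rw [gradient]; simp
  simp only [deriv_const, mul_zero, e, inner_zero_right, add_zero, integral_zero, mul_one,
    intervalIntegral.integral_zero] at ht
  linarith

/-- The density has a truncation whose mass is bounded below. -/
lemma truncated_mass (h : IsDissipativeWeakSolution P G T ρ₀ m₀ B₀ ρ u B E Du μc μB 𝔇 ℭ)
    (hpos : 0 < ∫ x, ρ₀ x ∂G.vol) :
    ∃ N, 0 ≤ N ∧ ∃ m, 0 < m ∧ ∀ᵐ t ∂(timeMeasure T), m ≤ ∫ x, min (ρ t x) N ∂G.vol := by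
  have hγ := one_pos.trans P.one_lt_γ
  set m₁ := ∫ x, ρ₀ x ∂G.vol
  obtain ⟨hm1, hm2⟩ := h.density_mem
  set L := eLpNorm (fun t => eLpNorm (ρ t) (ENNReal.ofReal P.γ) G.vol) ⊤ (timeMeasure T)
  set K := L.toReal ^ P.γ
  have hK : 0 ≤ K := by positivity
  have hlim := tendsto_rpow_neg_atTop (sub_pos.2 P.one_lt_γ)
  have hε : 0 < m₁ / 2 / (K + 1) := by positivity
  -- The mass above level `N` is at most `N ^ (1 - γ) ∫ ρ ^ γ`; for large `N` this is less than half
  -- of the conserved mass, so the truncation keeps the other half.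
  obtain ⟨N, hN1, hN⟩ := ((eventually_ge_atTop (1 : ℝ)).and (hlim.eventually_lt_const hε)).exists
  have hN0 : 0 < N := one_pos.trans_le hN1
  refine ⟨N, hN0.le, m₁ / 2, by positivity, ?_⟩
  have hae : ∀ᵐ t ∂(timeMeasure T), eLpNorm (ρ t) (ENNReal.ofReal P.γ) G.vol ≤ L := by
    have := ae_le_eLpNormEssSup (f := fun t => eLpNorm (ρ t) (ENNReal.ofReal P.γ) G.vol)
      (μ := timeMeasure T)
    simp only [enorm_eq_self] at this
    simpa only [L, eLpNorm_exponent_top] using this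
  filter_upwards [hae, h.mass_eq, MemLp.ae_slice (by simpa using hγ) ENNReal.ofReal_ne_top h.memLp_density,
    Measure.ae_ae_of_ae_prod h.density_nonneg, h.integrable_density.prod_right_ae]
    with t ht hmass hlp hnn hint
  have hγ' : (ENNReal.ofReal P.γ).toReal = P.γ := ENNReal.toReal_ofReal hγ.le
  have hpow : ∫ x, ρ t x ^ P.γ ∂G.vol ≤ K := by
    rw [hlp.eLpNorm_eq_integral_rpow_norm (by simpa using hγ) (by simp), hγ'] at ht
    have e : ∫ x, ‖ρ t x‖ ^ P.γ ∂G.vol = ∫ x, ρ t x ^ P.γ ∂G.vol := by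
      refine integral_congr_ae ?_
      filter_upwards [hnn] with x hx
      rw [Real.norm_of_nonneg hx]
    rw [e] at ht
    have hI : 0 ≤ ∫ x, ρ t x ^ P.γ ∂G.vol := integral_nonneg_of_ae (hnn.mono fun x hx => by
      simp only [Pi.zero_apply]; exact Real.rpow_nonneg hx _)
    have h1 := (ENNReal.ofReal_le_iff_le_toReal hm2.ne).1 ht
    calc ∫ x, ρ t x ^ P.γ ∂G.vol = ((∫ x, ρ t x ^ P.γ ∂G.vol) ^ P.γ⁻¹) ^ P.γ := by
          rw [← Real.rpow_mul hI, inv_mul_cancel₀ hγ.ne', Real.rpow_one]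
      _ ≤ K := Real.rpow_le_rpow (Real.rpow_nonneg hI _) h1 hγ.le
  have hipow : Integrable (fun x => ρ t x ^ P.γ) G.vol := by
    have h1 := hlp.integrable_norm_rpow (by simpa using hγ) (by simp)
    rw [hγ'] at h1
    refine h1.congr ?_
    filter_upwards [hnn] with x hx
    rw [Real.norm_of_nonneg hx]
  have himin : Integrable (fun x => min (ρ t x) N) G.vol := by
    refine hint.mono (hint.1.inf aestronglyMeasurable_const) ?_
    filter_upwards [hnn] with x hx
    rw [Real.norm_of_nonneg hx, Real.norm_of_nonneg (le_min hx hN0.le)]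
    exact min_le_left _ _
  have hle : ∫ x, ρ t x ∂G.vol ≤ ∫ x, (min (ρ t x) N + N ^ (-(P.γ - 1)) * ρ t x ^ P.γ) ∂G.vol := by
    refine integral_mono_ae hint (himin.add (hipow.const_mul _)) ?_
    filter_upwards [hnn] with x hx
    rcases le_total (ρ t x) N with hx1 | hx1
    · rw [min_eq_left hx1]
      have := Real.rpow_nonneg hx P.γ
      have := Real.rpow_nonneg hN0.le (-(P.γ - 1))
      nlinarith
    · have hx0 : 0 < ρ t x := hN0.trans_le hx1
      have h1 : (ρ t x) ^ (-(P.γ - 1)) ≤ N ^ (-(P.γ - 1)) :=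
        Real.rpow_le_rpow_of_nonpos hN0 hx1 (by linarith [P.one_lt_γ])
      have h2 : (ρ t x) ^ (-(P.γ - 1)) * ρ t x ^ P.γ = ρ t x := by
        rw [← Real.rpow_add hx0]
        simp
      have h3 : 0 ≤ min (ρ t x) N := le_min hx hN0.le
      have h4 := mul_le_mul_of_nonneg_right h1 (Real.rpow_nonneg hx P.γ)
      linarith
  rw [integral_add himin (hipow.const_mul _), integral_const_mul, hmass] at hle
  have h5 : N ^ (-(P.γ - 1)) * ∫ x, ρ t x ^ P.γ ∂G.vol ≤ m₁ / 2 := by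
    calc N ^ (-(P.γ - 1)) * ∫ x, ρ t x ^ P.γ ∂G.vol ≤ N ^ (-(P.γ - 1)) * K := by
          gcongr
      _ ≤ m₁ / 2 / (K + 1) * (K + 1) := by
          gcongr; linarith
      _ = m₁ / 2 := by field_simp
  change m₁ / 2 ≤ _
  linarith

end IsDissipativeWeakSolution

/-- The initial density is positive everywhere, so its integral vanishes only over a null set. -/
lemma IsClassicalSolution.initial_mass_pos (hc : IsClassicalSolution P G T ρ₀ u₀ B₀ ρ' u' B' E')
    (hT : 0 < T) (hG : G.vol ≠ 0) : 0 < ∫ x, ρ₀ x ∂G.vol := by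
  have h0 : (0 : ℝ) ∈ Icc 0 T := ⟨le_rfl, hT.le⟩
  have hcl : ∀ x ∈ G.cell, x ∈ closure G.region := fun x hx => subset_closure (G.cell_subset_region hx)
  have e : ∫ x, ρ₀ x ∂G.vol = ∫ x, ρ' 0 x ∂G.vol := G.integral_congr fun x hx =>
    (hc.initial_density x (hcl x hx)).symm
  have hnn : 0 ≤ᵐ[G.vol] ρ' 0 := by
    filter_upwards [G.ae_mem_cell] with x hx using (hc.density_pos 0 h0 x (hcl x hx)).le
  rw [e]
  refine lt_of_le_of_ne (integral_nonneg_of_ae hnn) fun hz => hG ?_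
  rw [eq_comm, integral_eq_zero_iff_of_nonneg_ae hnn
    (integrable_of_continuousOn (hc.density_C1.continuousOn_slice h0))] at hz
  rw [← ae_eq_bot, ← Filter.eventually_false_iff_eq_bot]
  filter_upwards [hz, G.ae_mem_cell] with x hx hx'
  exact (hc.density_pos 0 h0 x (hcl x hx')).ne' hx

/-- The right-hand side of the relative energy inequality is controlled by the relative energy. -/
lemma IsDissipativeWeakSolution.integral_relIntegrand_le
    (h : IsDissipativeWeakSolution P G T ρ₀ (fun x => ρ₀ x • u₀ x) B₀ ρ u B E Du μc μB 𝔇 ℭ)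
    (hc : IsClassicalSolution P G T ρ₀ u₀ B₀ ρ' u' B' E') (hd0 : 0 < d) (hd : d ≤ 3) (hT : 0 < T) :
    ∃ K, 0 ≤ K ∧ ∀ᵐ t ∂(timeMeasure T), ∫ x, relIntegrand P ρ ρ' u u' B B' E Du t x ∂G.vol
      ≤ K * (∫ x, relEnergy P ρ ρ' u u' B B' t x ∂G.vol)
        - 1 / 2 * ∫ x, ‖current (E t x) (u t x) (B t x) - current (E' t x) (u' t x) (B' t x)‖ ^ 2 ∂G.vol := by
  -- A bounded domain may be empty; then there is no positive mass for the weight, and all integrals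
  -- vanish.
  by_cases hG : G.vol = 0
  · exact ⟨0, le_rfl, Eventually.of_forall fun t => by simp [hG]⟩
  obtain ⟨m, M, hm, hmM, hb⟩ := hc.exists_bounds hd
  obtain ⟨N, hN, m₁, hm₁, hmass⟩ := h.truncated_mass (hc.initial_mass_pos hT hG)
  obtain ⟨Cp, hCp, hpoin⟩ := InClosure.poincare hd0 G hm₁ hN
  have hmu := P.mu_pos
  -- With `δ = μ / (Cp + 1)` the Poincaré inequality bounds `δ ∫ ‖u - u'‖²` by `μ ∫ ‖∇(u - u')‖²`,
  -- which Korn's inequality cancels, plus `2μ` times the relative energy, since the weight `min ρ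
  -- N` is at most `ρ`.
  obtain ⟨C, hC, hR⟩ := relRemainder_le (P := P) hd hm hmM (δ := P.mu / (Cp + 1)) (by positivity)
  refine ⟨C + 2 * P.mu, by positivity, ?_⟩
  filter_upwards [ae_timeMeasure_mem T, hmass, h.integral_relIntegrand_eq hc hd hT,
    Measure.ae_ae_of_ae_prod h.density_nonneg, h.integrable_density.prod_right_ae,
    (h.integrable_relEnergy hc).prod_right_ae] with t ht hw hfix hnn hint hen
  obtain ⟨hi, hk, iR, e⟩ := hfix
  have hv2 := (memLp_two_iff_integrable_sq_norm hi.memLp.1).1 hi.memLp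
  have hk2 := (memLp_two_iff_integrable_sq_norm hk.1).1 hk
  have hkorn := hi.korn hd0 P
  have hp := hpoin _ _ hi (fun x => min (ρ t x) N) (hint.1.inf aestronglyMeasurable_const)
    (hnn.mono fun x hx => ⟨le_min hx hN, min_le_right _ _⟩) hw
  have hwv : ∫ x, min (ρ t x) N * ‖(u t - u' t) x‖ ^ 2 ∂G.vol
      ≤ 2 * ∫ x, relEnergy P ρ ρ' u u' B B' t x ∂G.vol := by
    rw [← integral_const_mul]
    refine integral_mono_of_nonneg ?_ (hen.const_mul 2) ?_
    · filter_upwards [hnn] with x hx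
      have := le_min hx hN
      simp only [Pi.zero_apply]; positivity
    · filter_upwards [hnn, G.ae_mem_cell] with x hx hxc
      refine le_trans ?_ (relEnergy_lower (u := u) (B := B) hm (hb t ht x hxc) hx).2
      simp only [Pi.sub_apply]
      gcongr
      exact min_le_left _ _
  have hRi : ∫ x, relRemainder P ρ ρ' u u' B B' E E' t x ∂G.vol
      ≤ C * (∫ x, relEnergy P ρ ρ' u u' B B' t x ∂G.vol)
        + P.mu / (Cp + 1) * (∫ x, ‖(u t - u' t) x‖ ^ 2 ∂G.vol)
        + 1 / 2 * ∫ x, ‖current (E t x) (u t x) (B t x)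
          - current (E' t x) (u' t x) (B' t x)‖ ^ 2 ∂G.vol := by
    have i1 := hen.const_mul C
    have i2 := hv2.const_mul (P.mu / (Cp + 1))
    have i3 := hk2.const_mul (1 / 2)
    have a1 := integral_add (i1.add i2) i3
    have a2 := integral_add i1 i2
    have a3 := integral_mono_ae iR ((i1.add i2).add i3) (by
      filter_upwards [hnn, G.ae_mem_cell] with x hx hxc
      exact hR ρ ρ' u u' B B' E E' t x (hb t ht x hxc) hx)
    simp only [Pi.add_apply, integral_const_mul] at a1 a2 a3
    linarith
  have hV : 0 ≤ ∫ x, ‖(Du t - grad (u' t)) x‖ ^ 2 ∂G.vol := integral_nonneg fun x => by positivity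
  have he0 : 0 ≤ ∫ x, relEnergy P ρ ρ' u u' B B' t x ∂G.vol := integral_nonneg_of_ae (by
    filter_upwards [hnn, G.ae_mem_cell] with x hx hxc
    exact (relEnergy_lower (u := u) (B := B) hm (hb t ht x hxc) hx).1)
  have hδ : P.mu / (Cp + 1) * (∫ x, ‖(u t - u' t) x‖ ^ 2 ∂G.vol)
      ≤ P.mu * ((∫ x, ‖(Du t - grad (u' t)) x‖ ^ 2 ∂G.vol)
        + 2 * ∫ x, relEnergy P ρ ρ' u u' B B' t x ∂G.vol) := by
    set X := (∫ x, ‖(Du t - grad (u' t)) x‖ ^ 2 ∂G.vol)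
        + 2 * ∫ x, relEnergy P ρ ρ' u u' B B' t x ∂G.vol with hX
    have hX0 : 0 ≤ X := by positivity
    calc P.mu / (Cp + 1) * (∫ x, ‖(u t - u' t) x‖ ^ 2 ∂G.vol)
        ≤ P.mu / (Cp + 1) * (Cp * X) := by
          gcongr
          exact hp.trans (by rw [hX]; gcongr)
      _ ≤ P.mu / (Cp + 1) * ((Cp + 1) * X) := by gcongr; linarith
      _ = P.mu * X := by field_simp
  simp only [Pi.sub_apply] at hkorn hδ hRi e
  rw [e]
  linarith

end

/-! ### Uniqueness -/

/-- Gronwall's lemma for integrable functions. -/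
lemma ae_eq_zero_of_le_primitive {T K : ℝ} (hK : 0 ≤ K) {f : ℝ → ℝ}
    (hf : Integrable f (timeMeasure T)) (h0 : ∀ᵐ t ∂(timeMeasure T), 0 ≤ f t)
    (h : ∀ᵐ τ ∂(timeMeasure T), f τ ≤ K * ∫ t in (0)..τ, f t) : ∀ᵐ t ∂(timeMeasure T), f t = 0 := by
  set F := (Ioo 0 T).indicator f with hF
  have hFi : Integrable F := (integrable_indicator_iff measurableSet_Ioo).2 hf
  set g := fun τ => ∫ t in (0)..τ, F t with hg
  have hgc : Continuous g := intervalIntegral.continuous_primitive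
    (fun a b => hFi.intervalIntegrable) 0
  have hgf : ∀ τ ∈ Ioo 0 T, ∫ t in (0)..τ, f t = g τ := fun τ hτ => by
    rw [hg]
    simp only
    rw [intervalIntegral.integral_of_le hτ.1.le, intervalIntegral.integral_of_le hτ.1.le]
    refine setIntegral_congr_fun measurableSet_Ioc fun t ht => ?_
    rw [hF, indicator_of_mem (show t ∈ Ioo 0 T from ⟨ht.1, ht.2.trans_lt hτ.2⟩)]
  have hae : ∀ᵐ t, t ∈ Ioo 0 T → 0 ≤ F t ∧ F t ≤ K * g t := by
    rw [timeMeasure, ae_restrict_iff' measurableSet_Ioo] at h0 h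
    filter_upwards [h0, h] with t h1 h2 ht
    rw [hF, indicator_of_mem ht, ← hgf t ht]
    exact ⟨h1 ht, h2 ht⟩
  have hg0 : ∀ τ ∈ Ico 0 T, 0 ≤ g τ := fun τ hτ => by
    refine intervalIntegral.integral_nonneg_of_ae_restrict hτ.1 ?_
    refine (ae_restrict_iff' measurableSet_Icc).2 ?_
    filter_upwards [hae, Measure.ae_ne volume 0] with t h1 h2 ht
    exact (h1 ⟨lt_of_le_of_ne ht.1 h2.symm, ht.2.trans_lt hτ.2⟩).1
  -- `f` need not be continuous and `g` need not be `C¹`. The primitive of `g` is, and integrating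
  -- the hypothesis once gives `S' = g ≤ K S` with `S 0 = 0`, to which the classical lemma applies.
  set S := fun τ => ∫ t in (0)..τ, g t with hS
  have hSd : ∀ τ, HasDerivAt S (g τ) τ := fun τ => intervalIntegral.integral_hasDerivAt_right
    (hgc.intervalIntegrable _ _) (hgc.stronglyMeasurableAtFilter _ _) hgc.continuousAt
  have hgS : ∀ τ ∈ Ico 0 T, g τ ≤ K * S τ := fun τ hτ => by
    rw [hS, hg]
    simp only
    rw [← intervalIntegral.integral_const_mul]
    refine intervalIntegral.integral_mono_ae_restrict hτ.1 hFi.intervalIntegrable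
      ((hgc.const_mul K).intervalIntegrable _ _) ?_
    refine (ae_restrict_iff' measurableSet_Icc).2 ?_
    filter_upwards [hae, Measure.ae_ne volume 0] with t h1 h2 ht
    exact (h1 ⟨lt_of_le_of_ne ht.1 h2.symm, ht.2.trans_lt hτ.2⟩).2
  have hSz : ∀ τ ∈ Ico 0 T, S τ = 0 := fun τ hτ => by
    refine eq_zero_of_abs_deriv_le_mul_abs_self_of_eq_zero_right (K := K) (b := τ)
      (fun x _ => (hSd x).continuousAt.continuousWithinAt)
      (fun x _ => (hSd x).hasDerivWithinAt) (by simp [hS]) (fun x hx => ?_) τ ⟨hτ.1, le_rfl⟩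
    have hx' : x ∈ Ico 0 T := ⟨hx.1, hx.2.trans hτ.2⟩
    rw [Real.norm_of_nonneg (hg0 x hx')]
    exact (hgS x hx').trans (by gcongr; exact Real.le_norm_self _)
  filter_upwards [h0, h, ae_timeMeasure_mem T] with t h1 h2 ht
  have ht' : t ∈ Ico 0 T := ⟨ht.1.le, ht.2⟩
  have h3 : g t ≤ 0 := by simpa [hSz t ht'] using hgS t ht'
  have h4 : g t = 0 := le_antisymm h3 (hg0 t ht')
  rw [hgf t ht, h4, mul_zero] at h2
  exact le_antisymm h2 h1

/-- A family of vector measures whose total variation has vanishing integral is zero. -/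
lemma ae_eq_zero_of_lintegral_variation {α X V : Type*} [MeasurableSpace α] [mX : MeasurableSpace X]
    [MeasurableSpace.CountablyGenerated X] [NormedAddCommGroup V] {μ : Measure α}
    {ν : α → VectorMeasure X V} (hm : ∀ A, MeasurableSet A → AEStronglyMeasurable (fun t => ν t A) μ)
    (h : ∫⁻ t, (ν t).variation univ ∂μ = 0) : ∀ᵐ t ∂μ, ν t = 0 := by
  have h1 : ∀ A, MeasurableSet A → ∀ᵐ t ∂μ, ν t A = 0 := fun A hA => by
    have h2 : ∫⁻ t, ‖ν t A‖ₑ ∂μ = 0 := le_antisymm (h ▸ lintegral_mono fun t =>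
      ((ν t).enorm_measure_le_variation A).trans (measure_mono (subset_univ _))) zero_le
    rw [lintegral_eq_zero_iff' (hm A hA).enorm] at h2
    filter_upwards [h2] with t ht
    simpa using ht
  -- The exceptional null set of times depends on the measurable set. Countably many sets that
  -- generate the `σ`-algebra and are closed under intersection suffice to determine a vector
  -- measure.
  set C := generateSetAlgebra (MeasurableSpace.countableGeneratingSet X)
  have hC : C.Countable := countable_generateSetAlgebra MeasurableSpace.countable_countableGeneratingSet
  have hgen : mX = MeasurableSpace.generateFrom C := by
    rw [generateFrom_generateSetAlgebra_eq, MeasurableSpace.generateFrom_countableGeneratingSet]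
  have hCm : ∀ A ∈ C, MeasurableSet A := fun A hA =>
    hgen.ge A (MeasurableSpace.measurableSet_generateFrom hA)
  have h3 : ∀ᵐ t ∂μ, ∀ A ∈ C, ν t A = 0 := (ae_ball_iff hC).2 fun A hA => h1 A (hCm A hA)
  filter_upwards [h3] with t ht
  refine VectorMeasure.ext_of_generateFrom C (fun A hA => by simpa using ht A hA) hgen
    (fun A hA B hB _ => isSetAlgebra_generateSetAlgebra.inter_mem hA hB)
    (by simpa using ht univ isSetAlgebra_generateSetAlgebra.univ_mem)

section

variable {d : ℕ} {P : Params d} {G : Geometry d} {T : ℝ}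
  {ρ₀ : Vec d → ℝ} {u₀ m₀ B₀ : Vec d → Vec d} {ρ : ℝ → Vec d → ℝ} {u B : ℝ → Vec d → Vec d}
  {E : ℝ → Vec d → Vec 3} {Du : ℝ → Vec d → Ten d}
  {μc : ℝ → VectorMeasure G.closedCell (Ten d)} {μB : ℝ → VectorMeasure G.closedCell (Vec d)}
  {𝔇 : ℝ → Measure G.closedCell} {ℭ : Measure (Icc (0 : ℝ) T × G.closedCell)}
  {ρ' : ℝ → Vec d → ℝ} {u' B' : ℝ → Vec d → Vec d} {E' : ℝ → Vec d → Vec 3}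

namespace IsDissipativeWeakSolution

lemma ae_muc_eq_zero (h : IsDissipativeWeakSolution P G T ρ₀ m₀ B₀ ρ u B E Du μc μB 𝔇 ℭ)
    (hD : ∀ᵐ t ∂(timeMeasure T), 𝔇 t = 0) : ∀ᵐ t ∂(timeMeasure T), μc t = 0 := by
  obtain ⟨C, hC⟩ := h.compat_muc
  have h1 := hC (fun _ => 1) continuousOn_const fun _ _ => zero_le_one
  have h2 : ∫⁻ t, 𝔇 t univ ∂(timeMeasure T) = 0 := by
    rw [lintegral_congr_ae (hD.mono fun t ht => by rw [ht]), Measure.coe_zero]; simp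
  simp only [ENNReal.ofReal_one, one_mul, h2, mul_zero] at h1
  exact ae_eq_zero_of_lintegral_variation h.muc_meas (le_antisymm h1 zero_le)

/-- With `𝔇 = 0` the total variation is at most `C ε ℭ(univ)` for every `ε`. It is not enough that
`ℭ` vanishes before `T`, as the compatibility condition sees its mass at time `T` too; letting `ε`
tend to `0` avoids the issue. -/
lemma ae_muB_eq_zero (h : IsDissipativeWeakSolution P G T ρ₀ m₀ B₀ ρ u B E Du μc μB 𝔇 ℭ)
    (hD : ∀ᵐ t ∂(timeMeasure T), 𝔇 t = 0) : ∀ᵐ t ∂(timeMeasure T), μB t = 0 := by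
  have := h.dissipationDefect_finite
  obtain ⟨C, hC⟩ := h.compat_muB
  have h2 : ∫⁻ t, 𝔇 t univ ∂(timeMeasure T) = 0 := by
    rw [lintegral_congr_ae (hD.mono fun t ht => by rw [ht]), Measure.coe_zero]; simp
  have h3 : ∀ ε : ℝ≥0, 0 < ε → ∫⁻ t, (μB t).variation univ ∂(timeMeasure T) ≤ C * (ε * ℭ univ) := by
    intro ε hε
    have h1 := hC ε hε (fun _ => 1) continuousOn_const fun _ _ => zero_le_one
    simpa only [ENNReal.ofReal_one, one_mul, h2, mul_zero, zero_add, lintegral_one] using h1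
  refine ae_eq_zero_of_lintegral_variation h.muB_meas (le_antisymm ?_ zero_le)
  refine ENNReal.le_of_forall_pos_le_add fun δ hδ _ => ?_
  rw [zero_add]
  set c := (ℭ univ).toNNReal with hc
  have hcc : ℭ univ = c := (ENNReal.coe_toNNReal (measure_ne_top _ _)).symm
  have h4 := h3 (δ / (C * c + 1)) (by positivity)
  refine h4.trans ?_
  rw [hcc]
  norm_cast
  calc C * (δ / (C * c + 1) * c) = δ * ((C * c) / (C * c + 1)) := by
        field_simp
    _ ≤ δ * 1 := by
        gcongr
        exact div_le_one_of_le₀ (by simp) (by positivity)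
    _ = δ := mul_one _

end IsDissipativeWeakSolution

/-- A measure that vanishes up to almost every time before `T` vanishes before `T`. -/
lemma measure_before_eq_zero {X : Type*} [MeasurableSpace X] (hT : 0 < T)
    {ν : Measure (Icc (0 : ℝ) T × X)} (h : ∀ᵐ τ ∂(timeMeasure T), ν {z | (z.1 : ℝ) ≤ τ} = 0) :
    ν {z | (z.1 : ℝ) < T} = 0 := by
  have h1 : ∀ s < T, ν {z | (z.1 : ℝ) ≤ s} = 0 := by
    intro s hs
    have hlt : max s 0 < T := max_lt hs hT
    have h2 : ∀ᵐ τ ∂(volume.restrict (Ioo (max s 0) T)), ν {z | (z.1 : ℝ) ≤ τ} = 0 :=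
      ae_mono (Measure.restrict_mono (Ioo_subset_Ioo_left (le_max_right _ _)) le_rfl) h
    have : NeBot (ae (volume.restrict (Ioo (max s 0) T))) := by
      rw [ae_neBot, Ne, Measure.restrict_eq_zero, Real.volume_Ioo]
      simpa using hlt
    obtain ⟨τ, h3, h4⟩ := (h2.and (ae_restrict_mem measurableSet_Ioo)).exists
    exact measure_mono_null (fun z hz => le_trans hz ((le_max_left _ _).trans h4.1.le)) h3
  -- The times before `T` are exhausted by countably many closed conditions `t ≤ T - 1/(n + 1)`, and
  -- each of them is implied by one at a good time `τ`.
  have h5 : {z : Icc (0 : ℝ) T × X | (z.1 : ℝ) < T} ⊆ ⋃ n : ℕ, {z | (z.1 : ℝ) ≤ T - 1 / (n + 1)} := by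
    intro z hz
    obtain ⟨n, hn⟩ := exists_nat_one_div_lt (sub_pos.2 (show (z.1 : ℝ) < T from hz))
    exact mem_iUnion.2 ⟨n, show (z.1 : ℝ) ≤ T - 1 / (n + 1) by linarith⟩
  refine measure_mono_null h5 (measure_iUnion_null fun n => h1 _ ?_)
  have : (0 : ℝ) < 1 / (n + 1) := by positivity
  linarith

end

/-! ### Vanishing of the relative energy and equality of the solutions. -/

section

variable {d : ℕ} {P : Params d} {G : Geometry d} {T : ℝ}
  {ρ₀ : Vec d → ℝ} {u₀ B₀ : Vec d → Vec d} {ρ : ℝ → Vec d → ℝ} {u B : ℝ → Vec d → Vec d}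
  {E : ℝ → Vec d → Vec 3} {Du : ℝ → Vec d → Ten d}
  {μc : ℝ → VectorMeasure G.closedCell (Ten d)} {μB : ℝ → VectorMeasure G.closedCell (Vec d)}
  {𝔇 : ℝ → Measure G.closedCell} {ℭ : Measure (Icc (0 : ℝ) T × G.closedCell)}
  {ρ' : ℝ → Vec d → ℝ} {u' B' : ℝ → Vec d → Vec d} {E' : ℝ → Vec d → Vec 3}

lemma intervalIntegrable_of_timeMeasure {f : ℝ → ℝ} (hf : Integrable f (timeMeasure T)) {τ : ℝ}
    (hτ : τ ∈ Ioo 0 T) : IntervalIntegrable f volume 0 τ := by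
  have hsub : Ioc 0 τ ⊆ Ioo 0 T := fun s hs => ⟨hs.1, hs.2.trans_lt hτ.2⟩
  exact (intervalIntegrable_iff_integrableOn_Ioc_of_le hτ.1.le).2
    (hf.mono_measure (Measure.restrict_mono hsub le_rfl))

lemma intervalIntegral_mono_of_timeMeasure {f g : ℝ → ℝ} (hf : Integrable f (timeMeasure T))
    (hg : Integrable g (timeMeasure T)) (h : ∀ᵐ t ∂(timeMeasure T), f t ≤ g t) {τ : ℝ}
    (hτ : τ ∈ Ioo 0 T) : ∫ t in (0)..τ, f t ≤ ∫ t in (0)..τ, g t := by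
  have hsub : Ioc 0 τ ⊆ Ioo 0 T := fun s hs => ⟨hs.1, hs.2.trans_lt hτ.2⟩
  have hle := Measure.restrict_mono hsub (le_rfl (a := (volume : Measure ℝ)))
  rw [intervalIntegral.integral_of_le hτ.1.le, intervalIntegral.integral_of_le hτ.1.le]
  exact integral_mono_ae (hf.mono_measure hle) (hg.mono_measure hle) (ae_mono hle h)

namespace IsDissipativeWeakSolution

lemma ae_relEnergy_nonneg
    (h : IsDissipativeWeakSolution P G T ρ₀ (fun x => ρ₀ x • u₀ x) B₀ ρ u B E Du μc μB 𝔇 ℭ)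
    (hc : IsClassicalSolution P G T ρ₀ u₀ B₀ ρ' u' B' E') (hd : d ≤ 3) :
    ∀ᵐ z ∂((timeMeasure T).prod G.vol), 0 ≤ relEnergy P ρ ρ' u u' B B' z.1 z.2 := by
  obtain ⟨m, M, hm, hmM, hb⟩ := hc.exists_bounds hd
  filter_upwards [h.density_nonneg, ae_mem_cylinder G T] with z hz hzc
  exact (relEnergy_lower hm (hb _ hzc.1 _ hzc.2) hz).1

/-- The relative energy and the defect measures vanish, and the current densities agree. -/
lemma relEnergy_eq_zero
    (h : IsDissipativeWeakSolution P G T ρ₀ (fun x => ρ₀ x • u₀ x) B₀ ρ u B E Du μc μB 𝔇 ℭ)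
    (hc : IsClassicalSolution P G T ρ₀ u₀ B₀ ρ' u' B' E') (hd0 : 0 < d) (hd : d ≤ 3) (hT : 0 < T) :
    (∀ᵐ t ∂(timeMeasure T), ∫ x, relEnergy P ρ ρ' u u' B B' t x ∂G.vol = 0) ∧
    (∀ᵐ t ∂(timeMeasure T), 𝔇 t = 0) ∧
    (∀ᵐ τ ∂(timeMeasure T), ℭ {z | (z.1 : ℝ) ≤ τ} = 0) ∧
    (∀ᵐ t ∂(timeMeasure T),
      ∫ x, ‖current (E t x) (u t x) (B t x) - current (E' t x) (u' t x) (B' t x)‖ ^ 2 ∂G.vol = 0) := by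
  have := h.dissipationDefect_finite
  obtain ⟨K₁, hK₁, h1⟩ := h.relative_energy_absorbed hc hT
  obtain ⟨K₂, hK₂, h2⟩ := h.integral_relIntegrand_le hc hd0 hd hT
  have ie := (h.integrable_relEnergy hc).integral_prod_left
  have iq := (h.integrable_relIntegrand hc).integral_prod_left
  have iD := h.integrable_defect
  have e0 : ∀ᵐ t ∂(timeMeasure T), 0 ≤ ∫ x, relEnergy P ρ ρ' u u' B B' t x ∂G.vol := by
    filter_upwards [Measure.ae_ae_of_ae_prod (h.ae_relEnergy_nonneg hc hd)] with t ht
    exact integral_nonneg_of_ae ht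
  have hk0 : ∀ t, 0 ≤ ∫ x, ‖current (E t x) (u t x) (B t x)
      - current (E' t x) (u' t x) (B' t x)‖ ^ 2 ∂G.vol := fun t => integral_nonneg fun x => by positivity
  have hF : ∀ᵐ t ∂(timeMeasure T),
      (∫ x, relEnergy P ρ ρ' u u' B B' t x ∂G.vol) + (𝔇 t).real univ = 0 := by
    -- The integral of `𝔇` also occurs on the right, so Gronwall's lemma is applied to the sum of
    -- the relative energy and the mass of `𝔇`.
    refine ae_eq_zero_of_le_primitive (K := K₁ + K₂) (by positivity) (ie.add iD) ?_ ?_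
    · filter_upwards [e0] with t ht using add_nonneg ht measureReal_nonneg
    · filter_upwards [h1, ae_timeMeasure_mem T] with τ hτ hτm
      have m1 : ∫ t in (0)..τ, ∫ x, relIntegrand P ρ ρ' u u' B B' E Du t x ∂G.vol
          ≤ ∫ t in (0)..τ, K₂ * ∫ x, relEnergy P ρ ρ' u u' B B' t x ∂G.vol :=
        intervalIntegral_mono_of_timeMeasure iq (ie.const_mul K₂)
          (h2.mono fun t ht => ht.trans (by linarith [hk0 t])) hτm
      have m2 : 0 ≤ ∫ t in (0)..τ, ∫ x, relEnergy P ρ ρ' u u' B B' t x ∂G.vol := by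
        have := intervalIntegral_mono_of_timeMeasure (integrable_zero _ _ _) ie e0 hτm
        simpa using this
      have m3 : 0 ≤ ∫ t in (0)..τ, (𝔇 t).real univ :=
        intervalIntegral.integral_nonneg hτm.1.le fun t _ => measureReal_nonneg
      rw [intervalIntegral.integral_const_mul] at m1
      rw [intervalIntegral.integral_add (intervalIntegrable_of_timeMeasure ie hτm)
        (intervalIntegrable_of_timeMeasure iD hτm)]
      have hC : 0 ≤ ℭ.real {z | (z.1 : ℝ) ≤ τ} := measureReal_nonneg
      nlinarith [mul_nonneg hK₁ m2, mul_nonneg hK₂ m3]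
  have he : ∀ᵐ t ∂(timeMeasure T), ∫ x, relEnergy P ρ ρ' u u' B B' t x ∂G.vol = 0 := by
    filter_upwards [hF, e0] with t h3 h4
    have := measureReal_nonneg (μ := 𝔇 t) (s := univ)
    linarith
  have hDr : ∀ᵐ t ∂(timeMeasure T), (𝔇 t).real univ = 0 := by
    filter_upwards [hF, he] with t h3 h4
    linarith
  have hD : ∀ᵐ t ∂(timeMeasure T), 𝔇 t = 0 := by
    filter_upwards [hDr, ae_lt_top' (h.energyDefect_meas univ MeasurableSet.univ)
      h.lintegral_defect_ne_top] with t h3 h4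
    rw [measureReal_def, ENNReal.toReal_eq_zero_iff] at h3
    exact Measure.measure_univ_eq_zero.1 (h3.resolve_right h4.ne)
  have hq : ∀ᵐ t ∂(timeMeasure T), ∫ x, relIntegrand P ρ ρ' u u' B B' E Du t x ∂G.vol ≤ 0 := by
    filter_upwards [h2, he] with t h3 h4
    rw [h4] at h3
    linarith [hk0 t]
  have hDi : ∀ τ ∈ Ioo 0 T, ∫ t in (0)..τ, (𝔇 t).real univ = 0 := fun τ hτ => by
    have hsub : Ioc 0 τ ⊆ Ioo 0 T := fun s hs => ⟨hs.1, hs.2.trans_lt hτ.2⟩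
    rw [intervalIntegral.integral_of_le hτ.1.le]
    exact integral_eq_zero_of_ae (ae_mono (Measure.restrict_mono hsub le_rfl) hDr)
  -- The inequality now reads `½ ℭ([0, τ]) ≤ ∫₀^τ ∫ relIntegrand`, and the right side is at most
  -- `0`. Both therefore vanish.
  have hfin : ∀ᵐ τ ∂(timeMeasure T), ℭ.real {z | (z.1 : ℝ) ≤ τ} = 0 ∧
      ∫ t in (0)..τ, ∫ x, relIntegrand P ρ ρ' u u' B B' E Du t x ∂G.vol = 0 := by
    filter_upwards [h1, he, hDr, ae_timeMeasure_mem T] with τ h3 h4 h5 hτ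
    have m1 : ∫ t in (0)..τ, ∫ x, relIntegrand P ρ ρ' u u' B B' E Du t x ∂G.vol ≤ 0 := by
      have := intervalIntegral_mono_of_timeMeasure iq (integrable_zero _ _ _) hq hτ
      simpa using this
    have hC : 0 ≤ ℭ.real {z | (z.1 : ℝ) ≤ τ} := measureReal_nonneg
    rw [h4, h5, hDi τ hτ] at h3
    constructor <;> linarith
  refine ⟨he, hD, ?_, ?_⟩
  · filter_upwards [hfin] with τ hτ
    exact (measureReal_eq_zero_iff (measure_ne_top _ _)).1 hτ.1
  -- The space integral of `relIntegrand` vanishes at almost every time, and so does the relative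
  -- energy; the discarded `-½ ∫ |j - j'|²` must then vanish too.
  · filter_upwards [ae_eq_zero_of_primitive hT iq (hfin.mono fun τ hτ => hτ.2), h2, he] with t h3 h4 h5
    rw [h3, h5] at h4
    linarith [hk0 t]

/-- Equality of the fields. -/
lemma ae_eq_classical
    (h : IsDissipativeWeakSolution P G T ρ₀ (fun x => ρ₀ x • u₀ x) B₀ ρ u B E Du μc μB 𝔇 ℭ)
    (hc : IsClassicalSolution P G T ρ₀ u₀ B₀ ρ' u' B' E') (hd0 : 0 < d) (hd : d ≤ 3) (hT : 0 < T) :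
    ∀ᵐ z ∂((timeMeasure T).prod G.vol), ρ z.1 z.2 = ρ' z.1 z.2 ∧ u z.1 z.2 = u' z.1 z.2 ∧
      B z.1 z.2 = B' z.1 z.2 ∧ E z.1 z.2 = E' z.1 z.2 := by
  obtain ⟨he, hD, hC, hk⟩ := h.relEnergy_eq_zero hc hd0 hd hT
  obtain ⟨m, M, hm, hmM, hb⟩ := hc.exists_bounds hd
  have ie := h.integrable_relEnergy hc
  have he' : ∀ᵐ z ∂((timeMeasure T).prod G.vol), relEnergy P ρ ρ' u u' B B' z.1 z.2 = 0 := by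
    refine (integral_eq_zero_iff_of_nonneg_ae (h.ae_relEnergy_nonneg hc hd) ie).1 ?_
    rw [integral_prod _ ie]
    exact integral_eq_zero_of_ae he
  have mj' : MemLp (fun z : ℝ × Vec d => current (E' z.1 z.2) (u' z.1 z.2) (B' z.1 z.2)) 2
      ((timeMeasure T).prod G.vol) := by
    have c1 := hc.electric_continuous.mono (cylinder_subset G T)
    have c2 := hc.velocity_C1.continuousOn.mono (cylinder_subset G T)
    have c3 := hc.magnetic_C1.continuousOn.mono (cylinder_subset G T)
    have c4 : ContinuousOn (fun z : ℝ × Vec d => crossL (liftL d (u' z.1 z.2)) (liftL d (B' z.1 z.2)))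
      (Ioo 0 T ×ˢ G.region) := by fun_prop
    refine MemLp.of_bound (aestronglyMeasurable_cylinder (c1.add c4)) M ?_
    filter_upwards [ae_mem_cylinder G T] with z hz
    exact (hb _ hz.1 _ hz.2).current_le
  have mk := h.memLp_current.sub mj'
  have ik := (memLp_two_iff_integrable_sq_norm mk.1).1 mk
  have hk' : ∀ᵐ z ∂((timeMeasure T).prod G.vol), ‖current (E z.1 z.2) (u z.1 z.2) (B z.1 z.2)
      - current (E' z.1 z.2) (u' z.1 z.2) (B' z.1 z.2)‖ ^ 2 = 0 := by
    refine (integral_eq_zero_iff_of_nonneg (fun z => by positivity) ik).1 ?_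
    rw [integral_prod _ ik]
    exact integral_eq_zero_of_ae hk
  obtain ⟨C, hC0, hrel⟩ := P.relPotential_bound (M := M) hm
  filter_upwards [he', hk', h.density_nonneg, ae_mem_cylinder G T] with z e1 e2 e3 hz
  have hbz := hb _ hz.1 _ hz.2
  obtain ⟨p1, p2⟩ := hrel _ ⟨hbz.density_ge, hbz.density_le⟩ _ e3
  rw [relEnergy_eq] at e1
  have q1 : 0 ≤ ρ z.1 z.2 * ‖u z.1 z.2 - u' z.1 z.2‖ ^ 2 := by positivity
  have q2 : 0 ≤ ‖B z.1 z.2 - B' z.1 z.2‖ ^ 2 := by positivity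
  have r1 : P.relPotential (ρ z.1 z.2) (ρ' z.1 z.2) = 0 := by linarith
  have r2 : ρ z.1 z.2 * ‖u z.1 z.2 - u' z.1 z.2‖ ^ 2 = 0 := by linarith
  have r3 : ‖B z.1 z.2 - B' z.1 z.2‖ ^ 2 = 0 := by linarith
  rw [r1, mul_zero] at p2
  have s1 : ρ z.1 z.2 = ρ' z.1 z.2 := by
    rcases p2 with p2 | p2
    · exact sub_eq_zero.1 (pow_eq_zero_iff two_ne_zero |>.1 (le_antisymm p2 (sq_nonneg _)))
    · exact sub_eq_zero.1 (abs_nonpos_iff.1 p2)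
  -- Once the densities agree there is no vacuum, so the kinetic part determines the velocity. The
  -- electric field is then recovered from the current.
  have hpos : 0 < ρ z.1 z.2 := s1 ▸ hm.trans_le hbz.density_ge
  have s2 : u z.1 z.2 = u' z.1 z.2 := by
    have := (mul_eq_zero.1 r2).resolve_left hpos.ne'
    simpa [sub_eq_zero] using this
  have s3 : B z.1 z.2 = B' z.1 z.2 := by simpa [sub_eq_zero] using r3
  refine ⟨s1, s2, s3, ?_⟩
  simpa [sub_eq_zero, current, s2, s3] using e2

end IsDissipativeWeakSolution

end

end

end MHD

theorem theorem1 (d : ℕ) (hd : d = 2 ∨ d = 3) (P : MHD.Params d) (G : MHD.Geometry d)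
    (T : ℝ) (hT : 0 < T)
    (ρ₀ : MHD.Vec d → ℝ) (u₀ B₀ : MHD.Vec d → MHD.Vec d)
    (ρ' : ℝ → MHD.Vec d → ℝ) (u' B' : ℝ → MHD.Vec d → MHD.Vec d)
    (E' : ℝ → MHD.Vec d → MHD.Vec 3)
    (hclassical : MHD.IsClassicalSolution P G T ρ₀ u₀ B₀ ρ' u' B' E')
    (ρ : ℝ → MHD.Vec d → ℝ) (u B : ℝ → MHD.Vec d → MHD.Vec d)
    (E : ℝ → MHD.Vec d → MHD.Vec 3) (Du : ℝ → MHD.Vec d → MHD.Ten d)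
    (μc : ℝ → VectorMeasure G.closedCell (MHD.Ten d))
    (μB : ℝ → VectorMeasure G.closedCell (MHD.Vec d))
    (𝔇 : ℝ → Measure G.closedCell) (ℭ : Measure (Icc (0 : ℝ) T × G.closedCell))
    (hweak : MHD.IsDissipativeWeakSolution P G T ρ₀ (fun x => ρ₀ x • u₀ x) B₀
      ρ u B E Du μc μB 𝔇 ℭ) :
    (∀ᵐ z ∂((MHD.timeMeasure T).prod G.vol),
      ρ z.1 z.2 = ρ' z.1 z.2 ∧ u z.1 z.2 = u' z.1 z.2 ∧
        B z.1 z.2 = B' z.1 z.2 ∧ E z.1 z.2 = E' z.1 z.2) ∧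
    (∀ᵐ t ∂(MHD.timeMeasure T), μc t = 0 ∧ μB t = 0 ∧ 𝔇 t = 0) ∧
    ℭ {z | (z.1 : ℝ) < T} = 0 := by
  have hd0 : 0 < d := by omega
  have hd3 : d ≤ 3 := by omega
  obtain ⟨-, hD, hC, -⟩ := hweak.relEnergy_eq_zero hclassical hd0 hd3 hT
  refine ⟨hweak.ae_eq_classical hclassical hd0 hd3 hT, ?_, MHD.measure_before_eq_zero hT hC⟩
  filter_upwards [hD, hweak.ae_muc_eq_zero hD, hweak.ae_muB_eq_zero hD] with t h1 h2 h3
  exact ⟨h2, h3, h1⟩
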